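/- Let $n\ge 2$. Let $\mathcal F_{n+2}$ be the manifold of complete flags $V_1\subset V_2\subset\cdots\subset V_{n+1}\subset\mathbf R^{n+2}$, $\dim V_i=i$, with the projections $\pi_1(V_1,\dots,V_{n+1})=V_1\in P^{n+1}=\mathrm{Gr}(1,\mathbf R^{n+2})$ and $\pi_{n+1}(V_1,\dots,V_{n+1})=V_{n+1}\in \mathrm{Gr}(n+1,\mathbf R^{n+2})\cong P^{n+1*}$. The pseudo-contact distribution $\mathcal D\subset T\mathcal F_{n+2}$ consists of the tangent vectors $v$ at $(V_1,\dots,V_{n+1})$ with $(\pi_1)_*v\in T\,\mathrm{Gr}(1,V_{n+1})$; a smooth curve in $\mathcal F_{n+2}$ is $\mathcal D$-integral if its velocity vectors lie in $\mathcal D$. A smooth curve in $P^{n+1}$ (or, likewise, in $P^{n+1*}$) is of type $(a_1,\dots,a_{n+1})$ at $t_0$ if, for a smooth nowhere vanishing local lift $\gamma$ of it to the vector space, $a_j=\min\{r \mid \operatorname{rank}(\gamma(t_0),\gamma'(t_0),\dots,\gamma^{(r)}(t_0))=j+1\}$ for $1\le j\le n+1$ (in particular these minima exist). Let $I$ be an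 interval or a circle and $J$ a one-dimensional manifold. On the set of all $C^\infty$ one-parameter families $\Gamma_\lambda: I\to\mathcal F_{n+2}$ ($\lambda\in J$) of $\mathcal D$-integral curves, i.e. of $C^\infty$ maps $I\times J\to\mathcal F_{n+2}$, $(t,\lambda)\mapsto\Gamma_\lambda(t)$, with every $\Gamma_\lambda$ $\mathcal D$-integral, take the Whitney $C^\infty$ topology. Then for a generic family, namely for all families in an open dense subset, each of the two curves $\gamma_\lambda=\pi_1\circ\Gamma_\lambda$ and $\widehat\gamma_\lambda=\pi_{n+1}\circ\Gamma_\lambda$ has, at every point of $I$ and for every $\lambda\in J$, one of the types $$(1,2,\dots,n,n+1),\quad (1,2,\dots,n,n+2),\quad (1,2,\dots,n,n+3),\quad (1,2,\dots,n-1,n+1,n+2),$$ or, if $n=2$, $(2,3,4)$. More precisely, the set of all families with this property is itself open and dense. -/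

import Mathlib

open Set Filter Topology Module
open scoped Manifold ContDiff

noncomputable section

/-- The vector space `ℝ^{n+2}`. -/
abbrev AmbientSpace (n : ℕ) : Type := EuclideanSpace ℝ (Fin (n + 2))

/-- A complete flag `V_1 ⊂ V_2 ⊂ ⋯ ⊂ V_{n+1} ⊂ ℝ^{n+2}` of (non-oriented) vector subspaces with
`dim V_i = i`. The space `V_{i+1}` is `V i` for `i : Fin (n + 1)`. -/
structure CompleteFlag (n : ℕ) where
  V : Fin (n + 1) → Submodule ℝ (AmbientSpace n)
  finrank_V : ∀ i, finrank ℝ (V i) = (i : ℕ) + 1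
  mono : Monotone V

/-- The Euclidean space in which the flag manifold lies as a compact submanifold. -/
abbrev FlagAmbient (n : ℕ) : Type :=
  Fin (n + 1) → (AmbientSpace n →L[ℝ] AmbientSpace n)

namespace CompleteFlag

variable {n : ℕ}

/-- The projection `π_1` of the flag manifold to the projective space of lines in `ℝ^{n+2}`. -/
def line (F : CompleteFlag n) : Submodule ℝ (AmbientSpace n) := F.V 0

/-- The projection `π_{n+1}` of the flag manifold to the hyperplanes in `ℝ^{n+2}`. -/
def hyperplane (F : CompleteFlag n) : Submodule ℝ (AmbientSpace n) := F.V (Fin.last n)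

/-- The standard embedding of the flag manifold: a flag is sent to the tuple of the orthogonal
projections onto its members. The `C^∞` structure of the flag manifold is the one induced by it. -/
def embed (F : CompleteFlag n) : FlagAmbient n := fun i => (F.V i).starProjection

/-- The pseudo-contact distribution `D` at the flag `F`. For a tangent vector `v` of the flag
manifold at `F`, written in the embedding above, the vector `(π_1)_* v` of
`T_{V_1} Gr(1, ℝ^{n+2}) = Hom(V_1, ℝ^{n+2} / V_1)` is `x ↦ v 0 x mod V_1`; it lies in
`T_{V_1} Gr(1, V_{n+1}) = Hom(V_1, V_{n+1} / V_1)` if and only if `v 0` maps `V_1` into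
`V_{n+1}`. -/
def pseudoContact (F : CompleteFlag n) : Set (FlagAmbient n) :=
  {v | ∀ x ∈ F.line, v 0 x ∈ F.hyperplane}

end CompleteFlag

section Whitney

variable {E : Type*} [NormedAddCommGroup E] [NormedSpace ℝ E]
  {H : Type*} [TopologicalSpace H]
  {M : Type*} [TopologicalSpace M] [ChartedSpace H M]
  {W : Type*} [NormedAddCommGroup W] [NormedSpace ℝ W]

/-- The maps `g : M → W` whose derivatives of order at most `r` in the chart `c i` differ on `K i`
by less than `ε i` from those of `f`, for every `i`. -/
def whitneyBall (IM : ModelWithCorners ℝ E H) (f : M → W) (r : ℕ)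
    (c : ℕ → OpenPartialHomeomorph M H) (K : ℕ → Set M) (ε : ℕ → ℝ) : Set (M → W) :=
  {g | ∀ i, ∀ k ≤ r, ∀ x ∈ K i,
    ‖iteratedFDerivWithin ℝ k
      (fun u => g (((c i).extend IM).symm u) - f (((c i).extend IM).symm u))
      ((c i).extend IM).target ((c i).extend IM x)‖ < ε i}

/-- The Whitney (strong) `C^∞` topology on a set `X` of smooth maps from a second countable
manifold `M` to a normed space `W` (`Φ : X → (M → W)` is the inclusion). It is generated by the
balls given by a center `f`, an order `r`, a locally finite sequence of compact sets `K i`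
(possibly empty from some index on), each in the domain of a smooth chart `c i`, and
positive numbers `ε i`. -/
@[reducible]
def whitneyTopology (IM : ModelWithCorners ℝ E H) {X : Type*} (Φ : X → M → W) :
    TopologicalSpace X :=
  TopologicalSpace.generateFrom
    {U | ∃ (f : X) (r : ℕ) (c : ℕ → OpenPartialHomeomorph M H) (K : ℕ → Set M) (ε : ℕ → ℝ),
      (∀ i, c i ∈ IsManifold.maximalAtlas IM ∞ M) ∧
      (∀ i, IsCompact (K i) ∧ K i ⊆ (c i).source) ∧
      LocallyFinite K ∧ (∀ i, 0 < ε i) ∧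
      U = {g | Φ g ∈ whitneyBall IM (Φ f) r c K ε}}

end Whitney

section Families

variable (n : ℕ) {H : Type*} [TopologicalSpace H] (IM : ModelWithCorners ℝ ℝ H)
  (I : Type*) [TopologicalSpace I] [ChartedSpace H I]
  (J : Type*) [TopologicalSpace J] [ChartedSpace ℝ J]

/-- A `C^∞` one-parameter family `Γ_lam : I → F_{n+2}`, `lam ∈ J`, of integral curves of the
pseudo-contact distribution: `Γ_lam t = toFun (t, lam)` is smooth in `(t, lam)`, and every velocity
vector of every curve `Γ_lam` lies in the distribution. -/
structure IntegralFamily where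
  toFun : I × J → CompleteFlag n
  smooth : ContMDiff (IM.prod 𝓘(ℝ, ℝ)) 𝓘(ℝ, FlagAmbient n) ∞ (fun q => (toFun q).embed)
  integral : ∀ (lam : J) (t : I) (v : TangentSpace IM t),
    (mfderiv IM 𝓘(ℝ, FlagAmbient n) (fun s : I => (toFun (s, lam)).embed) t v : FlagAmbient n) ∈
      (toFun (t, lam)).pseudoContact

/-- The Whitney `C^∞` topology on the set of families of integral curves. -/
instance : TopologicalSpace (IntegralFamily n IM I J) :=
  whitneyTopology (M := I × J) (IM.prod 𝓘(ℝ, ℝ)) (fun Γ q => (Γ.toFun q).embed)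

end Families

section CurveType

variable {n : ℕ} {H : Type*} [TopologicalSpace H] (IM : ModelWithCorners ℝ ℝ H)
  {I : Type*} [TopologicalSpace I] [ChartedSpace H I]

/-- The `k`-th derivative at `t₀` of a curve `e : I → ℝ^{n+2}`, with respect to the local
coordinate of `I` at `t₀`. -/
def curveDeriv (e : I → AmbientSpace n) (t₀ : I) (k : ℕ) : AmbientSpace n :=
  iteratedDerivWithin k (e ∘ (extChartAt IM t₀).symm) (extChartAt IM t₀).target
    (extChartAt IM t₀ t₀)

/-- The rank of the matrix `(e, e', …, e^{(r)})` at `t₀`. -/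
def derivRank (e : I → AmbientSpace n) (t₀ : I) (r : ℕ) : ℕ :=
  finrank ℝ (Submodule.span ℝ (curveDeriv IM e t₀ '' Set.Iic r))

/-- The curve `L` of lines in `ℝ^{n+2}` is of type `(a_1, …, a_{n+1})` at `t₀`
(`a i` stands for `a_{i+1}`): for a smooth nowhere vanishing local lift `e` of `L` to `ℝ^{n+2}`,
`a_j` is the least `r` for which `(e, e', …, e^{(r)})` has rank `j + 1` at `t₀`. This depends
neither on the lift nor on the local coordinate of `I`. -/
def HasType (L : I → Submodule ℝ (AmbientSpace n)) (t₀ : I) (a : Fin (n + 1) → ℕ) : Prop :=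
  ∃ (e : I → AmbientSpace n) (U : Set I), U ∈ 𝓝 t₀ ∧
    ContMDiffOn IM 𝓘(ℝ, AmbientSpace n) ∞ e U ∧
    (∀ t ∈ U, e t ≠ 0 ∧ L t = Submodule.span ℝ {e t}) ∧
    ∀ i : Fin (n + 1), IsLeast {r : ℕ | derivRank IM e t₀ r = (i : ℕ) + 2} (a i)

end CurveType

/-- The list of types `(1, …, n, n+1)`, `(1, …, n, n+2)`, `(1, …, n, n+3)`,
`(1, …, n-1, n+1, n+2)`, and `(2, 3, 4)` if `n = 2`. The entry `a_{i+1}` is `a i`. -/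
def adaptedTypes (n : ℕ) : Set (Fin (n + 1) → ℕ) :=
  {a | a = (fun i : Fin (n + 1) => (i : ℕ) + 1) ∨
    a = (fun i : Fin (n + 1) => if (i : ℕ) < n then (i : ℕ) + 1 else n + 2) ∨
    a = (fun i : Fin (n + 1) => if (i : ℕ) < n then (i : ℕ) + 1 else n + 3) ∨
    a = (fun i : Fin (n + 1) => if (i : ℕ) + 1 < n then (i : ℕ) + 1 else (i : ℕ) + 2) ∨
    (n = 2 ∧ a = fun i : Fin (n + 1) => (i : ℕ) + 2)}

/-- The families for which, for all `lam` and at every point `t`, both `π_1 ∘ Γ_lam` and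
`π_{n+1} ∘ Γ_lam` have a type in the list. A curve of hyperplanes is a curve in the dual projective
space; by the Euclidean inner product it is the curve of the normal lines. -/
def goodFamilies (n : ℕ) {H : Type*} [TopologicalSpace H] (IM : ModelWithCorners ℝ ℝ H)
    (I : Type*) [TopologicalSpace I] [ChartedSpace H I]
    (J : Type*) [TopologicalSpace J] [ChartedSpace ℝ J] : Set (IntegralFamily n IM I J) :=
  {Γ | ∀ (lam : J) (t : I),
    (∃ a ∈ adaptedTypes n, HasType IM (fun s => (Γ.toFun (s, lam)).line) t a) ∧
    (∃ a ∈ adaptedTypes n, HasType IM (fun s => ((Γ.toFun (s, lam)).hyperplane)ᗮ) t a)}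

end

/-! Flag duality preserves the distribution, exchanges the two projections, and is a homeomorphism
of the space of families (`IntegralFamily.dualHomeo`). So it suffices to treat the curves of lines.
The listed types amount to lower bounds for ranks of jets (`goodRanks_iff_exists_type`,
`isOpen_goodRanks`). This is an open condition on jets, and the Whitney topology turns it into an
open condition on families (`JetOpen.isOpen_forall`).

For density, an exhaustion by compact sets reduces everything to perturbations in a small box around
one point (`JetOpen.dense_forall`). There a flag has contact coordinates `(x, p, z)`, the line being
spanned by `e + x + z f`, and integrality reads `z' = ⟨p, x'⟩`. The Heisenberg group moves these
coordinates at will and carries the other members of the flag along. Hence every small, compactly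
supported change of `(x, p, z)` that respects the relation comes from a change of the family
(`IntegralFamily.exists_modification_coords`).

Where `x' ≠ 0`, the pair `(x, z)` can be perturbed freely, because `p` can be corrected along the
new velocity (`IntegralFamily.ValidOn.exists_goodRanks`). The jets of `(x, z)` with bad ranks form
finitely many sets of codimension at least 3, and a family with the two parameters `(t, λ)` misses
them after a generic polynomial translation (`exists_forall_notMem_of_isThin`).

Where `x'` may vanish, `(x, p)` is perturbed and `z` is recovered by integration. The obstruction is
that `z` must return to its old value beyond the box. It is removed by an additional change `ν (-ψ
p', ψ x')` elsewhere in the box, where `ν` is the small root of a quadratic equation whose linear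
coefficient is close to `∫ ψ (|x'|² + |p'|²)`
(`IntegralFamily.ValidOn.eventually_change_compensated`). The bad jets of `(x, p)` again have
codimension at least 3: the condition `x' = 0` alone has codimension `n`, and for `n = 2` the only
nonimmersed points left have type `(2, 3, 4)`.

This compensation needs `(x, p)` to be nonconstant on a time window for every nearby `λ`
(`IntegralFamily.ValidOn.exists_notMem_constSet`). At a parameter `l` the displacement along the
window either equals `(λ - l)^k G` with `G` not identically zero on `λ = l`, or is flat there. The
flat parameters in a compact interval form a compact set; near it time can be stopped at a small
cost, and a bump is then added to `p`. The constant parameters that remain are isolated, hence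
finitely many, and each is removed by adding a small multiple of a rotated velocity. -/

set_option linter.unusedSectionVars false

/-! ### Smoothness of integrals with a variable end point and parameters. -/

section ParametricIntegral

variable {Q : Type} [NormedAddCommGroup Q] [NormedSpace ℝ Q]

theorem hasFDerivAt_of_hasFDerivWithinAt_slice {W : Type} [NormedAddCommGroup W] [NormedSpace ℝ W]
    {A : Set ℝ} {U : Set Q} (hU : IsOpen U) {F : ℝ × Q → W} {L : ℝ × Q →L[ℝ] W} {y : ℝ × Q}
    (hy : y ∈ A ×ˢ U) (hF : HasFDerivWithinAt F L (A ×ˢ U) y) :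
    HasFDerivAt (fun q => F (y.1, q)) (L.comp (ContinuousLinearMap.inr ℝ ℝ Q)) y.2 := by
  have h1 : HasFDerivAt (fun q : Q => (y.1, q)) (ContinuousLinearMap.inr ℝ ℝ Q) y.2 :=
    hasFDerivAt_prodMk_right y.1 y.2
  have h2 : HasFDerivWithinAt (fun q => F (y.1, q))
      (L.comp (ContinuousLinearMap.inr ℝ ℝ Q)) U y.2 :=
    HasFDerivWithinAt.comp y.2 (f := fun q : Q => (y.1, q)) (t := A ×ˢ U) hF
      h1.hasFDerivWithinAt (fun q hq => ⟨hy.1, hq⟩)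
  exact h2.hasFDerivAt (hU.mem_nhds hy.2)

/-- The fundamental theorem of calculus in the end point is combined with differentiation under the
integral sign in the parameter. The closed interval is needed because the time manifold may have a
boundary. -/
theorem hasFDerivWithinAt_integral_Icc [FiniteDimensional ℝ Q] {W : Type} [NormedAddCommGroup W] [NormedSpace ℝ W]
    [CompleteSpace W] {a b : ℝ} (hab : a ≤ b) {U : Set Q} (hU : IsOpen U) {F : ℝ × Q → W}
    {F' : ℝ × Q → Q →L[ℝ] W}
    (hF : ContinuousOn F (Icc a b ×ˢ U)) (hF' : ContinuousOn F' (Icc a b ×ˢ U))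
    (hd : ∀ y ∈ Icc a b ×ˢ U, HasFDerivAt (fun q => F (y.1, q)) (F' y) y.2)
    {y : ℝ × Q} (hy : y ∈ Icc a b ×ˢ U) :
    HasFDerivWithinAt (fun y : ℝ × Q => ∫ τ in a..y.1, F (τ, y.2))
      ((ContinuousLinearMap.toSpanSingleton ℝ (F y)).coprod (∫ τ in a..y.1, F' (τ, y.2)))
      (Icc a b ×ˢ U) y := by
  -- Clamping the time to `[a, b]` makes the integrand continuous on the whole line, so that
  -- two-sided differentiation applies; on `[a, b]` nothing changes.
  set pr : ℝ → ℝ := fun τ => projIcc a b hab τ with hpr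
  have prc : Continuous pr := continuous_subtype_val.comp continuous_projIcc
  have prm : ∀ τ, pr τ ∈ Icc a b := fun τ => (projIcc a b hab τ).2
  have pre : ∀ τ ∈ Icc a b, pr τ = τ := fun τ h => by simp [hpr, projIcc_of_mem hab h]
  have hslice : ∀ q ∈ U, Continuous (fun τ => F (pr τ, q)) := fun q hq =>
    hF.comp_continuous (by fun_prop) (fun τ => ⟨prm τ, hq⟩)
  have hslice' : ∀ q ∈ U, Continuous (fun τ => F' (pr τ, q)) := fun q hq =>
    hF'.comp_continuous (by fun_prop) (fun τ => ⟨prm τ, hq⟩)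
  have hboundF : ∀ {Z : Type} [NormedAddCommGroup Z] {K : ℝ × Q → Z},
      ContinuousOn K (Icc a b ×ˢ U) → ∀ q0 ∈ U, ∃ s ∈ 𝓝 q0, s ⊆ U ∧ ∃ C, ∀ q ∈ s, ∀ τ,
        ‖K (pr τ, q)‖ ≤ C := by
    intro Z _ K hK q0 hq0
    obtain ⟨δ, hδ, hsub⟩ := Metric.nhds_basis_closedBall.mem_iff.1 (hU.mem_nhds hq0)
    refine ⟨_, Metric.closedBall_mem_nhds q0 hδ, hsub, ?_⟩
    have hc : IsCompact (Icc a b ×ˢ Metric.closedBall q0 δ) :=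
      isCompact_Icc.prod (isCompact_closedBall _ _)
    obtain ⟨C, hC⟩ := hc.exists_bound_of_continuousOn (hK.mono (prod_mono_right hsub))
    exact ⟨C, fun q hq τ => hC _ ⟨prm τ, hq⟩⟩
  have key : HasStrictFDerivAt (↿(fun (t : ℝ) (q : Q) => ∫ τ in a..t, F (pr τ, q)))
      ((↿(fun (t : ℝ) (q : Q) => ContinuousLinearMap.toSpanSingleton ℝ (F (pr t, q))) y).coprod
        (↿(fun (t : ℝ) (q : Q) => ∫ τ in a..t, F' (pr τ, q)) y)) y := by
    have hUn : ∀ᶠ v : ℝ × Q in 𝓝 y, v.2 ∈ U := continuous_snd.continuousAt (hU.mem_nhds hy.2)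
    refine hasStrictFDerivAt_uncurry_coprod ?_ ?_ ?_ ?_
    · filter_upwards [hUn] with v hv
      exact ((hslice _ hv).integral_hasStrictDerivAt a v.1).hasDerivAt.hasFDerivAt
    · filter_upwards [hUn] with v hv
      obtain ⟨s, hs, hsU, C, hC⟩ := hboundF hF' v.2 hv
      refine intervalIntegral.hasFDerivAt_integral_of_dominated_of_fderiv_le
        (F := fun q τ => F (pr τ, q)) (F' := fun q τ => F' (pr τ, q)) (bound := fun _ => C)
        hs ?_ ?_ ?_ ?_ ?_ ?_
      · filter_upwards [hU.mem_nhds hv] with q hq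
        exact (hslice q hq).aestronglyMeasurable
      · exact (hslice _ hv).intervalIntegrable _ _
      · exact (hslice' _ hv).aestronglyMeasurable
      · exact Eventually.of_forall fun τ _ q hq => hC q hq τ
      · exact intervalIntegrable_const
      · exact Eventually.of_forall fun τ _ q hq => hd (pr τ, q) ⟨prm τ, hsU hq⟩
    · have : ContinuousAt (fun v : ℝ × Q => F (pr v.1, v.2)) y := by
        have h1 : ContinuousOn (fun v : ℝ × Q => F (pr v.1, v.2)) (univ ×ˢ U) :=
          hF.comp (by fun_prop) (fun v hv => ⟨prm _, hv.2⟩)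
        exact h1.continuousAt ((isOpen_univ.prod hU).mem_nhds ⟨trivial, hy.2⟩)
      exact (ContinuousLinearMap.toSpanSingletonCLE (𝕜 := ℝ) (E := W)).continuous.continuousAt.comp
        this
    · obtain ⟨s, hs, hsU, C, hC⟩ := hboundF hF' y.2 hy.2
      obtain ⟨δ, hδ, hball⟩ := Metric.mem_nhds_iff.1 hs
      have : ContinuousOn (fun v : ℝ × Q => ∫ τ in a..v.1, F' (pr τ, v.2))
          (univ ×ˢ Metric.ball y.2 δ) := by
        rw [continuousOn_iff_continuous_domRestrict]
        have h2 : Continuous (fun w : (univ ×ˢ Metric.ball y.2 δ : Set (ℝ × Q)) =>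
            ∫ τ in a..w.1.1, F' (pr τ, w.1.2)) := by
          refine intervalIntegral.continuous_parametric_intervalIntegral_of_continuous
            (f := fun (w : (univ ×ˢ Metric.ball y.2 δ : Set (ℝ × Q))) τ => F' (pr τ, w.1.2))
            ?_ (by fun_prop)
          exact hF'.comp_continuous (by fun_prop)
            (fun v => ⟨prm _, hsU (hball v.1.2.2)⟩)
        exact h2
      exact this.continuousAt ((isOpen_univ.prod Metric.isOpen_ball).mem_nhds
        ⟨trivial, Metric.mem_ball_self hδ⟩)
  have hInt : ∀ {Z : Type} [NormedAddCommGroup Z] [NormedSpace ℝ Z] (K : ℝ × Q → Z),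
      ∀ v ∈ Icc a b ×ˢ U, ∫ τ in a..v.1, K (pr τ, v.2) = ∫ τ in a..v.1, K (τ, v.2) := by
    intro Z _ _ K v hv
    refine intervalIntegral.integral_congr fun τ hτ => ?_
    rw [uIcc_of_le hv.1.1] at hτ
    simp only [pre τ ⟨hτ.1, hτ.2.trans hv.1.2⟩]
  have h3 := key.hasFDerivAt.hasFDerivWithinAt (s := Icc a b ×ˢ U)
  have h4 := h3.congr (f₁ := fun y : ℝ × Q => ∫ τ in a..y.1, F (τ, y.2))
    (fun v hv => (hInt F v hv).symm) (hInt F y hy).symm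
  convert h4 using 2
  · simp only [Function.HasUncurry.uncurry, id, pre y.1 hy.1]
  · exact (hInt F' y hy).symm

/-- Induction on the order: the derivative consists of `F` itself and of an integral of the same
shape with the parameter derivative of `F` as integrand. The target space changes at each step,
hence the generalization over `W`. -/
theorem contDiffOn_integral_Icc [FiniteDimensional ℝ Q] {a b : ℝ} (hab : a < b) {U : Set Q} (hU : IsOpen U)
    {W : Type} [NormedAddCommGroup W] [NormedSpace ℝ W] [CompleteSpace W] {F : ℝ × Q → W}
    (hF : ContDiffOn ℝ ∞ F (Icc a b ×ˢ U)) :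
    ContDiffOn ℝ ∞ (fun y : ℝ × Q => ∫ τ in a..y.1, F (τ, y.2)) (Icc a b ×ˢ U) := by
  have hu : UniqueDiffOn ℝ (Icc a b ×ˢ U) := (uniqueDiffOn_Icc hab).prod hU.uniqueDiffOn
  rw [contDiffOn_infty]
  intro n
  induction n generalizing W with
  | zero =>
    have hd : ∀ y ∈ Icc a b ×ˢ U, HasFDerivAt (fun q => F (y.1, q))
        ((fderivWithin ℝ F (Icc a b ×ˢ U) y).comp (ContinuousLinearMap.inr ℝ ℝ Q)) y.2 :=
      fun y hy => hasFDerivAt_of_hasFDerivWithinAt_slice hU hy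
        ((hF.differentiableOn (by simp)) y hy).hasFDerivWithinAt
    have hc : ContinuousOn (fun y => (fderivWithin ℝ F (Icc a b ×ˢ U) y).comp
        (ContinuousLinearMap.inr ℝ ℝ Q)) (Icc a b ×ˢ U) :=
      (hF.continuousOn_fderivWithin hu (by simp)).clm_comp continuousOn_const
    rw [Nat.cast_zero, contDiffOn_zero]
    exact fun y hy => (hasFDerivWithinAt_integral_Icc hab.le hU hF.continuousOn hc hd
      hy).continuousWithinAt
  | succ n ih =>
    have hd : ∀ y ∈ Icc a b ×ˢ U, HasFDerivAt (fun q => F (y.1, q))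
        ((fderivWithin ℝ F (Icc a b ×ˢ U) y).comp (ContinuousLinearMap.inr ℝ ℝ Q)) y.2 :=
      fun y hy => hasFDerivAt_of_hasFDerivWithinAt_slice hU hy
        ((hF.differentiableOn (by simp)) y hy).hasFDerivWithinAt
    have hc : ContDiffOn ℝ ∞ (fun y => (fderivWithin ℝ F (Icc a b ×ˢ U) y).comp
        (ContinuousLinearMap.inr ℝ ℝ Q)) (Icc a b ×ˢ U) :=
      (hF.fderivWithin hu (by simp)).clm_comp contDiffOn_const
    have hG := fun y hy => hasFDerivWithinAt_integral_Icc hab.le hU hF.continuousOn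
      hc.continuousOn hd (y := y) hy
    rw [Nat.cast_succ, contDiffOn_succ_iff_fderivWithin hu]
    refine ⟨fun y hy => (hG y hy).differentiableWithinAt, by simp, ?_⟩
    have h5 : ContDiffOn ℝ n (fun y : ℝ × Q =>
        (ContinuousLinearMap.toSpanSingleton ℝ (F y)).comp (ContinuousLinearMap.fst ℝ ℝ Q) +
          (∫ τ in a..y.1, (fderivWithin ℝ F (Icc a b ×ˢ U) (τ, y.2)).comp
            (ContinuousLinearMap.inr ℝ ℝ Q)).comp (ContinuousLinearMap.snd ℝ ℝ Q))
        (Icc a b ×ˢ U) := by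
      refine ContDiffOn.add (ContDiffOn.clm_comp ?_ contDiffOn_const)
        (ContDiffOn.clm_comp (ih hc) contDiffOn_const)
      exact (ContinuousLinearMap.toSpanSingletonCLE (𝕜 := ℝ) (E := W)).contDiff.comp_contDiffOn
        (hF.of_le (by exact_mod_cast le_top))
    refine h5.congr fun y hy => ?_
    rw [(hG y hy).fderivWithin (hu y hy)]
    ext v <;> simp

end ParametricIntegral

noncomputable section

/-! ### The partial derivative in time. -/

section TDeriv

variable {Q : Type*} [NormedAddCommGroup Q] [NormedSpace ℝ Q]
  {W : Type*} [NormedAddCommGroup W] [NormedSpace ℝ W]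

/-- The derivative within `A` with respect to the first variable. -/
def tderiv (A : Set ℝ) (F : ℝ × Q → W) (y : ℝ × Q) : W :=
  derivWithin (fun τ => F (τ, y.2)) A y.1

variable {A : Set ℝ} {U : Set Q} {F : ℝ × Q → W}

theorem hasDerivWithinAt_slice {L : ℝ × Q →L[ℝ] W} {y : ℝ × Q}
    (hy : y ∈ A ×ˢ U) (hF : HasFDerivWithinAt F L (A ×ˢ U) y) :
    HasDerivWithinAt (fun τ => F (τ, y.2)) (L (1, 0)) A y.1 := by
  have h1 : HasDerivWithinAt (fun τ : ℝ => (τ, y.2)) ((1 : ℝ), (0 : Q)) A y.1 :=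
    (hasDerivWithinAt_id y.1 A).prodMk (hasDerivWithinAt_const y.1 A y.2)
  exact HasFDerivWithinAt.comp_hasDerivWithinAt y.1 (t := A ×ˢ U) (f := fun τ : ℝ => (τ, y.2))
    hF h1 (fun τ hτ => ⟨hτ, hy.2⟩)

theorem tderiv_eq_fderivWithin (hA : UniqueDiffOn ℝ A)
    (hF : ContDiffOn ℝ ∞ F (A ×ˢ U)) {y : ℝ × Q} (hy : y ∈ A ×ˢ U) :
    tderiv A F y = fderivWithin ℝ F (A ×ˢ U) y (1, 0) :=
  (hasDerivWithinAt_slice hy ((hF.differentiableOn (by simp)) y hy).hasFDerivWithinAt).derivWithin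
    (hA y.1 hy.1)

theorem hasDerivWithinAt_tderiv (hA : UniqueDiffOn ℝ A)
    (hF : ContDiffOn ℝ ∞ F (A ×ˢ U)) {y : ℝ × Q} (hy : y ∈ A ×ˢ U) :
    HasDerivWithinAt (fun τ => F (τ, y.2)) (tderiv A F y) A y.1 := by
  rw [tderiv_eq_fderivWithin hA hF hy]
  exact hasDerivWithinAt_slice hy ((hF.differentiableOn (by simp)) y hy).hasFDerivWithinAt

theorem ContDiffOn.tderiv (hA : UniqueDiffOn ℝ A) (hU : IsOpen U)
    (hF : ContDiffOn ℝ ∞ F (A ×ˢ U)) : ContDiffOn ℝ ∞ (tderiv A F) (A ×ˢ U) := by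
  have hu : UniqueDiffOn ℝ (A ×ˢ U) := hA.prod hU.uniqueDiffOn
  exact ((hF.fderivWithin hu (by simp)).clm_apply contDiffOn_const).congr
    fun y hy => tderiv_eq_fderivWithin hA hF hy

theorem tderiv_congr_set {Q : Type*} {F : ℝ × Q → W} {A' : Set ℝ} {y : ℝ × Q} (h : A =ᶠ[𝓝 y.1] A') :
    tderiv A F y = tderiv A' F y :=
  derivWithin_congr_set h

end TDeriv

/-! ### Extension by zero, and derivatives of slices. -/

section Extension

variable {Y : Type*} [NormedAddCommGroup Y] [NormedSpace ℝ Y]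
  {W : Type*} [NormedAddCommGroup W] [NormedSpace ℝ W]

/-- Smoothness is local: near points of the closed set `C` it comes from `D`, and near all other
points the function vanishes. Compactly supported changes are extended by zero in this way. -/
theorem contDiffOn_of_eq_zero_off {T D C : Set Y} (hC : IsClosed C)
    (hD : ∀ y ∈ T, y ∈ C → D ∈ 𝓝[T] y) {g : Y → W} (hg : ContDiffOn ℝ ∞ g (T ∩ D))
    (h0 : ∀ y ∈ T, y ∉ C → g y = 0) : ContDiffOn ℝ ∞ g T := by
  intro y hy
  by_cases hyC : y ∈ C
  · have hDy := hD y hy hyC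
    have : ContDiffWithinAt ℝ ∞ g (T ∩ D) y := hg y ⟨hy, mem_of_mem_nhdsWithin hy hDy⟩
    exact this.mono_of_mem_nhdsWithin (inter_mem self_mem_nhdsWithin hDy)
  · have : g =ᶠ[𝓝[T] y] fun _ => 0 := by
      filter_upwards [self_mem_nhdsWithin, mem_nhdsWithin_of_mem_nhds
        (hC.isOpen_compl.mem_nhds hyC)] with z hz hzC using h0 z hz hzC
    exact contDiffWithinAt_const.congr_of_eventuallyEq this (h0 y hy hyC)

variable {S : Type*} [NormedAddCommGroup S] [NormedSpace ℝ S]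

open scoped Pointwise in
theorem iteratedFDerivWithin_slice {T : Set Y} {O : Set S} (hT : UniqueDiffOn ℝ T)
    (hO : IsOpen O) {F : Y × S → W} (hF : ContDiffOn ℝ ∞ F (T ×ˢ O)) (k : ℕ) {y : Y} {s : S}
    (hy : y ∈ T) (hs : s ∈ O) :
    iteratedFDerivWithin ℝ k (fun z => F (z, s)) T y =
      (iteratedFDerivWithin ℝ k F (T ×ˢ O) (y, s)).compContinuousLinearMap
        (fun _ => ContinuousLinearMap.inl ℝ Y S) := by
  -- The embedding of the slice is affine. Translating `s` to the origin makes it the linear map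
  -- `inl`, for which the chain rule has no higher terms.
  have hF' : ContDiffOn ℝ ∞ (fun w : Y × S => F (w + (0, s))) (T ×ˢ ((fun v => v + s) ⁻¹' O)) := by
    refine hF.comp (by fun_prop) fun w hw => ?_
    simpa using ⟨hw.1, hw.2⟩
  have hpre : (ContinuousLinearMap.inl ℝ Y S) ⁻¹' (T ×ˢ ((fun v => v + s) ⁻¹' O)) = T := by
    ext z; simp [hs]
  have hO' : IsOpen ((fun v => v + s) ⁻¹' O) := hO.preimage (by fun_prop)
  have h1 := (ContinuousLinearMap.inl ℝ Y S).iteratedFDerivWithin_comp_right (x := y) (i := k)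
    hF' (hT.prod hO'.uniqueDiffOn) (by rw [hpre]; exact hT) (by simp [hy, hs])
    (by exact_mod_cast le_top)
  rw [hpre] at h1
  have h2 : (fun w : Y × S => F (w + (0, s))) ∘ (ContinuousLinearMap.inl ℝ Y S) =
      fun z => F (z, s) := by
    ext z; simp
  rw [h2] at h1
  rw [h1, iteratedFDerivWithin_comp_add_right]
  congr 1
  have h3 : ((0 : Y), s) +ᵥ (T ×ˢ ((fun v => v + s) ⁻¹' O)) = T ×ˢ O := by
    ext ⟨z, v⟩
    rw [mem_vadd_set_iff_neg_vadd_mem]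
    simp [vadd_eq_add]
  rw [h3]
  simp

/-- The derivatives are jointly continuous and `C` is compact, so a change that depends smoothly on
a parameter tends to zero with all derivatives up to order `r`. Smooth families of changes become
Whitney-small changes by this lemma. -/
theorem eventually_iteratedFDerivWithin_lt {T : Set Y} {O : Set S} (hT : UniqueDiffOn ℝ T)
    (hO : IsOpen O) {s₀ : S} (h0 : s₀ ∈ O) {F : Y × S → W} (hF : ContDiffOn ℝ ∞ F (T ×ˢ O))
    {C : Set Y} (hC : IsCompact C) (hCT : C ⊆ T) (r : ℕ) {ε : ℝ} (hε : 0 < ε) :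
    ∀ᶠ s in 𝓝 s₀, ∀ k ≤ r, ∀ y ∈ C,
      ‖iteratedFDerivWithin ℝ k (fun z => F (z, s) - F (z, s₀)) T y‖ < ε := by
  have hu : UniqueDiffOn ℝ (T ×ˢ O) := hT.prod hO.uniqueDiffOn
  have hfin : ∀ k ∈ Iic r, ∀ᶠ s in 𝓝 s₀, ∀ y ∈ C,
      ‖iteratedFDerivWithin ℝ k (fun z => F (z, s) - F (z, s₀)) T y‖ < ε := by
    intro k _
    refine hC.eventually_forall_of_forall_eventually
      (P := fun s y => y ∈ C → ‖iteratedFDerivWithin ℝ k (fun z => F (z, s) - F (z, s₀)) T y‖ < ε)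
      (fun y hy => ?_) |>.mono fun s hs y hy => hs y hy hy
    have hc : ContinuousOn (fun w : Y × S => iteratedFDerivWithin ℝ k F (T ×ˢ O) w) (T ×ˢ O) :=
      hF.continuousOn_iteratedFDerivWithin (by exact_mod_cast le_top) hu
    have hc0 : ContinuousOn (fun w : Y × S => iteratedFDerivWithin ℝ k F (T ×ˢ O) (w.1, s₀))
        (T ×ˢ O) := hc.comp (by fun_prop) fun w hw => ⟨hw.1, h0⟩
    have hc1 : ContinuousWithinAt (fun w : Y × S => ‖(iteratedFDerivWithin ℝ k F (T ×ˢ O) w -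
        iteratedFDerivWithin ℝ k F (T ×ˢ O) (w.1, s₀)).compContinuousLinearMap
          (fun _ => ContinuousLinearMap.inl ℝ Y S)‖) (T ×ˢ O) (y, s₀) := by
      have h1 := (hc.sub hc0) (y, s₀) ⟨hCT hy, h0⟩
      have h2 : Continuous fun f : ContinuousMultilinearMap ℝ (fun _ : Fin k => Y × S) W =>
          ‖f.compContinuousLinearMap (fun _ => ContinuousLinearMap.inl ℝ Y S)‖ :=
        (ContinuousMultilinearMap.compContinuousLinearMapL (F := W)
          (fun _ : Fin k => ContinuousLinearMap.inl ℝ Y S)).continuous.norm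
      exact h2.continuousAt.comp_continuousWithinAt h1
    have hlt := hc1.eventually_lt continuousWithinAt_const
      (g := fun _ => ε) (by
        have h0' : (0 : ContinuousMultilinearMap ℝ (fun _ : Fin k => Y × S)
            W).compContinuousLinearMap (fun _ => ContinuousLinearMap.inl ℝ Y S) = 0 := by
          ext; simp
        simpa [h0'] using hε)
    rw [eventually_nhdsWithin_iff] at hlt
    replace hlt := (continuous_swap.tendsto (s₀, y)).eventually hlt
    filter_upwards [hlt, (continuous_fst.tendsto (s₀, y)).eventually (hO.mem_nhds h0)]
      with w' hw hwO hwC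
    obtain ⟨w, rfl⟩ : ∃ w : Y × S, w.swap = w' := ⟨w'.swap, by simp⟩
    simp only [Prod.swap_swap, Prod.fst_swap, Prod.snd_swap] at hw hwO hwC ⊢
    have hyT := hCT hwC
    have hs : ∀ s ∈ O, ContDiffWithinAt ℝ k (fun z => F (z, s)) T w.1 := fun s hs =>
      ((hF.comp (f := fun z : Y => (z, s)) (by fun_prop) fun z hz => ⟨hz, hs⟩).of_le
        (by exact_mod_cast le_top)) w.1 hyT
    have hsub : iteratedFDerivWithin ℝ k (fun z => F (z, w.2) - F (z, s₀)) T w.1 =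
        iteratedFDerivWithin ℝ k (fun z => F (z, w.2)) T w.1 -
          iteratedFDerivWithin ℝ k (fun z => F (z, s₀)) T w.1 :=
      iteratedFDerivWithin_sub_apply (hs _ hwO) (hs _ h0) hT hyT
    rw [hsub, iteratedFDerivWithin_slice hT hO hF k hyT hwO,
      iteratedFDerivWithin_slice hT hO hF k hyT h0]
    exact hw ⟨hyT, hwO⟩
  have := (eventually_all_finite (finite_Iic r)).2 hfin
  filter_upwards [this] with s hs k hk using hs k hk

end Extension

/-! ### Division by `λ - l`. -/

section Hadamard

variable {W : Type} [NormedAddCommGroup W] [NormedSpace ℝ W] [CompleteSpace W]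

/-- Hadamard's lemma: the difference of the values at `μ` and `l` is `μ - l` times the mean of the
`λ`-derivative over the segment between them. That mean is smooth in all variables, as a parametric
integral. -/
theorem exists_eq_sub_smul {T L : Set ℝ} (hT : IsOpen T) (hL : IsOpen L) (hLc : Convex ℝ L)
    {l : ℝ} (hl : l ∈ L) {F : ℝ × ℝ → W} (hF : ContDiffOn ℝ ∞ F (T ×ˢ L))
    (h0 : ∀ t ∈ T, F (t, l) = 0) :
    ∃ F₁ : ℝ × ℝ → W, ContDiffOn ℝ ∞ F₁ (T ×ˢ L) ∧
      ∀ y ∈ T ×ˢ L, F y = (y.2 - l) • F₁ y := by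
  have ho : IsOpen (T ×ˢ L) := hT.prod hL
  have hseg : ∀ μ ∈ L, ∀ s ∈ Icc (0 : ℝ) 1, l + s * (μ - l) ∈ L := fun μ hμ s hs =>
    hLc.add_smul_sub_mem hl hμ hs
  let G : ℝ × (ℝ × ℝ) → W := fun v => fderiv ℝ F (v.2.1, l + v.1 * (v.2.2 - l)) (0, 1)
  have hG : ContDiffOn ℝ ∞ G (Icc 0 1 ×ˢ (T ×ˢ L)) := by
    refine ContDiffOn.clm_apply ?_ contDiffOn_const
    exact (hF.fderiv_of_isOpen ho (m := ∞) (by simp)).comp (by fun_prop)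
      fun v hv => ⟨hv.2.1, hseg _ hv.2.2 _ hv.1⟩
  have hI := contDiffOn_integral_Icc one_pos ho hG
  refine ⟨fun y => ∫ s in (0 : ℝ)..1, G (s, y), ?_, fun y hy => ?_⟩
  · exact hI.comp (f := fun y : ℝ × ℝ => ((1 : ℝ), y)) (by fun_prop)
      fun y hy => ⟨⟨zero_le_one, le_rfl⟩, hy⟩
  · have hder : ∀ s ∈ uIcc (0 : ℝ) 1, HasDerivAt (fun s : ℝ => F (y.1, l + s * (y.2 - l)))
        ((y.2 - l) • G (s, y)) s := by
      intro s hs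
      rw [uIcc_of_le zero_le_one] at hs
      have h1 : HasFDerivAt F (fderiv ℝ F (y.1, l + s * (y.2 - l))) (y.1, l + s * (y.2 - l)) :=
        ((hF.contDiffAt (ho.mem_nhds (x := (y.1, l + s * (y.2 - l)))
          ⟨hy.1, hseg _ hy.2 _ hs⟩)).differentiableAt
          (by simp)).hasFDerivAt
      have h2 : HasDerivAt (fun s : ℝ => (y.1, l + s * (y.2 - l))) ((0 : ℝ), y.2 - l) s := by
        refine (hasDerivAt_const s y.1).prodMk ?_
        simpa using ((hasDerivAt_id s).mul_const (y.2 - l)).const_add l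
      have h3 := h1.comp_hasDerivAt s h2
      have h4 : ((0 : ℝ), y.2 - l) = (y.2 - l) • ((0 : ℝ), (1 : ℝ)) := by simp
      rw [h4, map_smul] at h3
      exact h3
    have hcont : ContinuousOn (fun s => (y.2 - l) • G (s, y)) (uIcc (0 : ℝ) 1) := by
      rw [uIcc_of_le zero_le_one]
      exact (hG.continuousOn.comp (f := fun s : ℝ => (s, y)) (by fun_prop)
        fun s hs => ⟨hs, hy⟩).const_smul _
    have h5 := intervalIntegral.integral_eq_sub_of_hasDerivAt hder hcont.intervalIntegrable
    rw [intervalIntegral.integral_smul] at h5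
    simp only [one_mul, zero_mul, add_zero, h0 y.1 hy.1, sub_zero] at h5
    rw [h5]
    simp

end Hadamard

/-! ### Ranks of jets. -/

section JetRank

variable {E : Type*} [NormedAddCommGroup E] [NormedSpace ℝ E]

/-- The rank of the vectors `w 0, …, w r`. -/
def jetRank (w : ℕ → E) (r : ℕ) : ℕ := finrank ℝ (Submodule.span ℝ (w '' Iic r))

theorem jetRank_mono [FiniteDimensional ℝ E] (w : ℕ → E) : Monotone (jetRank w) := fun _ _ h =>
  Submodule.finrank_mono (Submodule.span_mono (image_mono (Iic_subset_Iic.2 h)))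

theorem Iic_succ_eq_insert (r : ℕ) : Iic (r + 1) = insert (r + 1) (Iic r) := by
  ext k; simp; omega

theorem jetRank_succ_le [FiniteDimensional ℝ E] (w : ℕ → E) (r : ℕ) : jetRank w (r + 1) ≤ jetRank w r + 1 := by
  unfold jetRank
  rw [Iic_succ_eq_insert, image_insert_eq, Submodule.span_insert]
  refine (Submodule.finrank_add_le_finrank_add_finrank _ _).trans ?_
  have : finrank ℝ (Submodule.span ℝ {w (r + 1)}) ≤ 1 := by
    by_cases h : w (r + 1) = 0
    · have h0 : Submodule.span ℝ {w (r + 1)} = ⊥ := by simp [h]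
      rw [h0, finrank_bot]; omega
    · rw [finrank_span_singleton h]
  omega

theorem jetRank_zero {w : ℕ → E} (h : w 0 ≠ 0) : jetRank w 0 = 1 := by
  have : (Iic 0 : Set ℕ) = {0} := by ext; simp
  rw [jetRank, this, image_singleton]
  exact finrank_span_singleton h

theorem jetRank_zero_eq_zero {w : ℕ → E} (h : w 0 = 0) : jetRank w 0 = 0 := by
  have : (Iic 0 : Set ℕ) = {0} := by ext; simp
  rw [jetRank, this, image_singleton, h]
  simp

theorem jetRank_le_add [FiniteDimensional ℝ E] (w : ℕ → E) (r k : ℕ) : jetRank w (r + k) ≤ jetRank w r + k := by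
  induction k with
  | zero => simp
  | succ k ih => have := jetRank_succ_le w (r + k); rw [← add_assoc]; omega

theorem jetRank_le [FiniteDimensional ℝ E] (w : ℕ → E) (r : ℕ) : jetRank w r ≤ r + 1 := by
  have h := jetRank_le_add w 0 r
  have : jetRank w 0 ≤ 1 := by
    by_cases h0 : w 0 = 0
    · rw [jetRank_zero_eq_zero h0]; omega
    · rw [jetRank_zero h0]
  rw [zero_add] at h
  omega

theorem jetRank_le_finrank [FiniteDimensional ℝ E] (w : ℕ → E) (r : ℕ) : jetRank w r ≤ finrank ℝ E :=
  Submodule.finrank_le _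

/-- A basis of the span can be chosen among the vectors, and a finite independent family stays
independent under small changes. -/
theorem isOpen_le_jetRank [FiniteDimensional ℝ E] (m r : ℕ) : IsOpen {w : ℕ → E | m ≤ jetRank w r} := by
  rw [isOpen_iff_mem_nhds]
  intro w hw
  obtain ⟨b, hb, hspan, hli⟩ := exists_linearIndependent ℝ (w '' Iic r)
  have hbf : b.Finite := ((finite_Iic r).image w).subset hb
  have hcard : finrank ℝ (Submodule.span ℝ b) = b.ncard := by
    have := hbf.fintype
    rw [finrank_span_set_eq_card hli, Set.ncard_eq_toFinset_card']
  have hm : m ≤ b.ncard := by rw [← hcard, hspan]; exact hw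
  have hb' : ∀ x ∈ b, ∃ k, k ∈ Iic r ∧ w k = x := fun x hx => hb hx
  choose! g hg using hb'
  have hopen : IsOpen {w' : ℕ → E | LinearIndependent ℝ (fun x : b => w' (g x))} := by
    have := hbf.to_subtype
    have h1 : IsOpen {v : b → E | LinearIndependent ℝ v} := isOpen_setOfPred_linearIndependent
    exact h1.preimage (f := fun w' : ℕ → E => fun x : b => w' (g x)) (by fun_prop)
  refine mem_of_superset (hopen.mem_nhds ?_) fun w' hw' => ?_
  · have : (fun x : b => w (g x)) = Subtype.val := by ext x; exact (hg x x.2).2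
    simpa [this] using hli
  · refine hm.trans ?_
    have := hbf.fintype
    have h2 : finrank ℝ (Submodule.span ℝ (range fun x : b => w' (g x))) = Fintype.card b :=
      finrank_span_eq_card hw'
    rw [Set.ncard_eq_toFinset_card', Set.toFinset_card, ← h2]
    refine Submodule.finrank_mono (Submodule.span_mono ?_)
    rintro _ ⟨x, rfl⟩
    exact ⟨g x, (hg x x.2).1, rfl⟩

/-- Two triangular relations give equal spans at every order. This yields the independence of the
ranks from the lift and from the local coordinate. -/
theorem jetRank_eq_of_mem_span [FiniteDimensional ℝ E] {w v : ℕ → E}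
    (h : ∀ k, w k ∈ Submodule.span ℝ (v '' Iic k))
    (h' : ∀ k, v k ∈ Submodule.span ℝ (w '' Iic k)) : jetRank w = jetRank v := by
  have key : ∀ {w v : ℕ → E}, (∀ k, w k ∈ Submodule.span ℝ (v '' Iic k)) → ∀ r,
      Submodule.span ℝ (w '' Iic r) ≤ Submodule.span ℝ (v '' Iic r) := by
    intro w v h r
    rw [Submodule.span_le]
    rintro _ ⟨k, hk, rfl⟩
    exact Submodule.span_mono (image_mono (Iic_subset_Iic.2 hk)) (h k)
  funext r
  exact le_antisymm (Submodule.finrank_mono (key h r)) (Submodule.finrank_mono (key h' r))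

end JetRank

/-! ### The listed types as conditions on ranks. -/

/-- The rank conditions on the derivatives of a lift that characterize the listed types. -/
def GoodRanks (n : ℕ) (d : ℕ → ℕ) : Prop :=
  (d n = n + 1 ∧ d (n + 3) = n + 2) ∨ (d (n - 1) = n ∧ d (n + 2) = n + 2) ∨ (n = 2 ∧ d 4 = 4)

/-- A type records the orders at which the rank jumps, and jumps have height at most one. The five
types therefore collapse into three overlapping alternatives, chosen so that each one only asks for
ranks as large as possible. -/
theorem goodRanks_iff_exists_type {n : ℕ} (hn : 2 ≤ n) {d : ℕ → ℕ} (h0 : d 0 = 1)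
    (hmono : Monotone d) (hstep : ∀ r k, d (r + k) ≤ d r + k) (hle : ∀ r, d r ≤ n + 2) :
    (∃ a ∈ adaptedTypes n, ∀ i : Fin (n + 1), IsLeast {r | d r = (i : ℕ) + 2} (a i)) ↔
      GoodRanks n d := by
  constructor
  · rintro ⟨a, ha, hl⟩
    have hL := fun (i : ℕ) (hi : i < n + 1) => (hl ⟨i, hi⟩).1
    have h1 := hL n (by omega)
    have h2 := hL (n - 1) (by omega)
    simp only [mem_ofPred_eq] at h1 h2
    rcases ha with rfl | rfl | rfl | rfl | ⟨rfl, rfl⟩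
    · left
      simp only at h1 h2
      have h3 : n - 1 + 1 = n := by omega
      rw [h3] at h2
      have := hmono (show n + 1 ≤ n + 3 by omega)
      have := hle (n + 3)
      omega
    · left
      have h4 : n - 1 < n := by omega
      simp only [lt_irrefl, if_false, h4, if_true] at h1 h2
      have h3 : n - 1 + 1 = n := by omega
      rw [h3] at h2
      have := hmono (show n + 2 ≤ n + 3 by omega)
      have := hle (n + 3)
      omega
    · left
      have h4 : n - 1 < n := by omega
      simp only [lt_irrefl, if_false, h4, if_true] at h1 h2
      have h3 : n - 1 + 1 = n := by omega
      rw [h3] at h2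
      omega
    · right; left
      have h3 : ¬ n + 1 < n := by omega
      simp only [h3, if_false] at h1
      have h5 := hL (n - 2) (by omega)
      have h6 : n - 2 + 1 < n := by omega
      simp only [mem_ofPred_eq, h6, if_true] at h5
      have h7 : n - 2 + 1 = n - 1 := by omega
      rw [h7] at h5
      omega
    · right; right
      exact ⟨rfl, h1⟩
  · intro h
    have least : ∀ {a m : ℕ}, d (a + 1) = m + 1 → d a ≤ m → IsLeast {r | d r = m + 1} (a + 1) := by
      intro a m h1 h2
      refine ⟨h1, fun r hr => ?_⟩
      by_contra hlt
      have := hmono (show r ≤ a by omega)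
      simp only [mem_ofPred_eq] at hr
      omega
    -- With `d 0 = 1` and steps of height at most one, a maximal value at `r` leaves no room for a
    -- stall before `r`.
    have low : ∀ {r}, d r = r + 1 → ∀ i ≤ r, d i = i + 1 := by
      intro r hr i hi
      have h1 := hstep i (r - i)
      have h2 := hstep 0 i
      rw [show i + (r - i) = r by omega] at h1
      rw [zero_add] at h2
      omega
    have first : d n = n + 1 ∧ d (n + 3) = n + 2 →
        ∃ a ∈ adaptedTypes n, ∀ i : Fin (n + 1), IsLeast {r | d r = (i : ℕ) + 2} (a i) := by
      rintro ⟨h1, h2⟩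
      have hlow := low h1
      have hi : ∀ i < n, IsLeast {r | d r = i + 2} (i + 1) := fun i hi =>
        least (hlow (i + 1) (by omega)) (hlow i (by omega)).le
      have hd1 := hmono (show n ≤ n + 1 by omega)
      have hd2 := hmono (show n + 1 ≤ n + 2 by omega)
      have hd3 := hmono (show n + 2 ≤ n + 3 by omega)
      have aux : ∀ b, IsLeast {r | d r = n + 2} b → ∀ i : Fin (n + 1),
          IsLeast {r | d r = (i : ℕ) + 2} (if (i : ℕ) < n then (i : ℕ) + 1 else b) := by
        intro b hb i
        split_ifs with hin
        · exact hi i hin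
        · have : (i : ℕ) = n := by have := i.2; omega
          rw [this]; exact hb
      by_cases e1 : d (n + 1) = n + 2
      · refine ⟨_, Or.inl rfl, fun i => ?_⟩
        have := aux (n + 1) (least e1 h1.le) i
        split_ifs at this with hin
        · exact this
        · have h3 : (i : ℕ) = n := by have := i.2; omega
          simpa [h3] using this
      · by_cases e2 : d (n + 2) = n + 2
        · exact ⟨_, Or.inr (Or.inl rfl), aux (n + 2) (least e2 (by have := hle (n+1); omega))⟩
        · exact ⟨_, Or.inr (Or.inr (Or.inl rfl)),
            aux (n + 3) (least h2 (by have := hle (n + 2); omega))⟩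
    have second : d (n - 1) = n ∧ d (n + 2) = n + 2 →
        ∃ a ∈ adaptedTypes n, ∀ i : Fin (n + 1), IsLeast {r | d r = (i : ℕ) + 2} (a i) := by
      rintro ⟨h1, h2⟩
      by_cases e : d n = n + 1
      · refine first ⟨e, ?_⟩
        have := hmono (show n + 2 ≤ n + 3 by omega)
        have := hle (n + 3)
        omega
      · have hlow := low (r := n - 1) (by omega)
        have hd1 := hmono (show n - 1 ≤ n by omega)
        have hs := hstep (n - 1) 1
        rw [show n - 1 + 1 = n by omega] at hs
        have hs1 := hstep n 1
        have hs2 : d (n + 2) ≤ d (n + 1) + 1 := hstep (n + 1) 1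
        have hs3 := hstep n 2
        refine ⟨_, Or.inr (Or.inr (Or.inr (Or.inl rfl))), fun i => ?_⟩
        split_ifs with hin
        · exact least (hlow (i + 1) (by omega)) (hlow i (by omega)).le
        · have hin2 := i.2
          by_cases hi : (i : ℕ) = n
          · rw [hi]
            exact least h2 (by omega)
          · have hi' : (i : ℕ) = n - 1 := by omega
            have hh : n - 1 + 2 = n + 1 := by omega
            rw [hi', hh]
            exact least (by omega) (by omega)
    rcases h with h | h | ⟨rfl, h4⟩
    · exact first h
    · exact second h
    · have s1 := hstep 0 1
      have s2 := hstep 1 1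
      have s3 := hstep 2 1
      have s4 := hstep 3 1
      simp only [zero_add, Nat.reduceAdd] at s1 s2 s3 s4
      -- Going from 1 to 4 in four steps allows exactly one stall. If it occurs at order 1, the
      -- ranks are 1, 1, 2, 3, 4; otherwise the second alternative applies.
      by_cases e : d 1 = 2
      · exact second ⟨e, h4⟩
      · have := hmono (show 0 ≤ 1 by omega)
        refine ⟨_, Or.inr (Or.inr (Or.inr (Or.inr ⟨rfl, rfl⟩))), fun i => ?_⟩
        have hi := i.2
        have hcases : (i : ℕ) = 0 ∨ (i : ℕ) = 1 ∨ (i : ℕ) = 2 := by omega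
        rcases hcases with h | h | h <;> rw [h]
        · exact least (a := 1) (m := 1) (by norm_num; omega) (by omega)
        · exact least (a := 2) (m := 2) (by norm_num; omega) (by omega)
        · exact least (a := 3) (m := 3) (by norm_num; omega) (by omega)

/-- All the prescribed ranks are maximal, so the equalities are lower bounds, and ranks are lower
semicontinuous. -/
theorem isOpen_goodRanks {n : ℕ} (hn : 2 ≤ n) :
    IsOpen {w : ℕ → AmbientSpace n | GoodRanks n (jetRank w)} := by
  have hdim : finrank ℝ (AmbientSpace n) = n + 2 := by simp
  have h : {w : ℕ → AmbientSpace n | GoodRanks n (jetRank w)} =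
      ({w | n + 1 ≤ jetRank w n} ∩ {w | n + 2 ≤ jetRank w (n + 3)}) ∪
      (({w | n ≤ jetRank w (n - 1)} ∩ {w | n + 2 ≤ jetRank w (n + 2)}) ∪
      ({_w | n = 2} ∩ {w | 4 ≤ jetRank w 4})) := by
    ext w
    have h1 := jetRank_le w n
    have h2 := jetRank_le w (n - 1)
    have h3 := jetRank_le_finrank w (n + 3)
    have h4 := jetRank_le_finrank w (n + 2)
    have h5 := jetRank_le_finrank w 4
    rw [hdim] at h3 h4 h5
    simp only [GoodRanks, mem_ofPred_eq, mem_union, mem_inter_iff]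
    omega
  rw [h]
  exact ((isOpen_le_jetRank _ _).inter (isOpen_le_jetRank _ _)).union
    (((isOpen_le_jetRank _ _).inter (isOpen_le_jetRank _ _)).union
      (isOpen_const.inter (isOpen_le_jetRank _ _)))

/-! ### Change of the lift and of the local coordinate. -/

section Transform

variable {E : Type*} [NormedAddCommGroup E] [NormedSpace ℝ E]

/-- Only the triangular shape of the Leibniz and chain rules matters here, so the coefficients need
no closed formula; differentiation replaces `a_j` by `a_j' + φ' a_{j-1}`. -/
theorem exists_iteratedDerivWithin_eq_sum {A A' : Set ℝ} (hA : UniqueDiffOn ℝ A)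
    (hA' : UniqueDiffOn ℝ A') {c : ℝ → E} (hc : ContDiffOn ℝ ∞ c A) {φ f : ℝ → ℝ}
    (hφ : ContDiffOn ℝ ∞ φ A') (hφm : MapsTo φ A' A) (hf : ContDiffOn ℝ ∞ f A') (k : ℕ) :
    ∃ a : ℕ → ℝ → ℝ, (∀ j, ContDiffOn ℝ ∞ (a j) A') ∧ ∀ t ∈ A',
      iteratedDerivWithin k (fun t => f t • c (φ t)) A' t =
        ∑ j ∈ Finset.range (k + 1), a j t • iteratedDerivWithin j c A (φ t) := by
  induction k with
  | zero => exact ⟨fun _ => f, fun _ => hf, fun t ht => by simp⟩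
  | succ k ih =>
    obtain ⟨a, ha, hsum⟩ := ih
    have hda : ∀ j, ContDiffOn ℝ ∞ (derivWithin (a j) A') A' := fun j =>
      (ha j).derivWithin hA' (by simp)
    have hdφ : ContDiffOn ℝ ∞ (derivWithin φ A') A' := hφ.derivWithin hA' (by simp)
    refine ⟨fun j t => (if j ≤ k then derivWithin (a j) A' t else 0) +
      (if 1 ≤ j then derivWithin φ A' t * a (j - 1) t else 0), fun j => ?_, fun t ht => ?_⟩
    · refine ContDiffOn.add ?_ ?_
      · split_ifs
        exacts [hda j, contDiffOn_const]
      · split_ifs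
        exacts [hdφ.mul (ha _), contDiffOn_const]
    · have hder : ∀ j, HasDerivWithinAt (fun s => a j s • iteratedDerivWithin j c A (φ s))
          (a j t • (derivWithin φ A' t • iteratedDerivWithin (j + 1) c A (φ t)) +
            derivWithin (a j) A' t • iteratedDerivWithin j c A (φ t)) A' t := by
        intro j
        have h1 : HasDerivWithinAt (iteratedDerivWithin j c A)
            (iteratedDerivWithin (j + 1) c A (φ t)) A (φ t) := by
          rw [iteratedDerivWithin_succ]
          exact ((hc.differentiableOn_iteratedDerivWithin (by
            exact_mod_cast (ENat.natCast_lt_top j)) hA) _ (hφm ht)).hasDerivWithinAt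
        have h2 : HasDerivWithinAt φ (derivWithin φ A' t) A' t :=
          ((hφ.differentiableOn (by simp)) t ht).hasDerivWithinAt
        have h3 : HasDerivWithinAt (a j) (derivWithin (a j) A' t) A' t :=
          (((ha j).differentiableOn (by simp)) t ht).hasDerivWithinAt
        exact h3.smul (h1.scomp t h2 hφm)
      rw [iteratedDerivWithin_succ, derivWithin_congr hsum (hsum t ht),
        (HasDerivWithinAt.fun_sum fun j _ => hder j).derivWithin (hA' t ht)]
      simp only [add_smul, Finset.sum_add_distrib, smul_smul]
      rw [add_comm]
      congr 1
      · rw [Finset.sum_range_succ (n := k + 1)]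
        simp only [show ¬ k + 1 ≤ k by omega, if_false, zero_smul, add_zero]
        refine Finset.sum_congr rfl fun j hj => ?_
        rw [if_pos (by have := Finset.mem_range.1 hj; omega)]
      · rw [Finset.sum_range_succ' (n := k + 1)]
        simp only [show ¬ 1 ≤ 0 by omega, if_false, zero_smul, add_zero]
        refine Finset.sum_congr rfl fun j _ => ?_
        rw [if_pos (by omega), mul_comm, Nat.add_sub_cancel]

theorem iteratedDerivWithin_mem_span {A A' : Set ℝ} (hA : UniqueDiffOn ℝ A)
    (hA' : UniqueDiffOn ℝ A') {c c' : ℝ → E} (hc : ContDiffOn ℝ ∞ c A) {φ f : ℝ → ℝ}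
    (hφ : ContDiffOn ℝ ∞ φ A') (hφm : MapsTo φ A' A) (hf : ContDiffOn ℝ ∞ f A')
    (hcc : ∀ t ∈ A', c' t = f t • c (φ t)) {t : ℝ} (ht : t ∈ A') (k : ℕ) :
    iteratedDerivWithin k c' A' t ∈
      Submodule.span ℝ ((fun j => iteratedDerivWithin j c A (φ t)) '' Iic k) := by
  obtain ⟨a, -, h⟩ := exists_iteratedDerivWithin_eq_sum hA hA' hc hφ hφm hf k
  rw [iteratedDerivWithin_congr (fun t ht => hcc t ht) ht, h t ht]
  refine Submodule.sum_mem _ fun j hj => Submodule.smul_mem _ _ (Submodule.subset_span ?_)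
  exact ⟨j, by have := Finset.mem_range.1 hj; simp only [mem_Iic]; omega, rfl⟩

end Transform

/-! ### The orthogonal projection onto the range of an idempotent. -/

section Kovarik

variable {E : Type*} [NormedAddCommGroup E] [InnerProductSpace ℝ E] [FiniteDimensional ℝ E]

/-- The orthogonal projection onto the range of an idempotent `Q`. -/
def kovarik (Q : E →L[ℝ] E) : E →L[ℝ] E := Q * Ring.inverse (Q + star Q - 1)

/-- The square of this operator is `1 + (Q - Q*)(Q - Q*)*`, which is positive definite. Injectivity
suffices in finite dimension. -/
theorem isUnit_add_star_sub_one {Q : E →L[ℝ] E} (hQ : Q * Q = Q) : IsUnit (Q + star Q - 1) := by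
  have hstar : star Q * star Q = star Q := by rw [← star_mul, hQ]
  have hsq : (Q + star Q - 1) * (Q + star Q - 1) = 1 + (Q - star Q) * star (Q - star Q) := by
    simp only [star_sub, star_star]
    noncomm_ring
    simp only [hQ, hstar]
    abel
  have hinj : Function.Injective (Q + star Q - 1 : E →L[ℝ] E) := by
    rw [injective_iff_map_eq_zero]
    intro v hv
    have h1 : (1 + (Q - star Q) * star (Q - star Q)) v = 0 := by
      rw [← hsq, mul_apply_eq_comp, hv, map_zero]
    have h2 : inner ℝ v v + inner ℝ (star (Q - star Q) v) (star (Q - star Q) v) = 0 := by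
      have h3 : inner ℝ v ((1 + (Q - star Q) * star (Q - star Q)) v) = 0 := by rw [h1]; simp
      rw [add_apply, inner_add_right, mul_apply_eq_comp,
        one_apply_eq_self] at h3
      rw [← h3, ContinuousLinearMap.star_eq_adjoint, ContinuousLinearMap.adjoint_inner_left]
    have h4 := real_inner_self_nonneg (x := v)
    have h5 := real_inner_self_nonneg (x := star (Q - star Q) v)
    exact inner_self_eq_zero.1 (le_antisymm (by linarith) h4)
  rw [ContinuousLinearMap.isUnit_iff_bijective]
  exact ⟨hinj, LinearMap.injective_iff_surjective
    (f := ((Q + star Q - 1 : E →L[ℝ] E) : E →ₗ[ℝ] E)).1 hinj⟩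

/-- If `P` is the orthogonal projection, then `P Q = Q`, and taking adjoints in `Q P = P` gives `P
Q* = P`. Hence `P (Q + Q* - 1) = Q`, which is solved for `P`. -/
theorem starProjection_eq_kovarik {Q : E →L[ℝ] E} {V : Submodule ℝ E}
    (hV : ∀ v, Q v ∈ V) (hQ : ∀ v ∈ V, Q v = v) : V.starProjection = kovarik Q := by
  have hQQ : Q * Q = Q := by ext v; simp [hQ _ (hV v)]
  have h1 : V.starProjection * Q = Q := by
    ext v
    simp [Submodule.starProjection_eq_self_iff.2 (hV v)]
  have h2 : Q * V.starProjection = V.starProjection := by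
    ext v
    simp [hQ _ (V.starProjection_apply_mem v)]
  have h3 : star V.starProjection = V.starProjection :=
    (isSelfAdjoint_starProjection V).star_eq
  have h4 : V.starProjection * star Q = V.starProjection := by
    rw [← h3, ← star_mul, h2]
  have h5 : V.starProjection * (Q + star Q - 1) = Q := by
    rw [mul_sub, mul_add, h1, h4, mul_one, add_sub_cancel_right]
  rw [kovarik]
  nth_rewrite 1 [← h5]
  rw [mul_assoc, Ring.mul_inverse_cancel _ (isUnit_add_star_sub_one hQQ), mul_one]

theorem contDiffAt_kovarik {Q : E →L[ℝ] E} (hQ : Q * Q = Q) : ContDiffAt ℝ ∞ kovarik Q := by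
  obtain ⟨u, hu⟩ := isUnit_add_star_sub_one hQ
  have h1 : ContDiffAt ℝ ∞ (fun Q : E →L[ℝ] E => Q + star Q - 1) Q := by
    have : ContDiff ℝ ∞ (fun Q : E →L[ℝ] E => star Q) :=
      (starL' ℝ : (E →L[ℝ] E) ≃L[ℝ] (E →L[ℝ] E)).contDiff
    exact ((contDiff_id.add this).sub contDiff_const).contDiffAt
  have h2 : ContDiffAt ℝ ∞ Ring.inverse (Q + star Q - 1) := by
    rw [← hu]; exact contDiffAt_ringInverse ℝ u
  exact contDiffAt_id.mul (ContDiffAt.comp (g := Ring.inverse)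
    (f := fun Q : E →L[ℝ] E => Q + star Q - 1) Q h2 h1)

end Kovarik

/-! ### The Heisenberg group and its action on flags. -/

/-- Two orthonormal vectors, spanning the line and normal to the hyperplane of a reference contact
element. -/
structure ContactFrame (n : ℕ) where
  e : AmbientSpace n
  f : AmbientSpace n
  inner_e : inner ℝ e e = 1
  inner_f : inner ℝ f f = 1
  inner_ef : inner ℝ e f = 0

namespace ContactFrame

variable {n : ℕ} (fr : ContactFrame n)

theorem norm_e : ‖fr.e‖ = 1 := by
  rw [norm_eq_sqrt_real_inner, fr.inner_e, Real.sqrt_one]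

theorem norm_f : ‖fr.f‖ = 1 := by
  rw [norm_eq_sqrt_real_inner, fr.inner_f, Real.sqrt_one]

theorem inner_fe : inner ℝ fr.f fr.e = 0 := by rw [real_inner_comm]; exact fr.inner_ef

/-- The space of the horizontal coordinates. -/
abbrev W : Submodule ℝ (AmbientSpace n) := (Submodule.span ℝ {fr.e, fr.f})ᗮ

theorem inner_e_W (u : fr.W) : inner ℝ fr.e (u : AmbientSpace n) = 0 :=
  u.2 _ (Submodule.subset_span (by simp))

theorem inner_f_W (u : fr.W) : inner ℝ fr.f (u : AmbientSpace n) = 0 :=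
  u.2 _ (Submodule.subset_span (by simp))

theorem inner_W_e (u : fr.W) : inner ℝ (u : AmbientSpace n) fr.e = 0 := by
  rw [real_inner_comm]; exact fr.inner_e_W u

theorem inner_W_f (u : fr.W) : inner ℝ (u : AmbientSpace n) fr.f = 0 := by
  rw [real_inner_comm]; exact fr.inner_f_W u

theorem finrank_W : finrank ℝ fr.W = n := by
  have hli : LinearIndependent ℝ ![fr.e, fr.f] := by
    have : Orthonormal ℝ ![fr.e, fr.f] := by
      rw [orthonormal_iff_ite]
      intro i j
      fin_cases i <;> fin_cases j <;>
        simp [fr.norm_e, fr.norm_f, fr.inner_ef, fr.inner_fe]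
    exact this.linearIndependent
  have h2 : finrank ℝ (Submodule.span ℝ {fr.e, fr.f}) = 2 := by
    have := finrank_span_eq_card hli
    rw [Matrix.range_cons, Matrix.range_cons, Matrix.range_empty, union_empty] at this
    exact this
  have h3 := (Submodule.span ℝ {fr.e, fr.f}).finrank_add_finrank_orthogonal
  rw [h2] at h3
  have h4 : finrank ℝ (AmbientSpace n) = n + 2 := by simp
  change finrank ℝ ((Submodule.span ℝ {fr.e, fr.f})ᗮ : Submodule ℝ (AmbientSpace n)) = n
  omega

/-- The orthogonal projection to the horizontal coordinates. -/
def proj : AmbientSpace n →L[ℝ] fr.W := fr.W.orthogonalProjectionOnto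

theorem proj_W (u : fr.W) : fr.proj (u : AmbientSpace n) = u :=
  Submodule.orthogonalProjectionOnto_mem_subspace_eq_self u

theorem proj_e : fr.proj fr.e = 0 :=
  Submodule.orthogonalProjectionOnto_orthogonal_apply_eq_zero (Submodule.subset_span (by simp))

theorem proj_f : fr.proj fr.f = 0 :=
  Submodule.orthogonalProjectionOnto_orthogonal_apply_eq_zero (Submodule.subset_span (by simp))

theorem decomp (y : AmbientSpace n) :
    y = inner ℝ fr.e y • fr.e + (fr.proj y : AmbientSpace n) + inner ℝ fr.f y • fr.f := by
  have h1 : y - inner ℝ fr.e y • fr.e - inner ℝ fr.f y • fr.f ∈ fr.W := by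
    rw [Submodule.mem_orthogonal]
    intro v hv
    induction hv using Submodule.span_induction with
    | mem x hx =>
      rcases hx with rfl | rfl
      · simp [inner_sub_right, inner_smul_right, fr.norm_e, fr.inner_ef]
      · simp [inner_sub_right, inner_smul_right, fr.norm_f, fr.inner_fe]
    | zero => simp
    | add a b _ _ ha hb => rw [inner_add_left, ha, hb, add_zero]
    | smul c a _ ha => rw [inner_smul_left, ha, mul_zero]
  have h2 := fr.proj_W ⟨_, h1⟩
  simp only [map_sub, map_smul, fr.proj_e, fr.proj_f, smul_zero, sub_zero] at h2
  rw [h2]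
  module

/-- The translation parameters of the Heisenberg group. -/
abbrev Par : Type := fr.W × fr.W × ℝ

/-- The nilpotent part of an element of the Heisenberg group. -/
def heisN : fr.Par →L[ℝ] (AmbientSpace n →L[ℝ] AmbientSpace n) :=
  LinearMap.toContinuousLinearMap
    { toFun := fun q => (innerSL ℝ fr.e).smulRight ((q.1 : AmbientSpace n) + q.2.2 • fr.f) +
        (innerSL ℝ (q.2.1 : AmbientSpace n)).smulRight fr.f
      map_add' := fun a b => by
        ext1 y
        simp only [add_apply, ContinuousLinearMap.smulRight_apply,
          innerSL_apply_apply, Prod.fst_add, Prod.snd_add, Submodule.coe_add, inner_add_left]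
        module
      map_smul' := fun c a => by
        ext1 y
        simp only [add_apply, ContinuousLinearMap.smulRight_apply,
          smul_apply, innerSL_apply_apply, Prod.smul_fst, Prod.smul_snd,
          Submodule.coe_smul, RingHom.id_apply, real_inner_smul_left, smul_eq_mul]
        module }

/-- The element of the Heisenberg group with translation parameters `q`. -/
def heis (q : fr.Par) : AmbientSpace n →L[ℝ] AmbientSpace n := 1 + fr.heisN q

theorem heis_apply (q : fr.Par) (y : AmbientSpace n) :
    fr.heis q y = y + (inner ℝ fr.e y • ((q.1 : AmbientSpace n) + q.2.2 • fr.f) +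
      inner ℝ (q.2.1 : AmbientSpace n) y • fr.f) := rfl

/-- The parameters of the inverse. -/
def heisInv (q : fr.Par) : fr.Par := (-q.1, -q.2.1, inner ℝ q.2.1 q.1 - q.2.2)

theorem heis_heisInv (q : fr.Par) : fr.heis q * fr.heis (fr.heisInv q) = 1 := by
  ext1 y
  simp only [mul_apply_eq_comp, heis_apply, heisInv, one_apply_eq_self,
    inner_add_right, inner_smul_right, fr.inner_e_W, fr.inner_ef, fr.inner_W_f,
    Submodule.coe_neg, inner_neg_left, inner_neg_right, Submodule.coe_inner]
  module

theorem heisInv_heis (q : fr.Par) : fr.heis (fr.heisInv q) * fr.heis q = 1 := by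
  have h : fr.heisInv (fr.heisInv q) = q := by
    simp [heisInv]
  have := fr.heis_heisInv (fr.heisInv q)
  rwa [h] at this

/-- An element of the Heisenberg group as a linear automorphism. -/
def heisEquiv (q : fr.Par) : AmbientSpace n ≃ₗ[ℝ] AmbientSpace n :=
  LinearEquiv.ofLinearMap (fr.heis q : AmbientSpace n →ₗ[ℝ] AmbientSpace n)
    (fr.heis (fr.heisInv q) : AmbientSpace n →ₗ[ℝ] AmbientSpace n)
    (by ext1 y; exact DFunLike.congr_fun (fr.heis_heisInv q) y)
    (by ext1 y; exact DFunLike.congr_fun (fr.heisInv_heis q) y)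

/-- The action of the Heisenberg group on flags. -/
def act (q : fr.Par) (F : CompleteFlag n) : CompleteFlag n where
  V i := (F.V i).map (fr.heisEquiv q : AmbientSpace n →ₗ[ℝ] AmbientSpace n)
  finrank_V i := by rw [LinearEquiv.finrank_map_eq, F.finrank_V]
  mono _ _ h := Submodule.map_mono (F.mono h)

theorem act_zero (F : CompleteFlag n) : fr.act 0 F = F := by
  have h : (fr.heisEquiv 0 : AmbientSpace n →ₗ[ℝ] AmbientSpace n) = LinearMap.id := by
    ext1 y
    change fr.heis 0 y = y
    simp [heis]
  cases F
  simp only [act, h, Submodule.map_id]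

/-- The action of the Heisenberg group in the standard embedding. -/
def actEmbed (q : fr.Par) (P : FlagAmbient n) : FlagAmbient n := fun i =>
  kovarik (fr.heis q * P i * fr.heis (fr.heisInv q))

theorem idem_conj (q : fr.Par) {P : AmbientSpace n →L[ℝ] AmbientSpace n} (hP : P * P = P) :
    fr.heis q * P * fr.heis (fr.heisInv q) * (fr.heis q * P * fr.heis (fr.heisInv q)) =
      fr.heis q * P * fr.heis (fr.heisInv q) := by
  calc _ = fr.heis q * P * (fr.heis (fr.heisInv q) * fr.heis q) * P * fr.heis (fr.heisInv q) := by
        noncomm_ring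
    _ = _ := by rw [heisInv_heis, mul_one, mul_assoc (fr.heis q), hP]

theorem embed_idem (F : CompleteFlag n) (i : Fin (n + 1)) : F.embed i * F.embed i = F.embed i :=
  (F.V i).isIdempotentElem_starProjection

/-- Conjugating an orthogonal projection gives an idempotent with the transformed range, though in
general not an orthogonal one; `kovarik` repairs this by a smooth formula. So the action is smooth
in the embedding. -/
theorem embed_act (q : fr.Par) (F : CompleteFlag n) :
    (fr.act q F).embed = fr.actEmbed q F.embed := by
  funext i
  refine starProjection_eq_kovarik (fun v => ?_) (fun v hv => ?_)
  · exact ⟨_, (F.V i).starProjection_apply_mem _, rfl⟩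
  · obtain ⟨y, hy, rfl⟩ := hv
    have h1 : fr.heis (fr.heisInv q) (fr.heisEquiv q y) = y :=
      DFunLike.congr_fun (fr.heisInv_heis q) y
    have h2 : F.embed i y = y := Submodule.starProjection_eq_self_iff.2 hy
    change fr.heis q (F.embed i (fr.heis (fr.heisInv q) (fr.heisEquiv q y))) = fr.heisEquiv q y
    rw [h1, h2]
    rfl

theorem contDiff_heis : ContDiff ℝ ∞ fr.heis := contDiff_const.add fr.heisN.contDiff

theorem contDiff_heisInv : ContDiff ℝ ∞ fr.heisInv := by
  have h1 : ContDiff ℝ ∞ (fun q : fr.Par => inner ℝ q.2.1 q.1) :=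
    ContDiff.inner ℝ (by fun_prop) (by fun_prop)
  unfold heisInv
  exact contDiff_fst.neg.prodMk (ContDiff.prodMk (by fun_prop) (h1.sub (by fun_prop)))

theorem contDiffAt_actEmbed (q : fr.Par) (F : CompleteFlag n) :
    ContDiffAt ℝ ∞ (fun w : fr.Par × FlagAmbient n => fr.actEmbed w.1 w.2) (q, F.embed) := by
  rw [contDiffAt_pi]
  intro i
  have h1 : ContDiffAt ℝ ∞ (fun w : fr.Par × FlagAmbient n =>
      fr.heis w.1 * w.2 i * fr.heis (fr.heisInv w.1)) (q, F.embed) := by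
    have h2 := fr.contDiff_heis
    have h3 := fr.contDiff_heisInv
    have h4 : ContDiff ℝ ∞ (fun w : fr.Par × FlagAmbient n => w.2 i) := by fun_prop
    exact (((h2.comp contDiff_fst).mul h4).mul
      (h2.comp (h3.comp contDiff_fst))).contDiffAt
  exact ContDiffAt.comp (g := kovarik)
    (f := fun w : fr.Par × FlagAmbient n => fr.heis w.1 * w.2 i * fr.heis (fr.heisInv w.1))
    (q, F.embed) (contDiffAt_kovarik (fr.idem_conj q (embed_idem F i))) h1

end ContactFrame

/-! ### Contact coordinates of a flag. -/

namespace ContactFrame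

variable {n : ℕ} (fr : ContactFrame n)

/-- The vector in the line of a flag whose `e`-coordinate is `1`. -/
def lineLift (P : FlagAmbient n) : AmbientSpace n := (inner ℝ fr.e (P 0 fr.e))⁻¹ • P 0 fr.e

/-- The normal vector of the hyperplane of a flag whose `f`-coordinate is `1`. -/
def normalLift (P : FlagAmbient n) : AmbientSpace n :=
  (inner ℝ fr.f (fr.f - P (Fin.last n) fr.f))⁻¹ • (fr.f - P (Fin.last n) fr.f)

/-- The domain of the contact coordinates. -/
def Valid : Set (FlagAmbient n) :=
  {P | inner ℝ fr.e (P 0 fr.e) ≠ 0 ∧ inner ℝ fr.f (fr.f - P (Fin.last n) fr.f) ≠ 0}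

/-- The contact coordinate `x`. -/
def xc (P : FlagAmbient n) : fr.W := fr.proj (fr.lineLift P)

/-- The contact coordinate `z`. -/
def zc (P : FlagAmbient n) : ℝ := inner ℝ fr.f (fr.lineLift P)

/-- The contact coordinate `p`. -/
def pc (P : FlagAmbient n) : fr.W := -fr.proj (fr.normalLift P)

theorem isOpen_Valid : IsOpen fr.Valid := by
  refine IsOpen.inter (isOpen_ne_fun (f := fun P : FlagAmbient n => inner ℝ fr.e (P 0 fr.e))
    ?_ continuous_const) (isOpen_ne_fun
      (f := fun P : FlagAmbient n => inner ℝ fr.f (fr.f - P (Fin.last n) fr.f))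
      ?_ continuous_const) <;> fun_prop

theorem contDiffOn_lineLift : ContDiffOn ℝ ∞ fr.lineLift fr.Valid := by
  have h : ContDiff ℝ ∞ (fun P : FlagAmbient n => P 0 fr.e) := by fun_prop
  have h' : ContDiff ℝ ∞ (fun P : FlagAmbient n => inner ℝ fr.e (P 0 fr.e)) :=
    contDiff_const.inner ℝ h
  exact (h'.contDiffOn.inv fun P hP => hP.1).smul h.contDiffOn

theorem contDiffOn_normalLift : ContDiffOn ℝ ∞ fr.normalLift fr.Valid := by
  have h : ContDiff ℝ ∞ (fun P : FlagAmbient n => fr.f - P (Fin.last n) fr.f) := by fun_prop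
  have h' : ContDiff ℝ ∞ (fun P : FlagAmbient n => inner ℝ fr.f (fr.f - P (Fin.last n) fr.f)) :=
    contDiff_const.inner ℝ h
  exact (h'.contDiffOn.inv fun P hP => hP.2).smul h.contDiffOn

theorem contDiffOn_xc : ContDiffOn ℝ ∞ fr.xc fr.Valid :=
  fr.proj.contDiff.comp_contDiffOn fr.contDiffOn_lineLift

theorem contDiffOn_pc : ContDiffOn ℝ ∞ fr.pc fr.Valid :=
  (fr.proj.contDiff.comp_contDiffOn fr.contDiffOn_normalLift).neg

theorem contDiffOn_zc : ContDiffOn ℝ ∞ fr.zc fr.Valid :=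
  contDiffOn_const.inner ℝ fr.contDiffOn_lineLift

section

variable {fr} {F : CompleteFlag n}

theorem inner_e_lineLift {P : FlagAmbient n} (h : P ∈ fr.Valid) :
    inner ℝ fr.e (fr.lineLift P) = 1 := by
  rw [lineLift, inner_smul_right, inv_mul_cancel₀ h.1]

theorem inner_f_normalLift {P : FlagAmbient n} (h : P ∈ fr.Valid) :
    inner ℝ fr.f (fr.normalLift P) = 1 := by
  rw [normalLift, inner_smul_right, inv_mul_cancel₀ h.2]

theorem lineLift_eq {P : FlagAmbient n} (h : P ∈ fr.Valid) :
    fr.lineLift P = fr.e + (fr.xc P : AmbientSpace n) + fr.zc P • fr.f := by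
  nth_rewrite 1 [fr.decomp (fr.lineLift P)]
  rw [inner_e_lineLift h, one_smul]
  rfl

theorem lineLift_mem (F : CompleteFlag n) : fr.lineLift F.embed ∈ F.line :=
  Submodule.smul_mem _ _ ((F.V 0).starProjection_apply_mem _)

theorem lineLift_ne_zero {P : FlagAmbient n} (h : P ∈ fr.Valid) : fr.lineLift P ≠ 0 := by
  intro h0
  have := inner_e_lineLift h
  rw [h0] at this
  simp at this

theorem line_eq_span_of_mem {v : AmbientSpace n} (h0 : v ≠ 0) (hv : v ∈ F.line) :
    F.line = Submodule.span ℝ {v} := by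
  have h1 : Submodule.span ℝ {v} ≤ F.line := by simpa using hv
  have h2 : finrank ℝ F.line = 1 := F.finrank_V 0
  exact (Submodule.eq_of_le_of_finrank_eq h1 (by rw [finrank_span_singleton h0, h2])).symm

theorem line_eq_span (h : F.embed ∈ fr.Valid) :
    F.line = Submodule.span ℝ {fr.lineLift F.embed} :=
  line_eq_span_of_mem (lineLift_ne_zero h) (lineLift_mem F)

theorem normalLift_mem (F : CompleteFlag n) : fr.normalLift F.embed ∈ F.hyperplaneᗮ :=
  Submodule.smul_mem _ _ (Submodule.sub_starProjection_mem_orthogonal _)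

theorem hyperplane_eq_of_mem {v : AmbientSpace n} (h0 : v ≠ 0) (hv : v ∈ F.hyperplaneᗮ) :
    F.hyperplane = (Submodule.span ℝ {v})ᗮ := by
  have h1 : Submodule.span ℝ {v} ≤ F.hyperplaneᗮ := by simpa using hv
  have h2 : finrank ℝ F.hyperplane = n + 1 := by
    rw [CompleteFlag.hyperplane, F.finrank_V, Fin.val_last]
  have h3 := F.hyperplane.finrank_add_finrank_orthogonal
  have h4 : finrank ℝ (AmbientSpace n) = n + 2 := by simp
  rw [Submodule.eq_of_le_of_finrank_eq h1 (by rw [finrank_span_singleton h0]; omega),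
    Submodule.orthogonal_orthogonal]

theorem normalLift_ne_zero {P : FlagAmbient n} (h : P ∈ fr.Valid) : fr.normalLift P ≠ 0 := by
  intro h0
  have := inner_f_normalLift h
  rw [h0] at this
  simp at this

theorem hyperplane_eq (h : F.embed ∈ fr.Valid) :
    F.hyperplane = (Submodule.span ℝ {fr.normalLift F.embed})ᗮ :=
  hyperplane_eq_of_mem (normalLift_ne_zero h) (normalLift_mem F)

theorem mem_hyperplane_iff (h : F.embed ∈ fr.Valid) {y : AmbientSpace n} :
    y ∈ F.hyperplane ↔ inner ℝ (fr.normalLift F.embed) y = 0 := by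
  rw [hyperplane_eq h, Submodule.mem_orthogonal_singleton_iff_inner_right]

theorem line_le_hyperplane (F : CompleteFlag n) : F.line ≤ F.hyperplane := F.mono (Fin.le_last 0)

theorem inner_lift_expand (u v : fr.W) (a b c d : ℝ) :
    inner ℝ (a • fr.f - (v : AmbientSpace n) + b • fr.e) (c • fr.e + (u : AmbientSpace n) + d • fr.f)
      = a * d - inner ℝ v u + b * c := by
  simp only [inner_add_left, inner_sub_left, inner_add_right, real_inner_smul_left,
    inner_smul_right, fr.inner_e, fr.inner_f, fr.inner_ef, fr.inner_fe, fr.inner_e_W,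
    fr.inner_f_W, fr.inner_W_e, fr.inner_W_f, Submodule.coe_inner]
  ring

/-- The components along `f` and `W` are the normalization and the definition of `p`. The component
along `e` is forced by the inclusion of the line in the hyperplane. -/
theorem normalLift_eq (h : F.embed ∈ fr.Valid) :
    fr.normalLift F.embed = fr.f - (fr.pc F.embed : AmbientSpace n) +
      (inner ℝ (fr.pc F.embed) (fr.xc F.embed) - fr.zc F.embed) • fr.e := by
  have h1 : fr.normalLift F.embed = fr.f - (fr.pc F.embed : AmbientSpace n) +
      inner ℝ fr.e (fr.normalLift F.embed) • fr.e := by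
    nth_rewrite 1 [fr.decomp (fr.normalLift F.embed)]
    rw [inner_f_normalLift h, one_smul, pc]
    simp only [Submodule.coe_neg]
    module
  have h2 := (mem_hyperplane_iff h).1 (line_le_hyperplane F (lineLift_mem (fr := fr) F))
  have h3 := inner_lift_expand (fr := fr) (fr.xc F.embed) (fr.pc F.embed) 1
    (inner ℝ fr.e (fr.normalLift F.embed)) 1 (fr.zc F.embed)
  rw [one_smul, one_smul, ← lineLift_eq h, ← h1, h2] at h3
  rw [show inner ℝ (fr.pc F.embed) (fr.xc F.embed) - fr.zc F.embed =
    inner ℝ fr.e (fr.normalLift F.embed) by linarith]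
  exact h1

theorem starProjection_line {v : AmbientSpace n} (hv : F.line = Submodule.span ℝ {v}) :
    F.embed 0 = (Submodule.span ℝ {v}).starProjection := by
  change (F.V 0).starProjection = _
  have : F.V 0 = Submodule.span ℝ {v} := hv
  rw [this]

theorem lineLift_eq_of_span {v : AmbientSpace n} (hv : F.line = Submodule.span ℝ {v})
    (h1 : inner ℝ fr.e v = 1) :
    inner ℝ fr.e (F.embed 0 fr.e) ≠ 0 ∧ fr.lineLift F.embed = v := by
  have h0 : v ≠ 0 := by rintro rfl; simp at h1
  have hn : ‖v‖ ^ 2 ≠ 0 := by positivity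
  have h2 : F.embed 0 fr.e = (1 / ‖v‖ ^ 2) • v := by
    rw [starProjection_line hv, Submodule.starProjection_singleton, real_inner_comm, h1]
    simp
  have h3 : inner ℝ fr.e (F.embed 0 fr.e) = 1 / ‖v‖ ^ 2 := by
    rw [h2, inner_smul_right, h1, mul_one]
  refine ⟨by rw [h3]; positivity, ?_⟩
  rw [lineLift, h3, h2, smul_smul, inv_mul_cancel₀ (by positivity), one_smul]

theorem normalLift_eq_of_span {v : AmbientSpace n} (hv : F.hyperplane = (Submodule.span ℝ {v})ᗮ)
    (h1 : inner ℝ fr.f v = 1) :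
    inner ℝ fr.f (fr.f - F.embed (Fin.last n) fr.f) ≠ 0 ∧ fr.normalLift F.embed = v := by
  have h0 : v ≠ 0 := by rintro rfl; simp at h1
  have hn : ‖v‖ ^ 2 ≠ 0 := by positivity
  have h2 : fr.f - F.embed (Fin.last n) fr.f = (1 / ‖v‖ ^ 2) • v := by
    have h4 : F.V (Fin.last n) = (Submodule.span ℝ {v})ᗮ := hv
    change fr.f - (F.V (Fin.last n)).starProjection fr.f = _
    rw [h4, Submodule.starProjection_orthogonal', sub_apply, one_apply_eq_self, sub_sub_cancel,
      Submodule.starProjection_singleton, real_inner_comm, h1]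
    simp
  have h3 : inner ℝ fr.f (fr.f - F.embed (Fin.last n) fr.f) = 1 / ‖v‖ ^ 2 := by
    rw [h2, inner_smul_right, h1, mul_one]
  refine ⟨by rw [h3]; positivity, ?_⟩
  rw [normalLift, h3, h2, smul_smul, inv_mul_cancel₀ (by positivity), one_smul]

theorem heis_lineLift (q : fr.Par) {P : FlagAmbient n} (h : P ∈ fr.Valid) :
    fr.heis q (fr.lineLift P) = fr.e + ((fr.xc P + q.1 : fr.W) : AmbientSpace n) +
      (fr.zc P + q.2.2 + inner ℝ q.2.1 (fr.xc P)) • fr.f := by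
  rw [heis_apply, lineLift_eq h]
  simp only [inner_add_right, inner_smul_right, fr.inner_e, fr.inner_e_W, fr.inner_ef,
    fr.inner_W_e, fr.inner_W_f, Submodule.coe_add, Submodule.coe_inner]
  module

/-- The normal vector of the image of a hyperplane under the Heisenberg group. -/
theorem inner_normal_heis (q : fr.Par) (h : F.embed ∈ fr.Valid) (y : AmbientSpace n) :
    inner ℝ (fr.f - ((fr.pc F.embed + q.2.1 : fr.W) : AmbientSpace n) +
      (inner ℝ (fr.pc F.embed + q.2.1) (fr.xc F.embed + q.1) -
        (fr.zc F.embed + q.2.2 + inner ℝ q.2.1 (fr.xc F.embed))) • fr.e) (fr.heis q y) =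
      inner ℝ (fr.normalLift F.embed) y := by
  rw [normalLift_eq h, heis_apply]
  have hy := fr.decomp y
  set α := inner ℝ fr.e y
  set β := inner ℝ fr.f y
  have hv : inner ℝ (q.2.1 : AmbientSpace n) y = inner ℝ q.2.1 (fr.proj y) := by
    rw [hy]
    simp only [inner_add_right, inner_smul_right, fr.inner_W_e, fr.inner_W_f, map_add, map_smul,
      fr.proj_e, fr.proj_f, fr.proj_W, Submodule.coe_inner]
    simp
  have h1 : y + (α • ((q.1 : AmbientSpace n) + q.2.2 • fr.f) +
      inner ℝ (q.2.1 : AmbientSpace n) y • fr.f) =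
      α • fr.e + ((fr.proj y + α • q.1 : fr.W) : AmbientSpace n) +
        (β + α * q.2.2 + inner ℝ q.2.1 (fr.proj y)) • fr.f := by
    rw [hv]
    nth_rewrite 1 [hy]
    simp only [Submodule.coe_add, Submodule.coe_smul]
    module
  rw [h1]
  nth_rewrite 3 [hy]
  have h2 := fun (u v : fr.W) (b c d : ℝ) => inner_lift_expand (fr := fr) u v 1 b c d
  simp only [one_smul] at h2
  rw [h2, h2]
  simp only [inner_add_left, inner_add_right, inner_smul_right]
  ring

theorem hyperplane_act (q : fr.Par) (h : F.embed ∈ fr.Valid) :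
    (fr.act q F).hyperplane = (Submodule.span ℝ {fr.f -
      ((fr.pc F.embed + q.2.1 : fr.W) : AmbientSpace n) +
      (inner ℝ (fr.pc F.embed + q.2.1) (fr.xc F.embed + q.1) -
        (fr.zc F.embed + q.2.2 + inner ℝ q.2.1 (fr.xc F.embed))) • fr.e})ᗮ := by
  refine hyperplane_eq_of_mem ?_ ?_
  · intro h0
    have h1 := congrArg (inner ℝ fr.f) h0
    simp [inner_add_right, inner_sub_right, inner_smul_right, fr.norm_f, fr.inner_f_W,
      fr.inner_fe] at h1
  · rw [Submodule.mem_orthogonal']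
    rintro _ ⟨y, hy, rfl⟩
    exact (inner_normal_heis q h y).trans ((mem_hyperplane_iff h).1 hy)

theorem line_act (q : fr.Par) (h : F.embed ∈ fr.Valid) :
    (fr.act q F).line = Submodule.span ℝ {fr.heis q (fr.lineLift F.embed)} := by
  refine line_eq_span_of_mem ?_ ⟨_, lineLift_mem F, rfl⟩
  rw [heis_lineLift q h]
  intro h0
  have h1 := congrArg (inner ℝ fr.e) h0
  simp [inner_add_right, inner_smul_right, fr.norm_e, fr.inner_e_W, fr.inner_ef] at h1

/-- The group acts by contact transformations. A given change `(u, v, ζ)` of `(x, p, z)` is realized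
by the parameters `(u, v, ζ - ⟨v, x⟩)`, so any change of coordinates at a point comes from one group
element, and the rest of the flag follows. -/
theorem coords_act (q : fr.Par) (h : F.embed ∈ fr.Valid) :
    (fr.act q F).embed ∈ fr.Valid ∧ fr.xc (fr.act q F).embed = fr.xc F.embed + q.1 ∧
      fr.pc (fr.act q F).embed = fr.pc F.embed + q.2.1 ∧
      fr.zc (fr.act q F).embed = fr.zc F.embed + q.2.2 + inner ℝ q.2.1 (fr.xc F.embed) := by
  have h1 := lineLift_eq_of_span (fr := fr) (line_act q h) (by
    rw [heis_lineLift q h]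
    simp [inner_add_right, inner_smul_right, fr.norm_e, fr.inner_e_W, fr.inner_ef])
  have h2 := normalLift_eq_of_span (fr := fr) (hyperplane_act q h) (by
    simp [inner_add_right, inner_sub_right, inner_smul_right, fr.norm_f, fr.inner_f_W,
      fr.inner_fe])
  refine ⟨⟨h1.1, h2.1⟩, ?_, ?_, ?_⟩
  · rw [xc, h1.2, heis_lineLift q h]
    simp only [map_add, map_smul, fr.proj_e, fr.proj_f, fr.proj_W]
    simp
  · rw [pc, h2.2]
    simp only [map_add, map_sub, map_smul, fr.proj_e, fr.proj_f, fr.proj_W]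
    simp
  · rw [zc, h1.2, heis_lineLift q h]
    simp [inner_add_right, inner_smul_right, fr.norm_f, fr.inner_f_W, fr.inner_fe]

end

theorem exists_valid (F : CompleteFlag n) : ∃ fr : ContactFrame n, F.embed ∈ fr.Valid := by
  have h1 : finrank ℝ F.line = 1 := F.finrank_V 0
  have h2 : finrank ℝ F.hyperplane = n + 1 := by
    rw [CompleteFlag.hyperplane, F.finrank_V, Fin.val_last]
  have h3 := F.hyperplane.finrank_add_finrank_orthogonal
  have h4 : finrank ℝ (AmbientSpace n) = n + 2 := by simp
  have unit : ∀ V : Submodule ℝ (AmbientSpace n), finrank ℝ V ≠ 0 → ∃ v ∈ V, inner ℝ v v = (1 : ℝ) := by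
    intro V hV
    obtain ⟨v, hv, h0⟩ := V.exists_mem_ne_zero_of_ne_bot (by
      rintro rfl; simp at hV)
    refine ⟨‖v‖⁻¹ • v, V.smul_mem _ hv, ?_⟩
    rw [real_inner_smul_left, inner_smul_right, real_inner_self_eq_norm_sq]
    have : ‖v‖ ≠ 0 := norm_ne_zero_iff.2 h0
    field_simp
  obtain ⟨e, he, he1⟩ := unit F.line (by omega)
  obtain ⟨f, hf, hf1⟩ := unit F.hyperplaneᗮ (by omega)
  refine ⟨⟨e, f, he1, hf1, hf e (line_le_hyperplane F he)⟩, ?_, ?_⟩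
  · have : F.embed 0 e = e := Submodule.starProjection_eq_self_iff.2 he
    change inner ℝ e (F.embed 0 e) ≠ 0
    rw [this, he1]
    exact one_ne_zero
  · have : F.embed (Fin.last n) f = 0 := by
      change (F.V (Fin.last n)).starProjection f = 0
      exact (Submodule.starProjection_apply_eq_zero_iff _).2 hf
    change inner ℝ f (f - F.embed (Fin.last n) f) ≠ 0
    rw [this, sub_zero, hf1]
    exact one_ne_zero

end ContactFrame

/-! ### Families in product charts. -/

section LocalForm

variable {n : ℕ} {H : Type*} [TopologicalSpace H] {IM : ModelWithCorners ℝ ℝ H}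
  {I : Type*} [TopologicalSpace I] [ChartedSpace H I]
  {J : Type*} [TopologicalSpace J] [ChartedSpace ℝ J]

variable (IM) in
/-- The product chart at `q₀`. -/
abbrev chart (q₀ : I × J) : PartialEquiv (I × J) (ℝ × ℝ) := extChartAt (IM.prod 𝓘(ℝ, ℝ)) q₀

variable (IM) in
/-- The domain of the first coordinate of the product chart at `q₀`. -/
abbrev tdom (q₀ : I × J) : Set ℝ := (extChartAt IM q₀.1).target

/-- The domain of the second coordinate of the product chart at `q₀`. -/
abbrev ldom (q₀ : I × J) : Set ℝ := (extChartAt 𝓘(ℝ, ℝ) q₀.2).target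

theorem chart_target (q₀ : I × J) : (chart IM q₀).target = tdom IM q₀ ×ˢ ldom q₀ := by
  simp only [chart, extChartAt_prod]
  rfl

theorem chart_source (q₀ : I × J) : (chart IM q₀).source =
    (extChartAt IM q₀.1).source ×ˢ (extChartAt 𝓘(ℝ, ℝ) q₀.2).source := by
  simp only [chart, extChartAt_prod]
  rfl

theorem chart_apply (q₀ q : I × J) : chart IM q₀ q =
    (extChartAt IM q₀.1 q.1, extChartAt 𝓘(ℝ, ℝ) q₀.2 q.2) := by
  simp only [chart, extChartAt_prod]
  rfl

theorem chart_symm_apply (q₀ : I × J) (y : ℝ × ℝ) : (chart IM q₀).symm y =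
    ((extChartAt IM q₀.1).symm y.1, (extChartAt 𝓘(ℝ, ℝ) q₀.2).symm y.2) := by
  simp only [chart, extChartAt_prod]
  rfl

theorem isOpen_ldom {I : Type*} (q₀ : I × J) : IsOpen (ldom q₀) := isOpen_extChartAt_target q₀.2

theorem uniqueDiffOn_tdom {J : Type*} (q₀ : I × J) : UniqueDiffOn ℝ (tdom IM q₀) :=
  uniqueDiffOn_extChartAt_target q₀.1

theorem uniqueDiffOn_target (q₀ : I × J) : UniqueDiffOn ℝ (chart IM q₀).target :=
  uniqueDiffOn_extChartAt_target q₀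

theorem isOpen_chart_source (q₀ : I × J) : IsOpen (chart IM q₀).source :=
  isOpen_extChartAt_source q₀

/-- The embedded family in the product chart at `q₀`. -/
def IntegralFamily.loc (Γ : IntegralFamily n IM I J) (q₀ : I × J) (y : ℝ × ℝ) : FlagAmbient n :=
  (Γ.toFun ((chart IM q₀).symm y)).embed

/-- `f` is near `q` a smooth family of integral curves. -/
def LocIntegral (IM : ModelWithCorners ℝ ℝ H) (f : I × J → CompleteFlag n) (q : I × J) : Prop :=
  ContMDiffAt (IM.prod 𝓘(ℝ, ℝ)) 𝓘(ℝ, FlagAmbient n) ∞ (fun q => (f q).embed) q ∧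
    ∀ v : TangentSpace IM q.1,
      (mfderiv IM 𝓘(ℝ, FlagAmbient n) (fun s : I => (f (s, q.2)).embed) q.1 v : FlagAmbient n) ∈
        (f q).pseudoContact

theorem IntegralFamily.locIntegral (Γ : IntegralFamily n IM I J) (q : I × J) :
    LocIntegral IM Γ.toFun q :=
  ⟨Γ.smooth q, Γ.integral q.2 q.1⟩

theorem LocIntegral.congr {f g : I × J → CompleteFlag n} {q : I × J} (hf : LocIntegral IM f q)
    (h : g =ᶠ[𝓝 q] f) : LocIntegral IM g q := by
  refine ⟨hf.1.congr_of_eventuallyEq (h.mono fun x hx => by simp only [hx]), fun v => ?_⟩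
  have h1 : (fun s : I => (g (s, q.2)).embed) =ᶠ[𝓝 q.1] fun s : I => (f (s, q.2)).embed := by
    have hc : ContinuousAt (fun s : I => (s, q.2)) q.1 := by fun_prop
    exact (hc.eventually h).mono fun s hs => by simp only [hs]
  rw [h1.mfderiv_eq, h.eq_of_nhds]
  exact hf.2 v

/-- A family that is everywhere locally a smooth family of integral curves. -/
def IntegralFamily.ofLoc (f : I × J → CompleteFlag n) (h : ∀ q, LocIntegral IM f q) :
    IntegralFamily n IM I J where
  toFun := f
  smooth q := (h q).1
  integral lam t v := (h (t, lam)).2 v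

theorem pseudoContact_smul {F : CompleteFlag n} {v : FlagAmbient n} (c : ℝ)
    (h : v ∈ F.pseudoContact) : c • v ∈ F.pseudoContact :=
  fun x hx => F.hyperplane.smul_mem c (h x hx)

variable [IsManifold IM ∞ I] [IsManifold 𝓘(ℝ, ℝ) ∞ J]

theorem IntegralFamily.contDiffOn_loc (Γ : IntegralFamily n IM I J) (q₀ : I × J) :
    ContDiffOn ℝ ∞ (Γ.loc q₀) (chart IM q₀).target :=
  contMDiffOn_iff_contDiffOn.1
    (Γ.smooth.comp_contMDiffOn (contMDiffOn_extChartAt_symm q₀))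

theorem IntegralFamily.tderiv_loc_mem (Γ : IntegralFamily n IM I J) (q₀ : I × J) {y : ℝ × ℝ}
    (hy : y ∈ (chart IM q₀).target) :
    tderiv (tdom IM q₀) (Γ.loc q₀) y ∈ (Γ.toFun ((chart IM q₀).symm y)).pseudoContact := by
  rw [chart_target] at hy
  set l := (extChartAt 𝓘(ℝ, ℝ) q₀.2).symm y.2 with hl
  set s := (extChartAt IM q₀.1).symm y.1 with hs
  let h : I → FlagAmbient n := fun s => (Γ.toFun (s, l)).embed
  have hh : HasMFDerivAt IM 𝓘(ℝ, FlagAmbient n) h s (mfderiv IM 𝓘(ℝ, FlagAmbient n) h s) := by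
    have h1 : ContMDiff IM (IM.prod 𝓘(ℝ, ℝ)) ∞ (fun s : I => (s, l)) :=
      contMDiff_id.prodMk contMDiff_const
    exact ((Γ.smooth.comp h1).mdifferentiable (by simp) s).hasMFDerivAt
  have hσ : HasMFDerivWithinAt 𝓘(ℝ, ℝ) IM (extChartAt IM q₀.1).symm (tdom IM q₀) y.1
      (mfderivWithin 𝓘(ℝ, ℝ) IM (extChartAt IM q₀.1).symm (tdom IM q₀) y.1) :=
    ((contMDiffOn_extChartAt_symm (n := ∞) q₀.1).mdifferentiableOn (by simp) y.1
      hy.1).hasMFDerivWithinAt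
  have hcomp := hh.comp_hasMFDerivWithinAt y.1 hσ
  let L : ℝ →L[ℝ] FlagAmbient n := (mfderiv IM 𝓘(ℝ, FlagAmbient n) h s).comp
    (mfderivWithin 𝓘(ℝ, ℝ) IM (extChartAt IM q₀.1).symm (tdom IM q₀) y.1)
  have hd : HasFDerivWithinAt (h ∘ (extChartAt IM q₀.1).symm) L (tdom IM q₀) y.1 :=
    hasMFDerivWithinAt_iff_hasFDerivWithinAt.1 hcomp
  have heq : (fun τ => Γ.loc q₀ (τ, y.2)) = h ∘ (extChartAt IM q₀.1).symm := by
    funext τ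
    simp only [IntegralFamily.loc, chart_symm_apply]
    rfl
  have h2 : tderiv (tdom IM q₀) (Γ.loc q₀) y =
      mfderiv IM 𝓘(ℝ, FlagAmbient n) h s
        (mfderivWithin 𝓘(ℝ, ℝ) IM (extChartAt IM q₀.1).symm (tdom IM q₀) y.1 (1 : ℝ)) := by
    rw [tderiv, heq]
    exact hd.hasDerivWithinAt.derivWithin (uniqueDiffOn_tdom q₀ y.1 hy.1)
  rw [h2, chart_symm_apply]
  exact Γ.integral l s _

/-- Every velocity on the manifold is a multiple of the time derivative in the chart, and the
distribution is stable under scaling. -/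
theorem locIntegral_of_chart {f : I × J → CompleteFlag n} {q₀ : I × J}
    {F : ℝ × ℝ → CompleteFlag n} (hf : ∀ q ∈ (chart IM q₀).source, f q = F (chart IM q₀ q))
    (hF : ContDiffOn ℝ ∞ (fun y => (F y).embed) (chart IM q₀).target)
    (hInt : ∀ y ∈ (chart IM q₀).target,
      tderiv (tdom IM q₀) (fun y => (F y).embed) y ∈ (F y).pseudoContact)
    {q : I × J} (hq : q ∈ (chart IM q₀).source) : LocIntegral IM f q := by
  constructor
  · have h1 : ContMDiffOn (IM.prod 𝓘(ℝ, ℝ)) 𝓘(ℝ, FlagAmbient n) ∞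
        ((fun y => (F y).embed) ∘ chart IM q₀) (chart IM q₀).source :=
      (contMDiffOn_iff_contDiffOn.2 hF).comp
        ((contMDiffOn_extChartAt (n := ∞) (x := q₀)).mono (extChartAt_source _ q₀).subset)
        (chart IM q₀).mapsTo
    refine (h1.contMDiffAt ((isOpen_chart_source q₀).mem_nhds hq)).congr_of_eventuallyEq ?_
    filter_upwards [(isOpen_chart_source q₀).mem_nhds hq] with x hx
    simp only [hf x hx, Function.comp]
  · intro v
    have hq' := hq
    rw [chart_source] at hq'
    have hy : chart IM q₀ q ∈ (chart IM q₀).target := (chart IM q₀).map_source hq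
    have hy' := hy
    rw [chart_target] at hy'
    rw [chart_target] at hF
    have hK := (hasDerivWithinAt_tderiv (uniqueDiffOn_tdom q₀) hF hy').hasFDerivWithinAt
    have hκ : HasMFDerivWithinAt IM 𝓘(ℝ, ℝ) (extChartAt IM q₀.1) (extChartAt IM q₀.1).source q.1
        (mfderivWithin IM 𝓘(ℝ, ℝ) (extChartAt IM q₀.1) (extChartAt IM q₀.1).source q.1) :=
      (((contMDiffOn_extChartAt (n := ∞) (x := q₀.1)).mono
        (extChartAt_source _ q₀.1).subset).mdifferentiableOn (by simp) q.1
          hq'.1).hasMFDerivWithinAt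
    have h1 : extChartAt IM q₀.1 q.1 = (chart IM q₀ q).1 := by rw [chart_apply]
    have hcomp := HasMFDerivWithinAt.comp (I := IM) (I' := 𝓘(ℝ, ℝ)) (I'' := 𝓘(ℝ, FlagAmbient n))
      (g := fun τ => (F (τ, (chart IM q₀ q).2)).embed) (u := tdom IM q₀) q.1
      (by rw [h1]; exact hK.hasMFDerivWithinAt) hκ (extChartAt IM q₀.1).mapsTo
    have hopen := (isOpen_extChartAt_source (I := IM) q₀.1).mem_nhds hq'.1
    have hcomp2 := hcomp.hasMFDerivAt hopen
    have hev : (fun s : I => (f (s, q.2)).embed) =ᶠ[𝓝 q.1]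
        (fun τ => (F (τ, (chart IM q₀ q).2)).embed) ∘ extChartAt IM q₀.1 := by
      filter_upwards [hopen] with s hs
      rw [hf (s, q.2) (by rw [chart_source]; exact ⟨hs, hq'.2⟩)]
      simp only [chart_apply, Function.comp]
    rw [(hcomp2.congr_of_eventuallyEq hev).mfderiv, hf q hq]
    exact pseudoContact_smul _ (hInt _ hy)

end LocalForm

/-! ### The distribution along a lift of the line. -/

section TDerivWithinAt

variable {Q : Type*} [NormedAddCommGroup Q] [NormedSpace ℝ Q]
  {W : Type*} [NormedAddCommGroup W] [NormedSpace ℝ W]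
  {A : Set ℝ} {U : Set Q} {F : ℝ × Q → W} {y : ℝ × Q}

theorem ContDiffWithinAt.hasDerivWithinAt_tderiv (hF : ContDiffWithinAt ℝ ∞ F (A ×ˢ U) y)
    (hA : UniqueDiffOn ℝ A) (hy : y ∈ A ×ˢ U) :
    HasDerivWithinAt (fun τ => F (τ, y.2)) (_root_.tderiv A F y) A y.1 := by
  have h := hasDerivWithinAt_slice hy (hF.differentiableWithinAt (by simp)).hasFDerivWithinAt
  rw [_root_.tderiv, h.derivWithin (hA y.1 hy.1)]
  exact h

end TDerivWithinAt

/-- Differentiating `P₀ e = e`, where `P₀` projects onto the line, gives `P₀' e = e' - P₀ e'`. The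
last term lies in the line and hence in the hyperplane. -/
theorem pseudoContact_iff_of_lift {n : ℕ} {A : Set ℝ} {t : ℝ} (hA : UniqueDiffWithinAt ℝ A t)
    {F : ℝ → CompleteFlag n} {P' : FlagAmbient n}
    (hP : HasDerivWithinAt (fun τ => (F τ).embed) P' A t) {e : ℝ → AmbientSpace n}
    {e' : AmbientSpace n} (he : HasDerivWithinAt e e' A t) (hmem : ∀ τ, e τ ∈ (F τ).line)
    (h0 : e t ≠ 0) : P' ∈ (F t).pseudoContact ↔ e' ∈ (F t).hyperplane := by
  have hP0 : HasDerivWithinAt (fun τ => (F τ).embed 0) (P' 0) A t := hasDerivWithinAt_pi.1 hP 0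
  have h1 := hP0.clm_apply he
  have h2 : (fun τ => (F τ).embed 0 (e τ)) = e := by
    funext τ
    exact Submodule.starProjection_eq_self_iff.2 (hmem τ)
  rw [h2] at h1
  have h3 : P' 0 (e t) + (F t).embed 0 e' = e' := hA.eq_deriv _ h1 he
  have h4 : (F t).embed 0 e' ∈ (F t).hyperplane :=
    ContactFrame.line_le_hyperplane (F t) ((F t).V 0 |>.starProjection_apply_mem e')
  constructor
  · intro h
    rw [← h3]
    exact (F t).hyperplane.add_mem (h _ (hmem t)) h4
  · intro h x hx
    rw [ContactFrame.line_eq_span_of_mem h0 (hmem t)] at hx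
    obtain ⟨c, rfl⟩ := Submodule.mem_span_singleton.1 hx
    rw [map_smul]
    refine (F t).hyperplane.smul_mem c ?_
    have : P' 0 (e t) = e' - (F t).embed 0 e' := eq_sub_of_add_eq h3
    rw [this]
    exact (F t).hyperplane.sub_mem h h4

/-! ### Local modification by elements of the Heisenberg group. -/

section Modify

variable {n : ℕ} {H : Type*} [TopologicalSpace H] {IM : ModelWithCorners ℝ ℝ H}
  {I : Type*} [TopologicalSpace I] [ChartedSpace H I]
  {J : Type*} [TopologicalSpace J] [ChartedSpace ℝ J]
  [IsManifold IM ∞ I] [IsManifold 𝓘(ℝ, ℝ) ∞ J]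

variable (Γ : IntegralFamily n IM I J) (q₀ : I × J) (fr : ContactFrame n)

/-- The coordinate `x` of a family in the chart at `q₀`. -/
def IntegralFamily.X (y : ℝ × ℝ) : fr.W := fr.xc (Γ.loc q₀ y)

/-- The coordinate `p` of a family in the chart at `q₀`. -/
def IntegralFamily.P (y : ℝ × ℝ) : fr.W := fr.pc (Γ.loc q₀ y)

/-- The coordinate `z` of a family in the chart at `q₀`. -/
def IntegralFamily.Z (y : ℝ × ℝ) : ℝ := fr.zc (Γ.loc q₀ y)

variable {Γ q₀ fr} {y : ℝ × ℝ}

theorem IntegralFamily.contDiffWithinAt_loc (hy : y ∈ (chart IM q₀).target) :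
    ContDiffWithinAt ℝ ∞ (Γ.loc q₀) (tdom IM q₀ ×ˢ ldom q₀) y := by
  have := Γ.contDiffOn_loc q₀ y hy
  rwa [chart_target] at this

theorem IntegralFamily.contDiffWithinAt_X (hy : y ∈ (chart IM q₀).target)
    (hv : Γ.loc q₀ y ∈ fr.Valid) :
    ContDiffWithinAt ℝ ∞ (Γ.X q₀ fr) (tdom IM q₀ ×ˢ ldom q₀) y :=
  (fr.contDiffOn_xc.contDiffAt (fr.isOpen_Valid.mem_nhds hv)).comp_contDiffWithinAt y
    (contDiffWithinAt_loc hy)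

theorem IntegralFamily.contDiffWithinAt_P (hy : y ∈ (chart IM q₀).target)
    (hv : Γ.loc q₀ y ∈ fr.Valid) :
    ContDiffWithinAt ℝ ∞ (Γ.P q₀ fr) (tdom IM q₀ ×ˢ ldom q₀) y :=
  (fr.contDiffOn_pc.contDiffAt (fr.isOpen_Valid.mem_nhds hv)).comp_contDiffWithinAt y
    (contDiffWithinAt_loc hy)

theorem IntegralFamily.contDiffWithinAt_Z (hy : y ∈ (chart IM q₀).target)
    (hv : Γ.loc q₀ y ∈ fr.Valid) :
    ContDiffWithinAt ℝ ∞ (Γ.Z q₀ fr) (tdom IM q₀ ×ˢ ldom q₀) y :=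
  (fr.contDiffOn_zc.contDiffAt (fr.isOpen_Valid.mem_nhds hv)).comp_contDiffWithinAt y
    (contDiffWithinAt_loc hy)

theorem IntegralFamily.eventually_valid (hy : y ∈ (chart IM q₀).target)
    (hv : Γ.loc q₀ y ∈ fr.Valid) :
    ∀ᶠ z in 𝓝[tdom IM q₀ ×ˢ ldom q₀] y, Γ.loc q₀ z ∈ fr.Valid :=
  (contDiffWithinAt_loc hy).continuousWithinAt.eventually_mem (fr.isOpen_Valid.mem_nhds hv)

theorem tendsto_slice {A : Set ℝ} {Q : Type*} [TopologicalSpace Q] {U : Set Q} {y : ℝ × Q}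
    (hy : y ∈ A ×ˢ U) : Tendsto (fun τ => (τ, y.2)) (𝓝[A] y.1) (𝓝[A ×ˢ U] y) := by
  refine tendsto_nhdsWithin_iff.2 ⟨?_, ?_⟩
  · exact (Continuous.tendsto (f := fun τ => (τ, y.2)) (by fun_prop) y.1).mono_left
      nhdsWithin_le_nhds
  · filter_upwards [self_mem_nhdsWithin] with τ hτ using ⟨hτ, hy.2⟩

/-- The normalized lift `e + x + z f` has velocity `x' + z' f`, and its product with the normal
vector `f - p + (⟨p, x⟩ - z) e` is `z' - ⟨p, x'⟩`. The intermediate members of the flag play no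
role. -/
theorem IntegralFamily.tderiv_Z (hy : y ∈ (chart IM q₀).target) (hv : Γ.loc q₀ y ∈ fr.Valid) :
    tderiv (tdom IM q₀) (Γ.Z q₀ fr) y =
      inner ℝ (Γ.P q₀ fr y) (tderiv (tdom IM q₀) (Γ.X q₀ fr) y) := by
  have hy' := hy
  rw [chart_target] at hy'
  have hA := uniqueDiffOn_tdom (IM := IM) q₀
  have hloc := (Γ.contDiffWithinAt_loc hy).hasDerivWithinAt_tderiv hA hy'
  have hX := (contDiffWithinAt_X hy hv).hasDerivWithinAt_tderiv hA hy'
  have hZ := (contDiffWithinAt_Z hy hv).hasDerivWithinAt_tderiv hA hy'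
  have hX' : HasDerivWithinAt (fun τ => (Γ.X q₀ fr (τ, y.2) : AmbientSpace n))
      ((tderiv (tdom IM q₀) (Γ.X q₀ fr) y : fr.W) : AmbientSpace n) (tdom IM q₀) y.1 :=
    (fr.W.subtypeL.hasFDerivAt).comp_hasDerivWithinAt y.1 hX
  have he : HasDerivWithinAt (fun τ => fr.lineLift (Γ.loc q₀ (τ, y.2)))
      ((0 : ℝ) • fr.e + ((tderiv (tdom IM q₀) (Γ.X q₀ fr) y : fr.W) : AmbientSpace n) +
        tderiv (tdom IM q₀) (Γ.Z q₀ fr) y • fr.f) (tdom IM q₀) y.1 := by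
    have h1 := (hX'.const_add fr.e).add (hZ.smul_const fr.f)
    rw [zero_smul, zero_add]
    refine h1.congr_of_eventuallyEq ?_ (ContactFrame.lineLift_eq hv)
    filter_upwards [(tendsto_slice hy').eventually (eventually_valid hy hv)] with τ hτ
    exact ContactFrame.lineLift_eq hτ
  have h2 := (pseudoContact_iff_of_lift (F := fun τ => Γ.toFun ((chart IM q₀).symm (τ, y.2)))
    (hA y.1 hy'.1) hloc he (fun τ => ContactFrame.lineLift_mem _)
    (ContactFrame.lineLift_ne_zero hv)).1 (Γ.tderiv_loc_mem q₀ hy)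
  rw [ContactFrame.mem_hyperplane_iff hv, ContactFrame.normalLift_eq hv] at h2
  have h3 := ContactFrame.inner_lift_expand (fr := fr) (tderiv (tdom IM q₀) (Γ.X q₀ fr) y)
    (Γ.P q₀ fr y) 1 (inner ℝ (Γ.P q₀ fr y) (Γ.X q₀ fr y) - Γ.Z q₀ fr y) 0
    (tderiv (tdom IM q₀) (Γ.Z q₀ fr) y)
  rw [one_smul] at h3
  have h4 := h3.symm.trans h2
  linarith

/-- Local modification of a family by the Heisenberg group. -/
theorem IntegralFamily.exists_modification [T2Space I] [T2Space J]
    (Γ : IntegralFamily n IM I J) (q₀ : I × J) (fr : ContactFrame n) {C : Set (ℝ × ℝ)}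
    (hC : IsCompact C) (hCT : C ⊆ (chart IM q₀).target) (hv : ∀ y ∈ C, Γ.loc q₀ y ∈ fr.Valid)
    {g : ℝ × ℝ → fr.Par} (hg : ContDiffOn ℝ ∞ g (chart IM q₀).target)
    (hg0 : ∀ y ∈ (chart IM q₀).target, y ∉ C → g y = 0)
    (hrel : ∀ y ∈ C, tderiv (tdom IM q₀) (fun y => (g y).2.2) y =
      inner ℝ (Γ.P q₀ fr y + (g y).2.1) (tderiv (tdom IM q₀) (fun y => (g y).1) y) -
        inner ℝ (tderiv (tdom IM q₀) (fun y => (g y).2.1) y) (Γ.X q₀ fr y)) :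
    ∃ Γ' : IntegralFamily n IM I J,
      (∀ q ∉ (chart IM q₀).symm '' C, Γ'.toFun q = Γ.toFun q) ∧
      ∀ y ∈ (chart IM q₀).target, Γ'.toFun ((chart IM q₀).symm y) =
        fr.act (g y) (Γ.toFun ((chart IM q₀).symm y)) := by
  classical
  let F : ℝ × ℝ → CompleteFlag n := fun y => fr.act (g y) (Γ.toFun ((chart IM q₀).symm y))
  let f : I × J → CompleteFlag n := fun q =>
    if q ∈ (chart IM q₀).source then F (chart IM q₀ q) else Γ.toFun q
  have hA := uniqueDiffOn_tdom (IM := IM) q₀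
  have hfs : ∀ q ∈ (chart IM q₀).source, f q = F (chart IM q₀ q) := fun q hq => if_pos hq
  have hF : ContDiffOn ℝ ∞ (fun y => (F y).embed) (chart IM q₀).target := by
    have h1 : (fun y => (F y).embed) = fun y => fr.actEmbed (g y) (Γ.loc q₀ y) := by
      funext y
      exact fr.embed_act _ _
    rw [h1]
    intro y hy
    exact (fr.contDiffAt_actEmbed (g y) _).comp_contDiffWithinAt
      (f := fun y => (g y, Γ.loc q₀ y)) y ((hg y hy).prodMk (Γ.contDiffOn_loc q₀ y hy))
  have hoff : ∀ q ∉ (chart IM q₀).symm '' C, f q = Γ.toFun q := by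
    intro q hq
    by_cases hs : q ∈ (chart IM q₀).source
    · have h1 : chart IM q₀ q ∉ C := fun h => hq ⟨_, h, (chart IM q₀).left_inv hs⟩
      rw [hfs q hs]
      simp only [F]
      rw [hg0 _ ((chart IM q₀).map_source hs) h1, fr.act_zero, (chart IM q₀).left_inv hs]
    · exact if_neg hs
  have hclosed : IsClosed ((chart IM q₀).symm '' C) :=
    (hC.image_of_continuousOn ((continuousOn_extChartAt_symm q₀).mono hCT)).isClosed
  have hInt : ∀ y ∈ (chart IM q₀).target,
      tderiv (tdom IM q₀) (fun y => (F y).embed) y ∈ (F y).pseudoContact := by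
    intro y hy
    have hy' := hy
    rw [chart_target] at hy' hF hg
    -- On `C` the hypothesis `hrel` is the relation `z' = ⟨p, x'⟩` for the transformed coordinates;
    -- off `C` the curve is unchanged for nearby times.
    by_cases hyC : y ∈ C
    · have hvy := hv y hyC
      have hloc := (hF y hy').hasDerivWithinAt_tderiv hA hy'
      have hX := (contDiffWithinAt_X hy hvy).hasDerivWithinAt_tderiv hA hy'
      have hZ := (contDiffWithinAt_Z hy hvy).hasDerivWithinAt_tderiv hA hy'
      have hu := ((hg y hy').fst).hasDerivWithinAt_tderiv hA hy'
      have hvv := ((hg y hy').snd.fst).hasDerivWithinAt_tderiv hA hy'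
      have hw := ((hg y hy').snd.snd).hasDerivWithinAt_tderiv hA hy'
      set x' := tderiv (tdom IM q₀) (Γ.X q₀ fr) y
      set z' := tderiv (tdom IM q₀) (Γ.Z q₀ fr) y with hz'
      set u' := tderiv (tdom IM q₀) (fun y => (g y).1) y
      set v' := tderiv (tdom IM q₀) (fun y => (g y).2.1) y
      set w' := tderiv (tdom IM q₀) (fun y => (g y).2.2) y with hw'
      have hXu : HasDerivWithinAt (fun τ => ((Γ.X q₀ fr (τ, y.2) + (g (τ, y.2)).1 : fr.W) :
          AmbientSpace n)) ((x' + u' : fr.W) : AmbientSpace n) (tdom IM q₀) y.1 :=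
        (fr.W.subtypeL.hasFDerivAt).comp_hasDerivWithinAt y.1 (hX.add hu)
      have hin : HasDerivWithinAt (fun τ => inner ℝ (g (τ, y.2)).2.1 (Γ.X q₀ fr (τ, y.2)))
          (inner ℝ (g y).2.1 x' + inner ℝ v' (Γ.X q₀ fr y)) (tdom IM q₀) y.1 :=
        hvv.inner ℝ hX
      have he : HasDerivWithinAt (fun τ => fr.heis (g (τ, y.2)) (fr.lineLift (Γ.loc q₀ (τ, y.2))))
          ((0 : ℝ) • fr.e + ((x' + u' : fr.W) : AmbientSpace n) +
            (z' + w' + (inner ℝ (g y).2.1 x' + inner ℝ v' (Γ.X q₀ fr y))) • fr.f)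
          (tdom IM q₀) y.1 := by
        have h1 := (hXu.const_add fr.e).add (((hZ.add hw).add hin).smul_const fr.f)
        rw [zero_smul, zero_add]
        refine h1.congr_of_eventuallyEq ?_ (ContactFrame.heis_lineLift _ hvy)
        filter_upwards [(tendsto_slice hy').eventually (eventually_valid hy hvy)] with τ hτ
        exact ContactFrame.heis_lineLift _ hτ
      refine (pseudoContact_iff_of_lift (F := fun τ => F (τ, y.2))
        (hA y.1 hy'.1) hloc he (fun τ => ⟨_, ContactFrame.lineLift_mem _, rfl⟩) ?_).2 ?_
      · intro h0
        have := congrArg (fr.heis (fr.heisInv (g y))) h0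
        rw [map_zero] at this
        exact ContactFrame.lineLift_ne_zero hvy
          ((DFunLike.congr_fun (fr.heisInv_heis (g y)) _).symm.trans this)
      · have h2 := ContactFrame.hyperplane_act (fr := fr) (g y) (F := Γ.toFun ((chart IM q₀).symm y))
          hvy
        change _ ∈ (fr.act (g y) (Γ.toFun ((chart IM q₀).symm y))).hyperplane
        rw [h2, Submodule.mem_orthogonal_singleton_iff_inner_right]
        have h3 := fun b => ContactFrame.inner_lift_expand (fr := fr) (x' + u')
          (Γ.P q₀ fr y + (g y).2.1) 1 b 0
          (z' + w' + (inner ℝ (g y).2.1 x' + inner ℝ v' (Γ.X q₀ fr y)))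
        simp only [one_smul] at h3
        refine (h3 _).trans ?_
        rw [hw', hrel y hyC, hz', tderiv_Z hy hvy]
        simp only [inner_add_left, inner_add_right, x', u', v']
        ring
    · have hev : ∀ᶠ τ in 𝓝[tdom IM q₀] y.1, (τ, y.2) ∉ C := by
        have := (tendsto_slice hy').eventually (mem_nhdsWithin_of_mem_nhds
          (hC.isClosed.isOpen_compl.mem_nhds hyC))
        exact this
      have h1 : tderiv (tdom IM q₀) (fun y => (F y).embed) y =
          tderiv (tdom IM q₀) (Γ.loc q₀) y := by
        refine EventuallyEq.derivWithin_eq_of_mem ?_ hy'.1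
        filter_upwards [hev, self_mem_nhdsWithin] with τ hτ hτA
        simp only [F]
        rw [hg0 _ (by rw [chart_target]; exact ⟨hτA, hy'.2⟩) hτ, fr.act_zero]
        rfl
      have h2 : F y = Γ.toFun ((chart IM q₀).symm y) := by
        simp only [F]
        rw [hg0 y hy hyC, fr.act_zero]
      rw [h1, h2]
      exact Γ.tderiv_loc_mem q₀ hy
  refine ⟨IntegralFamily.ofLoc f fun q => ?_, hoff, fun y hy => ?_⟩
  · by_cases hs : q ∈ (chart IM q₀).source
    · exact locIntegral_of_chart hfs hF hInt hs
    · have hq : q ∉ (chart IM q₀).symm '' C := by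
        rintro ⟨y, hyC, rfl⟩
        exact hs ((chart IM q₀).map_target (hCT hyC))
      exact (Γ.locIntegral q).congr (by
        filter_upwards [hclosed.isOpen_compl.mem_nhds hq] with x hx using hoff x hx)
  · change f _ = F y
    rw [hfs _ ((chart IM q₀).map_target hy), (chart IM q₀).right_inv hy]

end Modify

/-! ### Estimates for the Whitney topology. -/

theorem Finset.exists_pos_forall_le {ι : Type*} (s : Finset ι) {η : ι → ℝ} (h : ∀ i, 0 < η i) :
    ∃ δ > 0, ∀ i ∈ s, δ ≤ η i := by
  rcases s.eq_empty_or_nonempty with rfl | hne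
  · exact ⟨1, one_pos, by simp⟩
  · obtain ⟨i, -, hi⟩ := s.exists_min_image η hne
    exact ⟨η i, h i, hi⟩

section Bounds

variable {E : Type*} [NormedAddCommGroup E] [NormedSpace ℝ E]
  {W : Type*} [NormedAddCommGroup W] [NormedSpace ℝ W]

theorem ContDiffOn.exists_iteratedFDerivWithin_bound {f : E → W} {s C : Set E}
    (hf : ContDiffOn ℝ ∞ f s) (hs : UniqueDiffOn ℝ s) (hC : IsCompact C) (hCs : C ⊆ s) (r : ℕ) :
    ∃ D, 1 ≤ D ∧ ∀ k ≤ r, ∀ y ∈ C, ‖iteratedFDerivWithin ℝ k f s y‖ ≤ D := by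
  have h : ∀ k, ∃ D, ∀ y ∈ C, ‖iteratedFDerivWithin ℝ k f s y‖ ≤ D := fun k =>
    hC.exists_bound_of_continuousOn
      ((hf.continuousOn_iteratedFDerivWithin (by exact_mod_cast le_top) hs).mono hCs)
  choose D hD using h
  refine ⟨max 1 (∑ k ∈ Finset.range (r + 1), |D k|), le_max_left _ _, fun k hk y hy => ?_⟩
  refine (hD k y hy).trans ((le_abs_self _).trans (le_trans ?_ (le_max_right _ _)))
  exact Finset.single_le_sum (f := fun k => |D k|) (fun i _ => abs_nonneg _)
    (Finset.mem_range.2 (by omega))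

end Bounds

section Whitney

variable {E : Type*} [NormedAddCommGroup E] [NormedSpace ℝ E]
  {H : Type*} [TopologicalSpace H]
  {M : Type*} [TopologicalSpace M] [ChartedSpace H M]
  {W : Type*} [NormedAddCommGroup W] [NormedSpace ℝ W]
  {IM : ModelWithCorners ℝ E H}

theorem uniqueDiffOn_extend_target (c : OpenPartialHomeomorph M H) :
    UniqueDiffOn ℝ (c.extend IM).target := by
  rw [OpenPartialHomeomorph.extend_target]
  exact IM.uniqueDiffOn_preimage c.open_target

theorem ContMDiff.contDiffOn_extend_symm {f : M → W} (hf : ContMDiff IM 𝓘(ℝ, W) ∞ f)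
    {c : OpenPartialHomeomorph M H} (hc : c ∈ IsManifold.maximalAtlas IM ∞ M) :
    ContDiffOn ℝ ∞ (fun u => f ((c.extend IM).symm u)) (c.extend IM).target := by
  rw [OpenPartialHomeomorph.extend_target']
  exact contMDiffOn_iff_contDiffOn.1 (hf.comp_contMDiffOn (contMDiffOn_extend_symm hc))

/-- The transition map has bounded derivatives on the compact set, and the estimate for derivatives
of a composition is linear in the outer function. So one constant serves all `d`. -/
theorem exists_bound_chart_change {c c' : OpenPartialHomeomorph M H}
    (hc : c ∈ IsManifold.maximalAtlas IM ∞ M) (hc' : c' ∈ IsManifold.maximalAtlas IM ∞ M)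
    {K : Set M} (hK : IsCompact K) (hKc : K ⊆ c.source) (hKc' : K ⊆ c'.source) (r : ℕ) :
    ∃ B, 0 < B ∧ ∀ d : M → W,
      ContDiffOn ℝ ∞ (fun u => d ((c'.extend IM).symm u)) (c'.extend IM).target →
      ∀ δ : ℝ, ∀ x ∈ K, (∀ k ≤ r, ‖iteratedFDerivWithin ℝ k (fun u => d ((c'.extend IM).symm u))
        (c'.extend IM).target (c'.extend IM x)‖ ≤ δ) →
      ∀ k ≤ r, ‖iteratedFDerivWithin ℝ k (fun u => d ((c.extend IM).symm u))
        (c.extend IM).target (c.extend IM x)‖ ≤ B * δ := by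
  set σ := IM.extendCoordChange c c' with hσdef
  have hσ : ContDiffOn ℝ ∞ σ σ.source := IM.contDiffOn_extendCoordChange hc hc'
  have hu : UniqueDiffOn ℝ σ.source := IM.uniqueDiffOn_extendCoordChange_source
  have hss : σ.source = (c.extend IM).target ∩ (c.extend IM).symm ⁻¹' c'.source := by
    rw [hσdef, ModelWithCorners.extendCoordChange, PartialEquiv.trans_source,
      OpenPartialHomeomorph.extend_source]
    rfl
  have hKs : c.extend IM '' K ⊆ σ.source := by
    rintro _ ⟨x, hx, rfl⟩
    rw [hss]
    refine ⟨(c.extend IM).map_source (by rw [c.extend_source]; exact hKc hx), ?_⟩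
    rw [mem_preimage, c.extend_left_inv (hKc hx)]
    exact hKc' hx
  have hKim : IsCompact (c.extend IM '' K) :=
    hK.image_of_continuousOn ((c.continuousOn_extend).mono (by rw [c.extend_source]; exact hKc))
  obtain ⟨D, hD1, hD⟩ := hσ.exists_iteratedFDerivWithin_bound hu hKim hKs r
  refine ⟨r.factorial * D ^ r, by positivity, fun d hd δ x hx hδ k hk => ?_⟩
  have hxs : c.extend IM x ∈ σ.source := hKs ⟨x, hx, rfl⟩
  have hδ0 : 0 ≤ δ := (norm_nonneg _).trans (hδ 0 (Nat.zero_le r))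
  have hσx : σ (c.extend IM x) = c'.extend IM x := by
    change c'.extend IM ((c.extend IM).symm (c.extend IM x)) = _
    rw [c.extend_left_inv (hKc hx)]
  have hev : σ.source =ᶠ[𝓝 (c.extend IM x)] (c.extend IM).target := by
    rw [← nhdsWithin_eq_iff_eventuallyEq]
    rw [hss]
    have h1 : (c.extend IM).symm ⁻¹' c'.source ∈ 𝓝 (c.extend IM x) :=
      (c.continuousAt_extend_symm (hKc hx)).preimage_mem_nhds
        (c'.open_source.mem_nhds (by rw [c.extend_left_inv (hKc hx)]; exact hKc' hx))
    exact nhdsWithin_inter_of_mem' (mem_nhdsWithin_of_mem_nhds h1)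
  rw [← iteratedFDerivWithin_congr_set hev]
  have hcomp : EqOn (fun u => d ((c.extend IM).symm u))
      ((fun u => d ((c'.extend IM).symm u)) ∘ σ) σ.source := by
    intro u hu'
    change _ = d ((c'.extend IM).symm (c'.extend IM ((c.extend IM).symm u)))
    rw [hss] at hu'
    rw [c'.extend_left_inv hu'.2]
  rw [iteratedFDerivWithin_congr hcomp hxs]
  have hmaps : MapsTo σ σ.source (c'.extend IM).target := fun u hu' =>
    (c'.extend IM).map_source (by rw [c'.extend_source]; rw [hss] at hu'; exact hu'.2)
  refine (norm_iteratedFDerivWithin_comp_le hd hσ (by exact_mod_cast le_top)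
    (uniqueDiffOn_extend_target c') hu hmaps hxs (C := δ) (D := D)
    (fun i hi => by rw [hσx]; exact hδ i (hi.trans hk)) (fun i h1 hi =>
      (hD i (hi.trans hk) _ ⟨x, hx, rfl⟩).trans (le_self_pow₀ hD1 (by omega)))).trans ?_
  calc (k.factorial : ℝ) * δ * D ^ k ≤ r.factorial * δ * D ^ r := by
        gcongr
    _ = _ := by ring

/-- The compact support of the change meets only finitely many of the sets `K i`, and on each of
these the strict inequalities leave a positive margin. Elsewhere the derivatives do not change. -/
theorem exists_whitneyBall_of_close [T2Space M] {f g : M → W} (hf : ContMDiff IM 𝓘(ℝ, W) ∞ f)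
    (hg : ContMDiff IM 𝓘(ℝ, W) ∞ g) {r : ℕ} {c : ℕ → OpenPartialHomeomorph M H}
    {K : ℕ → Set M} {ε : ℕ → ℝ} (hc : ∀ i, c i ∈ IsManifold.maximalAtlas IM ∞ M)
    (hK : ∀ i, IsCompact (K i) ∧ K i ⊆ (c i).source) (hfin : LocallyFinite K)
    (hgf : g ∈ whitneyBall IM f r c K ε) {c' : OpenPartialHomeomorph M H}
    (hc' : c' ∈ IsManifold.maximalAtlas IM ∞ M) {C : Set E} (hC : IsCompact C)
    (hCT : C ⊆ (c'.extend IM).target) :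
    ∃ δ > 0, ∀ g' : M → W, ContMDiff IM 𝓘(ℝ, W) ∞ g' →
      (∀ q ∉ (c'.extend IM).symm '' C, g' q = g q) →
      (∀ k ≤ r, ∀ y ∈ C, ‖iteratedFDerivWithin ℝ k
        (fun u => g' ((c'.extend IM).symm u) - g ((c'.extend IM).symm u))
        (c'.extend IM).target y‖ < δ) → g' ∈ whitneyBall IM f r c K ε := by
  set C' := (c'.extend IM).symm '' C with hC'
  have hC'c : IsCompact C' := hC.image_of_continuousOn ((c'.continuousOn_extend_symm).mono hCT)
  have hC's : C' ⊆ c'.source := by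
    rintro _ ⟨y, hy, rfl⟩
    have := (c'.extend IM).map_target (hCT hy)
    rwa [c'.extend_source] at this
  have hsub : ∀ {a b : M → W} (_ : ContMDiff IM 𝓘(ℝ, W) ∞ a) (_ : ContMDiff IM 𝓘(ℝ, W) ∞ b)
      (i k : ℕ) (x : M) (_ : x ∈ (c i).source), iteratedFDerivWithin ℝ k
        (fun u => a (((c i).extend IM).symm u) - b (((c i).extend IM).symm u))
        ((c i).extend IM).target ((c i).extend IM x) =
      iteratedFDerivWithin ℝ k (fun u => a (((c i).extend IM).symm u))
        ((c i).extend IM).target ((c i).extend IM x) -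
      iteratedFDerivWithin ℝ k (fun u => b (((c i).extend IM).symm u))
        ((c i).extend IM).target ((c i).extend IM x) := by
    intro a b ha hb i k x hx
    have hxt : (c i).extend IM x ∈ ((c i).extend IM).target :=
      ((c i).extend IM).map_source (by rwa [(c i).extend_source])
    exact iteratedFDerivWithin_sub_apply
      (((ha.contDiffOn_extend_symm (hc i)) _ hxt).of_le (by exact_mod_cast le_top))
      (((hb.contDiffOn_extend_symm (hc i)) _ hxt).of_le (by exact_mod_cast le_top))
      (uniqueDiffOn_extend_target _) hxt
  -- the bound for a single index
  have hone : ∀ i, ∃ δ > 0, ∀ g' : M → W, ContMDiff IM 𝓘(ℝ, W) ∞ g' →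
      (∀ k ≤ r, ∀ y ∈ C, ‖iteratedFDerivWithin ℝ k
        (fun u => g' ((c'.extend IM).symm u) - g ((c'.extend IM).symm u))
        (c'.extend IM).target y‖ < δ) → ∀ k ≤ r, ∀ x ∈ K i, x ∈ C' →
        ‖iteratedFDerivWithin ℝ k
      (fun u => g' (((c i).extend IM).symm u) - f (((c i).extend IM).symm u))
      ((c i).extend IM).target ((c i).extend IM x)‖ < ε i := by
    intro i
    have hKi : IsCompact (K i ∩ C') := (hK i).1.inter hC'c
    obtain ⟨B, hB, hBd⟩ := exists_bound_chart_change (W := W) (hc i) hc' hKi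
      (inter_subset_left.trans (hK i).2) (inter_subset_right.trans hC's) r
    -- A continuous function on a compact set attains its maximum, so a strict bound holds with a
    -- uniform margin `η`.
    have hmax : ∃ η > 0, ∀ k ≤ r, ∀ x ∈ K i, ‖iteratedFDerivWithin ℝ k
        (fun u => g (((c i).extend IM).symm u) - f (((c i).extend IM).symm u))
        ((c i).extend IM).target ((c i).extend IM x)‖ + η ≤ ε i := by
      have hk : ∀ k, ∃ η > 0, k ≤ r → ∀ x ∈ K i, ‖iteratedFDerivWithin ℝ k
          (fun u => g (((c i).extend IM).symm u) - f (((c i).extend IM).symm u))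
          ((c i).extend IM).target ((c i).extend IM x)‖ + η ≤ ε i := by
        intro k
        by_cases hkr : k ≤ r
        swap
        · exact ⟨1, one_pos, fun h => absurd h hkr⟩
        rcases (K i).eq_empty_or_nonempty with he | hne
        · exact ⟨1, one_pos, fun _ x hx => by simp [he] at hx⟩
        have hcont : ContinuousOn (fun x => ‖iteratedFDerivWithin ℝ k
            (fun u => g (((c i).extend IM).symm u) - f (((c i).extend IM).symm u))
            ((c i).extend IM).target ((c i).extend IM x)‖) (K i) := by
          refine ContinuousOn.norm (ContinuousOn.comp (t := ((c i).extend IM).target)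
            (((hg.contDiffOn_extend_symm (hc i)).sub
              (hf.contDiffOn_extend_symm (hc i))).continuousOn_iteratedFDerivWithin
              (by exact_mod_cast le_top) (uniqueDiffOn_extend_target _)) ?_ ?_)
          · exact ((c i).continuousOn_extend).mono (by rw [(c i).extend_source]; exact (hK i).2)
          · intro x hx
            exact ((c i).extend IM).map_source (by rw [(c i).extend_source]; exact (hK i).2 hx)
        obtain ⟨x₀, hx₀, hmx⟩ := (hK i).1.exists_isMaxOn hne hcont
        refine ⟨ε i - _, sub_pos.2 (hgf i k hkr x₀ hx₀), fun _ x hx => ?_⟩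
        have := hmx hx
        simp only [mem_ofPred_eq] at this
        linarith
      choose η hη hη' using hk
      obtain ⟨δ, hδ, hle⟩ := (Finset.range (r + 1)).exists_pos_forall_le hη
      exact ⟨δ, hδ, fun k hk x hx => by
        linarith [hη' k hk x hx, hle k (Finset.mem_range.2 (by omega))]⟩
    obtain ⟨η, hη, hηd⟩ := hmax
    refine ⟨η / (2 * B), by positivity, fun g' hg' hclose k hk x hx hxC => ?_⟩
    have h1 := hBd (fun q => g' q - g q) ((hg'.contDiffOn_extend_symm hc').sub
      (hg.contDiffOn_extend_symm hc')) (η / (2 * B)) x ⟨hx, hxC⟩ (fun k hk => by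
        obtain ⟨y, hy, rfl⟩ := hxC
        rw [(c'.extend IM).right_inv (hCT hy)]
        exact (hclose k hk y hy).le) k hk
    have h2 : B * (η / (2 * B)) = η / 2 := by field_simp
    rw [h2] at h1
    have hxs := (hK i).2 hx
    rw [hsub hg' hg i k x hxs] at h1
    have h3 := hηd k hk x hx
    rw [hsub hg hf i k x hxs] at h3
    rw [hsub hg' hf i k x hxs]
    have h4 := norm_add_le
      (iteratedFDerivWithin ℝ k (fun u => g' (((c i).extend IM).symm u))
        ((c i).extend IM).target ((c i).extend IM x) -
      iteratedFDerivWithin ℝ k (fun u => g (((c i).extend IM).symm u))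
        ((c i).extend IM).target ((c i).extend IM x))
      (iteratedFDerivWithin ℝ k (fun u => g (((c i).extend IM).symm u))
        ((c i).extend IM).target ((c i).extend IM x) -
      iteratedFDerivWithin ℝ k (fun u => f (((c i).extend IM).symm u))
        ((c i).extend IM).target ((c i).extend IM x))
    rw [sub_add_sub_cancel] at h4
    linarith
  choose δ hδ hδd using hone
  have hfinite : {i | (K i ∩ C').Nonempty}.Finite := hfin.finite_nonempty_inter_compact hC'c
  obtain ⟨δ₀, hδ₀, hδ₀d⟩ := hfinite.toFinset.exists_pos_forall_le hδ
  refine ⟨δ₀, hδ₀, fun g' hg' hoff hclose i k hk x hx => ?_⟩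
  by_cases hxC : x ∈ C'
  · have hi : i ∈ hfinite.toFinset := by
      rw [Set.Finite.mem_toFinset]
      exact ⟨x, hx, hxC⟩
    exact hδd i g' hg' (fun k hk y hy => (hclose k hk y hy).trans_le (hδ₀d i hi)) k hk x hx hxC
  · have hev : (fun u => g' (((c i).extend IM).symm u) - f (((c i).extend IM).symm u))
        =ᶠ[𝓝 ((c i).extend IM x)]
        (fun u => g (((c i).extend IM).symm u) - f (((c i).extend IM).symm u)) := by
      have h1 : ∀ᶠ u in 𝓝 ((c i).extend IM x), ((c i).extend IM).symm u ∉ C' :=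
        ((c i).continuousAt_extend_symm ((hK i).2 hx)).preimage_mem_nhds
          (hC'c.isClosed.isOpen_compl.mem_nhds (by
            rw [(c i).extend_left_inv ((hK i).2 hx)]; exact hxC))
      filter_upwards [h1] with u hu
      rw [hoff _ hu]
    rw [(hev.filter_mono nhdsWithin_le_nhds).iteratedFDerivWithin_eq hev.eq_of_nhds]
    exact hgf i k hk x hx

end Whitney

/-! ### Neighbourhoods and open conditions in the space of families. -/

section FamilyTopology

variable {n : ℕ} {H : Type*} [TopologicalSpace H] {IM : ModelWithCorners ℝ ℝ H}
  {I : Type*} [TopologicalSpace I] [ChartedSpace H I]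
  {J : Type*} [TopologicalSpace J] [ChartedSpace ℝ J]

/-- `𝒰` contains a family as soon as it contains all of its germs. -/
def GermClosed (𝒰 : Set (IntegralFamily n IM I J)) : Prop :=
  ∀ Γ : IntegralFamily n IM I J, (∀ q, ∃ Γ' ∈ 𝒰, Γ'.toFun =ᶠ[𝓝 q] Γ.toFun) → Γ ∈ 𝒰

/-- Finite intersections of the defining balls form a basis, and membership in a ball is tested
point by point on derivatives, that is, on germs. This keeps the limit of a locally stationary
sequence inside a neighbourhood. -/
theorem exists_germClosed_subset {Γ : IntegralFamily n IM I J}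
    {𝒰 : Set (IntegralFamily n IM I J)} (h𝒰 : 𝒰 ∈ 𝓝 Γ) :
    ∃ 𝒱 ⊆ 𝒰, IsOpen 𝒱 ∧ Γ ∈ 𝒱 ∧ GermClosed 𝒱 := by
  have hb := TopologicalSpace.isTopologicalBasis_of_subbasis (t := (inferInstance :
    TopologicalSpace (IntegralFamily n IM I J))) rfl
  obtain ⟨𝒱, h𝒱b, hΓ, h𝒱⟩ := hb.mem_nhds_iff.1 h𝒰
  refine ⟨𝒱, h𝒱, hb.isOpen h𝒱b, hΓ, ?_⟩
  obtain ⟨S, ⟨-, hS⟩, rfl⟩ := h𝒱b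
  intro Γ₁ h
  refine mem_sInter.2 fun U hU => ?_
  obtain ⟨f, r, c, K, ε, hc, hK, hfin, hε, rfl⟩ := hS hU
  intro i k hk x hx
  obtain ⟨Γ', hΓ', hev⟩ := h x
  have h1 : Γ' ∈ {g | (fun q => (IntegralFamily.toFun g q).embed) ∈
    whitneyBall (IM.prod 𝓘(ℝ, ℝ)) (fun q => (f.toFun q).embed) r c K ε} := mem_sInter.1 hΓ' _ hU
  have h2 := h1 i k hk x hx
  have hxs := (hK i).2 hx
  have hev' : (fun u => (Γ₁.toFun (((c i).extend (IM.prod 𝓘(ℝ, ℝ))).symm u)).embed -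
        (f.toFun (((c i).extend (IM.prod 𝓘(ℝ, ℝ))).symm u)).embed)
      =ᶠ[𝓝 ((c i).extend (IM.prod 𝓘(ℝ, ℝ)) x)]
      (fun u => (Γ'.toFun (((c i).extend (IM.prod 𝓘(ℝ, ℝ))).symm u)).embed -
        (f.toFun (((c i).extend (IM.prod 𝓘(ℝ, ℝ))).symm u)).embed) := by
    have h3 := ((c i).continuousAt_extend_symm (I := IM.prod 𝓘(ℝ, ℝ)) hxs)
    rw [ContinuousAt, (c i).extend_left_inv hxs] at h3
    filter_upwards [h3.eventually hev] with u hu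
    rw [hu]
  rw [(hev'.filter_mono nhdsWithin_le_nhds).iteratedFDerivWithin_eq hev'.eq_of_nhds]
  exact h2

variable [IsManifold IM ∞ I] [IsManifold 𝓘(ℝ, ℝ) ∞ J]

theorem exists_mem_of_close [T2Space I] [T2Space J] {Γ : IntegralFamily n IM I J}
    {𝒰 : Set (IntegralFamily n IM I J)} (h𝒰 : 𝒰 ∈ 𝓝 Γ) (q₀ : I × J) {C : Set (ℝ × ℝ)}
    (hC : IsCompact C) (hCT : C ⊆ (chart IM q₀).target) :
    ∃ r : ℕ, ∃ δ > 0, ∀ Γ' : IntegralFamily n IM I J,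
      (∀ q ∉ (chart IM q₀).symm '' C, Γ'.toFun q = Γ.toFun q) →
      (∀ k ≤ r, ∀ y ∈ C, ‖iteratedFDerivWithin ℝ k (fun u => Γ'.loc q₀ u - Γ.loc q₀ u)
        (chart IM q₀).target y‖ < δ) → Γ' ∈ 𝒰 := by
  let P : Set (IntegralFamily n IM I J) → Prop := fun 𝒰 =>
    ∃ r : ℕ, ∃ δ > 0, ∀ Γ' : IntegralFamily n IM I J,
      (∀ q ∉ (chart IM q₀).symm '' C, Γ'.toFun q = Γ.toFun q) →
      (∀ k ≤ r, ∀ y ∈ C, ‖iteratedFDerivWithin ℝ k (fun u => Γ'.loc q₀ u - Γ.loc q₀ u)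
        (chart IM q₀).target y‖ < δ) → Γ' ∈ 𝒰
  -- The sets with the required property form a filter, so the comparison with the neighbourhood
  -- filter need only be made on the generating balls.
  let F : Filter (IntegralFamily n IM I J) :=
    { sets := {𝒰 | P 𝒰}
      univ_sets := ⟨0, 1, one_pos, fun _ _ _ => mem_univ _⟩
      sets_of_superset := by
        rintro s t ⟨r, δ, hδ, h⟩ hst
        exact ⟨r, δ, hδ, fun Γ' h1 h2 => hst (h Γ' h1 h2)⟩
      inter_sets := by
        rintro s t ⟨r, δ, hδ, h⟩ ⟨r', δ', hδ', h'⟩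
        refine ⟨max r r', min δ δ', lt_min hδ hδ', fun Γ' h1 h2 => ⟨h Γ' h1 fun k hk y hy => ?_,
          h' Γ' h1 fun k hk y hy => ?_⟩⟩
        · exact (h2 k (hk.trans (le_max_left _ _)) y hy).trans_le (min_le_left _ _)
        · exact (h2 k (hk.trans (le_max_right _ _)) y hy).trans_le (min_le_right _ _) }
  have hF : F ≤ 𝓝 Γ := by
    rw [TopologicalSpace.nhds_generateFrom]
    refine le_iInf₂ fun s hs => le_principal_iff.2 ?_
    obtain ⟨hΓs, f, r, c, K, ε, hc, hK, hfin, hε, rfl⟩ := hs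
    rw [mem_ofPred_eq] at hΓs
    obtain ⟨δ, hδ, h⟩ := exists_whitneyBall_of_close (IM := IM.prod 𝓘(ℝ, ℝ))
      (f := fun q => (f.toFun q).embed) (g := fun q => (Γ.toFun q).embed) (r := r) (ε := ε)
      f.smooth Γ.smooth hc hK hfin hΓs (c' := chartAt (ModelProd H ℝ) q₀)
      (IsManifold.chart_mem_maximalAtlas q₀) (C := C) hC hCT
    refine ⟨r, δ, hδ, fun Γ' h1 h2 => ?_⟩
    rw [mem_ofPred_eq]
    exact h (fun q => (Γ'.toFun q).embed) Γ'.smooth (fun q hq => by rw [h1 q hq]) h2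
  exact hF h𝒰

/-- `G Γ q` is an open condition on the jet of order `r` of `Γ` at `q`. -/
def JetOpen (r : ℕ) (G : IntegralFamily n IM I J → I × J → Prop) : Prop :=
  ∀ Γ q, G Γ q → ∃ N ∈ 𝓝 q, ∃ δ > 0, ∀ Γ' : IntegralFamily n IM I J, ∀ q' ∈ N,
    (∀ k ≤ r, ‖iteratedFDerivWithin ℝ k (fun u => Γ'.loc q u - Γ.loc q u)
      (chart IM q).target (chart IM q q')‖ < δ) → G Γ' q'

variable [T2Space I] [SecondCountableTopology I] [T2Space J] [SecondCountableTopology J]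

/-- The closed set is covered by a locally finite family of compact sets, each inside a
neighbourhood on which closeness of jets suffices. A single Whitney ball then controls all of them
at once. -/
theorem JetOpen.isOpen_forall {r : ℕ} {G : IntegralFamily n IM I J → I × J → Prop}
    (hG : JetOpen r G) {S : Set (I × J)} (hS : IsClosed S) :
    IsOpen {Γ : IntegralFamily n IM I J | ∀ q ∈ S, G Γ q} := by
  classical
  have : LocallyCompactSpace (I × J) := Manifold.locallyCompact_of_finiteDimensional
    (IM.prod 𝓘(ℝ, ℝ))
  rcases isEmpty_or_nonempty (I × J) with hem | ⟨⟨q₁⟩⟩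
  · convert isOpen_univ
    ext Γ
    simp only [mem_ofPred_eq, mem_univ, iff_true]
    exact fun q => hem.elim q
  rw [isOpen_iff_mem_nhds]
  intro Γ hΓ
  have hloc : ∀ q : I × J, ∃ N ∈ 𝓝 q, ∃ δ > 0, N ⊆ (chartAt (ModelProd H ℝ) q).source ∧
      (q ∈ S → ∀ Γ' : IntegralFamily n IM I J, ∀ q' ∈ N,
      (∀ k ≤ r, ‖iteratedFDerivWithin ℝ k (fun u => Γ'.loc q u - Γ.loc q u)
        (chart IM q).target (chart IM q q')‖ < δ) → G Γ' q') := by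
    intro q
    have hs := chart_source_mem_nhds (ModelProd H ℝ) q
    by_cases hq : q ∈ S
    · obtain ⟨N, hN, δ, hδ, h⟩ := hG Γ q (hΓ q hq)
      exact ⟨N ∩ (chartAt (ModelProd H ℝ) q).source, inter_mem hN hs, δ, hδ, inter_subset_right,
        fun _ Γ' q' hq' => h Γ' q' hq'.1⟩
    · exact ⟨_, hs, 1, one_pos, subset_rfl, fun h => absurd h hq⟩
  choose N hN δ hδ hNs hNG using hloc
  have hbasis : ∀ q ∈ S, (𝓝 q).HasBasis (fun s : Set (I × J) => (s ∈ 𝓝 q ∧ IsCompact s) ∧ s ⊆ N q)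
      (fun s => s) := fun q _ => by
    have := (compact_basis_nhds q).restrict_subset (hN q)
    simpa using this
  obtain ⟨α, c, K, hcK, hcov, hfin⟩ :=
    refinement_of_locallyCompact_sigmaCompact_of_nhds_basis_set hS hbasis
  have hcount : Countable α := by
    rw [← countable_univ_iff]
    exact hfin.countable_univ fun a => ⟨c a, mem_of_mem_nhds (hcK a).2.1.1⟩
  obtain ⟨j, hj⟩ := exists_injective_nat α
  -- Balls are indexed by natural numbers. Indices outside the image of `j` receive the empty set,
  -- so the chart and the radius 1 given to them are irrelevant.
  let K' : ℕ → Set (I × J) := fun i => if h : ∃ a, j a = i then K h.choose else ∅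
  let c' : ℕ → OpenPartialHomeomorph (I × J) (ModelProd H ℝ) := fun i =>
    if h : ∃ a, j a = i then chartAt _ (c h.choose) else chartAt _ q₁
  let ε : ℕ → ℝ := fun i => if h : ∃ a, j a = i then δ (c h.choose) else 1
  have hch : ∀ a (h : ∃ b, j b = j a), h.choose = a := fun a h => hj h.choose_spec
  have hK' : ∀ a, K' (j a) = K a := fun a => by
    simp only [K']
    rw [dif_pos ⟨a, rfl⟩, hch]
  have hc' : ∀ a, c' (j a) = chartAt _ (c a) := fun a => by
    simp only [c']
    rw [dif_pos ⟨a, rfl⟩, hch]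
  have hε' : ∀ a, ε (j a) = δ (c a) := fun a => by
    simp only [ε]
    rw [dif_pos ⟨a, rfl⟩, hch]
  have hcases : ∀ i, (∃ a, j a = i) ∨ K' i = ∅ := fun i => by
    by_cases h : ∃ a, j a = i
    · exact Or.inl h
    · exact Or.inr (dif_neg h)
  let U : Set (IntegralFamily n IM I J) := {Γ' | (fun q => (Γ'.toFun q).embed) ∈
    whitneyBall (IM.prod 𝓘(ℝ, ℝ)) (fun q => (Γ.toFun q).embed) r c' K' ε}
  have hεpos : ∀ i, 0 < ε i := fun i => by
    simp only [ε]
    split_ifs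
    · exact hδ _
    · exact one_pos
  have hU : IsOpen U := by
    refine TopologicalSpace.isOpen_generateFrom_of_mem ⟨Γ, r, c', K', ε, ?_, ?_, ?_, hεpos, rfl⟩
    · intro i
      simp only [c']
      split_ifs <;> exact IsManifold.chart_mem_maximalAtlas _
    · intro i
      rcases hcases i with ⟨a, rfl⟩ | h
      · rw [hK', hc']
        exact ⟨(hcK a).2.1.2, (hcK a).2.2.trans (hNs _)⟩
      · rw [h]
        exact ⟨isCompact_empty, empty_subset _⟩
    · intro q
      obtain ⟨t, ht, htf⟩ := hfin q
      refine ⟨t, ht, (htf.image j).subset ?_⟩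
      rintro i hi
      rcases hcases i with ⟨a, rfl⟩ | h
      · simp only [mem_ofPred_eq, hK'] at hi
        exact ⟨a, hi, rfl⟩
      · simp only [mem_ofPred_eq, h, empty_inter, Set.not_nonempty_empty] at hi
  have hΓU : Γ ∈ U := by
    intro i k hk x hx
    have : (fun u => (Γ.toFun (((c' i).extend (IM.prod 𝓘(ℝ, ℝ))).symm u)).embed -
      (Γ.toFun (((c' i).extend (IM.prod 𝓘(ℝ, ℝ))).symm u)).embed) = fun _ => 0 := by
      funext u
      exact sub_self _
    simp only [this]
    rw [show (fun _ : ℝ × ℝ => (0 : FlagAmbient n)) = 0 from rfl, iteratedFDerivWithin_zero,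
      Pi.zero_apply, norm_zero]
    exact hεpos i
  refine mem_of_superset (hU.mem_nhds hΓU) fun Γ' hΓ' q hq => ?_
  obtain ⟨a, ha⟩ := mem_iUnion.1 (hcov hq)
  refine hNG (c a) (hcK a).1 Γ' q ((hcK a).2.2 ha) fun k hk => ?_
  have h := hΓ' (j a) k hk q (by rw [hK']; exact ha)
  rw [hc', hε'] at h
  exact h

end FamilyTopology

/-! ### From local to global density. -/

section LocalToGlobal

variable {n : ℕ} {H : Type*} [TopologicalSpace H] {IM : ModelWithCorners ℝ ℝ H}
  {I : Type*} [TopologicalSpace I] [ChartedSpace H I]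
  {J : Type*} [TopologicalSpace J] [ChartedSpace ℝ J]

/-- Every family close to `Γ₀ ∈ 𝒪` can be perturbed slightly, with support in a given neighbourhood
of `q ∈ L`, so that `G` holds on a neighbourhood of `q` that depends only on `Γ₀` and `q`. -/
def LocallyDense (G : IntegralFamily n IM I J → I × J → Prop) (𝒪 : Set (IntegralFamily n IM I J))
    (L : Set (I × J)) : Prop :=
  ∀ Γ₀ ∈ 𝒪, ∀ q ∈ L, ∀ S ∈ 𝓝 q, ∃ 𝒱 ∈ 𝓝 Γ₀, ∃ N ∈ 𝓝 q, ∀ Γ ∈ 𝒱, ∀ 𝒰 ∈ 𝓝 Γ, ∃ Γ' ∈ 𝒰,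
    (∀ q' ∉ S, Γ'.toFun q' = Γ.toFun q') ∧ ∀ q' ∈ N, G Γ' q'

variable [IsManifold IM ∞ I] [IsManifold 𝓘(ℝ, ℝ) ∞ J]
  [T2Space I] [SecondCountableTopology I] [T2Space J] [SecondCountableTopology J]

theorem JetOpen.eventually {r : ℕ} {G : IntegralFamily n IM I J → I × J → Prop}
    (hG : JetOpen r G) {Γ : IntegralFamily n IM I J} {q : I × J} (h : G Γ q) :
    ∀ᶠ q' in 𝓝 q, G Γ q' := by
  obtain ⟨N, hN, δ, hδ, hd⟩ := hG Γ q h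
  filter_upwards [hN] with q' hq'
  refine hd Γ q' hq' fun k _ => ?_
  have : (fun u => Γ.loc q u - Γ.loc q u) = 0 := by
    funext u
    exact sub_self _
  rw [this, iteratedFDerivWithin_zero, Pi.zero_apply, norm_zero]
  exact hδ

theorem JetOpen.exists_nhds {r : ℕ} {G : IntegralFamily n IM I J → I × J → Prop}
    (hG : JetOpen r G) {Γ : IntegralFamily n IM I J} {q : I × J} (h : G Γ q) :
    ∃ 𝒱 ∈ 𝓝 Γ, ∃ N ∈ 𝓝 q, ∀ Γ' ∈ 𝒱, ∀ q' ∈ N, G Γ' q' := by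
  have : LocallyCompactSpace (I × J) := Manifold.locallyCompact_of_finiteDimensional
    (IM.prod 𝓘(ℝ, ℝ))
  obtain ⟨N, hN, hNs, hNc⟩ := local_compact_nhds (hG.eventually h)
  exact ⟨_, (hG.isOpen_forall hNc.isClosed).mem_nhds fun q' hq' => hNs hq', N, hN,
    fun Γ' hΓ' => hΓ'⟩

/-- Induction over compact sets. The statement is carried for all families near `Γ₀`, so that the
second of two perturbations can start from the result of the first. The condition won on the closed
set `L'` is open and survives a small second step. -/
theorem JetOpen.exists_forall_mem_of_isCompact {r : ℕ}
    {G : IntegralFamily n IM I J → I × J → Prop} (hG : JetOpen r G)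
    {𝒪 : Set (IntegralFamily n IM I J)} {L : Set (I × J)} (hd : LocallyDense G 𝒪 L)
    (hL : IsCompact L) {S : Set (I × J)} (hS : S ∈ 𝓝ˢ L) {Γ₀ : IntegralFamily n IM I J}
    (hΓ₀ : Γ₀ ∈ 𝒪) {𝒰 : Set (IntegralFamily n IM I J)} (h𝒰 : 𝒰 ∈ 𝓝 Γ₀) :
    ∃ Γ' ∈ 𝒰, (∀ q' ∉ S, Γ'.toFun q' = Γ₀.toFun q') ∧ ∀ q' ∈ L, G Γ' q' := by
  have : LocallyCompactSpace (I × J) := Manifold.locallyCompact_of_finiteDimensional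
    (IM.prod 𝓘(ℝ, ℝ))
  have key : ∃ 𝒱 ∈ 𝓝 Γ₀, ∃ L' ⊇ L, IsClosed L' ∧ ∀ Γ ∈ 𝒱, ∀ 𝒰 ∈ 𝓝 Γ, ∃ Γ' ∈ 𝒰,
      (∀ q' ∉ S, Γ'.toFun q' = Γ.toFun q') ∧ ∀ q' ∈ L', G Γ' q' := by
    refine hL.induction_on (p := fun s => ∃ 𝒱 ∈ 𝓝 Γ₀, ∃ L' ⊇ s, IsClosed L' ∧ ∀ Γ ∈ 𝒱, ∀ 𝒰 ∈ 𝓝 Γ,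
      ∃ Γ' ∈ 𝒰, (∀ q' ∉ S, Γ'.toFun q' = Γ.toFun q') ∧ ∀ q' ∈ L', G Γ' q') ?_ ?_ ?_ ?_
    · exact ⟨univ, univ_mem, ∅, subset_rfl, isClosed_empty, fun Γ _ 𝒰 h => ⟨Γ, mem_of_mem_nhds h,
        fun _ _ => rfl, by simp⟩⟩
    · rintro s t hst ⟨𝒱, h𝒱, L', hL', h⟩
      exact ⟨𝒱, h𝒱, L', hst.trans hL', h⟩
    · rintro s t ⟨𝒱, h𝒱, L₁, hs, hL₁, h₁⟩ ⟨𝒱', h𝒱', L₂, ht, hL₂, h₂⟩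
      refine ⟨𝒱 ∩ interior 𝒱', inter_mem h𝒱 (interior_mem_nhds.2 h𝒱'), L₁ ∪ L₂,
        union_subset_union hs ht, hL₁.union hL₂, fun Γ hΓ 𝒰 h𝒰 => ?_⟩
      obtain ⟨Γ₁, hΓ₁, heq₁, hg₁⟩ := h₁ Γ hΓ.1 (interior 𝒰 ∩ interior 𝒱')
        (inter_mem (interior_mem_nhds.2 h𝒰) (isOpen_interior.mem_nhds hΓ.2))
      obtain ⟨Γ₂, hΓ₂, heq₂, hg₂⟩ := h₂ Γ₁ (interior_subset hΓ₁.2)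
        (𝒰 ∩ {Γ | ∀ q ∈ L₁, G Γ q}) (inter_mem (mem_interior_iff_mem_nhds.1 hΓ₁.1)
          ((hG.isOpen_forall hL₁).mem_nhds hg₁))
      refine ⟨Γ₂, hΓ₂.1, fun q hq => (heq₂ q hq).trans (heq₁ q hq), fun q hq => ?_⟩
      exact hq.elim (hΓ₂.2 q) (hg₂ q)
    · intro q hq
      obtain ⟨𝒱, h𝒱, N, hN, h⟩ := hd Γ₀ hΓ₀ q hq S (mem_nhdsSet_iff_forall.1 hS q hq)
      obtain ⟨N', hN', hN's, hN'c⟩ := local_compact_nhds hN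
      refine ⟨N', mem_nhdsWithin_of_mem_nhds hN', 𝒱, h𝒱, N', subset_rfl, hN'c.isClosed,
        fun Γ hΓ 𝒰 h𝒰 => ?_⟩
      obtain ⟨Γ', h1, h2, h3⟩ := h Γ hΓ 𝒰 h𝒰
      exact ⟨Γ', h1, h2, fun q' hq' => h3 q' (hN's hq')⟩
  obtain ⟨𝒱, h𝒱, L', hL', -, h⟩ := key
  obtain ⟨Γ', h1, h2, h3⟩ := h Γ₀ (mem_of_mem_nhds h𝒱) 𝒰 h𝒰
  exact ⟨Γ', h1, h2, fun q' hq' => h3 q' (hL' hq')⟩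

/-- The condition is achieved on the members of an exhaustion one after another. Each step leaves
the earlier members untouched, with a delay of one index, so the sequence is locally stationary. Its
limit is again a family, and it stays in a germ-closed neighbourhood. -/
theorem JetOpen.dense_forall {r : ℕ} {G : IntegralFamily n IM I J → I × J → Prop}
    (hG : JetOpen r G)
    (hgerm : ∀ Γ Γ' : IntegralFamily n IM I J, ∀ q, Γ.toFun =ᶠ[𝓝 q] Γ'.toFun → G Γ q → G Γ' q)
    (hd : LocallyDense G univ univ) : Dense {Γ : IntegralFamily n IM I J | ∀ q, G Γ q} := by
  have : LocallyCompactSpace (I × J) := Manifold.locallyCompact_of_finiteDimensional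
    (IM.prod 𝓘(ℝ, ℝ))
  have hdL : ∀ L, LocallyDense G univ L := fun L Γ₀ h₀ q _ => hd Γ₀ h₀ q (mem_univ q)
  let K : CompactExhaustion (I × J) := CompactExhaustion.choice _
  intro Γ₀
  rw [mem_closure_iff_nhds]
  intro 𝒰 h𝒰
  obtain ⟨𝒱, h𝒱𝒰, h𝒱o, hΓ₀, h𝒱g⟩ := exists_germClosed_subset h𝒰
  obtain ⟨Γ₁, hΓ₁, -, hg₁⟩ := hG.exists_forall_mem_of_isCompact (hdL (K 0)) (K.isCompact 0)
    (S := univ) univ_mem (mem_univ Γ₀) (h𝒱o.mem_nhds hΓ₀)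
  have hstep : ∀ (j : ℕ) (Γ : {Γ : IntegralFamily n IM I J // Γ ∈ 𝒱 ∧ ∀ q ∈ K j, G Γ q}),
      ∃ Γ' : {Γ : IntegralFamily n IM I J // Γ ∈ 𝒱 ∧ ∀ q ∈ K (j + 1), G Γ q},
        ∀ i < j, ∀ q ∈ K i, Γ'.1.toFun q = Γ.1.toFun q := by
    rintro j ⟨Γ, hΓ, hg⟩
    -- On `K j` the condition persists because it is open, so only this shell needs work. The shell
    -- is disjoint from every `K i` with `i < j`, since `K i` lies in the interior of `K j`.
    have hLc : IsCompact (K (j + 1) \ interior (K j)) := (K.isCompact _).diff isOpen_interior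
    have hS : (⋃ i ∈ Iio j, K i)ᶜ ∈ 𝓝ˢ (K (j + 1) \ interior (K j)) := by
      refine IsOpen.mem_nhdsSet (isOpen_compl_iff.2 ((finite_Iio j).isClosed_biUnion fun i _ =>
        (K.isCompact i).isClosed)) |>.2 ?_
      rintro q ⟨-, hq⟩ hq'
      obtain ⟨i, hi, hqi⟩ := mem_iUnion₂.1 hq'
      exact hq (K.subset_interior hi hqi)
    obtain ⟨Γ', hΓ', heq, hg'⟩ := hG.exists_forall_mem_of_isCompact (hdL _) hLc hS (mem_univ Γ)
      (inter_mem (h𝒱o.mem_nhds hΓ) ((hG.isOpen_forall (K.isCompact j).isClosed).mem_nhds hg))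
    refine ⟨⟨Γ', hΓ'.1, fun q hq => ?_⟩, fun i hi q hq => heq q fun h => h
      (mem_iUnion₂.2 ⟨i, hi, hq⟩)⟩
    by_cases hqi : q ∈ interior (K j)
    · exact hΓ'.2 q (interior_subset hqi)
    · exact hg' q ⟨hq, hqi⟩
  choose next hnext using hstep
  let Γs : ∀ j, {Γ : IntegralFamily n IM I J // Γ ∈ 𝒱 ∧ ∀ q ∈ K j, G Γ q} := fun j =>
    Nat.rec ⟨Γ₁, hΓ₁, hg₁⟩ (fun j Γ => next j Γ) j
  have hΓs : ∀ j, ∀ i < j, ∀ q ∈ K i, (Γs (j + 1)).1.toFun q = (Γs j).1.toFun q := fun j =>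
    hnext j (Γs j)
  have hconst : ∀ i, ∀ q ∈ K i, ∀ k, (Γs (i + 1 + k)).1.toFun q = (Γs (i + 1)).1.toFun q := by
    intro i q hq k
    induction k with
    | zero => rfl
    | succ k ih => rw [← ih]; exact hΓs (i + 1 + k) i (by omega) q hq
  let f : I × J → CompleteFlag n := fun q => (Γs (K.find q + 1)).1.toFun q
  have hf : ∀ i, ∀ q ∈ K i, f q = (Γs (i + 1)).1.toFun q := by
    intro i q hq
    obtain ⟨k, hk⟩ := Nat.exists_eq_add_of_le (K.mem_iff_find_le.1 hq)
    have := hconst (K.find q) q (K.mem_find q) k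
    rw [show K.find q + 1 + k = i + 1 by omega] at this
    exact this.symm
  have hfev : ∀ q, ∃ i, q ∈ K i ∧ (Γs (i + 1)).1.toFun =ᶠ[𝓝 q] f := by
    intro q
    obtain ⟨i, hi⟩ := K.exists_mem_nhds q
    exact ⟨i, mem_of_mem_nhds hi, by filter_upwards [hi] with q' hq' using (hf i q' hq').symm⟩
  let Γ : IntegralFamily n IM I J := IntegralFamily.ofLoc f fun q => by
    obtain ⟨i, -, hi⟩ := hfev q
    exact ((Γs (i + 1)).1.locIntegral q).congr hi.symm
  refine ⟨Γ, h𝒱𝒰 (h𝒱g Γ fun q => ?_), fun q => ?_⟩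
  · obtain ⟨i, -, hi⟩ := hfev q
    exact ⟨_, (Γs (i + 1)).2.1, hi⟩
  · obtain ⟨i, hq, hi⟩ := hfev q
    exact hgerm (Γs (i + 1)).1 Γ q hi ((Γs (i + 1)).2.2 q (K.subset_succ i hq))

end LocalToGlobal

/-! ### Substitution of a small function. -/

section CompClose

variable {Y : Type*} [NormedAddCommGroup Y] [NormedSpace ℝ Y]
  {A : Type*} [NormedAddCommGroup A] [NormedSpace ℝ A] [FiniteDimensional ℝ A]
  {W : Type*} [NormedAddCommGroup W] [NormedSpace ℝ W]

/-- Substitution in a smooth map is continuous in the `C^r` topology on compact sets. -/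
theorem exists_comp_close {T : Set Y} (hT : UniqueDiffOn ℝ T) {Φ : Y × A → W}
    (hΦ : ContDiffOn ℝ ∞ Φ (T ×ˢ univ)) {C : Set Y} (hC : IsCompact C) (hCT : C ⊆ T) (r : ℕ)
    {ε : ℝ} (hε : 0 < ε) :
    ∃ δ > 0, ∀ h : Y → A, ContDiffOn ℝ ∞ h T →
      (∀ k ≤ r, ∀ y ∈ C, ‖iteratedFDerivWithin ℝ k h T y‖ < δ) →
      ∀ k ≤ r, ∀ y ∈ C,
        ‖iteratedFDerivWithin ℝ k (fun y => Φ (y, h y) - Φ (y, 0)) T y‖ < ε := by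
  have : ProperSpace A := FiniteDimensional.proper ℝ A
  obtain ⟨D, hD1, hD⟩ := (contDiffOn_id (𝕜 := ℝ) (n := ∞) (s := T)).exists_iteratedFDerivWithin_bound
    hT hC hCT r
  -- Writing `h = (η / 2) ĥ` with the derivatives of `ĥ` bounded by 1 turns the small function into
  -- a small scalar. The parametric estimate on the unit ball then holds uniformly in `h`.
  let Ψ : (Y × A) × ℝ → W := fun w => Φ (w.1.1, w.2 • w.1.2)
  have hΨ : ContDiffOn ℝ ∞ Ψ ((T ×ˢ univ) ×ˢ univ) :=
    hΦ.comp (by fun_prop) fun w hw => ⟨hw.1.1, mem_univ _⟩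
  have hT2 : UniqueDiffOn ℝ (T ×ˢ (univ : Set A)) := hT.prod uniqueDiffOn_univ
  have hev := eventually_iteratedFDerivWithin_lt hT2 isOpen_univ (mem_univ (0 : ℝ)) hΨ
    (hC.prod (isCompact_closedBall (0 : A) 1)) (prod_mono hCT (subset_univ _)) r
    (ε := ε / (2 * (r.factorial * D ^ r))) (by positivity)
  obtain ⟨η, hη, hηd⟩ := Metric.eventually_nhds_iff.1 hev
  refine ⟨η / 2, half_pos hη, fun h hh hsmall k hk y hy => ?_⟩
  have hb := hηd (y := η / 2) (by rw [dist_zero_right, Real.norm_of_nonneg (by positivity)]; linarith)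
  let ĥ : Y → A := fun y => (η / 2)⁻¹ • h y
  have hĥ : ContDiffOn ℝ ∞ ĥ T := hh.const_smul _
  have hĥd : ∀ k ≤ r, ∀ y ∈ C, ‖iteratedFDerivWithin ℝ k ĥ T y‖ ≤ 1 := by
    intro k hk y hy
    have h1 : iteratedFDerivWithin ℝ k ĥ T y = (η / 2)⁻¹ • iteratedFDerivWithin ℝ k h T y :=
      iteratedFDerivWithin_const_smul_apply ((hh.of_le (by exact_mod_cast le_top)) y (hCT hy)) hT
        (hCT hy)
    rw [h1, norm_smul, norm_inv, Real.norm_of_nonneg (by positivity), inv_mul_le_one₀ (by positivity)]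
    exact (hsmall k hk y hy).le
  let f : Y → Y × A := fun y => (id y, ĥ y)
  have hf : ContDiffOn ℝ ∞ f T := contDiffOn_id.prodMk hĥ
  let G : Y × A → W := fun z => Ψ (z, η / 2) - Ψ (z, 0)
  have hslice : ∀ s : ℝ, ContDiffOn ℝ ∞ (fun z => Ψ (z, s)) (T ×ˢ univ) := fun s =>
    hΨ.comp (by fun_prop) fun z hz => ⟨hz, mem_univ _⟩
  have hG : ContDiffOn ℝ ∞ G (T ×ˢ univ) := (hslice _).sub (hslice _)
  have heq : (fun y => Φ (y, h y) - Φ (y, 0)) = G ∘ f := by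
    funext y
    simp only [G, f, Ψ, ĥ, Function.comp, zero_smul, id]
    rw [smul_inv_smul₀ (by positivity)]
  rw [heq]
  refine (norm_iteratedFDerivWithin_comp_le hG hf (n := k) (by exact_mod_cast le_top) hT2 hT
    (fun z hz => ⟨hz, mem_univ _⟩) (hCT hy) (C := ε / (2 * (r.factorial * D ^ r))) (D := D)
    (fun i hi => ?_) (fun i h1 hi => ?_)).trans_lt ?_
  · refine (hb i (hi.trans hk) (f y) ⟨hy, ?_⟩).le
    rw [mem_closedBall_zero_iff]
    have := hĥd 0 (Nat.zero_le _) y hy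
    rwa [norm_iteratedFDerivWithin_zero] at this
  · rw [show f = fun y => (id y, ĥ y) from rfl, iteratedFDerivWithin_prodMk (contDiffOn_id y (hCT hy)) (hĥ y (hCT hy)) hT (hCT hy)
      (by exact_mod_cast le_top), ContinuousMultilinearMap.opNorm_prod]
    refine (max_le (hD i (hi.trans hk) y hy) ((hĥd i (hi.trans hk) y hy).trans hD1)).trans
      (le_self_pow₀ hD1 (by omega))
  · calc (k.factorial : ℝ) * (ε / (2 * (r.factorial * D ^ r))) * D ^ k
        ≤ r.factorial * (ε / (2 * (r.factorial * D ^ r))) * D ^ r := by gcongr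
      _ = ε / 2 := by field_simp
      _ < ε := half_lt_self hε

end CompClose

/-! ### Prescribed changes of the contact coordinates. -/

section ModifyCoords

variable {n : ℕ} {H : Type*} [TopologicalSpace H] {IM : ModelWithCorners ℝ ℝ H}
  {I : Type*} [TopologicalSpace I] [ChartedSpace H I]
  {J : Type*} [TopologicalSpace J] [ChartedSpace ℝ J]
  [IsManifold IM ∞ I] [IsManifold 𝓘(ℝ, ℝ) ∞ J]

theorem IntegralFamily.exists_validTarget (Γ : IntegralFamily n IM I J) (q₀ : I × J)
    (fr : ContactFrame n) : ∃ O : Set (ℝ × ℝ), IsOpen O ∧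
      (chart IM q₀).target ∩ Γ.loc q₀ ⁻¹' fr.Valid = (chart IM q₀).target ∩ O := by
  obtain ⟨O, hO, h⟩ := (continuousOn_iff'.1 (Γ.contDiffOn_loc q₀).continuousOn) _ fr.isOpen_Valid
  exact ⟨O, hO, by rw [inter_comm, h, inter_comm]⟩

/-- The change of the Heisenberg coordinates of a family by `h = (u, v, ζ)`. -/
theorem IntegralFamily.exists_modification_coords [T2Space I] [T2Space J]
    (Γ : IntegralFamily n IM I J) (q₀ : I × J) (fr : ContactFrame n) {C : Set (ℝ × ℝ)}
    (hC : IsCompact C) (hCT : C ⊆ (chart IM q₀).target) (hv : ∀ y ∈ C, Γ.loc q₀ y ∈ fr.Valid)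
    {𝒰 : Set (IntegralFamily n IM I J)} (h𝒰 : 𝒰 ∈ 𝓝 Γ) :
    ∃ r : ℕ, ∃ δ > 0, ∀ h : ℝ × ℝ → fr.Par, ContDiffOn ℝ ∞ h (chart IM q₀).target →
      (∀ y ∈ (chart IM q₀).target, y ∉ C → h y = 0) →
      (∀ y ∈ C, tderiv (tdom IM q₀) (fun y => Γ.Z q₀ fr y + (h y).2.2) y =
        inner ℝ (Γ.P q₀ fr y + (h y).2.1)
          (tderiv (tdom IM q₀) (fun y => Γ.X q₀ fr y + (h y).1) y)) →
      (∀ k ≤ r, ∀ y ∈ C, ‖iteratedFDerivWithin ℝ k h (chart IM q₀).target y‖ < δ) →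
      ∃ Γ' ∈ 𝒰, (∀ q ∉ (chart IM q₀).symm '' C, Γ'.toFun q = Γ.toFun q) ∧
        ∀ y ∈ (chart IM q₀).target, Γ.loc q₀ y ∈ fr.Valid → Γ'.loc q₀ y ∈ fr.Valid ∧
          Γ'.X q₀ fr y = Γ.X q₀ fr y + (h y).1 ∧ Γ'.P q₀ fr y = Γ.P q₀ fr y + (h y).2.1 ∧
          Γ'.Z q₀ fr y = Γ.Z q₀ fr y + (h y).2.2 := by
  obtain ⟨r, ε, hε, hmem⟩ := exists_mem_of_close h𝒰 q₀ hC hCT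
  obtain ⟨O, hO, hTO⟩ := Γ.exists_validTarget q₀ fr
  -- The coordinates are smooth only where they are defined; `T` is that part of the chart, and it
  -- is a neighbourhood of `C` in the chart domain.
  set T := (chart IM q₀).target ∩ O with hTdef
  have hTu : UniqueDiffOn ℝ T := (uniqueDiffOn_target q₀).inter hO
  have hTv : ∀ y ∈ T, Γ.loc q₀ y ∈ fr.Valid := fun y hy => by
    rw [← hTO] at hy
    exact hy.2
  have hCT' : C ⊆ T := fun y hy => by
    rw [← hTO]
    exact ⟨hCT hy, hv y hy⟩
  have hloc : ContDiffOn ℝ ∞ (Γ.loc q₀) T := (Γ.contDiffOn_loc q₀).mono inter_subset_left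
  have hX : ContDiffOn ℝ ∞ (Γ.X q₀ fr) T := fr.contDiffOn_xc.comp hloc hTv
  -- The group adds its last parameter plus `⟨v, x⟩` to `z`, hence the correction by `-⟨v, x⟩`.
  let gg : (ℝ × ℝ) × fr.Par → fr.Par := fun w =>
    (w.2.1, w.2.2.1, w.2.2.2 - inner ℝ w.2.2.1 (Γ.X q₀ fr w.1))
  have hgg : ContDiffOn ℝ ∞ gg (T ×ˢ univ) := by
    refine ContDiffOn.prodMk (by fun_prop) (ContDiffOn.prodMk (by fun_prop) ?_)
    refine ContDiffOn.sub (by fun_prop) (ContDiffOn.inner ℝ (by fun_prop) ?_)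
    exact hX.comp contDiffOn_fst fun w hw => hw.1
  let Φ : (ℝ × ℝ) × fr.Par → FlagAmbient n := fun w => fr.actEmbed (gg w) (Γ.loc q₀ w.1)
  have hΦ : ContDiffOn ℝ ∞ Φ (T ×ˢ univ) := fun w hw =>
    (fr.contDiffAt_actEmbed (gg w) (Γ.toFun ((chart IM q₀).symm w.1))).comp_contDiffWithinAt
      (f := fun w => (gg w, Γ.loc q₀ w.1)) w
      ((hgg w hw).prodMk ((hloc.comp contDiffOn_fst fun w hw => hw.1) w hw))
  obtain ⟨δ, hδ, hsmall⟩ := exists_comp_close hTu hΦ hC hCT' r hε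
  refine ⟨r, δ, hδ, fun h hh h0 hrel hhs => ?_⟩
  let g : ℝ × ℝ → fr.Par := fun y => gg (y, h y)
  have hgg0 : ∀ y, gg (y, 0) = 0 := fun y => by simp [gg]
  have hg0 : ∀ y ∈ (chart IM q₀).target, y ∉ C → g y = 0 := fun y hy hyC => by
    simp only [g]
    rw [h0 y hy hyC, hgg0]
  have hTnhds : ∀ y ∈ C, T ∈ 𝓝[(chart IM q₀).target] y := fun y hy =>
    inter_mem self_mem_nhdsWithin (mem_nhdsWithin_of_mem_nhds (hO.mem_nhds (hCT' hy).2))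
  have hg : ContDiffOn ℝ ∞ g (chart IM q₀).target := by
    refine contDiffOn_of_eq_zero_off (C := C) (D := T) hC.isClosed (fun y _ hyC => hTnhds y hyC)
      ?_ hg0
    rw [inter_eq_right.2 inter_subset_left]
    exact hgg.comp (contDiffOn_id.prodMk (hh.mono inter_subset_left)) fun y hy => ⟨hy, mem_univ _⟩
  have hgrel : ∀ y ∈ C, tderiv (tdom IM q₀) (fun y => (g y).2.2) y =
      inner ℝ (Γ.P q₀ fr y + (g y).2.1) (tderiv (tdom IM q₀) (fun y => (g y).1) y) -
        inner ℝ (tderiv (tdom IM q₀) (fun y => (g y).2.1) y) (Γ.X q₀ fr y) := by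
    intro y hyC
    have hy := hCT hyC
    have hvy := hv y hyC
    have hy' := hy
    have hh' := hh
    rw [chart_target] at hy' hh'
    have hA := uniqueDiffOn_tdom (IM := IM) q₀
    have hXd := (contDiffWithinAt_X hy hvy).hasDerivWithinAt_tderiv hA hy'
    have hZd := (contDiffWithinAt_Z hy hvy).hasDerivWithinAt_tderiv hA hy'
    have hu := ((hh' y hy').fst).hasDerivWithinAt_tderiv hA hy'
    have hvv := ((hh' y hy').snd.fst).hasDerivWithinAt_tderiv hA hy'
    have hw := ((hh' y hy').snd.snd).hasDerivWithinAt_tderiv hA hy'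
    have h1 := hrel y hyC
    have h2 : tderiv (tdom IM q₀) (fun y => Γ.Z q₀ fr y + (h y).2.2) y =
        tderiv (tdom IM q₀) (Γ.Z q₀ fr) y + tderiv (tdom IM q₀) (fun y => (h y).2.2) y :=
      (hZd.add hw).derivWithin (hA _ hy'.1)
    have h3 : tderiv (tdom IM q₀) (fun y => Γ.X q₀ fr y + (h y).1) y =
        tderiv (tdom IM q₀) (Γ.X q₀ fr) y + tderiv (tdom IM q₀) (fun y => (h y).1) y :=
      (hXd.add hu).derivWithin (hA _ hy'.1)
    have h4 : tderiv (tdom IM q₀) (fun y => (g y).2.2) y =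
        tderiv (tdom IM q₀) (fun y => (h y).2.2) y -
        (inner ℝ (h y).2.1 (tderiv (tdom IM q₀) (Γ.X q₀ fr) y) +
          inner ℝ (tderiv (tdom IM q₀) (fun y => (h y).2.1) y) (Γ.X q₀ fr y)) :=
      (hw.sub (hvv.inner ℝ hXd)).derivWithin (hA _ hy'.1)
    rw [h2, h3, tderiv_Z hy hvy] at h1
    rw [h4]
    change _ = inner ℝ (Γ.P q₀ fr y + (h y).2.1) (tderiv (tdom IM q₀) (fun y => (h y).1) y) -
      inner ℝ (tderiv (tdom IM q₀) (fun y => (h y).2.1) y) (Γ.X q₀ fr y)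
    simp only [inner_add_left, inner_add_right] at h1 ⊢
    linarith
  obtain ⟨Γ', hoff, hact⟩ := Γ.exists_modification q₀ fr hC hCT hv hg hg0 hgrel
  have hloc' : ∀ y ∈ (chart IM q₀).target, Γ'.loc q₀ y = fr.actEmbed (g y) (Γ.loc q₀ y) := by
    intro y hy
    simp only [IntegralFamily.loc]
    rw [hact y hy, fr.embed_act]
  refine ⟨Γ', hmem Γ' hoff fun k hk y hy => ?_, hoff, fun y hy hvy => ?_⟩
  · have h1 := hsmall h (hh.mono inter_subset_left) (fun k hk y hy => by
      have hev : T =ᶠ[𝓝 y] (chart IM q₀).target := nhdsWithin_eq_iff_eventuallyEq.1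
        (nhdsWithin_inter_of_mem' (mem_nhdsWithin_of_mem_nhds (hO.mem_nhds (hCT' hy).2)))
      rw [iteratedFDerivWithin_congr_set hev]
      exact hhs k hk y hy) k hk y hy
    have hev : T =ᶠ[𝓝 y] (chart IM q₀).target := nhdsWithin_eq_iff_eventuallyEq.1
      (nhdsWithin_inter_of_mem' (mem_nhdsWithin_of_mem_nhds (hO.mem_nhds (hCT' hy).2)))
    rw [iteratedFDerivWithin_congr_set hev] at h1
    have heq : EqOn (fun u => Γ'.loc q₀ u - Γ.loc q₀ u)
        (fun y => Φ (y, h y) - Φ (y, 0)) (chart IM q₀).target := by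
      intro z hz
      have h2 : fr.actEmbed 0 (Γ.loc q₀ z) = Γ.loc q₀ z := by
        have := fr.embed_act 0 (Γ.toFun ((chart IM q₀).symm z))
        rw [fr.act_zero] at this
        exact this.symm
      simp only [Φ, hgg0, h2]
      rw [hloc' z hz]
    rw [iteratedFDerivWithin_congr heq (hCT hy)]
    convert h1 using 2
  · have h1 := ContactFrame.coords_act (g y) hvy
    rw [← hact y hy] at h1
    refine ⟨h1.1, h1.2.1, h1.2.2.1, h1.2.2.2.trans ?_⟩
    change Γ.Z q₀ fr y + ((h y).2.2 - inner ℝ (h y).2.1 (Γ.X q₀ fr y)) +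
      inner ℝ (h y).2.1 (Γ.X q₀ fr y) = _
    ring

end ModifyCoords

/-! ### Derivatives of a curve in an arbitrary chart. -/

section ChartDeriv

variable {E : Type*} [NormedAddCommGroup E] [NormedSpace ℝ E]
  {H : Type*} [TopologicalSpace H] {IM : ModelWithCorners ℝ ℝ H}
  {I : Type*} [TopologicalSpace I] [ChartedSpace H I]

variable (IM) in
/-- The `k`-th derivative at `t` of a curve, with respect to the local coordinate at `t₁`. -/
def chartDeriv (t₁ : I) (e : I → E) (t : I) (k : ℕ) : E :=
  iteratedDerivWithin k (e ∘ (extChartAt IM t₁).symm) (extChartAt IM t₁).target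
    (extChartAt IM t₁ t)

theorem exists_isOpen_inter_target (t₁ : I) {U : Set I} (hU : IsOpen U) :
    ∃ O : Set ℝ, IsOpen O ∧ (extChartAt IM t₁).target ∩ (extChartAt IM t₁).symm ⁻¹' U =
      (extChartAt IM t₁).target ∩ O := by
  obtain ⟨O, hO, h⟩ := (continuousOn_iff'.1 (continuousOn_extChartAt_symm (I := IM) t₁)) U hU
  exact ⟨O, hO, by rw [inter_comm, h, inter_comm]⟩

variable [IsManifold IM ∞ I]

theorem chartDeriv_mem_span {t₁ t₂ t : I} (h₁ : t ∈ (extChartAt IM t₁).source)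
    (h₂ : t ∈ (extChartAt IM t₂).source) {e₁ e₂ : I → E} {f : I → ℝ} {U : Set I} (hU : U ∈ 𝓝 t)
    (he₁ : ContMDiffOn IM 𝓘(ℝ, E) ∞ e₁ U) (hf : ContMDiffOn IM 𝓘(ℝ, ℝ) ∞ f U)
    (h : ∀ s ∈ U, e₂ s = f s • e₁ s) (k : ℕ) :
    chartDeriv IM t₂ e₂ t k ∈ Submodule.span ℝ (chartDeriv IM t₁ e₁ t '' Iic k) := by
  wlog hUo : IsOpen U generalizing U
  · exact this (interior_mem_nhds.2 hU) (he₁.mono interior_subset) (hf.mono interior_subset)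
      (fun s hs => h s (interior_subset hs)) isOpen_interior
  have htU := mem_of_mem_nhds hU
  set κ₁ := extChartAt IM t₁
  set κ₂ := extChartAt IM t₂
  have hVo : IsOpen (U ∩ κ₁.source) := hUo.inter (isOpen_extChartAt_source t₁)
  obtain ⟨O₁, hO₁, hA₁⟩ := exists_isOpen_inter_target (IM := IM) t₁ hUo
  obtain ⟨O₂, hO₂, hA₂⟩ := exists_isOpen_inter_target (IM := IM) t₂ hVo
  have hu₁ : UniqueDiffOn ℝ (κ₁.target ∩ O₁) := (uniqueDiffOn_extChartAt_target t₁).inter hO₁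
  have hu₂ : UniqueDiffOn ℝ (κ₂.target ∩ O₂) := (uniqueDiffOn_extChartAt_target t₂).inter hO₂
  have hm₁ : κ₁ t ∈ κ₁.target ∩ O₁ := by
    rw [← hA₁]
    exact ⟨κ₁.map_source h₁, by rw [mem_preimage, κ₁.left_inv h₁]; exact htU⟩
  have hm₂ : κ₂ t ∈ κ₂.target ∩ O₂ := by
    rw [← hA₂]
    exact ⟨κ₂.map_source h₂, by rw [mem_preimage, κ₂.left_inv h₂]; exact ⟨htU, h₁⟩⟩
  have hev₁ : (κ₁.target ∩ O₁ : Set ℝ) =ᶠ[𝓝 (κ₁ t)] κ₁.target := nhdsWithin_eq_iff_eventuallyEq.1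
    (nhdsWithin_inter_of_mem' (mem_nhdsWithin_of_mem_nhds (hO₁.mem_nhds hm₁.2)))
  have hev₂ : (κ₂.target ∩ O₂ : Set ℝ) =ᶠ[𝓝 (κ₂ t)] κ₂.target := nhdsWithin_eq_iff_eventuallyEq.1
    (nhdsWithin_inter_of_mem' (mem_nhdsWithin_of_mem_nhds (hO₂.mem_nhds hm₂.2)))
  have hs₂ : ∀ τ ∈ κ₂.target ∩ O₂, κ₂.symm τ ∈ U ∩ κ₁.source := fun τ hτ => by
    rw [← hA₂] at hτ
    exact hτ.2
  have hκ₂ : ContMDiffOn 𝓘(ℝ, ℝ) IM ∞ κ₂.symm (κ₂.target ∩ O₂) :=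
    (contMDiffOn_extChartAt_symm t₂).mono inter_subset_left
  have hc : ContDiffOn ℝ ∞ (e₁ ∘ κ₁.symm) (κ₁.target ∩ O₁) := by
    refine contMDiffOn_iff_contDiffOn.1 (he₁.comp
      ((contMDiffOn_extChartAt_symm t₁).mono inter_subset_left) fun τ hτ => ?_)
    rw [← hA₁] at hτ
    exact hτ.2
  have hφ : ContDiffOn ℝ ∞ (κ₁ ∘ κ₂.symm) (κ₂.target ∩ O₂) :=
    contMDiffOn_iff_contDiffOn.1 (((contMDiffOn_extChartAt (n := ∞) (x := t₁)).mono
      (extChartAt_source _ t₁).subset).comp hκ₂ fun τ hτ => (hs₂ τ hτ).2)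
  have hf' : ContDiffOn ℝ ∞ (f ∘ κ₂.symm) (κ₂.target ∩ O₂) :=
    contMDiffOn_iff_contDiffOn.1 (hf.comp hκ₂ fun τ hτ => (hs₂ τ hτ).1)
  have key := iteratedDerivWithin_mem_span hu₁ hu₂ hc hφ (fun τ hτ => by
    rw [← hA₁]
    refine ⟨κ₁.map_source (hs₂ τ hτ).2, ?_⟩
    rw [mem_preimage, Function.comp, κ₁.left_inv (hs₂ τ hτ).2]
    exact (hs₂ τ hτ).1) hf' (c' := e₂ ∘ κ₂.symm) (fun τ hτ => by
      simp only [Function.comp]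
      rw [κ₁.left_inv (hs₂ τ hτ).2]
      exact h _ (hs₂ τ hτ).1) hm₂ k
  have hφt : (κ₁ ∘ κ₂.symm) (κ₂ t) = κ₁ t := by
    rw [Function.comp, κ₂.left_inv h₂]
  rw [hφt] at key
  have hcongr : ∀ (A B : Set ℝ) (c : ℝ → E) (x : ℝ), A =ᶠ[𝓝 x] B → ∀ j,
      iteratedDerivWithin j c A x = iteratedDerivWithin j c B x := by
    intro A B c x hAB j
    rw [iteratedDerivWithin, iteratedDerivWithin, iteratedFDerivWithin_congr_set hAB]
  rw [hcongr _ _ _ _ hev₂] at key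
  have : (fun j => iteratedDerivWithin j (e₁ ∘ κ₁.symm) (κ₁.target ∩ O₁) (κ₁ t)) =
      chartDeriv IM t₁ e₁ t := by
    funext j
    exact hcongr _ _ _ _ hev₁ j
  rw [this] at key
  exact key

end ChartDeriv

/-! ### The ranks of the curve of lines. -/

section LineRank

variable {n : ℕ} {H : Type*} [TopologicalSpace H] {IM : ModelWithCorners ℝ ℝ H}
  {I : Type*} [TopologicalSpace I] [ChartedSpace H I]
  {J : Type*} [TopologicalSpace J] [ChartedSpace ℝ J]
  [IsManifold IM ∞ I] [IsManifold 𝓘(ℝ, ℝ) ∞ J]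

theorem IntegralFamily.contMDiff_slice (Γ : IntegralFamily n IM I J) (l : J) :
    ContMDiff IM 𝓘(ℝ, FlagAmbient n) ∞ fun s : I => (Γ.toFun (s, l)).embed :=
  Γ.smooth.comp (contMDiff_id.prodMk contMDiff_const)

/-- The image of `v` under the projection to the line of the flag. -/
def IntegralFamily.vlift (Γ : IntegralFamily n IM I J) (v : AmbientSpace n) (l : J) (s : I) :
    AmbientSpace n := (Γ.toFun (s, l)).embed 0 v

theorem IntegralFamily.contMDiff_vlift (Γ : IntegralFamily n IM I J) (v : AmbientSpace n) (l : J) :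
    ContMDiff IM 𝓘(ℝ, AmbientSpace n) ∞ (Γ.vlift v l) := by
  let L : FlagAmbient n →L[ℝ] AmbientSpace n :=
    (ContinuousLinearMap.apply ℝ (AmbientSpace n) v).comp (ContinuousLinearMap.proj 0)
  exact L.contMDiff.comp (Γ.contMDiff_slice l)

theorem IntegralFamily.vlift_mem (Γ : IntegralFamily n IM I J) (v : AmbientSpace n) (l : J)
    (s : I) : Γ.vlift v l s ∈ (Γ.toFun (s, l)).line :=
  Submodule.starProjection_apply_mem _ _

theorem IntegralFamily.exists_vlift_ne_zero (Γ : IntegralFamily n IM I J) (q : I × J) :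
    ∃ v, Γ.vlift v q.2 q.1 ≠ 0 := by
  have h1 : finrank ℝ (Γ.toFun q).line = 1 := (Γ.toFun q).finrank_V 0
  obtain ⟨v, hv, h0⟩ := (Γ.toFun q).line.exists_mem_ne_zero_of_ne_bot (by
    intro h; rw [h] at h1; simp at h1)
  refine ⟨v, ?_⟩
  have : Γ.vlift v q.2 q.1 = v := Submodule.starProjection_eq_self_iff.2 hv
  rwa [this]

/-- The ranks of the derivatives of a lift of the curve of lines. -/
def IntegralFamily.lineRank (Γ : IntegralFamily n IM I J) (q : I × J) : ℕ → ℕ :=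
  jetRank (chartDeriv IM q.1 (Γ.vlift (Γ.exists_vlift_ne_zero q).choose q.2) q.1)

/-- Two lifts of the same curve differ by a smooth factor, in either direction, so each jet is
triangular in the other. -/
theorem jetRank_chartDeriv_eq {L : I → Submodule ℝ (AmbientSpace n)} {t₁ t₂ t : I}
    (h₁ : t ∈ (extChartAt IM t₁).source) (h₂ : t ∈ (extChartAt IM t₂).source)
    {e₁ e₂ : I → AmbientSpace n} {U : Set I} (hU : U ∈ 𝓝 t)
    (he₁ : ContMDiffOn IM 𝓘(ℝ, AmbientSpace n) ∞ e₁ U)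
    (he₂ : ContMDiffOn IM 𝓘(ℝ, AmbientSpace n) ∞ e₂ U)
    (hL₁ : ∀ s ∈ U, e₁ s ≠ 0 ∧ L s = Submodule.span ℝ {e₁ s})
    (hL₂ : ∀ s ∈ U, e₂ s ≠ 0 ∧ L s = Submodule.span ℝ {e₂ s}) :
    jetRank (chartDeriv IM t₁ e₁ t) = jetRank (chartDeriv IM t₂ e₂ t) := by
  have key : ∀ {e₁ e₂ : I → AmbientSpace n}, ContMDiffOn IM 𝓘(ℝ, AmbientSpace n) ∞ e₁ U →
      ContMDiffOn IM 𝓘(ℝ, AmbientSpace n) ∞ e₂ U →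
      (∀ s ∈ U, e₁ s ≠ 0 ∧ L s = Submodule.span ℝ {e₁ s}) →
      (∀ s ∈ U, e₂ s ≠ 0 ∧ L s = Submodule.span ℝ {e₂ s}) →
      ∃ f : I → ℝ, ContMDiffOn IM 𝓘(ℝ, ℝ) ∞ f U ∧ ∀ s ∈ U, e₂ s = f s • e₁ s := by
    intro e₁ e₂ he₁ he₂ hL₁ hL₂
    -- The factor is the quotient of inner products, which shows that it is smooth.
    refine ⟨fun s => (inner ℝ (e₁ s) (e₁ s))⁻¹ * inner ℝ (e₁ s) (e₂ s), ?_, fun s hs => ?_⟩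
    · have hin : ContDiffOn ℝ ∞ (fun w : AmbientSpace n × AmbientSpace n =>
          (inner ℝ w.1 w.1)⁻¹ * inner ℝ w.1 w.2) {w | w.1 ≠ 0} := by
        refine ContDiffOn.mul (ContDiffOn.inv (contDiffOn_fst.inner ℝ contDiffOn_fst) ?_)
          (contDiffOn_fst.inner ℝ contDiffOn_snd)
        exact fun w hw => inner_self_ne_zero.2 hw
      have h12 : ContMDiffOn IM 𝓘(ℝ, AmbientSpace n × AmbientSpace n) ∞
          (fun s => (e₁ s, e₂ s)) U := he₁.prodMk_space he₂
      exact hin.contMDiffOn.comp h12 fun s hs => (hL₁ s hs).1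
    · have hmem : e₂ s ∈ Submodule.span ℝ {e₁ s} := by
        rw [← (hL₁ s hs).2, (hL₂ s hs).2]
        exact Submodule.mem_span_singleton_self _
      obtain ⟨c, hc⟩ := Submodule.mem_span_singleton.1 hmem
      simp only [← hc, inner_smul_right]
      have : (inner ℝ (e₁ s) (e₁ s) : ℝ) ≠ 0 := inner_self_ne_zero.2 (hL₁ s hs).1
      congr 1
      field_simp
  obtain ⟨f, hf, hfe⟩ := key he₁ he₂ hL₁ hL₂
  obtain ⟨g, hg, hge⟩ := key he₂ he₁ hL₂ hL₁
  exact jetRank_eq_of_mem_span (fun k => chartDeriv_mem_span h₂ h₁ hU he₂ hg hge k)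
    (fun k => chartDeriv_mem_span h₁ h₂ hU he₁ hf hfe k)

theorem IntegralFamily.lineRank_eq (Γ : IntegralFamily n IM I J) {q : I × J} {t₁ : I}
    (h₁ : q.1 ∈ (extChartAt IM t₁).source) {e : I → AmbientSpace n} {U : Set I}
    (hU : U ∈ 𝓝 q.1) (he : ContMDiffOn IM 𝓘(ℝ, AmbientSpace n) ∞ e U)
    (hL : ∀ s ∈ U, e s ≠ 0 ∧ (Γ.toFun (s, q.2)).line = Submodule.span ℝ {e s}) :
    Γ.lineRank q = jetRank (chartDeriv IM t₁ e q.1) := by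
  set v := (Γ.exists_vlift_ne_zero q).choose
  have hv : Γ.vlift v q.2 q.1 ≠ 0 := (Γ.exists_vlift_ne_zero q).choose_spec
  have hev : {s | Γ.vlift v q.2 s ≠ 0} ∈ 𝓝 q.1 :=
    (Γ.contMDiff_vlift v q.2).continuous.continuousAt.eventually_ne hv
  exact jetRank_chartDeriv_eq (L := fun s => (Γ.toFun (s, q.2)).line) (mem_extChartAt_source q.1)
    h₁ (inter_mem hU hev) (Γ.contMDiff_vlift v q.2).contMDiffOn (he.mono inter_subset_left)
    (fun s hs => ⟨hs.2, ContactFrame.line_eq_span_of_mem hs.2 (Γ.vlift_mem v q.2 s)⟩)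
    fun s hs => hL s hs.1

theorem IntegralFamily.lineRank_eq_vlift (Γ : IntegralFamily n IM I J) {q : I × J} {t₁ : I}
    (h₁ : q.1 ∈ (extChartAt IM t₁).source) {v : AmbientSpace n} (hv : Γ.vlift v q.2 q.1 ≠ 0) :
    Γ.lineRank q = jetRank (chartDeriv IM t₁ (Γ.vlift v q.2) q.1) := by
  have hev : {s | Γ.vlift v q.2 s ≠ 0} ∈ 𝓝 q.1 :=
    (Γ.contMDiff_vlift v q.2).continuous.continuousAt.eventually_ne hv
  exact Γ.lineRank_eq h₁ hev (Γ.contMDiff_vlift v q.2).contMDiffOn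
    fun s hs => ⟨hs, ContactFrame.line_eq_span_of_mem hs (Γ.vlift_mem v q.2 s)⟩

theorem IntegralFamily.lineRank_zero (Γ : IntegralFamily n IM I J) (q : I × J) :
    Γ.lineRank q 0 = 1 := by
  refine jetRank_zero ?_
  rw [chartDeriv, iteratedDerivWithin_zero, Function.comp, (extChartAt IM q.1).left_inv
    (mem_extChartAt_source q.1)]
  exact (Γ.exists_vlift_ne_zero q).choose_spec

theorem IntegralFamily.hasType_line_iff (hn : 2 ≤ n) (Γ : IntegralFamily n IM I J) (q : I × J) :
    (∃ a ∈ adaptedTypes n, HasType IM (fun s => (Γ.toFun (s, q.2)).line) q.1 a) ↔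
      GoodRanks n (Γ.lineRank q) := by
  rw [← goodRanks_iff_exists_type hn (Γ.lineRank_zero q) (jetRank_mono _) (jetRank_le_add _)
    (fun r => (jetRank_le_finrank _ r).trans (by simp))]
  constructor
  · rintro ⟨a, ha, e, U, hU, he, hL, hleast⟩
    refine ⟨a, ha, fun i => ?_⟩
    rw [Γ.lineRank_eq (mem_extChartAt_source q.1) hU he hL]
    exact hleast i
  · rintro ⟨a, ha, hleast⟩
    set v := (Γ.exists_vlift_ne_zero q).choose
    have hv : Γ.vlift v q.2 q.1 ≠ 0 := (Γ.exists_vlift_ne_zero q).choose_spec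
    have hev : {s | Γ.vlift v q.2 s ≠ 0} ∈ 𝓝 q.1 :=
      (Γ.contMDiff_vlift v q.2).continuous.continuousAt.eventually_ne hv
    exact ⟨a, ha, Γ.vlift v q.2, _, hev, (Γ.contMDiff_vlift v q.2).contMDiffOn,
      fun s hs => ⟨hs, ContactFrame.line_eq_span_of_mem hs (Γ.vlift_mem v q.2 s)⟩, hleast⟩

theorem IntegralFamily.chartDeriv_vlift (Γ : IntegralFamily n IM I J) (q₀ : I × J) {q : I × J}
    (hq : q ∈ (chart IM q₀).source) (v : AmbientSpace n) (k : ℕ) :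
    chartDeriv IM q₀.1 (Γ.vlift v q.2) q.1 k =
      (iteratedFDerivWithin ℝ k (Γ.loc q₀) (chart IM q₀).target (chart IM q₀ q)
        (fun _ => (1, 0))) 0 v := by
  have hy := (chart IM q₀).map_source hq
  have hF := Γ.contDiffOn_loc q₀
  rw [chart_target] at hy hF ⊢
  set y := chart IM q₀ q with hydef
  let L : FlagAmbient n →L[ℝ] AmbientSpace n :=
    (ContinuousLinearMap.apply ℝ (AmbientSpace n) v).comp (ContinuousLinearMap.proj 0)
  have hs : ContDiffOn ℝ ∞ (fun τ => Γ.loc q₀ (τ, y.2)) (tdom IM q₀) :=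
    hF.comp (by fun_prop) fun τ hτ => ⟨hτ, hy.2⟩
  have h1 : Γ.vlift v q.2 ∘ (extChartAt IM q₀.1).symm = L ∘ fun τ => Γ.loc q₀ (τ, y.2) := by
    funext τ
    have hq2 : (extChartAt 𝓘(ℝ, ℝ) q₀.2).symm y.2 = q.2 := by
      rw [chart_source] at hq
      rw [hydef, chart_apply]
      exact (extChartAt 𝓘(ℝ, ℝ) q₀.2).left_inv hq.2
    simp only [Function.comp, IntegralFamily.vlift, IntegralFamily.loc, chart_symm_apply, hq2]
    rfl
  have h2 : extChartAt IM q₀.1 q.1 = y.1 := by rw [hydef, chart_apply]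
  rw [chartDeriv, h1, h2, iteratedDerivWithin, L.iteratedFDerivWithin_comp_left (hs y.1 hy.1)
    (uniqueDiffOn_tdom q₀) hy.1 (by exact_mod_cast le_top),
    iteratedFDerivWithin_slice (uniqueDiffOn_tdom q₀) (isOpen_ldom q₀) hF k hy.1 hy.2]
  rfl

/-- For a fixed vector `v` the lift by projection is linear in the embedded flag, so its derivatives
depend continuously on the jet of the family. The ranks do not depend on the lift, so any `v` with
nonzero projection may be used. -/
theorem jetOpen_lineRank {D : (ℕ → ℕ) → Prop} {r : ℕ}
    (hD : IsOpen {w : ℕ → AmbientSpace n | D (jetRank w)})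
    (hdep : ∀ d d' : ℕ → ℕ, (∀ k ≤ r, d k = d' k) → D d → D d') :
    JetOpen r fun (Γ : IntegralFamily n IM I J) q => D (Γ.lineRank q) := by
  intro Γ q hΓ
  obtain ⟨v, hv⟩ := Γ.exists_vlift_ne_zero q
  have hqs : q ∈ (chart IM q).source := mem_extChartAt_source q
  have hsource : ∀ q' ∈ (chart IM q).source, q'.1 ∈ (extChartAt IM q.1).source := fun q' h => by
    rw [chart_source] at h
    exact h.1
  set w₀ := chartDeriv IM q.1 (Γ.vlift v q.2) q.1 with hw₀
  have hDw : D (jetRank w₀) := by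
    rw [hw₀, ← Γ.lineRank_eq_vlift (hsource q hqs) hv]
    exact hΓ
  have hw00 : ∀ (Γ : IntegralFamily n IM I J), ∀ q' ∈ (chart IM q).source,
      chartDeriv IM q.1 (Γ.vlift v q'.2) q'.1 0 = Γ.vlift v q'.2 q'.1 := by
    intro Γ q' hq'
    rw [chartDeriv, iteratedDerivWithin_zero, Function.comp,
      (extChartAt IM q.1).left_inv (hsource q' hq')]
  obtain ⟨η, hη, hηD⟩ : ∃ η > 0, ∀ w : ℕ → AmbientSpace n, (∀ k ≤ r, ‖w k - w₀ k‖ < η) →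
      D (jetRank w) ∧ w 0 ≠ 0 := by
    have hnh := hD.mem_nhds hDw
    rw [nhds_pi, Filter.mem_pi] at hnh
    obtain ⟨F, hF, t, ht, hsub⟩ := hnh
    have hballs : ∀ k, ∃ η > 0, Metric.ball (w₀ k) η ⊆ t k := fun k => Metric.mem_nhds_iff.1 (ht k)
    choose η hη hηt using hballs
    obtain ⟨η₀, hη₀, hle⟩ := hF.toFinset.exists_pos_forall_le hη
    have hne : w₀ 0 ≠ 0 := by
      rw [hw₀, hw00 Γ q hqs]
      exact hv
    refine ⟨min η₀ ‖w₀ 0‖, lt_min hη₀ (norm_pos_iff.2 hne), fun w hw => ⟨?_, fun h0 => ?_⟩⟩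
    -- The open neighbourhood may also restrict members beyond order `r`. These are not controlled,
    -- so they are replaced by those of `w₀`, which does not affect `D`.
    · let wr : ℕ → AmbientSpace n := fun k => if k ≤ r then w k else w₀ k
      have h1 : D (jetRank wr) := by
        refine hsub fun k hk => hηt k ?_
        simp only [wr]
        split_ifs with hkr
        · rw [mem_ball_iff_norm]
          exact (hw k hkr).trans_le ((min_le_left _ _).trans (hle k (hF.mem_toFinset.2 hk)))
        · exact Metric.mem_ball_self (hη k)
      refine hdep _ _ (fun k hk => ?_) h1
      have : wr '' Iic k = w '' Iic k := image_congr fun j hj => if_pos (le_trans hj hk)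
      rw [jetRank, jetRank, this]
    · have h1 := hw 0 (Nat.zero_le r)
      rw [h0, zero_sub, norm_neg] at h1
      exact absurd (h1.trans_le (min_le_right _ _)) (lt_irrefl _)
  -- continuity of the jets of the given family
  have hcont : ∀ k, ∀ᶠ q' in 𝓝 q, ‖(iteratedFDerivWithin ℝ k (Γ.loc q) (chart IM q).target
      (chart IM q q') (fun _ => (1, 0))) 0 v - w₀ k‖ < η / 2 := by
    intro k
    have hc : ContinuousOn (fun q' => (iteratedFDerivWithin ℝ k (Γ.loc q) (chart IM q).target
        (chart IM q q') (fun _ => ((1 : ℝ), (0 : ℝ)))) 0 v) (chart IM q).source := by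
      have h1 : ContinuousOn (fun q' => iteratedFDerivWithin ℝ k (Γ.loc q) (chart IM q).target
          (chart IM q q')) (chart IM q).source :=
        ((Γ.contDiffOn_loc q).continuousOn_iteratedFDerivWithin (by exact_mod_cast le_top)
          (uniqueDiffOn_target q)).comp (continuousOn_extChartAt q) (chart IM q).mapsTo
      have h2 : Continuous fun f : ContinuousMultilinearMap ℝ (fun _ : Fin k => ℝ × ℝ)
          (FlagAmbient n) => (f fun _ => ((1 : ℝ), (0 : ℝ))) 0 v := by
        have h3 : Continuous fun f : ContinuousMultilinearMap ℝ (fun _ : Fin k => ℝ × ℝ)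
          (FlagAmbient n) => f fun _ => ((1 : ℝ), (0 : ℝ)) 
            := continuous_eval_const _
        exact ((continuous_apply 0).comp h3).clm_apply continuous_const
      exact h2.comp_continuousOn h1
    have h3 := (hc.continuousAt ((isOpen_chart_source q).mem_nhds hqs)).sub
      (continuousAt_const (y := w₀ k)) |>.norm
    refine h3.eventually_lt continuousAt_const ?_
    rw [Pi.sub_apply, ← Γ.chartDeriv_vlift q hqs, ← hw₀, sub_self, norm_zero]
    exact half_pos hη
  have hN : ∀ᶠ q' in 𝓝 q, ∀ k ∈ Iic r, ‖(iteratedFDerivWithin ℝ k (Γ.loc q) (chart IM q).target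
      (chart IM q q') (fun _ => (1, 0))) 0 v - w₀ k‖ < η / 2 :=
    (eventually_all_finite (finite_Iic r)).2 fun k _ => hcont k
  -- Evaluation at `v` costs a factor `‖v‖`. Half of `η` is spent on this change, the other half on
  -- moving from `q` to `q'`.
  refine ⟨_, inter_mem hN ((isOpen_chart_source q).mem_nhds hqs), η / (2 * (‖v‖ + 1)),
    by positivity, fun Γ' q' hq' hclose => ?_⟩
  have hw := hηD (chartDeriv IM q.1 (Γ'.vlift v q'.2) q'.1) fun k hk => by
    rw [Γ'.chartDeriv_vlift q hq'.2]
    have hy := (chart IM q).map_source hq'.2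
    have h1 := hclose k hk
    have hsub : iteratedFDerivWithin ℝ k (fun u => Γ'.loc q u - Γ.loc q u)
        (chart IM q).target (chart IM q q') =
        iteratedFDerivWithin ℝ k (Γ'.loc q) (chart IM q).target (chart IM q q') -
          iteratedFDerivWithin ℝ k (Γ.loc q) (chart IM q).target (chart IM q q') :=
      iteratedFDerivWithin_sub_apply
        (((Γ'.contDiffOn_loc q) _ hy).of_le (by exact_mod_cast le_top))
        (((Γ.contDiffOn_loc q) _ hy).of_le (by exact_mod_cast le_top)) (uniqueDiffOn_target q) hy
    rw [hsub] at h1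
    set F' := iteratedFDerivWithin ℝ k (Γ'.loc q) (chart IM q).target (chart IM q q')
    set F := iteratedFDerivWithin ℝ k (Γ.loc q) (chart IM q).target (chart IM q q') with hFd
    have h2 : ‖((F' - F) fun _ => ((1 : ℝ), (0 : ℝ))) 0 v‖ ≤ ‖F' - F‖ * ‖v‖ := by
      refine (ContinuousLinearMap.le_opNorm _ _).trans ?_
      gcongr
      refine (norm_le_pi_norm _ 0).trans ?_
      refine ((F' - F).le_opNorm _).trans ?_
      simp
    have h3 : ‖F' - F‖ * ‖v‖ < η / 2 := by
      have h4 : ‖F' - F‖ * (‖v‖ + 1) < η / 2 := by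
        rw [lt_div_iff₀ (by positivity)] at h1
        linarith
      nlinarith [norm_nonneg (F' - F)]
    have h5 := hq'.1 k hk
    rw [← hFd] at h5
    have h6 := norm_add_le (((F' - F) fun _ => ((1 : ℝ), (0 : ℝ))) 0 v)
      ((F fun _ => ((1 : ℝ), (0 : ℝ))) 0 v - w₀ k)
    have h7 : ((F' - F) fun _ => ((1 : ℝ), (0 : ℝ))) 0 v +
        ((F fun _ => ((1 : ℝ), (0 : ℝ))) 0 v - w₀ k) =
        (F' fun _ => ((1 : ℝ), (0 : ℝ))) 0 v - w₀ k := by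
      have h8 : ((F' - F) fun _ => ((1 : ℝ), (0 : ℝ))) 0 v =
        (F' fun _ => ((1 : ℝ), (0 : ℝ))) 0 v - (F fun _ => ((1 : ℝ), (0 : ℝ))) 0 v := rfl
      rw [h8]
      abel
    rw [h7] at h6
    linarith
  have hv' : Γ'.vlift v q'.2 q'.1 ≠ 0 := by
    rw [← hw00 Γ' q' hq'.2]
    exact hw.2
  change D (Γ'.lineRank q')
  rw [Γ'.lineRank_eq_vlift (hsource q' hq'.2) hv']
  exact hw.1

theorem jetOpen_goodRanks (hn : 2 ≤ n) :
    JetOpen (n + 3) fun (Γ : IntegralFamily n IM I J) q => GoodRanks n (Γ.lineRank q) := by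
  refine jetOpen_lineRank (D := GoodRanks n) (isOpen_goodRanks hn) fun d d' h => ?_
  simp only [GoodRanks]
  rw [h n (by omega), h (n + 3) le_rfl, h (n - 1) (by omega), h (n + 2) (by omega),
    h 4 (by omega)]
  exact id

theorem IntegralFamily.lineRank_congr {Γ Γ' : IntegralFamily n IM I J} {q : I × J}
    (h : Γ.toFun =ᶠ[𝓝 q] Γ'.toFun) : Γ.lineRank q = Γ'.lineRank q := by
  obtain ⟨v, hv⟩ := Γ.exists_vlift_ne_zero q
  have hev : {s | Γ.vlift v q.2 s ≠ 0} ∈ 𝓝 q.1 :=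
    (Γ.contMDiff_vlift v q.2).continuous.continuousAt.eventually_ne hv
  have hc : ContinuousAt (fun s : I => (s, q.2)) q.1 := by fun_prop
  have h1 : ∀ᶠ s in 𝓝 q.1, Γ.toFun (s, q.2) = Γ'.toFun (s, q.2) := hc.eventually h
  rw [Γ.lineRank_eq_vlift (mem_extChartAt_source q.1) hv]
  refine (Γ'.lineRank_eq (mem_extChartAt_source q.1) (inter_mem hev h1)
    (Γ.contMDiff_vlift v q.2).contMDiffOn fun s hs => ⟨hs.1, ?_⟩).symm
  have h2 : Γ.toFun (s, q.2) = Γ'.toFun (s, q.2) := hs.2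
  rw [← h2]
  exact ContactFrame.line_eq_span_of_mem hs.1 (Γ.vlift_mem v q.2 s)

end LineRank

/-! ### Duality of flags. -/

namespace CompleteFlag

variable {n : ℕ}

theorem ext_V {F F' : CompleteFlag n} (h : F.V = F'.V) : F = F' := by
  cases F
  cases F'
  subst h
  rfl

/-- The flag of the orthogonal complements. -/
def dual (F : CompleteFlag n) : CompleteFlag n where
  V i := (F.V i.rev)ᗮ
  finrank_V i := by
    have h1 := (F.V i.rev).finrank_add_finrank_orthogonal
    rw [F.finrank_V] at h1
    have h2 : finrank ℝ (AmbientSpace n) = n + 2 := by simp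
    have h3 : (i.rev : ℕ) = n - i := by rw [Fin.val_rev]; omega
    have := i.2
    omega
  mono i j h := Submodule.orthogonal_le (F.mono (Fin.rev_le_rev.2 h))

theorem dual_dual (F : CompleteFlag n) : F.dual.dual = F := by
  refine ext_V ?_
  funext i
  simp only [dual, Fin.rev_rev]
  exact Submodule.orthogonal_orthogonal _

theorem dual_line (F : CompleteFlag n) : F.dual.line = F.hyperplaneᗮ := by
  simp [line, hyperplane, dual]

theorem dual_hyperplane (F : CompleteFlag n) : F.dual.hyperplane = F.lineᗮ := by
  simp [line, hyperplane, dual]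

variable (n) in
/-- The linear part of the duality in the embedding. -/
def dualL : FlagAmbient n ≃ₗᵢ[ℝ] FlagAmbient n where
  toFun v i := -v i.rev
  invFun v i := -v i.rev
  left_inv v := by funext i; simp
  right_inv v := by funext i; simp
  map_add' v w := by funext i; simp [add_comm]
  map_smul' c v := by funext i; simp
  norm_map' v := by
    have key : ∀ v : FlagAmbient n, ‖(fun i : Fin (n + 1) => -v i.rev : FlagAmbient n)‖ ≤ ‖v‖ := by
      intro v
      refine (pi_norm_le_iff_of_nonneg (norm_nonneg v)).2 fun i => ?_
      rw [norm_neg]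
      exact norm_le_pi_norm v _
    refine le_antisymm (key v) ?_
    have := key (fun i : Fin (n + 1) => -v i.rev)
    simpa using this

/-- Complementary orthogonal projections add up to the identity, so in the embedding duality is an
affine isometry. -/
theorem embed_dual (F : CompleteFlag n) : F.dual.embed = (fun _ => 1) + dualL n F.embed := by
  funext i
  change (F.V i.rev)ᗮ.starProjection = 1 + -(F.V i.rev).starProjection
  rw [Submodule.starProjection_orthogonal']
  abel

end CompleteFlag

/-! ### Duality of families. -/

section DualFamily

variable {n : ℕ} {H : Type*} [TopologicalSpace H] {IM : ModelWithCorners ℝ ℝ H}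
  {I : Type*} [TopologicalSpace I] [ChartedSpace H I]
  {J : Type*} [TopologicalSpace J] [ChartedSpace ℝ J]
  [IsManifold IM ∞ I] [IsManifold 𝓘(ℝ, ℝ) ∞ J]

theorem embed_last_mul_embed_zero (F : CompleteFlag n) :
    F.embed (Fin.last n) * F.embed 0 = F.embed 0 := by
  ext1 x
  exact Submodule.starProjection_eq_self_iff.2
    (ContactFrame.line_le_hyperplane F (Submodule.starProjection_apply_mem _ x))

/-- The family of the dual flags. -/
def IntegralFamily.dual (Γ : IntegralFamily n IM I J) : IntegralFamily n IM I J where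
  toFun q := (Γ.toFun q).dual
  smooth := by
    simp only [CompleteFlag.embed_dual]
    exact contMDiff_const.add ((CompleteFlag.dualL n).contDiff.contMDiff.comp Γ.smooth)
  integral lam t w := by
    let c : I → FlagAmbient n := fun s => (Γ.toFun (s, lam)).embed
    let D : ℝ →L[ℝ] FlagAmbient n := mfderiv IM 𝓘(ℝ, FlagAmbient n) c t
    have hc : HasMFDerivAt IM 𝓘(ℝ, FlagAmbient n) c t (mfderiv IM 𝓘(ℝ, FlagAmbient n) c t) :=
      ((Γ.contMDiff_slice lam).mdifferentiable (by simp) t).hasMFDerivAt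
    have hcd : HasFDerivWithinAt (c ∘ (extChartAt IM t).symm) D (range IM) (extChartAt IM t t) :=
      hc.2
    have hu : UniqueDiffWithinAt ℝ (range IM) (extChartAt IM t t) :=
      IM.uniqueDiffOn _ (extChartAt_target_subset_range t (mem_extChartAt_target t))
    have hct : (c ∘ (extChartAt IM t).symm) (extChartAt IM t t) = (Γ.toFun (t, lam)).embed := by
      rw [Function.comp, extChartAt_to_inv]
    let v : FlagAmbient n := D (1 : ℝ)
    have hv : v ∈ (Γ.toFun (t, lam)).pseudoContact := Γ.integral lam t (1 : ℝ)
    have hdual : mfderiv IM 𝓘(ℝ, FlagAmbient n)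
        (fun s : I => ((Γ.toFun (s, lam)).dual).embed) t w =
          (show ℝ from w) • CompleteFlag.dualL n v := by
      have h1 : (fun s : I => ((Γ.toFun (s, lam)).dual).embed) =
          (fun P => (fun _ => 1) + CompleteFlag.dualL n P) ∘ c := by
        funext s
        exact CompleteFlag.embed_dual _
      have h2 : HasFDerivAt (fun P => (fun _ => 1) + CompleteFlag.dualL n P)
          (CompleteFlag.dualL n).toContinuousLinearEquiv.toContinuousLinearMap (c t) :=
        (CompleteFlag.dualL n).toContinuousLinearEquiv.hasFDerivAt.const_add _
      rw [h1, (h2.hasMFDerivAt.comp t hc).mfderiv]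
      change CompleteFlag.dualL n (D (show ℝ from w)) = _
      rw [← map_smul, ← map_smul, smul_eq_mul, mul_one]
    have hi : ∀ i, HasDerivWithinAt (fun τ => (c ∘ (extChartAt IM t).symm) τ i)
        (v i) (range IM) (extChartAt IM t t) := fun i =>
      hasDerivWithinAt_pi.1 hcd.hasDerivWithinAt i
    -- The projections are symmetric, and so are their derivatives.
    have hsymm : ∀ i (x y : AmbientSpace n), inner ℝ (v i x) y = inner ℝ x (v i y) := by
      intro i x y
      have h1 := ((hi i).clm_apply (hasDerivWithinAt_const _ _ x)).inner ℝ
        (hasDerivWithinAt_const _ _ y)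
      have h2 := (hasDerivWithinAt_const (𝕜 := ℝ) (extChartAt IM t t) (range IM) x).inner ℝ
        ((hi i).clm_apply (hasDerivWithinAt_const _ _ y))
      have h3 : (fun τ => inner ℝ ((c ∘ (extChartAt IM t).symm) τ i x) y) =
          fun τ => inner ℝ x ((c ∘ (extChartAt IM t).symm) τ i y) := by
        funext τ
        exact Submodule.inner_starProjection_left_eq_right _ x y
      rw [h3] at h1
      have h4 := hu.eq_deriv _ h1 h2
      simpa using h4
    -- This is the derivative of the inclusion of the line in the hyperplane, written as the product
    -- of the two projections.
    have hincl : ∀ y, v (Fin.last n) ((Γ.toFun (t, lam)).embed 0 y) +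
        (Γ.toFun (t, lam)).embed (Fin.last n) (v 0 y) = v 0 y := by
      intro y
      have h0 := (hi 0).clm_apply (hasDerivWithinAt_const _ _ y)
      have h1 := (hi (Fin.last n)).clm_apply h0
      have h2 : (fun τ => (c ∘ (extChartAt IM t).symm) τ (Fin.last n)
          ((c ∘ (extChartAt IM t).symm) τ 0 y)) = fun τ => (c ∘ (extChartAt IM t).symm) τ 0 y := by
        funext τ
        exact DFunLike.congr_fun (embed_last_mul_embed_zero _) y
      rw [h2] at h1
      have h4 := hu.eq_deriv _ h1 h0
      rw [hct, map_zero, add_zero] at h4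
      exact h4
    rw [hdual]
    refine pseudoContact_smul _ fun x hx => ?_
    rw [CompleteFlag.dual_line] at hx
    rw [CompleteFlag.dual_hyperplane]
    change -v (Fin.rev 0) x ∈ _
    rw [Fin.rev_zero]
    refine Submodule.neg_mem _ fun y hy => ?_
    have h1 := hincl y
    have hy0 : (Γ.toFun (t, lam)).embed 0 y = y := Submodule.starProjection_eq_self_iff.2 hy
    have hvy : (Γ.toFun (t, lam)).embed (Fin.last n) (v 0 y) = v 0 y :=
      Submodule.starProjection_eq_self_iff.2 (hv y hy)
    -- Integrality makes the two other terms of `hincl` cancel on the line. By symmetry, the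
    -- derivative of the hyperplane projection then maps into the complement of the line, which is
    -- the dual condition.
    have h2 : v (Fin.last n) y = 0 := by
      rw [hy0, hvy] at h1
      simpa using h1
    rw [← hsymm, h2, inner_zero_left]

theorem IntegralFamily.ext_toFun {Γ Γ' : IntegralFamily n IM I J} (h : Γ.toFun = Γ'.toFun) :
    Γ = Γ' := by
  cases Γ
  cases Γ'
  subst h
  rfl

theorem IntegralFamily.dual_dual (Γ : IntegralFamily n IM I J) : Γ.dual.dual = Γ :=
  IntegralFamily.ext_toFun (funext fun _ => CompleteFlag.dual_dual _)

/-- A linear isometry preserves the norms of all derivatives, so the preimage of a ball is the ball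
around the dual centre. -/
theorem IntegralFamily.continuous_dual :
    Continuous (IntegralFamily.dual : IntegralFamily n IM I J → IntegralFamily n IM I J) := by
  refine continuous_generateFrom_iff.2 ?_
  rintro U ⟨f, r, c, K, ε, hc, hK, hfin, hε, rfl⟩
  refine TopologicalSpace.isOpen_generateFrom_of_mem ⟨f.dual, r, c, K, ε, hc, hK, hfin, hε, ?_⟩
  ext Γ
  simp only [mem_preimage, mem_ofPred_eq, whitneyBall]
  refine forall_congr' fun i => forall_congr' fun k => forall_congr' fun _ =>
    forall_congr' fun x => forall_congr' fun hx => ?_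
  set κ := (c i).extend (IM.prod 𝓘(ℝ, ℝ))
  have h1 : (fun u => (Γ.dual.toFun (κ.symm u)).embed - (f.toFun (κ.symm u)).embed) =
      CompleteFlag.dualL n ∘
        fun u => (Γ.toFun (κ.symm u)).embed - (f.dual.toFun (κ.symm u)).embed := by
    funext u
    have h2 : (f.toFun (κ.symm u)).embed = (f.dual.toFun (κ.symm u)).dual.embed := by
      change _ = ((f.toFun (κ.symm u)).dual).dual.embed
      rw [CompleteFlag.dual_dual]
    have h3 : (Γ.dual.toFun (κ.symm u)).embed = (Γ.toFun (κ.symm u)).dual.embed := rfl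
    rw [h2, h3, CompleteFlag.embed_dual, CompleteFlag.embed_dual, Function.comp, map_sub]
    abel
  have hxt : κ x ∈ κ.target := κ.map_source (by
    rw [OpenPartialHomeomorph.extend_source]; exact (hK i).2 hx)
  rw [h1, LinearIsometryEquiv.norm_iteratedFDerivWithin_comp_left _ _
    (uniqueDiffOn_extend_target (c i)) hxt]

variable (n IM I J) in
/-- The duality as a homeomorphism of the space of families. -/
def IntegralFamily.dualHomeo : IntegralFamily n IM I J ≃ₜ IntegralFamily n IM I J where
  toFun := IntegralFamily.dual
  invFun := IntegralFamily.dual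
  left_inv := IntegralFamily.dual_dual
  right_inv := IntegralFamily.dual_dual
  continuous_toFun := IntegralFamily.continuous_dual
  continuous_invFun := IntegralFamily.continuous_dual

theorem goodFamilies_eq (hn : 2 ≤ n) : goodFamilies n IM I J =
    {Γ | ∀ q, GoodRanks n (Γ.lineRank q)} ∩
      IntegralFamily.dualHomeo n IM I J ⁻¹' {Γ | ∀ q, GoodRanks n (Γ.lineRank q)} := by
  ext Γ
  simp only [goodFamilies, mem_ofPred_eq, mem_inter_iff, mem_preimage]
  have h1 : ∀ (lam : J) (t : I), (fun s => ((Γ.toFun (s, lam)).hyperplane)ᗮ) =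
      fun s => ((Γ.dual).toFun (s, lam)).line := fun lam t => by
    funext s
    exact (CompleteFlag.dual_line _).symm
  constructor
  · intro h
    refine ⟨fun q => (Γ.hasType_line_iff hn q).1 (h q.2 q.1).1, fun q => ?_⟩
    have h2 := (h q.2 q.1).2
    rw [h1 q.2 q.1] at h2
    exact (Γ.dual.hasType_line_iff hn q).1 h2
  · rintro ⟨h, h'⟩ lam t
    refine ⟨(Γ.hasType_line_iff hn (t, lam)).2 (h (t, lam)), ?_⟩
    rw [h1 lam t]
    exact (Γ.dual.hasType_line_iff hn (t, lam)).2 (h' (t, lam))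

end DualFamily

/-! ### Avoiding sets of codimension at least three. -/

section Thin

variable {V : Type*} [NormedAddCommGroup V] [NormedSpace ℝ V] [FiniteDimensional ℝ V]

/-- A set covered by the image of a `C^1` map defined on an open subset of a space of codimension at
least `3`. -/
def IsThin (S : Set V) : Prop :=
  ∃ (k : ℕ) (Ω : Set (Fin k → ℝ)) (ψ : (Fin k → ℝ) → V), IsOpen Ω ∧ ContDiffOn ℝ 1 ψ Ω ∧
    k + 3 ≤ finrank ℝ V ∧ S ⊆ ψ '' Ω

theorem IsThin.of_param {P : Type*} [NormedAddCommGroup P] [NormedSpace ℝ P]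
    [FiniteDimensional ℝ P] {S : Set V} {Ω : Set P} {ψ : P → V} (hΩ : IsOpen Ω)
    (hψ : ContDiffOn ℝ 1 ψ Ω) (hdim : finrank ℝ P + 3 ≤ finrank ℝ V) (hS : S ⊆ ψ '' Ω) :
    IsThin S := by
  let e : (Fin (finrank ℝ P) → ℝ) ≃L[ℝ] P := ContinuousLinearEquiv.ofFinrankEq (by simp)
  refine ⟨finrank ℝ P, e ⁻¹' Ω, ψ ∘ e, hΩ.preimage e.continuous,
    hψ.comp e.contDiff.contDiffOn fun _ h => h, hdim, fun w hw => ?_⟩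
  obtain ⟨p, hp, rfl⟩ := hS hw
  exact ⟨e.symm p, by simpa using hp, by simp⟩

theorem IsThin.preimage_fst {V' : Type*} [NormedAddCommGroup V'] [NormedSpace ℝ V']
    [FiniteDimensional ℝ V'] {S : Set V} (hS : IsThin S) : IsThin (Prod.fst ⁻¹' S : Set (V × V')) := by
  obtain ⟨k, Ω, ψ, hΩ, hψ, hdim, hsub⟩ := hS
  refine IsThin.of_param (P := (Fin k → ℝ) × V') (Ω := Ω ×ˢ univ) (ψ := fun w => (ψ w.1, w.2))
    (hΩ.prod isOpen_univ) ((hψ.comp contDiffOn_fst fun w hw => hw.1).prodMk contDiffOn_snd) ?_ ?_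
  · simp only [Module.finrank_prod, Module.finrank_fin_fun]
    omega
  · intro w hw
    obtain ⟨p, hp, hpw⟩ := hsub hw
    exact ⟨(p, w.2), ⟨hp, mem_univ _⟩, Prod.ext hpw rfl⟩

/-- A generic translate of a two-parameter family avoids thin sets. -/
theorem exists_forall_notMem_of_isThin {ι : Type*} [Finite ι] {S : ι → Set V}
    (hS : ∀ i, IsThin (S i)) {B : Set (ℝ × ℝ)} (hB : Convex ℝ B) {j : ℝ × ℝ → V}
    (hj : ContDiffOn ℝ 1 j B) {A A' : ℝ × ℝ → V →L[ℝ] V} (hA' : ContDiffOn ℝ 1 A' B)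
    (hAA : ∀ y ∈ B, ∀ s, A' y (A y s) = s) {O : Set V} (hO : O ∈ 𝓝 0) :
    ∃ s ∈ O, ∀ y ∈ B, ∀ i, j y + A y s ∉ S i := by
  choose k Ω ψ hΩ hψ hdim hsub using hS
  -- A translation `s` is bad if `j y + A y s = ψ w`, that is, if `s = A' y (ψ w - j y)`. Bad
  -- translations are thus covered by `C^1` images of sets of dimension `k + 2 < dim V`, and the
  -- complement is dense by Hausdorff dimension.
  let R : ∀ i, (ℝ × ℝ) × (Fin (k i) → ℝ) → V := fun i w => A' w.1 (ψ i w.2 - j w.1)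
  have hR : ∀ i, ContDiffOn ℝ 1 (R i) (B ×ˢ Ω i) := fun i =>
    (hA'.comp contDiffOn_fst fun w hw => hw.1).clm_apply
      (((hψ i).comp contDiffOn_snd fun w hw => hw.2).sub
        (hj.comp contDiffOn_fst fun w hw => hw.1))
  have hdimR : ∀ i, dimH (R i '' (B ×ˢ Ω i)) ≤ ((finrank ℝ V - 1 : ℕ) : ENNReal) := by
    intro i
    have h1 : dimH (R i '' (B ×ˢ Ω i)) ≤ dimH (B ×ˢ Ω i) := by
      refine dimH_image_le_of_locally_lipschitzOn fun w hw => ?_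
      obtain ⟨ε, hε, hball⟩ := Metric.isOpen_iff.1 (hΩ i) w.2 hw.2
      -- A `C^1` map on a convex set is locally Lipschitz, also at boundary points; the parameter
      -- domain is replaced by a ball for convexity.
      obtain ⟨C, u, hu, hC⟩ := ((hR i w hw).mono (prod_mono subset_rfl hball)
        ).exists_lipschitzOnWith (hB.prod (convex_ball w.2 ε))
      refine ⟨C, u, ?_, hC⟩
      refine nhdsWithin_le_of_mem ?_ hu
      filter_upwards [self_mem_nhdsWithin, mem_nhdsWithin_of_mem_nhds
        (continuous_snd.continuousAt.preimage_mem_nhds (Metric.ball_mem_nhds w.2 hε))]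
        with w' hw' hw'' using ⟨hw'.1, hw''⟩
    refine h1.trans ((dimH_mono (subset_univ _)).trans ?_)
    rw [Real.dimH_univ_eq_finrank]
    simp only [Module.finrank_prod, Module.finrank_fin_fun, Module.finrank_self]
    have := hdim i
    exact_mod_cast (by omega : 1 + 1 + k i ≤ finrank ℝ V - 1)
  have hlt : dimH (⋃ i, R i '' (B ×ˢ Ω i)) < finrank ℝ V ∨ IsEmpty ι := by
    rcases isEmpty_or_nonempty ι with h | ⟨⟨i⟩⟩
    · exact Or.inr h
    · left
      rw [dimH_iUnion]
      refine (iSup_le hdimR).trans_lt ?_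
      have := hdim i
      exact_mod_cast (by omega : finrank ℝ V - 1 < finrank ℝ V)
  rcases hlt with hlt | hemp
  · obtain ⟨s, hs, hsO⟩ := (dense_compl_of_dimH_lt_finrank hlt).inter_nhds_nonempty hO
    refine ⟨s, hsO, fun y hy i hmem => hs ?_⟩
    obtain ⟨p, hp, hpe⟩ := hsub i hmem
    refine mem_iUnion.2 ⟨i, (y, p), ⟨hy, hp⟩, ?_⟩
    simp only [R, hpe, add_sub_cancel_left]
    exact hAA y hy s
  · exact ⟨0, mem_of_mem_nhds hO, fun y _ i => hemp.elim i⟩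

end Thin

/-! ### Linear dependence as a thin condition. -/

section Dependent

variable {E : Type*} [NormedAddCommGroup E] [NormedSpace ℝ E] [FiniteDimensional ℝ E] {m : ℕ}

/-- The vectors outside `K` are free, and a vector in `K` is described by its coefficients. The
codimension is therefore the sum of `dim E - |L k|` over `K`; disjointness ensures that the vectors
being combined are free ones. -/
theorem isThin_dependent (K : Finset (Fin (m + 1))) (L : Fin (m + 1) → Finset (Fin (m + 1)))
    (hd : ∀ k ∈ K, Disjoint (L k) K)
    (hdim : ∑ k ∈ K, (L k).card + 3 ≤ K.card * finrank ℝ E) :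
    IsThin {w : Fin (m + 1) → E | ∀ k ∈ K, w k ∈ Submodule.span ℝ (w '' L k)} := by
  classical
  let ψ : ({k : Fin (m + 1) // k ∉ K} → E) × ((Σ k : K, L k) → ℝ) → Fin (m + 1) → E := fun w k =>
    if h : k ∈ K then
      ∑ l : L k, w.2 ⟨⟨k, h⟩, l⟩ • w.1 ⟨l.1, fun hl => Finset.disjoint_left.1 (hd k h) l.2 hl⟩
    else w.1 ⟨k, h⟩
  refine IsThin.of_param (P := ({k : Fin (m + 1) // k ∉ K} → E) × ((Σ k : K, L k) → ℝ))
    (Ω := univ) (ψ := ψ) isOpen_univ (ContDiff.contDiffOn (contDiff_pi.2 fun k => ?_)) ?_ ?_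
  · by_cases h : k ∈ K
    · have : (fun w => ψ w k) = fun w => ∑ l : L k, w.2 ⟨⟨k, h⟩, l⟩ • w.1 ⟨l.1, fun hl =>
          Finset.disjoint_left.1 (hd k h) l.2 hl⟩ := by
        funext w
        exact dif_pos h
      rw [this]
      exact ContDiff.sum fun l _ => by fun_prop
    · have : (fun w => ψ w k) = fun w => w.1 ⟨k, h⟩ := by
        funext w
        exact dif_neg h
      rw [this]
      fun_prop
  · have h1 : Fintype.card {k : Fin (m + 1) // k ∉ K} + K.card = m + 1 := by
      rw [Fintype.card_subtype_compl, Fintype.card_fin, Fintype.card_coe]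
      have := Finset.card_le_univ K
      rw [Fintype.card_fin] at this
      omega
    have h2 : Fintype.card (Σ k : K, L k) = ∑ k ∈ K, (L k).card := by
      rw [Fintype.card_sigma]
      simp only [Fintype.card_coe]
      exact Finset.sum_coe_sort K fun k => (L k).card
    have h3 : finrank ℝ (Fin (m + 1) → E) = (m + 1) * finrank ℝ E := by
      rw [Module.finrank_pi_fintype]
      simp
    have h4 : finrank ℝ ({k : Fin (m + 1) // k ∉ K} → E) =
        Fintype.card {k : Fin (m + 1) // k ∉ K} * finrank ℝ E := by
      rw [Module.finrank_pi_fintype]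
      simp only [Finset.sum_const, Finset.card_univ, smul_eq_mul]
    rw [Module.finrank_prod, h4, Module.finrank_fintype_fun_eq_card, h2, h3]
    calc _ ≤ Fintype.card {k : Fin (m + 1) // k ∉ K} * finrank ℝ E + K.card * finrank ℝ E := by
          omega
      _ = (m + 1) * finrank ℝ E := by rw [← add_mul, h1]
  · intro w hw
    have hc : ∀ k : K, ∃ c : L k → ℝ, ∑ l : L k, c l • w l = w k := fun k =>
      (Submodule.mem_span_image_finset_iff_exists_fun ℝ).1 (hw k k.2)
    choose c hc using hc
    refine ⟨(fun k => w k, fun kl => c kl.1 kl.2), mem_univ _, ?_⟩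
    funext k
    by_cases h : k ∈ K
    · simp only [ψ, dif_pos h]
      exact hc ⟨k, h⟩
    · simp only [ψ, dif_neg h]

end Dependent

/-! ### Polynomial perturbations and their jets. -/

section TaylorShift

variable (E : Type*) [NormedAddCommGroup E] [NormedSpace ℝ E] [FiniteDimensional ℝ E] (m : ℕ)

/-- The shift on jets of order `m`. -/
def jetShift : (Fin (m + 1) → E) →L[ℝ] (Fin (m + 1) → E) :=
  ContinuousLinearMap.pi fun j => if h : (j : ℕ) + 1 < m + 1 then
    ContinuousLinearMap.proj (⟨(j : ℕ) + 1, h⟩ : Fin (m + 1)) else 0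

theorem jetShift_apply (s : Fin (m + 1) → E) (j : Fin (m + 1)) :
    jetShift E m s j = if h : (j : ℕ) + 1 < m + 1 then s ⟨(j : ℕ) + 1, h⟩ else 0 := by
  simp only [jetShift, ContinuousLinearMap.pi_apply]
  split_ifs <;> rfl

/-- The flow on jets given by the translation of polynomials. -/
def jetFlow (t : ℝ) : (Fin (m + 1) → E) →L[ℝ] (Fin (m + 1) → E) :=
  NormedSpace.exp (t • jetShift E m)

theorem jetFlow_neg_jetFlow (t : ℝ) (s : Fin (m + 1) → E) :
    jetFlow E m (-t) (jetFlow E m t s) = s := by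
  let _ : NormedAlgebra ℚ ((Fin (m + 1) → E) →L[ℝ] (Fin (m + 1) → E)) :=
    NormedAlgebra.restrictScalars ℚ ℝ _
  have h : jetFlow E m (-t) * jetFlow E m t = 1 := by
    rw [jetFlow, jetFlow, ← NormedSpace.exp_add_of_commute]
    · rw [← add_smul, neg_add_cancel, zero_smul, NormedSpace.exp_zero]
    · exact ((Commute.refl (jetShift E m)).smul_left _).smul_right _
  exact DFunLike.congr_fun h s

theorem contDiff_jetFlow : ContDiff ℝ ∞ (jetFlow E m) := by
  refine contDiff_iff_contDiffAt.2 fun t => ?_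
  have h1 : ContDiffAt ℝ ∞ (fun x => NormedSpace.exp x) (t • jetShift E m) :=
    (NormedSpace.exp_analytic (𝕂 := ℝ) (t • jetShift E m)).contDiffAt
  have h2 : ContDiffAt ℝ ∞ (fun t : ℝ => t • jetShift E m) t := by fun_prop
  exact h1.comp t h2

variable {E m}

theorem hasDerivAt_jetFlow (t : ℝ) (s : Fin (m + 1) → E) {k : ℕ} (hk : k + 1 < m + 1) :
    HasDerivAt (fun t => jetFlow E m t s ⟨k, by omega⟩) (jetFlow E m t s ⟨k + 1, hk⟩) t := by
  have h1 : HasDerivAt (jetFlow E m) (jetShift E m * jetFlow E m t) t :=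
    hasDerivAt_exp_smul_const' (𝕂 := ℝ) (jetShift E m) t
  have h2 := h1.clm_apply (hasDerivAt_const t s)
  have h3 := hasDerivAt_pi.1 h2 ⟨k, by omega⟩
  have h4 : ((jetShift E m * jetFlow E m t) s + (jetFlow E m t) 0) ⟨k, by omega⟩ =
      jetFlow E m t s ⟨k + 1, hk⟩ := by
    rw [map_zero, add_zero]
    change jetShift E m (jetFlow E m t s) _ = _
    rw [jetShift_apply, dif_pos hk]
  rw [h4] at h3
  exact h3

/-- The exponential of the nilpotent shift sends the jet of a polynomial at `t₀` to its jet at `t`.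
The flow is invertible, so at each time a polynomial perturbation can move the jet in any direction.
-/
theorem iteratedDerivWithin_jetFlow {A : Set ℝ} (hA : UniqueDiffOn ℝ A) (t₀ : ℝ)
    (s : Fin (m + 1) → E) {k : ℕ} (hk : k < m + 1) {t : ℝ} (ht : t ∈ A) :
    iteratedDerivWithin k (fun t => jetFlow E m (t - t₀) s 0) A t =
      jetFlow E m (t - t₀) s ⟨k, hk⟩ := by
  induction k generalizing t with
  | zero => rw [iteratedDerivWithin_zero]; rfl
  | succ k ih =>
    rw [iteratedDerivWithin_succ, derivWithin_congr (fun τ hτ => ih (by omega) hτ)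
      (ih (by omega) ht)]
    have h1 := (hasDerivAt_jetFlow (t - t₀) s hk).comp_sub_const t t₀
    exact h1.hasDerivWithinAt.derivWithin (hA t ht)

end TaylorShift

/-! ### Ranks of affine curves. -/

section AffineRank

variable {E F : Type*} [NormedAddCommGroup E] [NormedSpace ℝ E] [FiniteDimensional ℝ E]
  [NormedAddCommGroup F] [NormedSpace ℝ F] [FiniteDimensional ℝ F]

/-- The rank of the members `1, …, r` of a sequence. -/
def affRank (y : ℕ → F) (r : ℕ) : ℕ := finrank ℝ (Submodule.span ℝ (y '' Icc 1 r))

/-- In an affine chart only the member of order zero has a component outside the image of `κ`; it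
contributes exactly one to the rank. -/
theorem jetRank_eq_affRank {w : ℕ → E} {y : ℕ → F} {κ : F →ₗ[ℝ] E}
    (hκ : Function.Injective κ) (hw : ∀ k, 1 ≤ k → w k = κ (y k)) (h0 : w 0 ∉ LinearMap.range κ)
    (r : ℕ) : jetRank w r = 1 + affRank y r := by
  have hI : (Iic r : Set ℕ) = insert 0 (Icc 1 r) := by
    ext k
    simp only [mem_Iic, mem_insert_iff, mem_Icc]
    omega
  have him : w '' Icc 1 r = κ '' (y '' Icc 1 r) := by
    rw [← image_comp]
    exact image_congr fun k hk => hw k hk.1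
  have h1 : Submodule.span ℝ (w '' Iic r) =
      Submodule.span ℝ {w 0} ⊔ (Submodule.span ℝ (y '' Icc 1 r)).map κ := by
    rw [hI, image_insert_eq, Submodule.span_insert, him, Submodule.span_image]
  have hle : (Submodule.span ℝ (y '' Icc 1 r)).map κ ≤ LinearMap.range κ := LinearMap.map_le_range
  have hne : w 0 ≠ 0 := fun h => h0 (h ▸ Submodule.zero_mem _)
  have h2 : Submodule.span ℝ {w 0} ⊓ (Submodule.span ℝ (y '' Icc 1 r)).map κ = ⊥ := by
    rw [← disjoint_iff]
    exact (Submodule.disjoint_span_singleton' hne).2 (fun h => h0 (hle h)) |>.symm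
  have h3 := Submodule.finrank_sup_add_finrank_inf_eq (Submodule.span ℝ {w 0})
    ((Submodule.span ℝ (y '' Icc 1 r)).map κ)
  rw [h2, finrank_bot, add_zero, finrank_span_singleton hne,
    ← (Submodule.equivMapOfInjective κ hκ _).finrank_eq] at h3
  rw [jetRank, h1, h3, affRank]

theorem affRank_succ {y : ℕ → F} {r : ℕ}
    (h : y (r + 1) ∉ Submodule.span ℝ (y '' Icc 1 r)) : affRank y (r + 1) = affRank y r + 1 := by
  have hI : (Icc 1 (r + 1) : Set ℕ) = insert (r + 1) (Icc 1 r) := by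
    ext k
    simp only [mem_insert_iff, mem_Icc]
    omega
  have hne : y (r + 1) ≠ 0 := fun h0 => h (h0 ▸ Submodule.zero_mem _)
  have h2 : Submodule.span ℝ {y (r + 1)} ⊓ Submodule.span ℝ (y '' Icc 1 r) = ⊥ := by
    rw [← disjoint_iff]
    exact (Submodule.disjoint_span_singleton' hne).2 h |>.symm
  have h3 := Submodule.finrank_sup_add_finrank_inf_eq (Submodule.span ℝ {y (r + 1)})
    (Submodule.span ℝ (y '' Icc 1 r))
  rw [h2, finrank_bot, add_zero, finrank_span_singleton hne] at h3
  rw [affRank, hI, image_insert_eq, Submodule.span_insert, h3, affRank, add_comm]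

theorem affRank_mono (y : ℕ → F) : Monotone (affRank y) := fun _ _ h =>
  Submodule.finrank_mono (Submodule.span_mono (image_mono (Icc_subset_Icc_right h)))

theorem affRank_le (y : ℕ → F) (r : ℕ) : affRank y r ≤ finrank ℝ F := Submodule.finrank_le _

theorem affRank_zero (y : ℕ → F) : affRank y 0 = 0 := by
  simp [affRank]

/-- The ranks are good off the exceptional strata of immersed curves. -/
theorem goodRanks_of_immersed {n : ℕ} (hn : 2 ≤ n) (hF : finrank ℝ F = n + 1) {y : ℕ → F}
    (h1 : y 1 ≠ 0) (hj : ∀ j, 2 ≤ j → j ≤ n - 1 → y j ∉ Submodule.span ℝ (y '' Ico 1 j))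
    (ha : ¬ ∀ k ∈ Icc (n + 1) (n + 3), y k ∈ Submodule.span ℝ (y '' Icc 1 n))
    (hb : ¬ (y n ∈ Submodule.span ℝ (y '' Icc 1 (n - 1)) ∧
      y (n + 1) ∈ Submodule.span ℝ (y '' Icc 1 (n - 1))))
    (hc : ¬ (y n ∈ Submodule.span ℝ (y '' Icc 1 (n - 1)) ∧
      y (n + 2) ∈ Submodule.span ℝ (y '' insert (n + 1) (Icc 1 (n - 1)))))
    {d : ℕ → ℕ} (hd : ∀ r, d r = 1 + affRank y r) : GoodRanks n d := by
  have hIco : ∀ j : ℕ, (Ico 1 (j + 1) : Set ℕ) = Icc 1 j := fun j => by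
    ext k
    simp only [mem_Ico, mem_Icc]
    omega
  have hr : ∀ j, j ≤ n - 1 → affRank y j = j := by
    intro j
    induction j with
    | zero => intro _; exact affRank_zero y
    | succ j ih =>
      intro hjn
      rw [affRank_succ, ih (by omega)]
      rcases Nat.eq_zero_or_pos j with rfl | hj0
      · simpa using h1
      · have := hj (j + 1) (by omega) hjn
        rwa [hIco] at this
  have hn1 := hr (n - 1) le_rfl
  have hle := affRank_le y
  simp only [hF] at hle
  -- If the rank stalls at order `n`, then `hb` and `hc` force it to grow at the orders `n + 1` and
  -- `n + 2`, which is the second alternative. Otherwise `ha` lets it become full at order `n + 3`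
  -- at the latest.
  by_cases hyn : y n ∈ Submodule.span ℝ (y '' Icc 1 (n - 1))
  · refine Or.inr (Or.inl ⟨by rw [hd, hn1]; omega, ?_⟩)
    have hspan : Submodule.span ℝ (y '' Icc 1 n) = Submodule.span ℝ (y '' Icc 1 (n - 1)) := by
      have hI : (Icc 1 n : Set ℕ) = insert n (Icc 1 (n - 1)) := by
        ext k
        simp only [mem_insert_iff, mem_Icc]
        omega
      rw [hI, image_insert_eq, Submodule.span_insert_eq_span hyn]
    have hrn : affRank y n = n - 1 := by rw [affRank, hspan]; exact hn1
    have hy1 : y (n + 1) ∉ Submodule.span ℝ (y '' Icc 1 n) := fun h => hb ⟨hyn, hspan ▸ h⟩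
    have hrn1 : affRank y (n + 1) = n := by rw [affRank_succ hy1, hrn]; omega
    have hspan1 : Submodule.span ℝ (y '' Icc 1 (n + 1)) =
        Submodule.span ℝ (y '' insert (n + 1) (Icc 1 (n - 1))) := by
      have hI : (Icc 1 (n + 1) : Set ℕ) = insert (n + 1) (Icc 1 n) := by
        ext k
        simp only [mem_insert_iff, mem_Icc]
        omega
      rw [hI, image_insert_eq, image_insert_eq, Submodule.span_insert, Submodule.span_insert, hspan]
    have hy2 : y (n + 1 + 1) ∉ Submodule.span ℝ (y '' Icc 1 (n + 1)) := fun h =>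
      hc ⟨hyn, hspan1 ▸ h⟩
    have := affRank_succ hy2
    rw [hd, show n + 2 = n + 1 + 1 from rfl, this, hrn1]
    omega
  · have hrn : affRank y n = n := by
      obtain ⟨m, rfl⟩ : ∃ m, n = m + 1 := ⟨n - 1, by omega⟩
      rw [Nat.add_sub_cancel] at hyn hn1
      rw [affRank_succ hyn, hn1]
    refine Or.inl ⟨by rw [hd, hrn]; omega, ?_⟩
    push Not at ha
    obtain ⟨k, hk, hyk⟩ := ha
    have hlt : affRank y n < affRank y k := by
      refine Submodule.finrank_lt_finrank_of_lt (lt_of_le_of_ne (Submodule.span_mono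
        (image_mono (Icc_subset_Icc_right (by have := hk.1; omega)))) fun heq => hyk ?_)
      rw [heq]
      exact Submodule.subset_span ⟨k, ⟨by have := hk.1; omega, le_rfl⟩, rfl⟩
    have h2 := affRank_mono y hk.2
    have h3 := hle (n + 3)
    rw [hd]
    omega

end AffineRank

/-! ### Bad jets of immersed curves. -/

section ImmersedStrata

variable {F : Type*} [NormedAddCommGroup F] [NormedSpace ℝ F] [FiniteDimensional ℝ F]

/-- The set of jets of order `m` whose members `k ∈ K` depend on the members in `L k`. -/
def depStratum (F : Type*) [NormedAddCommGroup F] [NormedSpace ℝ F] (m : ℕ) (K : Finset ℕ)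
    (L : ℕ → Finset ℕ) : Set (Fin (m + 1) → F) :=
  {w | ∀ k : Fin (m + 1), (k : ℕ) ∈ K →
    w k ∈ Submodule.span ℝ (w '' {i : Fin (m + 1) | (i : ℕ) ∈ L k})}

theorem isThin_depStratum {m : ℕ} {K : Finset ℕ} {L : ℕ → Finset ℕ} (hK : ∀ k ∈ K, k ≤ m)
    (hd : ∀ k ∈ K, Disjoint (L k) K) (hdim : ∑ k ∈ K, (L k).card + 3 ≤ K.card * finrank ℝ F) :
    IsThin (depStratum F m K L) := by
  classical
  let ι : ℕ → Fin (m + 1) := fun k => if h : k < m + 1 then ⟨k, h⟩ else 0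
  have hι : ∀ k ≤ m, (ι k : ℕ) = k := fun k hk => by
    simp only [ι]
    rw [dif_pos (by omega)]
  let R : Finset ℕ → Finset (Fin (m + 1)) := fun S => Finset.univ.filter fun i => (i : ℕ) ∈ S
  have hRcard : ∀ S, (R S).card ≤ S.card := fun S =>
    Finset.card_le_card_of_injOn (fun i => (i : ℕ)) (fun i hi => (Finset.mem_filter.1 hi).2)
      (fun i _ j _ h => Fin.ext h)
  have hRK : (R K).card = K.card := by
    refine le_antisymm (hRcard K) (Finset.card_le_card_of_injOn ι (fun k hk => ?_) ?_)
    · refine Finset.mem_coe.2 (Finset.mem_filter.2 ⟨Finset.mem_univ _, ?_⟩)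
      rw [hι k (hK k hk)]
      exact hk
    · intro i hi j hj hij
      rw [← hι i (hK i hi), ← hι j (hK j hj), hij]
  have hsum : ∑ k ∈ R K, (R (L k)).card ≤ ∑ k ∈ K, (L k).card := by
    have hle : ∑ k ∈ R K, (R (L k)).card ≤ ∑ k ∈ R K, (L (k : ℕ)).card :=
      Finset.sum_le_sum fun k _ => hRcard (L k)
    refine hle.trans ?_
    have : ∑ k ∈ R K, (L (k : ℕ)).card = ∑ k ∈ (R K).image (fun i : Fin (m + 1) => (i : ℕ)), (L k).card := by
      rw [Finset.sum_image fun i _ j _ h => Fin.ext h]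
    rw [this]
    refine Finset.sum_le_sum_of_subset fun k hk => ?_
    obtain ⟨i, hi, rfl⟩ := Finset.mem_image.1 hk
    exact (Finset.mem_filter.1 hi).2
  have h := isThin_dependent (E := F) (R K) (fun k => R (L k)) (fun k hk => by
    rw [Finset.disjoint_left]
    intro i hi hiK
    exact Finset.disjoint_left.1 (hd k (Finset.mem_filter.1 hk).2) (Finset.mem_filter.1 hi).2
      (Finset.mem_filter.1 hiK).2) (by rw [hRK]; omega)
  obtain ⟨k, Ω, ψ, h1, h2, h3, h4⟩ := h
  refine ⟨k, Ω, ψ, h1, h2, h3, fun w hw => h4 fun k hk => ?_⟩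
  have := hw k (Finset.mem_filter.1 hk).2
  simpa [R] using this

/-- The strata to be avoided by immersed curves. -/
def immersedStrata (F : Type*) [NormedAddCommGroup F] [NormedSpace ℝ F] (n : ℕ) :
    (Fin n ⊕ Unit ⊕ Unit ⊕ Unit) → Set (Fin (n + 3 + 1) → F) :=
  Sum.elim
    (fun j => if 2 ≤ (j : ℕ) then depStratum F (n + 3) {(j : ℕ)} (fun _ => Finset.Ico 1 j) else ∅)
    (Sum.elim
      (fun _ => depStratum F (n + 3) (Finset.Icc (n + 1) (n + 3)) (fun _ => Finset.Icc 1 n))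
      (Sum.elim
        (fun _ => depStratum F (n + 3) {n, n + 1} (fun _ => Finset.Icc 1 (n - 1)))
        (fun _ => depStratum F (n + 3) {n, n + 2} (fun k => if k = n then Finset.Icc 1 (n - 1)
          else insert (n + 1) (Finset.Icc 1 (n - 1))))))

/-- In dimension `n + 1` the codimensions are `n + 2 - j ≥ 3` for a stall at `j ≤ n - 1`, then `1 +
1 + 1 = 3`, `2 + 2 = 4` and `2 + 1 = 3`. -/
theorem isThin_immersedStrata {n : ℕ} (hn : 2 ≤ n) (hF : finrank ℝ F = n + 1)
    (i : Fin n ⊕ Unit ⊕ Unit ⊕ Unit) : IsThin (immersedStrata F n i) := by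
  rw [immersedStrata]
  rcases i with j | _ | _ | _
  · rw [Sum.elim_inl]
    have hj := j.2
    split_ifs with h
    · refine isThin_depStratum ?_ ?_ ?_
      · intro k hk
        rw [Finset.mem_singleton] at hk
        omega
      · intro k _
        rw [Finset.disjoint_singleton_right, Finset.mem_Ico]
        omega
      · rw [Finset.sum_singleton, Nat.card_Ico, Finset.card_singleton, hF]
        omega
    -- The indices `j < 2` belong to no condition and were given the empty stratum.
    · refine ⟨0, ∅, 0, isOpen_empty, contDiffOn_const, ?_, empty_subset _⟩
      rw [Module.finrank_pi_fintype]
      simp only [Finset.sum_const, Finset.card_univ, Fintype.card_fin, hF, smul_eq_mul]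
      nlinarith
  · rw [Sum.elim_inr, Sum.elim_inl]
    refine isThin_depStratum ?_ ?_ ?_
    · intro k hk
      rw [Finset.mem_Icc] at hk
      omega
    · intro k _
      rw [Finset.disjoint_left]
      intro i hi hi'
      rw [Finset.mem_Icc] at hi hi'
      omega
    · rw [Finset.sum_const, Nat.card_Icc, Nat.card_Icc, hF, smul_eq_mul,
        show n + 3 + 1 - (n + 1) = 3 by omega]
      omega
  · rw [Sum.elim_inr, Sum.elim_inr, Sum.elim_inl]
    refine isThin_depStratum ?_ ?_ ?_
    · intro k hk
      simp only [Finset.mem_insert, Finset.mem_singleton] at hk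
      omega
    · intro k _
      rw [Finset.disjoint_left]
      intro i hi hi'
      simp only [Finset.mem_insert, Finset.mem_singleton] at hi'
      rw [Finset.mem_Icc] at hi
      omega
    · rw [Finset.sum_const, Finset.card_pair (by omega), Nat.card_Icc, hF, smul_eq_mul]
      omega
  · rw [Sum.elim_inr, Sum.elim_inr, Sum.elim_inr]
    refine isThin_depStratum ?_ ?_ ?_
    · intro k hk
      simp only [Finset.mem_insert, Finset.mem_singleton] at hk
      omega
    · intro k _
      rw [Finset.disjoint_left]
      intro i hi hi'
      simp only [Finset.mem_insert, Finset.mem_singleton] at hi'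
      split_ifs at hi
      · rw [Finset.mem_Icc] at hi
        omega
      · rw [Finset.mem_insert, Finset.mem_Icc] at hi
        omega
    · rw [Finset.sum_pair (by omega), if_pos rfl, if_neg (by omega), Finset.card_pair (by omega),
        Finset.card_insert_of_notMem (by rw [Finset.mem_Icc]; omega), Nat.card_Icc, hF]
      omega

theorem mem_depStratum_of_forall {m : ℕ} {K : Finset ℕ} {L : ℕ → Finset ℕ} {y : ℕ → F}
    (hL : ∀ k ∈ K, ∀ i ∈ L k, i ≤ m)
    (h : ∀ k ∈ K, y k ∈ Submodule.span ℝ (y '' (L k : Set ℕ))) :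
    (fun i : Fin (m + 1) => y i) ∈ depStratum F m K L := by
  intro k hk
  refine Submodule.span_mono ?_ (h k hk)
  rintro _ ⟨i, hi, rfl⟩
  exact ⟨⟨i, Nat.lt_succ_of_le (hL k hk i hi)⟩, hi, rfl⟩

theorem goodRanks_of_notMem_immersedStrata {n : ℕ} (hn : 2 ≤ n) (hF : finrank ℝ F = n + 1)
    {y : ℕ → F} (h1 : y 1 ≠ 0)
    (h : ∀ i, (fun k : Fin (n + 3 + 1) => y k) ∉ immersedStrata F n i) {d : ℕ → ℕ}
    (hd : ∀ r, d r = 1 + affRank y r) : GoodRanks n d := by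
  refine goodRanks_of_immersed hn hF h1 (fun j h2 hjn hmem => ?_) (fun hmem => ?_)
    (fun hmem => ?_) (fun hmem => ?_) hd
  · refine h (Sum.inl ⟨j, by omega⟩) ?_
    rw [immersedStrata, Sum.elim_inl, if_pos h2]
    refine mem_depStratum_of_forall (fun k _ i hi => ?_) fun k hk => ?_
    · rw [Finset.mem_Ico] at hi
      simp only at hi
      omega
    · rw [Finset.mem_singleton] at hk
      subst hk
      simpa using hmem
  · refine h (Sum.inr (Sum.inl ())) ?_
    rw [immersedStrata, Sum.elim_inr, Sum.elim_inl]
    refine (mem_depStratum_of_forall (fun k _ i hi => ?_) fun k hk => ?_)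
    · rw [Finset.mem_Icc] at hi
      omega
    · have := hmem k (by simpa using hk)
      simpa using this
  · refine h (Sum.inr (Sum.inr (Sum.inl ()))) ?_
    rw [immersedStrata, Sum.elim_inr, Sum.elim_inr, Sum.elim_inl]
    refine (mem_depStratum_of_forall (fun k _ i hi => ?_) fun k hk => ?_)
    · rw [Finset.mem_Icc] at hi
      omega
    · simp only [Finset.mem_insert, Finset.mem_singleton] at hk
      rcases hk with rfl | rfl
      · simpa using hmem.1
      · simpa using hmem.2
  · refine h (Sum.inr (Sum.inr (Sum.inr ()))) ?_
    rw [immersedStrata, Sum.elim_inr, Sum.elim_inr, Sum.elim_inr]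
    refine (mem_depStratum_of_forall (fun k _ i hi => ?_) fun k hk => ?_)
    · split_ifs at hi
      · rw [Finset.mem_Icc] at hi
        omega
      · rw [Finset.mem_insert, Finset.mem_Icc] at hi
        omega
    · simp only [Finset.mem_insert, Finset.mem_singleton] at hk
      rcases hk with rfl | rfl
      · rw [if_pos rfl]
        simpa using hmem.1
      · rw [if_neg (by omega)]
        simpa using hmem.2

end ImmersedStrata

/-! ### Boxes in a chart and admissible changes on them. -/

section Box

variable {n : ℕ} {H : Type*} [TopologicalSpace H] {IM : ModelWithCorners ℝ ℝ H}
  {I : Type*} [TopologicalSpace I] [ChartedSpace H I]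
  {J : Type*} [TopologicalSpace J] [ChartedSpace ℝ J]

variable (IM) in
/-- A box in the product chart at `q₀`, relatively open in the chart domain. -/
structure IsBox (q₀ : I × J) (A L : Set ℝ) : Prop where
  exists_open : ∃ U, IsOpen U ∧ A = tdom IM q₀ ∩ U
  isOpen_right : IsOpen L
  right_subset : L ⊆ ldom q₀
  convex_left : Convex ℝ A
  convex_right : Convex ℝ L

namespace IsBox

variable {q₀ : I × J} {A L : Set ℝ}

theorem left_subset (hB : IsBox IM q₀ A L) : A ⊆ tdom IM q₀ := by
  obtain ⟨U, -, rfl⟩ := hB.exists_open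
  exact inter_subset_left

theorem subset_target (hB : IsBox IM q₀ A L) : A ×ˢ L ⊆ (chart IM q₀).target := by
  rw [chart_target]
  exact prod_mono hB.left_subset hB.right_subset

theorem uniqueDiffOn_left (hB : IsBox IM q₀ A L) : UniqueDiffOn ℝ A := by
  obtain ⟨U, hU, rfl⟩ := hB.exists_open
  exact (uniqueDiffOn_tdom q₀).inter hU

theorem uniqueDiffOn (hB : IsBox IM q₀ A L) : UniqueDiffOn ℝ (A ×ˢ L) :=
  hB.uniqueDiffOn_left.prod hB.isOpen_right.uniqueDiffOn

theorem left_eventuallyEq (hB : IsBox IM q₀ A L) {t : ℝ} (ht : t ∈ A) : A =ᶠ[𝓝 t] tdom IM q₀ := by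
  obtain ⟨U, hU, rfl⟩ := hB.exists_open
  filter_upwards [hU.mem_nhds ht.2] with s hs
  exact propext ⟨fun h => h.1, fun h => ⟨h, hs⟩⟩

theorem eventuallyEq (hB : IsBox IM q₀ A L) {y : ℝ × ℝ} (hy : y ∈ A ×ˢ L) :
    A ×ˢ L =ᶠ[𝓝 y] (chart IM q₀).target := by
  rw [chart_target, show y = (y.1, y.2) from rfl, nhds_prod_eq]
  have h2 : L =ᶠ[𝓝 y.2] ldom q₀ := by
    filter_upwards [hB.isOpen_right.mem_nhds hy.2] with s hs
    exact propext ⟨fun h => hB.right_subset h, fun _ => hs⟩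
  filter_upwards [(hB.left_eventuallyEq hy.1).prod_mk h2] with z hz
  exact propext (and_congr hz.1.to_iff hz.2.to_iff)

end IsBox

/-- The part of the model interval at distance less than `ρ` from `t₀`. -/
abbrev tball (IM : ModelWithCorners ℝ ℝ H) (t₀ ρ : ℝ) : Set ℝ := range IM ∩ Metric.ball t₀ ρ

/-- The part of the model interval at distance at most `ρ` from `t₀`. -/
abbrev tcball (IM : ModelWithCorners ℝ ℝ H) (t₀ ρ : ℝ) : Set ℝ :=
  range IM ∩ Metric.closedBall t₀ ρ

theorem isCompact_tcball (t₀ ρ : ℝ) : IsCompact (tcball IM t₀ ρ) :=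
  (isCompact_closedBall t₀ ρ).inter_left IM.isClosed_range

theorem convex_tball (t₀ ρ : ℝ) : Convex ℝ (tball IM t₀ ρ) :=
  IM.convex_range.inter (convex_ball _ _)

theorem convex_tcball (t₀ ρ : ℝ) : Convex ℝ (tcball IM t₀ ρ) :=
  IM.convex_range.inter (convex_closedBall _ _)

/-- All small boxes around a point are boxes in the chart, and lie in a given neighborhood. -/
theorem exists_isBox (q₀ : I × J) {S : Set (I × J)} (hS : S ∈ 𝓝 q₀) :
    ∃ ρ₀ > 0, ∀ ρ, 0 < ρ → ρ ≤ ρ₀ →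
      IsBox IM q₀ (tball IM (chart IM q₀ q₀).1 ρ) (Metric.ball (chart IM q₀ q₀).2 ρ) ∧
      ∀ y ∈ tball IM (chart IM q₀ q₀).1 ρ ×ˢ Metric.ball (chart IM q₀ q₀).2 ρ,
        (chart IM q₀).symm y ∈ S := by
  have h1 : tdom IM q₀ =ᶠ[𝓝 (chart IM q₀ q₀).1] range IM := by
    rw [chart_apply]
    exact extChartAt_target_eventuallyEq
  have h2 : ldom q₀ ∈ 𝓝 (chart IM q₀ q₀).2 := by
    rw [chart_apply]
    exact (isOpen_ldom q₀).mem_nhds (mem_extChartAt_target q₀.2)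
  have h3 : ∀ᶠ y in 𝓝[(chart IM q₀).target] (chart IM q₀ q₀), (chart IM q₀).symm y ∈ S := by
    have hc := (continuousOn_extChartAt_symm (I := IM.prod 𝓘(ℝ, ℝ)) q₀) _ (mem_extChartAt_target q₀)
    have hS' : S ∈ 𝓝 ((chart IM q₀).symm (chart IM q₀ q₀)) := by
      rw [extChartAt_to_inv q₀]
      exact hS
    exact hc hS'
  obtain ⟨ρ₁, hρ₁, hb₁⟩ := Metric.eventually_nhds_iff_ball.1 h1
  obtain ⟨ρ₂, hρ₂, hb₂⟩ := Metric.mem_nhds_iff.1 h2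
  obtain ⟨ρ₃, hρ₃, hb₃⟩ := Metric.mem_nhdsWithin_iff.1 h3
  refine ⟨min ρ₁ (min ρ₂ ρ₃), lt_min hρ₁ (lt_min hρ₂ hρ₃), fun ρ hρ hρle => ?_⟩
  have hle₁ : ρ ≤ ρ₁ := hρle.trans (min_le_left _ _)
  have hle₂ : ρ ≤ ρ₂ := hρle.trans ((min_le_right _ _).trans (min_le_left _ _))
  have hle₃ : ρ ≤ ρ₃ := hρle.trans ((min_le_right _ _).trans (min_le_right _ _))
  have hA : tball IM (chart IM q₀ q₀).1 ρ = tdom IM q₀ ∩ Metric.ball (chart IM q₀ q₀).1 ρ := by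
    ext t
    refine and_congr_left fun ht => ?_
    exact (hb₁ t (Metric.ball_subset_ball hle₁ ht)).to_iff.symm
  have hBx : IsBox IM q₀ (tball IM (chart IM q₀ q₀).1 ρ) (Metric.ball (chart IM q₀ q₀).2 ρ) :=
    ⟨⟨_, Metric.isOpen_ball, hA⟩, Metric.isOpen_ball, (Metric.ball_subset_ball hle₂).trans hb₂,
      convex_tball _ _, convex_ball _ _⟩
  refine ⟨hBx, fun y hy => hb₃ ⟨?_, hBx.subset_target hy⟩⟩
  rw [Metric.mem_ball, Prod.dist_eq]
  exact (max_lt hy.1.2 hy.2).trans_le hle₃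

theorem box_mem_nhds (q₀ : I × J) {ρ : ℝ} (hρ : 0 < ρ) :
    {q | q ∈ (chart IM q₀).source ∧ chart IM q₀ q ∈
      tball IM (chart IM q₀ q₀).1 ρ ×ˢ Metric.ball (chart IM q₀ q₀).2 ρ} ∈ 𝓝 q₀ := by
  have h1 : (chart IM q₀).source ∈ 𝓝 q₀ :=
    (isOpen_chart_source q₀).mem_nhds (mem_extChartAt_source q₀)
  have h2 := (continuousAt_extChartAt (I := IM.prod 𝓘(ℝ, ℝ)) q₀) (Metric.ball_mem_nhds _ hρ)
  filter_upwards [h1, h2] with q hq hq2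
  rw [mem_preimage, Metric.mem_ball, Prod.dist_eq, max_lt_iff] at hq2
  refine ⟨hq, ⟨?_, ?_⟩, ?_⟩
  · have h3 := (chart IM q₀).map_source hq
    rw [chart_target] at h3
    exact extChartAt_target_subset_range q₀.1 h3.1
  · exact hq2.1
  · exact hq2.2

variable [IsManifold IM ∞ I] [IsManifold 𝓘(ℝ, ℝ) ∞ J]

/-- The coordinates of the frame are defined on the box. -/
def IntegralFamily.ValidOn (Γ : IntegralFamily n IM I J) (q₀ : I × J) (fr : ContactFrame n)
    (A L : Set ℝ) : Prop := ∀ y ∈ A ×ˢ L, Γ.loc q₀ y ∈ fr.Valid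

theorem jetOpen_valid (fr : ContactFrame n) :
    JetOpen 0 fun (Γ : IntegralFamily n IM I J) q => (Γ.toFun q).embed ∈ fr.Valid := by
  intro Γ q hq
  obtain ⟨ε, hε, hb⟩ := Metric.mem_nhds_iff.1 (fr.isOpen_Valid.mem_nhds hq)
  have hN := Γ.smooth.continuous.continuousAt (x := q) (Metric.ball_mem_nhds _ (half_pos hε))
  refine ⟨_, inter_mem hN ((isOpen_chart_source (IM := IM) q).mem_nhds (mem_extChartAt_source q)),
    ε / 2, half_pos hε, fun Γ' q' hq' hd => hb ?_⟩
  have h1 := hd 0 le_rfl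
  rw [norm_iteratedFDerivWithin_zero] at h1
  simp only [IntegralFamily.loc] at h1
  rw [(chart IM q).left_inv hq'.2] at h1
  have h2 : ‖(Γ.toFun q').embed - (Γ.toFun q).embed‖ < ε / 2 := by
    have := hq'.1
    rwa [mem_preimage, mem_ball_iff_norm] at this
  rw [mem_ball_iff_norm]
  calc ‖(Γ'.toFun q').embed - (Γ.toFun q).embed‖
      ≤ ‖(Γ'.toFun q').embed - (Γ.toFun q').embed‖ + ‖(Γ.toFun q').embed - (Γ.toFun q).embed‖ :=
        norm_sub_le_norm_sub_add_norm_sub _ _ _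
    _ < ε := by linarith

variable {Γ : IntegralFamily n IM I J} {q₀ : I × J} {fr : ContactFrame n} {A L : Set ℝ}

theorem IntegralFamily.ValidOn.contDiffOn_X (hv : Γ.ValidOn q₀ fr A L) (hB : IsBox IM q₀ A L) :
    ContDiffOn ℝ ∞ (Γ.X q₀ fr) (A ×ˢ L) := fun y hy =>
  (IntegralFamily.contDiffWithinAt_X (hB.subset_target hy) (hv y hy)).mono
    (prod_mono hB.left_subset hB.right_subset)

theorem IntegralFamily.ValidOn.contDiffOn_P (hv : Γ.ValidOn q₀ fr A L) (hB : IsBox IM q₀ A L) :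
    ContDiffOn ℝ ∞ (Γ.P q₀ fr) (A ×ˢ L) := fun y hy =>
  (IntegralFamily.contDiffWithinAt_P (hB.subset_target hy) (hv y hy)).mono
    (prod_mono hB.left_subset hB.right_subset)

theorem IntegralFamily.ValidOn.contDiffOn_Z (hv : Γ.ValidOn q₀ fr A L) (hB : IsBox IM q₀ A L) :
    ContDiffOn ℝ ∞ (Γ.Z q₀ fr) (A ×ˢ L) := fun y hy =>
  (IntegralFamily.contDiffWithinAt_Z (hB.subset_target hy) (hv y hy)).mono
    (prod_mono hB.left_subset hB.right_subset)

theorem IntegralFamily.ValidOn.tderiv_Z (hv : Γ.ValidOn q₀ fr A L) (hB : IsBox IM q₀ A L)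
    {y : ℝ × ℝ} (hy : y ∈ A ×ˢ L) :
    tderiv A (Γ.Z q₀ fr) y = inner ℝ (Γ.P q₀ fr y) (tderiv A (Γ.X q₀ fr) y) := by
  rw [tderiv_congr_set (hB.left_eventuallyEq hy.1), tderiv_congr_set (hB.left_eventuallyEq hy.1)]
  exact IntegralFamily.tderiv_Z (hB.subset_target hy) (hv y hy)

/-- The family `Γ'` arises from `Γ` by the change `h` of the coordinates, supported in `C`. -/
def IntegralFamily.IsChange (Γ Γ' : IntegralFamily n IM I J) (q₀ : I × J) (fr : ContactFrame n)
    (A L : Set ℝ) (C : Set (ℝ × ℝ)) (h : ℝ × ℝ → fr.Par) : Prop :=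
  (∀ q ∉ (chart IM q₀).symm '' C, Γ'.toFun q = Γ.toFun q) ∧ Γ'.ValidOn q₀ fr A L ∧
    ∀ y ∈ A ×ˢ L, Γ'.X q₀ fr y = Γ.X q₀ fr y + (h y).1 ∧
      Γ'.P q₀ fr y = Γ.P q₀ fr y + (h y).2.1 ∧ Γ'.Z q₀ fr y = Γ.Z q₀ fr y + (h y).2.2

/-- The changes of the coordinates on `A × L` that keep the family integral. -/
def IntegralFamily.Admissible (Γ : IntegralFamily n IM I J) (q₀ : I × J) (fr : ContactFrame n)
    (A L : Set ℝ) (h : ℝ × ℝ → fr.Par) : Prop :=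
  ∀ y ∈ A ×ˢ L, tderiv A (fun y => Γ.Z q₀ fr y + (h y).2.2) y =
    inner ℝ (Γ.P q₀ fr y + (h y).2.1) (tderiv A (fun y => Γ.X q₀ fr y + (h y).1) y)

variable [T2Space I] [T2Space J]

/-- A change supported in the compact set `C` extends by zero from the box to the whole chart,
without losing smoothness since the box is relatively open. -/
theorem IntegralFamily.ValidOn.exists_isChange (hv : Γ.ValidOn q₀ fr A L) (hB : IsBox IM q₀ A L)
    {C : Set (ℝ × ℝ)} (hC : IsCompact C) (hCB : C ⊆ A ×ˢ L)
    {𝒰 : Set (IntegralFamily n IM I J)} (h𝒰 : 𝒰 ∈ 𝓝 Γ) :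
    ∃ r : ℕ, ∃ δ > 0, ∀ h : ℝ × ℝ → fr.Par, ContDiffOn ℝ ∞ h (A ×ˢ L) →
      (∀ y ∈ A ×ˢ L, y ∉ C → h y = 0) → Γ.Admissible q₀ fr A L h →
      (∀ k ≤ r, ∀ y ∈ C, ‖iteratedFDerivWithin ℝ k h (A ×ˢ L) y‖ < δ) →
      ∃ Γ' ∈ 𝒰, Γ.IsChange Γ' q₀ fr A L C h := by
  classical
  obtain ⟨r, δ, hδ, hmod⟩ := Γ.exists_modification_coords q₀ fr hC (hCB.trans hB.subset_target)
    (fun y hy => hv y (hCB hy)) h𝒰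
  refine ⟨r, δ, hδ, fun h hh h0 hrel hs => ?_⟩
  let h' : ℝ × ℝ → fr.Par := (A ×ˢ L).indicator h
  have hh' : EqOn h' h (A ×ˢ L) := fun y hy => indicator_of_mem hy _
  have hmem : ∀ y ∈ A ×ˢ L, A ×ˢ L ∈ 𝓝[(chart IM q₀).target] y := fun y hy => by
    rw [← nhdsWithin_eq_iff_eventuallyEq.2 (hB.eventuallyEq hy)]
    exact self_mem_nhdsWithin
  have hsm : ContDiffOn ℝ ∞ h' (chart IM q₀).target := by
    refine contDiffOn_of_eq_zero_off (C := C) (D := A ×ˢ L) hC.isClosed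
      (fun y _ hyC => hmem y (hCB hyC)) ?_ fun y _ hyC => ?_
    · rw [inter_eq_right.2 hB.subset_target]
      exact hh.congr hh'
    · by_cases hy : y ∈ A ×ˢ L
      · rw [hh' hy, h0 y hy hyC]
      · exact indicator_of_notMem hy _
  have hslice : ∀ {V : Type} [NormedAddCommGroup V] [NormedSpace ℝ V] (f g : ℝ × ℝ → V),
      EqOn f g (A ×ˢ L) → ∀ y ∈ A ×ˢ L, tderiv (tdom IM q₀) f y = tderiv A g y := by
    intro V _ _ f g hfg y hy
    rw [← tderiv_congr_set (hB.left_eventuallyEq hy.1)]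
    exact derivWithin_congr (fun τ hτ => hfg ⟨hτ, hy.2⟩) (hfg hy)
  obtain ⟨Γ', hΓ', hoff, hc⟩ := hmod h' hsm (fun y _ hyC => by
    by_cases hy : y ∈ A ×ˢ L
    · rw [hh' hy, h0 y hy hyC]
    · exact indicator_of_notMem hy _) (fun y hyC => by
    have hy := hCB hyC
    rw [hslice _ (fun y => Γ.Z q₀ fr y + (h y).2.2) (fun z hz => by simp only [hh' hz]) y hy,
      hslice _ (fun y => Γ.X q₀ fr y + (h y).1) (fun z hz => by simp only [hh' hz]) y hy, hh' hy]
    exact hrel y hy) (fun k hk y hyC => by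
    have hy := hCB hyC
    rw [← iteratedFDerivWithin_congr_set (hB.eventuallyEq hy), iteratedFDerivWithin_congr hh' hy]
    exact hs k hk y hyC)
  refine ⟨Γ', hΓ', hoff, fun y hy => (hc y (hB.subset_target hy) (hv y hy)).1, fun y hy => ?_⟩
  have := (hc y (hB.subset_target hy) (hv y hy)).2
  rwa [hh' hy] at this

/-- A smooth family of admissible changes that is zero at `s₀` is small in every order for `s` near
`s₀`. Perturbations with finitely many parameters are realized in this form. -/
theorem IntegralFamily.ValidOn.eventually_isChange (hv : Γ.ValidOn q₀ fr A L)
    (hB : IsBox IM q₀ A L) {C : Set (ℝ × ℝ)} (hC : IsCompact C) (hCB : C ⊆ A ×ˢ L)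
    {𝒰 : Set (IntegralFamily n IM I J)} (h𝒰 : 𝒰 ∈ 𝓝 Γ)
    {S : Type*} [NormedAddCommGroup S] [NormedSpace ℝ S] {O : Set S} (hO : IsOpen O) {s₀ : S}
    (hs₀ : s₀ ∈ O) {h : (ℝ × ℝ) × S → fr.Par} (hh : ContDiffOn ℝ ∞ h ((A ×ˢ L) ×ˢ O))
    (hh0 : ∀ y ∈ A ×ˢ L, h (y, s₀) = 0) (hoff : ∀ s ∈ O, ∀ y ∈ A ×ˢ L, y ∉ C → h (y, s) = 0)
    (hrel : ∀ s ∈ O, Γ.Admissible q₀ fr A L fun y => h (y, s)) :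
    ∀ᶠ s in 𝓝 s₀, ∃ Γ' ∈ 𝒰, Γ.IsChange Γ' q₀ fr A L C fun y => h (y, s) := by
  obtain ⟨r, δ, hδ, hch⟩ := hv.exists_isChange hB hC hCB h𝒰
  filter_upwards [hO.mem_nhds hs₀,
    eventually_iteratedFDerivWithin_lt hB.uniqueDiffOn hO hs₀ hh hC hCB r hδ] with s hs hlt
  refine hch _ (hh.comp (contDiffOn_id.prodMk contDiffOn_const) fun y hy => ⟨hy, hs⟩) (hoff s hs)
    (hrel s hs) fun k hk y hy => ?_
  have := hlt k hk y hy
  rwa [iteratedFDerivWithin_congr (f := fun z => h (z, s)) (fun z hz => by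
    simp only [hh0 z hz, sub_zero]) (hCB hy)] at this

end Box

/-! ### Ranks in terms of the coordinates. -/

section Bridge

theorem iteratedDerivWithin_const_add_clm {V V' : Type*} [NormedAddCommGroup V] [NormedSpace ℝ V]
    [NormedAddCommGroup V'] [NormedSpace ℝ V'] {A : Set ℝ} (hA : UniqueDiffOn ℝ A) (c : V')
    (κ : V →L[ℝ] V') {f : ℝ → V} {t : ℝ} (hf : ContDiffWithinAt ℝ ∞ f A t) (ht : t ∈ A) {k : ℕ}
    (hk : 1 ≤ k) :
    iteratedDerivWithin k (fun τ => c + κ (f τ)) A t = κ (iteratedDerivWithin k f A t) := by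
  rw [iteratedDerivWithin_const_add (by omega), iteratedDerivWithin_eq_iteratedFDerivWithin,
    iteratedDerivWithin_eq_iteratedFDerivWithin]
  have := κ.iteratedFDerivWithin_comp_left hf hA ht (i := k) (by exact_mod_cast le_top)
  rw [show (fun τ => κ (f τ)) = κ ∘ f from rfl, this]
  rfl

variable {n : ℕ} {H : Type*} [TopologicalSpace H] {IM : ModelWithCorners ℝ ℝ H}
  {I : Type*} [TopologicalSpace I] [ChartedSpace H I]
  {J : Type*} [TopologicalSpace J] [ChartedSpace ℝ J]
  [IsManifold IM ∞ I] [IsManifold 𝓘(ℝ, ℝ) ∞ J]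
  {Γ : IntegralFamily n IM I J} {q₀ : I × J} {fr : ContactFrame n} {A L : Set ℝ}

theorem ContactFrame.finrank_W_prod (fr : ContactFrame n) : finrank ℝ (fr.W × ℝ) = n + 1 := by
  rw [finrank_prod, fr.finrank_W, finrank_self]

/-- The affine part of the normalized lift of the line. -/
def ContactFrame.affineLift (fr : ContactFrame n) : (fr.W × ℝ) →L[ℝ] AmbientSpace n :=
  fr.W.subtypeL.comp (ContinuousLinearMap.fst ℝ fr.W ℝ) +
    (ContinuousLinearMap.snd ℝ fr.W ℝ).smulRight fr.f

theorem ContactFrame.affineLift_apply (fr : ContactFrame n) (w : fr.W × ℝ) :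
    fr.affineLift w = (w.1 : AmbientSpace n) + w.2 • fr.f := rfl

theorem ContactFrame.inner_e_affineLift (fr : ContactFrame n) (w : fr.W × ℝ) :
    inner ℝ fr.e (fr.affineLift w) = 0 := by
  rw [fr.affineLift_apply, inner_add_right, fr.inner_e_W, real_inner_smul_right, fr.inner_ef]
  simp

theorem ContactFrame.affineLift_injective (fr : ContactFrame n) :
    Function.Injective fr.affineLift := by
  rw [injective_iff_map_eq_zero]
  intro w hw
  have h1 : inner ℝ fr.f (fr.affineLift w) = 0 := by rw [hw, inner_zero_right]
  rw [fr.affineLift_apply, inner_add_right, fr.inner_f_W, real_inner_smul_right, fr.inner_f,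
    zero_add, mul_one] at h1
  rw [fr.affineLift_apply, h1, zero_smul, add_zero] at hw
  exact Prod.ext (Subtype.ext hw) h1

variable (Γ q₀ fr) in
/-- The curve `(x, z)` of the affine coordinates of the lines. -/
def IntegralFamily.Y (y : ℝ × ℝ) : fr.W × ℝ := (Γ.X q₀ fr y, Γ.Z q₀ fr y)

/-- The normalized lift is `e` plus an injective linear image of `(x, z)`. Beyond order zero its
derivatives are those of `(x, z)`. -/
theorem IntegralFamily.ValidOn.lineRank_eq (hv : Γ.ValidOn q₀ fr A L) (hB : IsBox IM q₀ A L)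
    {y : ℝ × ℝ} (hy : y ∈ A ×ˢ L) (r : ℕ) :
    Γ.lineRank ((chart IM q₀).symm y) r =
      1 + affRank (fun k => iteratedDerivWithin k (fun τ => Γ.Y q₀ fr (τ, y.2)) A y.1) r := by
  have hyt := hB.subset_target hy
  have hyt' := hyt
  rw [chart_target] at hyt'
  set q := (chart IM q₀).symm y with hq
  have hq' := chart_symm_apply (IM := IM) q₀ y
  rw [← hq] at hq'
  have hq1 : q.1 = (extChartAt IM q₀.1).symm y.1 := by rw [hq']
  have hq2 : q.2 = (extChartAt 𝓘(ℝ, ℝ) q₀.2).symm y.2 := by rw [hq']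
  have hsrc : q.1 ∈ (extChartAt IM q₀.1).source := by
    rw [hq1]
    exact (extChartAt IM q₀.1).map_target hyt'.1
  let e : I → AmbientSpace n := fun s => fr.lineLift (Γ.toFun (s, q.2)).embed
  have hsm := Γ.contMDiff_slice q.2
  have hUo : IsOpen {s : I | (Γ.toFun (s, q.2)).embed ∈ fr.Valid} :=
    fr.isOpen_Valid.preimage hsm.continuous
  have hqU : (Γ.toFun (q.1, q.2)).embed ∈ fr.Valid := hv y hy
  rw [Γ.lineRank_eq hsrc (e := e) (hUo.mem_nhds hqU)
    (fun s hs => ((fr.contDiffOn_lineLift.contDiffAt (fr.isOpen_Valid.mem_nhds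
      hs)).contMDiffAt.comp s (hsm s)).contMDiffWithinAt)
    (fun s hs => ⟨ContactFrame.lineLift_ne_zero hs, ContactFrame.line_eq_span hs⟩)]
  have hY : ContDiffOn ℝ ∞ (Γ.Y q₀ fr) (A ×ˢ L) := (hv.contDiffOn_X hB).prodMk (hv.contDiffOn_Z hB)
  have hYs : ContDiffOn ℝ ∞ (fun τ => Γ.Y q₀ fr (τ, y.2)) A :=
    hY.comp (contDiffOn_id.prodMk contDiffOn_const) fun τ hτ => ⟨hτ, hy.2⟩
  have hcd : ∀ k, chartDeriv IM q₀.1 e q.1 k =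
      iteratedDerivWithin k (fun τ => fr.e + fr.affineLift (Γ.Y q₀ fr (τ, y.2))) A y.1 := by
    intro k
    rw [chartDeriv, hq1, (extChartAt IM q₀.1).right_inv hyt'.1]
    rw [iteratedDerivWithin_eq_iteratedFDerivWithin, iteratedDerivWithin_eq_iteratedFDerivWithin,
      ← iteratedFDerivWithin_congr_set (hB.left_eventuallyEq hy.1)]
    congr 1
    refine iteratedFDerivWithin_congr (fun τ hτ => ?_) hy.1 k
    have hval := hv (τ, y.2) ⟨hτ, hy.2⟩
    have h1 := ContactFrame.lineLift_eq hval
    have h2 : Γ.loc q₀ (τ, y.2) = (Γ.toFun ((extChartAt IM q₀.1).symm τ, q.2)).embed := by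
      rw [IntegralFamily.loc, chart_symm_apply, hq2]
    simp only [e, Function.comp]
    rw [← h2, h1, fr.affineLift_apply, add_assoc]
    rfl
  refine jetRank_eq_affRank (κ := (fr.affineLift : (fr.W × ℝ) →ₗ[ℝ] AmbientSpace n))
    fr.affineLift_injective (fun k hk => ?_) ?_ r
  · rw [hcd, iteratedDerivWithin_const_add_clm hB.uniqueDiffOn_left _ _ (hYs _ hy.1) hy.1 hk]
    rfl
  · rintro ⟨w, hw⟩
    have h1 : inner ℝ fr.e (chartDeriv IM q₀.1 e q.1 0) = 0 := by
      rw [← hw]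
      exact fr.inner_e_affineLift w
    rw [hcd, iteratedDerivWithin_zero, inner_add_right, fr.inner_e_affineLift, fr.inner_e] at h1
    norm_num at h1

theorem affRank_one {F : Type*} [NormedAddCommGroup F] [NormedSpace ℝ F] (y : ℕ → F) :
    1 ≤ affRank y 1 ↔ y 1 ≠ 0 := by
  rw [affRank, Icc_self, image_singleton]
  refine ⟨fun h h0 => ?_, fun h => (finrank_span_singleton h).ge⟩
  rw [h0, Submodule.span_zero_singleton, finrank_bot] at h
  omega

/-- Since `z' = ⟨p, x'⟩`, the vanishing of `x'` forces that of `z'`. -/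
theorem IntegralFamily.ValidOn.immersed_iff (hv : Γ.ValidOn q₀ fr A L) (hB : IsBox IM q₀ A L)
    {y : ℝ × ℝ} (hy : y ∈ A ×ˢ L) :
    2 ≤ Γ.lineRank ((chart IM q₀).symm y) 1 ↔ tderiv A (Γ.X q₀ fr) y ≠ 0 := by
  have h0 : ∀ a : ℕ, 2 ≤ 1 + a ↔ 1 ≤ a := fun a => by omega
  rw [hv.lineRank_eq hB hy, h0, affRank_one, iteratedDerivWithin_one]
  have hA := hB.uniqueDiffOn_left
  have h1 := (hasDerivWithinAt_tderiv hA (hv.contDiffOn_X hB) hy).prodMk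
    (hasDerivWithinAt_tderiv hA (hv.contDiffOn_Z hB) hy)
  have h2 : derivWithin (fun τ => Γ.Y q₀ fr (τ, y.2)) A y.1 =
      (tderiv A (Γ.X q₀ fr) y, tderiv A (Γ.Z q₀ fr) y) := h1.derivWithin (hA _ hy.1)
  rw [h2, hv.tderiv_Z hB hy]
  refine not_congr ⟨fun h => (Prod.ext_iff.1 h).1, fun h => ?_⟩
  rw [h, inner_zero_right]
  rfl

end Bridge

/-! ### Higher derivatives in time. -/

section TJet

variable {Q : Type*} [NormedAddCommGroup Q] [NormedSpace ℝ Q]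
  {W : Type*} [NormedAddCommGroup W] [NormedSpace ℝ W] {A : Set ℝ} {U : Set Q} {F G : ℝ × Q → W}

/-- The `k`-th derivative with respect to the first variable, along `A`. -/
def tjet (A : Set ℝ) (F : ℝ × Q → W) (k : ℕ) (y : ℝ × Q) : W :=
  iteratedDerivWithin k (fun τ => F (τ, y.2)) A y.1

theorem tjet_zero (y : ℝ × Q) : tjet A F 0 y = F y := by
  rw [tjet, iteratedDerivWithin_zero]

theorem tjet_succ (k : ℕ) (y : ℝ × Q) : tjet A F (k + 1) y = tderiv A (tjet A F k) y := by
  rw [tjet, iteratedDerivWithin_succ]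
  rfl

theorem tjet_one (y : ℝ × Q) : tjet A F 1 y = tderiv A F y := by
  rw [tjet, iteratedDerivWithin_one]
  rfl

theorem ContDiffOn.tjet (hA : UniqueDiffOn ℝ A) (hU : IsOpen U)
    (hF : ContDiffOn ℝ ∞ F (A ×ˢ U)) (k : ℕ) : ContDiffOn ℝ ∞ (tjet A F k) (A ×ˢ U) := by
  induction k with
  | zero => exact hF.congr fun y _ => tjet_zero y
  | succ k ih => exact (ih.tderiv hA hU).congr fun y _ => tjet_succ k y

theorem contDiffOn_slice (hF : ContDiffOn ℝ ∞ F (A ×ˢ U)) {l : Q} (hl : l ∈ U) :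
    ContDiffOn ℝ ∞ (fun τ => F (τ, l)) A :=
  hF.comp (contDiffOn_id.prodMk contDiffOn_const) fun _ hτ => ⟨hτ, hl⟩

theorem tjet_add (hA : UniqueDiffOn ℝ A) (hF : ContDiffOn ℝ ∞ F (A ×ˢ U))
    (hG : ContDiffOn ℝ ∞ G (A ×ˢ U)) (k : ℕ) {y : ℝ × Q} (hy : y ∈ A ×ˢ U) :
    tjet A (fun y => F y + G y) k y = tjet A F k y + tjet A G k y :=
  iteratedDerivWithin_fun_add hy.1 hA ((contDiffOn_slice hF hy.2 y.1 hy.1).of_le (by exact_mod_cast le_top))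
    ((contDiffOn_slice hG hy.2 y.1 hy.1).of_le (by exact_mod_cast le_top))

theorem tjet_congr_of_eventuallyEq {y : ℝ × Q} (hy : y.1 ∈ A)
    (h : ∀ᶠ τ in 𝓝[A] y.1, F (τ, y.2) = G (τ, y.2)) (k : ℕ) : tjet A F k y = tjet A G k y := by
  rw [tjet, tjet, iteratedDerivWithin_eq_iteratedFDerivWithin,
    iteratedDerivWithin_eq_iteratedFDerivWithin]
  have := Filter.EventuallyEq.iteratedFDerivWithin_eq (𝕜 := ℝ) (f₁ := fun τ => F (τ, y.2))
    (f := fun τ => G (τ, y.2)) h (h.self_of_nhdsWithin hy) k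
  rw [this]

theorem tderiv_eq_zero_of_eventually {y : ℝ × Q} (hy : y.1 ∈ A)
    (h : ∀ᶠ τ in 𝓝[A] y.1, F (τ, y.2) = 0) : tderiv A F y = 0 := by
  have := tjet_congr_of_eventuallyEq (G := fun _ => (0 : W)) hy h 1
  rw [tjet_one, tjet_one] at this
  rw [this]
  simp [tderiv]

theorem tderiv_add (hA : UniqueDiffOn ℝ A) (hF : ContDiffOn ℝ ∞ F (A ×ˢ U))
    (hG : ContDiffOn ℝ ∞ G (A ×ˢ U)) {y : ℝ × Q} (hy : y ∈ A ×ˢ U) :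
    tderiv A (fun y => F y + G y) y = tderiv A F y + tderiv A G y := by
  simpa only [tjet_one] using tjet_add hA hF hG 1 hy

theorem tderiv_clm {W' : Type*} [NormedAddCommGroup W'] [NormedSpace ℝ W'] (hA : UniqueDiffOn ℝ A)
    (κ : W →L[ℝ] W') (hF : ContDiffOn ℝ ∞ F (A ×ˢ U)) {y : ℝ × Q} (hy : y ∈ A ×ˢ U) :
    tderiv A (fun y => κ (F y)) y = κ (tderiv A F y) :=
  (κ.hasFDerivAt.comp_hasDerivWithinAt y.1 (hasDerivWithinAt_tderiv hA hF hy)).derivWithin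
    (hA _ hy.1)

theorem exists_isOpen_forall_mem {Y S V : Type*} [TopologicalSpace Y] [TopologicalSpace S]
    [TopologicalSpace V] {C : Set Y} (hC : IsCompact C) {g : Y × S → V}
    (hg : ContinuousOn g (C ×ˢ univ)) {s₀ : S} {N : Set V} (hN : IsOpen N)
    (h : ∀ y ∈ C, g (y, s₀) ∈ N) :
    ∃ O, IsOpen O ∧ s₀ ∈ O ∧ ∀ s ∈ O, ∀ y ∈ C, g (y, s) ∈ N := by
  have : CompactSpace C := isCompact_iff_compactSpace.1 hC
  have hc : Continuous fun w : C × S => g (w.1, w.2) :=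
    hg.comp_continuous (by fun_prop) fun w => ⟨w.1.2, mem_univ _⟩
  obtain ⟨u, v, -, hv, hu, hsv, huv⟩ := generalized_tube_lemma (s := (univ : Set C)) isCompact_univ
    (t := {s₀}) isCompact_singleton (hN.preimage hc) (by
      rintro ⟨y, s⟩ ⟨-, rfl⟩
      exact h y y.2)
  exact ⟨v, hv, hsv rfl, fun s hs y hy => huv (show ((⟨y, hy⟩ : C), s) ∈ u ×ˢ v from ⟨hu trivial, hs⟩)⟩

end TJet

theorem exists_cutoff (t₀ : ℝ) {ρ ρ' : ℝ} (hρ : 0 < ρ) (hρ' : ρ < ρ') :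
    ∃ φ : ℝ → ℝ, ContDiff ℝ ∞ φ ∧ (∀ t ∈ Metric.closedBall t₀ ρ, φ t = 1) ∧
      (∀ t ∉ Metric.ball t₀ ρ', φ t = 0) ∧ ∀ t, 0 ≤ φ t ∧ φ t ≤ 1 := by
  let f : ContDiffBump t₀ := ⟨ρ, ρ', hρ, hρ'⟩
  exact ⟨f, f.contDiff, fun t ht => f.one_of_mem_closedBall ht, fun t ht => by
    rw [← f.support_eq] at ht
    simpa using ht, fun t => ⟨f.nonneg, f.le_one⟩⟩

/-! ### Perturbation of immersed families. -/

section ImmersedPerturbation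

variable {n : ℕ} {H : Type*} [TopologicalSpace H] {IM : ModelWithCorners ℝ ℝ H}
  {I : Type*} [TopologicalSpace I] [ChartedSpace H I]
  {J : Type*} [TopologicalSpace J] [ChartedSpace ℝ J]
  [IsManifold IM ∞ I] [IsManifold 𝓘(ℝ, ℝ) ∞ J] [T2Space I] [T2Space J]
  {Γ : IntegralFamily n IM I J} {q₀ : I × J} {fr : ContactFrame n}

/-- An immersed family becomes good on a box after an arbitrarily small change near the box. -/
theorem IntegralFamily.ValidOn.exists_goodRanks (hn : 2 ≤ n) {t₀ l₀ ρ ρ₁ ρ₂ : ℝ} (hρ : 0 < ρ)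
    (hρ₁ : ρ < ρ₁) (hρ₂ : ρ₁ < ρ₂) (hB : IsBox IM q₀ (tball IM t₀ ρ₂) (Metric.ball l₀ ρ₂))
    (hv : Γ.ValidOn q₀ fr (tball IM t₀ ρ₂) (Metric.ball l₀ ρ₂))
    (him : ∀ y ∈ tball IM t₀ ρ₂ ×ˢ Metric.ball l₀ ρ₂,
      tderiv (tball IM t₀ ρ₂) (Γ.X q₀ fr) y ≠ 0)
    {𝒰 : Set (IntegralFamily n IM I J)} (h𝒰 : 𝒰 ∈ 𝓝 Γ) :
    ∃ Γ' ∈ 𝒰, (∀ q ∉ (chart IM q₀).symm '' (tball IM t₀ ρ₂ ×ˢ Metric.ball l₀ ρ₂),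
        Γ'.toFun q = Γ.toFun q) ∧
      ∀ y ∈ tball IM t₀ ρ ×ˢ Metric.ball l₀ ρ,
        GoodRanks n (Γ'.lineRank ((chart IM q₀).symm y)) := by
  set A := tball IM t₀ ρ₂ with hAdef
  set L := Metric.ball l₀ ρ₂ with hLdef
  have hA := hB.uniqueDiffOn_left
  have hL := hB.isOpen_right
  let C : Set (ℝ × ℝ) := tcball IM t₀ ρ₁ ×ˢ Metric.closedBall l₀ ρ₁
  have hC : IsCompact C := (isCompact_tcball t₀ ρ₁).prod (isCompact_closedBall l₀ ρ₁)
  have hCB : C ⊆ A ×ˢ L := prod_mono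
    (inter_subset_inter_right _ (Metric.closedBall_subset_ball hρ₂))
    (Metric.closedBall_subset_ball hρ₂)
  obtain ⟨φ, hφ, hφ1, hφ0, -⟩ := exists_cutoff t₀ hρ hρ₁
  obtain ⟨χ, hχ, hχ1, hχ0, -⟩ := exists_cutoff l₀ hρ hρ₁
  let V := Fin (n + 3 + 1) → fr.W × ℝ
  -- the perturbation of `(x, z)`, as a function of `(t, (l, s))`
  let c : ℝ × (ℝ × V) → fr.W × ℝ := fun w =>
    (φ w.1 * χ w.2.1) • jetFlow (fr.W × ℝ) (n + 3) (w.1 - t₀) w.2.2 0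
  have hc : ContDiff ℝ ∞ c := by
    refine ContDiff.smul (f := fun w : ℝ × (ℝ × V) => φ w.1 * χ w.2.1)
      ((hφ.comp contDiff_fst).mul (hχ.comp contDiff_snd.fst)) ?_
    have h1 : ContDiff ℝ ∞ fun w : ℝ × (ℝ × V) =>
        jetFlow (fr.W × ℝ) (n + 3) (w.1 - t₀) w.2.2 :=
      ((contDiff_jetFlow (fr.W × ℝ) (n + 3)).comp (contDiff_fst.sub contDiff_const)).clm_apply
        contDiff_snd.snd
    exact contDiff_pi.1 h1 0
  have hc0 : ∀ t l, c (t, (l, 0)) = 0 := fun t l => by simp [c]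
  have hcoff : ∀ t ∈ A, ∀ l s, (t, l) ∉ C → c (t, (l, s)) = 0 := by
    intro t ht l s hC
    have : φ t * χ l = 0 := by
      by_cases h1 : t ∈ Metric.ball t₀ ρ₁
      · rw [hχ0 l, mul_zero]
        exact fun h2 => hC ⟨⟨ht.1, Metric.ball_subset_closedBall h1⟩, Metric.ball_subset_closedBall h2⟩
      · rw [hφ0 t h1, zero_mul]
    simp only [c, this, zero_smul]
  let U : Set (ℝ × V) := L ×ˢ univ
  have hU : IsOpen U := hL.prod isOpen_univ
  have hcs : ContDiffOn ℝ ∞ c (A ×ˢ U) := hc.contDiffOn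
  let c' : ℝ × (ℝ × V) → fr.W × ℝ := tderiv A c
  have hc' : ContDiffOn ℝ ∞ c' (A ×ˢ U) := hcs.tderiv hA hU
  have hcoff' : ∀ t ∈ A, ∀ l s, (t, l) ∉ C → c' (t, (l, s)) = 0 := by
    intro t ht l s hC'
    refine tderiv_eq_zero_of_eventually ht ?_
    have : ∀ᶠ τ in 𝓝 t, (τ, l) ∉ C := by
      have hcont : ContinuousAt (fun τ : ℝ => (τ, l)) t := by fun_prop
      exact hcont.eventually (hC.isClosed.isOpen_compl.mem_nhds hC')
    filter_upwards [mem_nhdsWithin_of_mem_nhds this, self_mem_nhdsWithin] with τ hτ hτA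
    exact hcoff τ hτA l s hτ
  have hc'0 : ∀ t ∈ A, ∀ l, c' (t, (l, 0)) = 0 := fun t ht l =>
    tderiv_eq_zero_of_eventually ht (Eventually.of_forall fun τ => hc0 τ l)
  have hX := hv.contDiffOn_X hB
  have hP := hv.contDiffOn_P hB
  have hZ := hv.contDiffOn_Z hB
  let X' := tderiv A (Γ.X q₀ fr)
  have hX' : ContDiffOn ℝ ∞ X' (A ×ˢ L) := hX.tderiv hA hL
  let re : (ℝ × ℝ) × V → ℝ × (ℝ × V) := fun w => (w.1.1, (w.1.2, w.2))
  have hre : ContDiff ℝ ∞ re := by fun_prop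
  have hrem : ∀ O : Set V, MapsTo re ((A ×ˢ L) ×ˢ O) (A ×ˢ U) := fun O w hw =>
    ⟨hw.1.1, hw.1.2, mem_univ _⟩
  let g : (ℝ × ℝ) × V → fr.W := fun w => X' w.1 + (c' (re w)).1
  have hg : ContDiffOn ℝ ∞ g ((A ×ˢ L) ×ˢ univ) :=
    (hX'.comp contDiffOn_fst fun w hw => hw.1).add (hc'.comp hre.contDiffOn (hrem univ)).fst
  obtain ⟨O, hO, h0O, hne⟩ := exists_isOpen_forall_mem hC (s₀ := (0 : V)) (N := {w : fr.W | w ≠ 0})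
    (hg.continuousOn.mono (prod_mono hCB Subset.rfl)) isOpen_ne (fun y hy => by
      have hy' := hCB hy
      simp only [g, re, hc'0 y.1 hy'.1 y.2, Prod.fst_zero, add_zero]
      exact him y hy')
  -- On the compact support the new velocity of `x` stays nonzero for small `s`; off the support it
  -- is the old one.
  have hgne : ∀ s ∈ O, ∀ y ∈ A ×ˢ L, g (y, s) ≠ 0 := by
    intro s hs y hy
    by_cases hyC : y ∈ C
    · exact hne s hs y hyC
    · simp only [g, re, hcoff' y.1 hy.1 y.2 s hyC, Prod.fst_zero, add_zero]
      exact him y hy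
  -- After `(x, z)` has been changed freely, `p` is corrected by the multiple `κ g` of the new
  -- velocity `g = x'` for which `z' = ⟨p, x'⟩` holds again. This is where immersedness is needed.
  let κ : (ℝ × ℝ) × V → ℝ := fun w =>
    ((c' (re w)).2 - inner ℝ (Γ.P q₀ fr w.1) (c' (re w)).1) / inner ℝ (g w) (g w)
  let h : (ℝ × ℝ) × V → fr.Par := fun w => ((c (re w)).1, κ w • g w, (c (re w)).2)
  have hh : ContDiffOn ℝ ∞ h ((A ×ˢ L) ×ˢ O) := by
    have hc1 := (hcs.comp hre.contDiffOn (hrem O))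
    have hc2 := (hc'.comp hre.contDiffOn (hrem O))
    have hg' := hg.mono (prod_mono Subset.rfl (subset_univ O))
    refine ContDiffOn.prodMk hc1.fst (ContDiffOn.prodMk ?_ hc1.snd)
    refine ContDiffOn.smul (ContDiffOn.div ?_ (hg'.inner ℝ hg') ?_) hg'
    · exact hc2.snd.sub ((hP.comp contDiffOn_fst fun w hw => hw.1).inner ℝ hc2.fst)
    · intro w hw
      exact inner_self_ne_zero.2 (hgne w.2 hw.2 w.1 hw.1)
  have hh0 : ∀ y ∈ A ×ˢ L, h (y, 0) = 0 := by
    intro y hy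
    simp only [h, κ, re, hc0, hc'0 y.1 hy.1 y.2]
    simp
  have hoff : ∀ s ∈ O, ∀ y ∈ A ×ˢ L, y ∉ C → h (y, s) = 0 := by
    intro s _ y hy hyC
    simp only [h, κ, re, hcoff y.1 hy.1 y.2 s hyC, hcoff' y.1 hy.1 y.2 s hyC]
    simp
  have hcsl : ∀ s, ContDiffOn ℝ ∞ (fun y : ℝ × ℝ => c (y.1, (y.2, s))) (A ×ˢ L) := fun s =>
    (hc.comp (by fun_prop : ContDiff ℝ ∞ fun y : ℝ × ℝ => (y.1, (y.2, s)))).contDiffOn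
  have hdc : ∀ s, ∀ y ∈ A ×ˢ L, tderiv A (fun y : ℝ × ℝ => (c (y.1, (y.2, s))).1) y =
      (c' (y.1, (y.2, s))).1 ∧ tderiv A (fun y : ℝ × ℝ => (c (y.1, (y.2, s))).2) y =
      (c' (y.1, (y.2, s))).2 := by
    intro s y hy
    have h1 : (y.1, (y.2, s)) ∈ A ×ˢ U := ⟨hy.1, hy.2, mem_univ _⟩
    exact ⟨tderiv_clm hA (ContinuousLinearMap.fst ℝ fr.W ℝ) hcs h1,
      tderiv_clm hA (ContinuousLinearMap.snd ℝ fr.W ℝ) hcs h1⟩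
  have hdX : ∀ s, ∀ y ∈ A ×ˢ L, tderiv A (fun y => Γ.X q₀ fr y + (h (y, s)).1) y = g (y, s) := by
    intro s y hy
    have h1 := tderiv_add hA hX (hcsl s).fst hy
    rw [(hdc s y hy).1] at h1
    exact h1
  have hrel : ∀ s ∈ O, Γ.Admissible q₀ fr A L fun y => h (y, s) := by
    intro s hs y hy
    have h1 := tderiv_add hA hZ (hcsl s).snd hy
    rw [(hdc s y hy).2, hv.tderiv_Z hB hy] at h1
    rw [hdX s y hy]
    refine h1.trans ?_
    have hgn : inner ℝ (g (y, s)) (g (y, s)) ≠ 0 := inner_self_ne_zero.2 (hgne s hs y hy)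
    have h2 : inner ℝ (κ (y, s) • g (y, s)) (g (y, s)) =
        (c' (y.1, (y.2, s))).2 - inner ℝ (Γ.P q₀ fr y) (c' (y.1, (y.2, s))).1 := by
      rw [real_inner_smul_left]
      exact div_mul_cancel₀ _ hgn
    have h3 : inner ℝ (Γ.P q₀ fr y + κ (y, s) • g (y, s)) (g (y, s)) =
        inner ℝ (Γ.P q₀ fr y) (X' y + (c' (y.1, (y.2, s))).1) +
          ((c' (y.1, (y.2, s))).2 - inner ℝ (Γ.P q₀ fr y) (c' (y.1, (y.2, s))).1) := by
      rw [inner_add_left, h2]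
    rw [h3, inner_add_right]
    ring
  have hev := hv.eventually_isChange hB hC hCB h𝒰 hO h0O hh hh0 hoff hrel
  have hY : ContDiffOn ℝ ∞ (Γ.Y q₀ fr) (A ×ˢ L) := hX.prodMk hZ
  let B : Set (ℝ × ℝ) := tball IM t₀ ρ ×ˢ Metric.ball l₀ ρ
  have hBA : B ⊆ A ×ˢ L := prod_mono
    (inter_subset_inter_right _ (Metric.ball_subset_ball (hρ₁.trans hρ₂).le))
    (Metric.ball_subset_ball (hρ₁.trans hρ₂).le)
  -- On the inner box the cutoffs equal 1, so the parameter `s` translates the jet of `(x, z)` by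
  -- the invertible flow. A small generic `s` avoids all strata and still gives an admissible change
  -- in `𝒰`.
  obtain ⟨s, ⟨hsO, Γ', hΓ', hoffΓ, hvΓ, hcoord⟩, hs⟩ := exists_forall_notMem_of_isThin
    (isThin_immersedStrata (F := fr.W × ℝ) hn fr.finrank_W_prod)
    (B := B) ((convex_tball t₀ ρ).prod (convex_ball l₀ ρ))
    (j := fun y k => tjet A (Γ.Y q₀ fr) k y)
    (contDiffOn_pi.2 fun k => ((hY.tjet hA hL k).mono hBA).of_le (by exact_mod_cast le_top))
    (A := fun y => jetFlow (fr.W × ℝ) (n + 3) (y.1 - t₀))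
    (A' := fun y => jetFlow (fr.W × ℝ) (n + 3) (-(y.1 - t₀)))
    (((contDiff_jetFlow (fr.W × ℝ) (n + 3)).comp
      (contDiff_fst.sub contDiff_const).neg).contDiffOn.of_le (by exact_mod_cast le_top))
    (fun y _ s => jetFlow_neg_jetFlow (fr.W × ℝ) (n + 3) (y.1 - t₀) s)
    (O := {s | s ∈ O ∧ ∃ Γ' ∈ 𝒰, Γ.IsChange Γ' q₀ fr A L C fun y => h (y, s)})
    (inter_mem (hO.mem_nhds h0O) hev)
  refine ⟨Γ', hΓ', fun q hq => hoffΓ q fun h => hq (image_mono hCB h), fun y hy => ?_⟩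
  have hyA := hBA hy
  have hjet : ∀ k : Fin (n + 3 + 1), tjet A (Γ'.Y q₀ fr) k y =
      tjet A (Γ.Y q₀ fr) k y + jetFlow (fr.W × ℝ) (n + 3) (y.1 - t₀) s k := by
    intro k
    have h1 : tjet A (Γ'.Y q₀ fr) k y = tjet A (fun y => Γ.Y q₀ fr y +
        jetFlow (fr.W × ℝ) (n + 3) (y.1 - t₀) s 0) k y := by
      refine tjet_congr_of_eventuallyEq hyA.1 ?_ k
      filter_upwards [self_mem_nhdsWithin,
        mem_nhdsWithin_of_mem_nhds (Metric.isOpen_ball.mem_nhds hy.1.2)] with τ hτ hτb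
      have h2 := hcoord (τ, y.2) ⟨hτ, hyA.2⟩
      have h3 : c (τ, (y.2, s)) = jetFlow (fr.W × ℝ) (n + 3) (τ - t₀) s 0 := by
        simp only [c]
        rw [hφ1 τ (Metric.ball_subset_closedBall hτb), hχ1 _ (Metric.ball_subset_closedBall hy.2),
          mul_one, one_smul]
      rw [← h3]
      exact Prod.ext h2.1 h2.2.2
    rw [h1, tjet_add hA hY (U := L) (G := fun y : ℝ × ℝ =>
      jetFlow (fr.W × ℝ) (n + 3) (y.1 - t₀) s 0) ?_ k hyA]
    · congr 1
      exact iteratedDerivWithin_jetFlow hA t₀ s k.2 hyA.1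
    · have h4 : ContDiff ℝ ∞ fun y : ℝ × ℝ => jetFlow (fr.W × ℝ) (n + 3) (y.1 - t₀) s :=
        ((contDiff_jetFlow (fr.W × ℝ) (n + 3)).comp (contDiff_fst.sub contDiff_const)).clm_apply
          contDiff_const
      exact (contDiff_pi.1 h4 0).contDiffOn
  refine goodRanks_of_notMem_immersedStrata hn fr.finrank_W_prod
    (y := fun k => tjet A (Γ'.Y q₀ fr) k y) ?_ (fun i hi => hs y hy i ?_)
    (fun r => hvΓ.lineRank_eq hB hyA r)
  · have h1 : 2 ≤ Γ'.lineRank ((chart IM q₀).symm y) 1 := by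
      rw [hvΓ.immersed_iff hB hyA]
      have h2 : tderiv A (Γ'.X q₀ fr) y = g (y, s) := by
        rw [← hdX s y hyA]
        exact derivWithin_congr (fun τ hτ => (hcoord (τ, y.2) ⟨hτ, hyA.2⟩).1) (hcoord y hyA).1
      rw [h2]
      exact hgne s hsO y hyA
    rw [hvΓ.lineRank_eq hB hyA] at h1
    have h2 : 2 ≤ 1 + affRank (fun k => tjet A (Γ'.Y q₀ fr) k y) 1 := h1
    exact (affRank_one fun k => tjet A (Γ'.Y q₀ fr) k y).1 (by omega)
  · have h1 : (fun k : Fin (n + 3 + 1) => tjet A (Γ'.Y q₀ fr) k y) =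
        (fun k : Fin (n + 3 + 1) => tjet A (Γ.Y q₀ fr) k y) +
          jetFlow (fr.W × ℝ) (n + 3) (y.1 - t₀) s := funext hjet
    rw [← h1]
    exact hi

variable [SecondCountableTopology I] [SecondCountableTopology J]

theorem locallyDense_of_immersed (hn : 2 ≤ n) (K : Set (I × J)) :
    LocallyDense (fun (Γ : IntegralFamily n IM I J) q => GoodRanks n (Γ.lineRank q))
      {Γ | ∀ q ∈ K, 2 ≤ Γ.lineRank q 1 ∨ GoodRanks n (Γ.lineRank q)} K := by
  intro Γ₀ hΓ₀ q hq S hS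
  rcases hΓ₀ q hq with h1 | h1
  · obtain ⟨fr, hfr⟩ := ContactFrame.exists_valid (Γ₀.toFun q)
    obtain ⟨𝒱₁, h𝒱₁, N₁, hN₁, hval⟩ := (jetOpen_valid fr).exists_nhds hfr
    have him : JetOpen 1 fun (Γ : IntegralFamily n IM I J) q => 2 ≤ Γ.lineRank q 1 :=
      jetOpen_lineRank (D := fun d => 2 ≤ d 1) (isOpen_le_jetRank 2 1)
        fun d d' h hd => (h 1 le_rfl) ▸ hd
    obtain ⟨𝒱₂, h𝒱₂, N₂, hN₂, himm⟩ := him.exists_nhds h1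
    obtain ⟨ρ₀, hρ₀, hbox⟩ := exists_isBox (IM := IM) q (inter_mem hS (inter_mem hN₁ hN₂))
    obtain ⟨hB, hsub⟩ := hbox ρ₀ hρ₀ le_rfl
    refine ⟨𝒱₁ ∩ 𝒱₂, inter_mem h𝒱₁ h𝒱₂, _, box_mem_nhds (IM := IM) q (ρ := ρ₀ / 3) (by linarith),
      fun Γ hΓ 𝒰 h𝒰 => ?_⟩
    have hv : Γ.ValidOn q fr (tball IM (chart IM q q).1 ρ₀) (Metric.ball (chart IM q q).2 ρ₀) :=
      fun y hy => hval Γ hΓ.1 _ (hsub y hy).2.1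
    obtain ⟨Γ', hΓ', hoff, hgood⟩ := hv.exists_goodRanks hn (ρ := ρ₀ / 3) (ρ₁ := ρ₀ / 2)
      (by linarith) (by linarith) (by linarith) hB
      (fun y hy => (hv.immersed_iff hB hy).1 (himm Γ hΓ.2 _ (hsub y hy).2.2)) h𝒰
    refine ⟨Γ', hΓ', fun q' hq' => hoff q' ?_, fun q' hq' => ?_⟩
    · rintro ⟨y, hy, rfl⟩
      exact hq' (hsub y hy).1
    · have := hgood _ hq'.2
      rwa [(chart IM q).left_inv hq'.1] at this
  · obtain ⟨𝒱, h𝒱, N, hN, h⟩ := (jetOpen_goodRanks hn).exists_nhds h1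
    exact ⟨𝒱, h𝒱, N, hN, fun Γ hΓ 𝒰 h𝒰 =>
      ⟨Γ, mem_of_mem_nhds h𝒰, fun _ _ => rfl, fun q' hq' => h Γ hΓ q' hq'⟩⟩

end ImmersedPerturbation

/-! ### Recovering the coordinate `z` by integration. -/

section Closing

theorem hasDerivWithinAt_integral_Icc {Q : Type*} [NormedAddCommGroup Q] [NormedSpace ℝ Q]
    {a b : ℝ} {U : Set Q} {F : ℝ × Q → ℝ}
    (hF : ContDiffOn ℝ ∞ F (Icc a b ×ˢ U)) {y : ℝ × Q} (hy : y ∈ Icc a b ×ˢ U) :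
    HasDerivWithinAt (fun t => ∫ τ in a..t, F (τ, y.2)) (F y) (Icc a b) y.1 := by
  have hc : ContinuousOn (fun τ => F (τ, y.2)) (Icc a b) :=
    (contDiffOn_slice hF hy.2).continuousOn
  have hc' : ContinuousOn (fun τ => F (τ, y.2)) (uIcc a y.1) :=
    hc.mono (by rw [uIcc_of_le hy.1.1]; exact Icc_subset_Icc_right hy.1.2)
  have : Fact (y.1 ∈ Icc a b) := ⟨hy.1⟩
  exact intervalIntegral.integral_hasDerivWithinAt_right hc'.intervalIntegrable
    (hc.stronglyMeasurableAtFilter_nhdsWithin measurableSet_Icc y.1) (hc y.1 hy.1)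

variable {n : ℕ} {H : Type*} [TopologicalSpace H] {IM : ModelWithCorners ℝ ℝ H}
  {I : Type*} [TopologicalSpace I] [ChartedSpace H I]
  {J : Type*} [TopologicalSpace J] [ChartedSpace ℝ J]
  [IsManifold IM ∞ I] [IsManifold 𝓘(ℝ, ℝ) ∞ J]
  {Γ : IntegralFamily n IM I J} {q₀ : I × J} {fr : ContactFrame n}

variable (Γ q₀ fr) in
/-- The derivative of the defect of the third coordinate under a change `(u, v)` of the first
two. -/
def IntegralFamily.defect (A : Set ℝ) (u v : ℝ × ℝ → fr.W) (y : ℝ × ℝ) : ℝ :=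
  inner ℝ (v y) (tderiv A (Γ.X q₀ fr) y + tderiv A u y) - inner ℝ (tderiv A (Γ.P q₀ fr) y) (u y)

variable [T2Space I] [T2Space J]

/-- Changes of `(x, p)` with vanishing total defect extend to changes of the family. -/
theorem IntegralFamily.ValidOn.eventually_change_of_defect {t₀ ρ' ρ'' ρ₂ a b : ℝ}
    (hρ0 : 0 ≤ ρ') (hρ' : ρ' < ρ'') (hρ'' : ρ'' < ρ₂) (hab : a < b) (ht₀ : t₀ ∈ Icc a b)
    (hIcc : Icc a b = tcball IM t₀ ρ'') {L Λ : Set ℝ} (hB : IsBox IM q₀ (tball IM t₀ ρ₂) L)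
    (hv : Γ.ValidOn q₀ fr (tball IM t₀ ρ₂) L) (hΛ : IsCompact Λ) (hΛL : Λ ⊆ L)
    {𝒰 : Set (IntegralFamily n IM I J)} (h𝒰 : 𝒰 ∈ 𝓝 Γ)
    {S : Type} [NormedAddCommGroup S] [NormedSpace ℝ S] [FiniteDimensional ℝ S] {O : Set S}
    (hO : IsOpen O) {s₀ : S} (hs₀ : s₀ ∈ O) {u v : (ℝ × ℝ) × S → fr.W}
    (hu : ContDiffOn ℝ ∞ u ((tball IM t₀ ρ₂ ×ˢ L) ×ˢ O))
    (hvs : ContDiffOn ℝ ∞ v ((tball IM t₀ ρ₂ ×ˢ L) ×ˢ O))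
    (huv0 : ∀ y ∈ tball IM t₀ ρ₂ ×ˢ L, u (y, s₀) = 0 ∧ v (y, s₀) = 0)
    (hoff : ∀ s ∈ O, ∀ y ∈ tball IM t₀ ρ₂ ×ˢ L, y ∉ tcball IM t₀ ρ' ×ˢ Λ →
      u (y, s) = 0 ∧ v (y, s) = 0)
    (hclose : ∀ s ∈ O, ∀ l ∈ Λ, ∫ τ in a..b, Γ.defect q₀ fr (tball IM t₀ ρ₂)
      (fun y => u (y, s)) (fun y => v (y, s)) (τ, l) = 0) :
    ∀ᶠ s in 𝓝 s₀, ∃ Γ' ∈ 𝒰,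
      (∀ q ∉ (chart IM q₀).symm '' (tball IM t₀ ρ₂ ×ˢ L), Γ'.toFun q = Γ.toFun q) ∧
      Γ'.ValidOn q₀ fr (tball IM t₀ ρ₂) L ∧ ∀ y ∈ tball IM t₀ ρ₂ ×ˢ L,
        Γ'.X q₀ fr y = Γ.X q₀ fr y + u (y, s) ∧ Γ'.P q₀ fr y = Γ.P q₀ fr y + v (y, s) := by
  set A := tball IM t₀ ρ₂ with hAdef
  have hA := hB.uniqueDiffOn_left
  have hL := hB.isOpen_right
  set C : Set (ℝ × ℝ) := tcball IM t₀ ρ' ×ˢ Λ with hCdef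
  have hC : IsCompact C := (isCompact_tcball t₀ ρ').prod hΛ
  have hCB : C ⊆ A ×ˢ L := prod_mono
    (inter_subset_inter_right _ (Metric.closedBall_subset_ball (hρ'.trans hρ''))) hΛL
  have hIA : Icc a b ⊆ A := by
    rw [hIcc]
    exact inter_subset_inter_right _ (Metric.closedBall_subset_ball hρ'')
  have hX := hv.contDiffOn_X hB
  have hP := hv.contDiffOn_P hB
  have hZ := hv.contDiffOn_Z hB
  have hX' := hX.tderiv hA hL
  have hP' := hP.tderiv hA hL
  let re : ℝ × (ℝ × S) → (ℝ × ℝ) × S := fun w => ((w.1, w.2.1), w.2.2)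
  have hre : ContDiff ℝ ∞ re := by fun_prop
  have hrem : MapsTo re (A ×ˢ (L ×ˢ O)) ((A ×ˢ L) ×ˢ O) := fun w hw =>
    ⟨⟨hw.1, hw.2.1⟩, hw.2.2⟩
  have hLO : IsOpen (L ×ˢ O) := hL.prod hO
  have hu' : ContDiffOn ℝ ∞ (fun w => u (re w)) (A ×ˢ (L ×ˢ O)) := hu.comp hre.contDiffOn hrem
  have hv' : ContDiffOn ℝ ∞ (fun w => v (re w)) (A ×ˢ (L ×ˢ O)) := hvs.comp hre.contDiffOn hrem
  have hdu := hu'.tderiv hA hLO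
  have husl : ∀ s ∈ O, ContDiffOn ℝ ∞ (fun y => u (y, s)) (A ×ˢ L) := fun s hs =>
    hu.comp (contDiffOn_id.prodMk contDiffOn_const) fun y hy => ⟨hy, hs⟩
  let F : ℝ × (ℝ × S) → ℝ := fun w => Γ.defect q₀ fr A (fun y => u (y, w.2.2))
    (fun y => v (y, w.2.2)) (w.1, w.2.1)
  have hF : ContDiffOn ℝ ∞ F (A ×ˢ (L ×ˢ O)) := by
    have hp : ContDiffOn ℝ ∞ (fun w : ℝ × (ℝ × S) => (w.1, w.2.1)) (A ×ˢ (L ×ˢ O)) :=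
      (by fun_prop : ContDiff ℝ ∞ fun w : ℝ × (ℝ × S) => (w.1, w.2.1)).contDiffOn
    have hpm : MapsTo (fun w : ℝ × (ℝ × S) => (w.1, w.2.1)) (A ×ˢ (L ×ˢ O)) (A ×ˢ L) :=
      fun w hw => ⟨hw.1, hw.2.1⟩
    exact (hv'.inner ℝ ((hX'.comp hp hpm).add hdu)).sub ((hP'.comp hp hpm).inner ℝ hu')
  have hFI : ContDiffOn ℝ ∞ F (Icc a b ×ˢ (L ×ˢ O)) := hF.mono (prod_mono hIA Subset.rfl)
  -- the defect vanishes off the support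
  have hF0 : ∀ s ∈ O, ∀ y ∈ A ×ˢ L, y ∉ C → F (y.1, (y.2, s)) = 0 := by
    intro s hs y hy hyC
    have h1 := hoff s hs y hy hyC
    simp only [F, IntegralFamily.defect]
    rw [h1.1, h1.2]
    simp
  let Θ : ℝ × (ℝ × S) → ℝ := fun w => ∫ τ in a..w.1, F (τ, w.2)
  have hΘ : ContDiffOn ℝ ∞ Θ (Icc a b ×ˢ (L ×ˢ O)) := contDiffOn_integral_Icc hab hLO hFI
  have hord : A.OrdConnected := hB.convex_left.ordConnected
  -- Before the support the integrand has been zero all along; after it the integral equals the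
  -- total defect, which vanishes by `hclose`. For parameters outside `Λ` the integrand is zero.
  have hΘ0 : ∀ s ∈ O, ∀ y ∈ A ×ˢ L, y ∉ C → Θ (y.1, (y.2, s)) = 0 := by
    intro s hs y hy hyC
    have hFz : ∀ τ ∈ A, (τ, y.2) ∉ C → F (τ, (y.2, s)) = 0 := fun τ hτ hn =>
      hF0 s hs (τ, y.2) ⟨hτ, hy.2⟩ hn
    have haA : a ∈ A := hIA ⟨le_rfl, hab.le⟩
    have hbA : b ∈ A := hIA ⟨hab.le, le_rfl⟩
    have hInt : ∀ c ∈ A, ∀ d ∈ A, IntervalIntegrable (fun τ => F (τ, (y.2, s)))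
        MeasureTheory.volume c d := fun c hc d hd =>
      ((contDiffOn_slice hF (l := (y.2, s)) ⟨hy.2, hs⟩).continuousOn.mono
        (hord.uIcc_subset hc hd)).intervalIntegrable
    have hzero : ∀ c ∈ A, ∀ d ∈ A, (∀ τ ∈ uIcc c d, (τ, y.2) ∉ C) →
        ∫ τ in c..d, F (τ, (y.2, s)) = 0 := by
      intro c hc d hd hn
      rw [intervalIntegral.integral_congr (g := fun _ => (0 : ℝ)) fun τ hτ =>
        hFz τ (hord.uIcc_subset hc hd hτ) (hn τ hτ)]
      simp
    have ht0A : t₀ ∈ A := hIA ht₀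
    by_cases hl : y.2 ∈ Λ
    · have hyt : y.1 ∉ Metric.closedBall t₀ ρ' := fun h => hyC ⟨⟨hy.1.1, h⟩, hl⟩
      rw [Real.closedBall_eq_Icc, mem_Icc, not_and_or, not_le, not_le] at hyt
      rcases hyt with hlt | hlt
      · refine hzero a haA y.1 hy.1 fun τ hτ hτC => ?_
        have ha' : a < t₀ - ρ' := by
          have hm : max y.1 (t₀ - ρ'') ∈ Icc a b := by
            rw [hIcc]
            refine ⟨?_, ?_⟩
            · exact (hord.out hy.1 ht0A ⟨le_max_left _ _, max_le (by linarith) (by linarith)⟩).1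
            · rw [Real.closedBall_eq_Icc]
              exact ⟨le_max_right _ _, max_le (by linarith) (by linarith)⟩
          exact hm.1.trans_lt (max_lt hlt (by linarith))
        have h1 := hτC.1.2
        rw [Real.closedBall_eq_Icc] at h1
        have h2 := hτ.2
        have h3 : max a y.1 < t₀ - ρ' := max_lt ha' hlt
        linarith [h1.1]
      · have h0 : ∫ τ in a..b, F (τ, (y.2, s)) = 0 := hclose s hs y.2 hl
        rw [← intervalIntegral.integral_add_adjacent_intervals (hInt a haA y.1 hy.1)
          (hInt y.1 hy.1 b hbA), hzero y.1 hy.1 b hbA, add_zero] at h0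
        · exact h0
        · intro τ hτ hτC
          have h1 := hτC.1.2
          have hb' : t₀ + ρ' < b := by
            have hm : min y.1 (t₀ + ρ'') ∈ Icc a b := by
              rw [hIcc]
              refine ⟨?_, ?_⟩
              · exact (hord.out ht0A hy.1 ⟨le_min (by linarith) (by linarith),
                  min_le_left _ _⟩).1
              · rw [Real.closedBall_eq_Icc]
                exact ⟨le_min (by linarith) (by linarith), min_le_right _ _⟩
            exact (lt_min hlt (by linarith)).trans_le hm.2
          rw [Real.closedBall_eq_Icc] at h1
          have h2 := hτ.1
          have h3 : t₀ + ρ' < min y.1 b := lt_min hlt hb'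
          linarith [h1.2]
    · exact hzero a haA y.1 hy.1 fun τ _ hτC => hl hτC.2
  -- The change of `z` must have derivative `⟨p, u'⟩ + ⟨v, x' + u'⟩ = ⟨p, u⟩' + defect`. Hence it is
  -- `⟨p, u⟩` plus the integral of the defect.
  let h : (ℝ × ℝ) × S → fr.Par := fun w =>
    (u w, v w, inner ℝ (Γ.P q₀ fr w.1) (u w) + Θ (w.1.1, (w.1.2, w.2)))
  -- The integral is known to be smooth only over `[a, b]`. Near the support this interval and `A`
  -- coincide because `ρ' < ρ''`.
  have hnear : ∀ t ∈ tcball IM t₀ ρ', A =ᶠ[𝓝 t] Icc a b := by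
    intro t ht
    have h1 : Metric.ball t₀ ρ'' ∈ 𝓝 t :=
      Metric.isOpen_ball.mem_nhds (Metric.closedBall_subset_ball hρ' ht.2)
    filter_upwards [h1] with τ hτ
    refine propext ⟨fun h => ?_, fun h => hIA h⟩
    change τ ∈ Icc a b
    rw [hIcc]
    exact ⟨h.1, Metric.ball_subset_closedBall hτ⟩
  have hh0off : ∀ s ∈ O, ∀ y ∈ A ×ˢ L, y ∉ C → h (y, s) = 0 := by
    intro s hs y hy hyC
    simp only [h]
    rw [hΘ0 s hs y hy hyC, (hoff s hs y hy hyC).1, (hoff s hs y hy hyC).2]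
    simp
  have hΘs : ContDiffOn ℝ ∞ (fun w : (ℝ × ℝ) × S => Θ (w.1.1, (w.1.2, w.2)))
      ((Icc a b ×ˢ L) ×ˢ O) :=
    hΘ.comp (f := fun w : (ℝ × ℝ) × S => (w.1.1, (w.1.2, w.2)))
      (by fun_prop : ContDiff ℝ ∞ fun w : (ℝ × ℝ) × S => (w.1.1, (w.1.2, w.2))).contDiffOn
      fun w hw => ⟨hw.1.1, hw.1.2, hw.2⟩
  have hh : ContDiffOn ℝ ∞ h ((A ×ˢ L) ×ˢ O) := by
    refine contDiffOn_of_eq_zero_off (C := C ×ˢ univ) (D := (Icc a b ×ˢ L) ×ˢ O)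
      (hC.isClosed.prod isClosed_univ) ?_ ?_ fun w hw hwC =>
        hh0off w.2 hw.2 w.1 hw.1 fun h => hwC ⟨h, mem_univ _⟩
    · intro w hw hwC
      have h1 : ∀ᶠ z : (ℝ × ℝ) × S in 𝓝 w, (z.1.1 ∈ A) = (z.1.1 ∈ Icc a b) := by
        have hcont : ContinuousAt (fun z : (ℝ × ℝ) × S => z.1.1) w := by fun_prop
        exact hcont.eventually (hnear w.1.1 hwC.1.1)
      filter_upwards [mem_nhdsWithin_of_mem_nhds h1, self_mem_nhdsWithin] with z hz1 hz2
      exact ⟨⟨hz1.to_iff.1 hz2.1.1, hz2.1.2⟩, hz2.2⟩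
    · have hsub : (A ×ˢ L) ×ˢ O ∩ (Icc a b ×ˢ L) ×ˢ O ⊆ (A ×ˢ L) ×ˢ O := inter_subset_left
      refine ContDiffOn.prodMk (hu.mono hsub) (ContDiffOn.prodMk (hvs.mono hsub) ?_)
      exact ((hP.comp contDiffOn_fst fun w hw => hw.1.1).inner ℝ (hu.mono hsub)).add
        (hΘs.mono inter_subset_right)
  have hh0 : ∀ y ∈ A ×ˢ L, h (y, s₀) = 0 := by
    intro y hy
    have h1 : Θ (y.1, (y.2, s₀)) = 0 := by
      simp only [Θ]
      rw [intervalIntegral.integral_congr (g := fun _ => (0 : ℝ)) fun τ hτ => ?_]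
      · simp
      · have hτA : τ ∈ A := hord.uIcc_subset (hIA ⟨le_rfl, hab.le⟩) hy.1 hτ
        have h2 := huv0 (τ, y.2) ⟨hτA, hy.2⟩
        simp only [F, IntegralFamily.defect]
        rw [h2.1, h2.2]
        simp
    simp only [h]
    rw [h1, (huv0 y hy).1, (huv0 y hy).2]
    simp
  have hrel : ∀ s ∈ O, Γ.Admissible q₀ fr A L fun y => h (y, s) := by
    intro s hs y hy
    have hdX := tderiv_add hA hX (husl s hs) hy
    have hZd := hasDerivWithinAt_tderiv hA hZ hy
    have hud := hasDerivWithinAt_tderiv hA (husl s hs) hy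
    have hPd := hasDerivWithinAt_tderiv hA hP hy
    have hΘd : HasDerivWithinAt (fun τ => Θ (τ, (y.2, s))) (F (y.1, (y.2, s))) A y.1 := by
      by_cases hyC : y ∈ C
      · have h1 := hnear y.1 hyC.1
        have hyI : y.1 ∈ Icc a b := (h1.self_of_nhds).to_iff.1 hy.1
        have h2 := hasDerivWithinAt_integral_Icc hFI (y := (y.1, (y.2, s))) ⟨hyI, hy.2, hs⟩
        exact (hasDerivWithinAt_congr_set h1).2 h2
      · rw [hF0 s hs y hy hyC]
        refine (hasDerivWithinAt_const y.1 A (0 : ℝ)).congr_of_eventuallyEq ?_ (hΘ0 s hs y hy hyC)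
        have : ∀ᶠ τ in 𝓝 y.1, (τ, y.2) ∉ C := by
          have hcont : ContinuousAt (fun τ : ℝ => (τ, y.2)) y.1 := by fun_prop
          exact hcont.eventually (hC.isClosed.isOpen_compl.mem_nhds hyC)
        filter_upwards [mem_nhdsWithin_of_mem_nhds this, self_mem_nhdsWithin] with τ hτ hτA
        exact hΘ0 s hs (τ, y.2) ⟨hτA, hy.2⟩ hτ
    have h3 := (hZd.add ((hPd.inner ℝ hud).add hΘd)).derivWithin (hA _ hy.1)
    have h4 : tderiv A (fun y => Γ.X q₀ fr y + (h (y, s)).1) y =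
        tderiv A (Γ.X q₀ fr) y + tderiv A (fun y => u (y, s)) y := hdX
    rw [h4]
    refine h3.trans ?_
    simp only [F, h, IntegralFamily.defect]
    simp only [Prod.mk.eta, hv.tderiv_Z hB hy, inner_add_left, inner_add_right]
    ring
  filter_upwards [hv.eventually_isChange hB hC hCB h𝒰 hO hs₀ hh hh0 hh0off hrel] with s hs
  obtain ⟨Γ', hΓ', hoffΓ, hvΓ, hcoord⟩ := hs
  exact ⟨Γ', hΓ', fun q hq => hoffΓ q fun h => hq (image_mono hCB h), hvΓ,
    fun y hy => ⟨(hcoord y hy).1, (hcoord y hy).2.1⟩⟩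

end Closing

/-! ### Compensation of the defect. -/

section Compensation

/-- The small root of a quadratic polynomial with positive linear coefficient. -/
theorem small_root {f M q : ℝ} (hM : 0 < M) (hd : 0 < M ^ 2 - 4 * q * f) :
    f + (-2 * f / (M + √(M ^ 2 - 4 * q * f))) * M +
      (-2 * f / (M + √(M ^ 2 - 4 * q * f))) ^ 2 * q = 0 := by
  have hr : √(M ^ 2 - 4 * q * f) ^ 2 = M ^ 2 - 4 * q * f := Real.sq_sqrt hd.le
  have hpos : 0 < M + √(M ^ 2 - 4 * q * f) := add_pos_of_pos_of_nonneg hM (Real.sqrt_nonneg _)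
  set r := √(M ^ 2 - 4 * q * f) with hrdef
  clear_value r
  field_simp
  linear_combination f * hr

variable {n : ℕ} {H : Type*} [TopologicalSpace H] {IM : ModelWithCorners ℝ ℝ H}
  {I : Type*} [TopologicalSpace I] [ChartedSpace H I]
  {J : Type*} [TopologicalSpace J] [ChartedSpace ℝ J]
  [IsManifold IM ∞ I] [IsManifold 𝓘(ℝ, ℝ) ∞ J] [T2Space I] [T2Space J]
  {Γ : IntegralFamily n IM I J} {q₀ : I × J} {fr : ContactFrame n}

/-- Arbitrary small changes of `(x, p)` can be compensated on the support of `ψ`, provided that the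
curves are not constant there. -/
theorem IntegralFamily.ValidOn.eventually_change_compensated {t₀ ρ' ρ'' ρ₂ a b : ℝ}
    (hρ0 : 0 ≤ ρ') (hρ' : ρ' < ρ'') (hρ'' : ρ'' < ρ₂) (hab : a < b) (ht₀ : t₀ ∈ Icc a b)
    (hIcc : Icc a b = tcball IM t₀ ρ'') {L Λ : Set ℝ} (hB : IsBox IM q₀ (tball IM t₀ ρ₂) L)
    (hv : Γ.ValidOn q₀ fr (tball IM t₀ ρ₂) L) (hΛ : IsCompact Λ) (hΛL : Λ ⊆ L)
    {𝒰 : Set (IntegralFamily n IM I J)} (h𝒰 : 𝒰 ∈ 𝓝 Γ) {ψ : ℝ → ℝ} (hψ : ContDiff ℝ ∞ ψ)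
    (hψ0 : ∀ t ∉ Metric.closedBall t₀ ρ', ψ t = 0)
    (hpos : ∀ l ∈ L, 0 < ∫ τ in a..b, ψ τ *
      (inner ℝ (tderiv (tball IM t₀ ρ₂) (Γ.X q₀ fr) (τ, l))
        (tderiv (tball IM t₀ ρ₂) (Γ.X q₀ fr) (τ, l)) +
      inner ℝ (tderiv (tball IM t₀ ρ₂) (Γ.P q₀ fr) (τ, l))
        (tderiv (tball IM t₀ ρ₂) (Γ.P q₀ fr) (τ, l))))
    {S : Type} [NormedAddCommGroup S] [NormedSpace ℝ S] [FiniteDimensional ℝ S]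
    {c d : (ℝ × ℝ) × S → fr.W} (hc : ContDiff ℝ ∞ c) (hd : ContDiff ℝ ∞ d)
    (hcd0 : ∀ y, c (y, 0) = 0 ∧ d (y, 0) = 0)
    (hoff : ∀ s, ∀ y ∈ tball IM t₀ ρ₂ ×ˢ L, y ∉ tcball IM t₀ ρ' ×ˢ Λ →
      c (y, s) = 0 ∧ d (y, s) = 0) :
    ∀ᶠ s in 𝓝 0, ∃ Γ' ∈ 𝒰,
      (∀ q ∉ (chart IM q₀).symm '' (tball IM t₀ ρ₂ ×ˢ L), Γ'.toFun q = Γ.toFun q) ∧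
      Γ'.ValidOn q₀ fr (tball IM t₀ ρ₂) L ∧ ∀ y ∈ tball IM t₀ ρ₂ ×ˢ L, ψ y.1 = 0 →
        Γ'.X q₀ fr y = Γ.X q₀ fr y + c (y, s) ∧ Γ'.P q₀ fr y = Γ.P q₀ fr y + d (y, s) := by
  set A := tball IM t₀ ρ₂ with hAdef
  have hA := hB.uniqueDiffOn_left
  have hL := hB.isOpen_right
  have hIA : Icc a b ⊆ A := by
    rw [hIcc]
    exact inter_subset_inter_right _ (Metric.closedBall_subset_ball hρ'')
  set X' := tderiv A (Γ.X q₀ fr) with hX'def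
  set P' := tderiv A (Γ.P q₀ fr) with hP'def
  have hX' : ContDiffOn ℝ ∞ X' (A ×ˢ L) := (hv.contDiffOn_X hB).tderiv hA hL
  have hP' : ContDiffOn ℝ ∞ P' (A ×ˢ L) := (hv.contDiffOn_P hB).tderiv hA hL
  have hψs : ContDiffOn ℝ ∞ (fun y : ℝ × ℝ => ψ y.1) (A ×ˢ L) :=
    (hψ.comp contDiff_fst).contDiffOn
  -- To first order the change `(-ψ p', ψ x')` has defect `ψ (|x'|² + |p'|²)`, whose integral is
  -- positive by `hpos`.
  let u₁ : ℝ × ℝ → fr.W := fun y => -(ψ y.1 • P' y)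
  let v₁ : ℝ × ℝ → fr.W := fun y => ψ y.1 • X' y
  have hu₁ : ContDiffOn ℝ ∞ u₁ (A ×ˢ L) := (hψs.smul hP').neg
  have hv₁ : ContDiffOn ℝ ∞ v₁ (A ×ˢ L) := hψs.smul hX'
  have hu₁' := hu₁.tderiv hA hL
  let re : ℝ × (ℝ × S) → (ℝ × ℝ) × S := fun w => ((w.1, w.2.1), w.2.2)
  have hre : ContDiff ℝ ∞ re := by fun_prop
  have hLu : IsOpen (L ×ˢ (univ : Set S)) := hL.prod isOpen_univ
  let T : Set (ℝ × (ℝ × S)) := A ×ˢ (L ×ˢ (univ : Set S))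
  have hcr : ContDiffOn ℝ ∞ (fun w => c (re w)) T := (hc.comp hre).contDiffOn
  have hdr : ContDiffOn ℝ ∞ (fun w => d (re w)) T := (hd.comp hre).contDiffOn
  let c' : ℝ × (ℝ × S) → fr.W := tderiv A fun w => c (re w)
  have hc' : ContDiffOn ℝ ∞ c' T := hcr.tderiv hA hLu
  have hc'0 : ∀ t ∈ A, ∀ l s, (∀ τ ∈ A, c ((τ, l), s) = 0) → c' (t, (l, s)) = 0 := by
    intro t ht l s h
    refine tderiv_eq_zero_of_eventually ht ?_
    filter_upwards [self_mem_nhdsWithin] with τ hτ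
    exact h τ hτ
  have hp : ContDiffOn ℝ ∞ (fun w : ℝ × (ℝ × S) => (w.1, w.2.1)) T :=
    (by fun_prop : ContDiff ℝ ∞ fun w : ℝ × (ℝ × S) => (w.1, w.2.1)).contDiffOn
  have hpm : MapsTo (fun w : ℝ × (ℝ × S) => (w.1, w.2.1)) T (A ×ˢ L) :=
    fun w hw => ⟨hw.1, hw.2.1⟩
  -- The defect of `(c + ν u₁, d + ν v₁)` is `D₀ + ν D₁ + ν² D₂`. As `ν` does not depend on time,
  -- closing up is a quadratic equation for `ν` with integrated coefficients.
  let D₀ : ℝ × (ℝ × S) → ℝ := fun w => inner ℝ (d (re w)) (X' (w.1, w.2.1) + c' w) -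
    inner ℝ (P' (w.1, w.2.1)) (c (re w))
  let D₁ : ℝ × (ℝ × S) → ℝ := fun w => inner ℝ (v₁ (w.1, w.2.1)) (X' (w.1, w.2.1) + c' w) +
    inner ℝ (d (re w)) (tderiv A u₁ (w.1, w.2.1)) - inner ℝ (P' (w.1, w.2.1)) (u₁ (w.1, w.2.1))
  let D₂ : ℝ × (ℝ × S) → ℝ := fun w => inner ℝ (v₁ (w.1, w.2.1)) (tderiv A u₁ (w.1, w.2.1))
  have hX'c := hX'.comp hp hpm
  have hP'c := hP'.comp hp hpm
  have hD₀ : ContDiffOn ℝ ∞ D₀ T := (hdr.inner ℝ (hX'c.add hc')).sub (hP'c.inner ℝ hcr)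
  have hD₁ : ContDiffOn ℝ ∞ D₁ T := (((hv₁.comp hp hpm).inner ℝ (hX'c.add hc')).add
    (hdr.inner ℝ (hu₁'.comp hp hpm))).sub (hP'c.inner ℝ (hu₁.comp hp hpm))
  have hD₂ : ContDiffOn ℝ ∞ D₂ T := (hv₁.comp hp hpm).inner ℝ (hu₁'.comp hp hpm)
  have hInt : ∀ D : ℝ × (ℝ × S) → ℝ, ContDiffOn ℝ ∞ D T →
      ContDiffOn ℝ ∞ (fun w : ℝ × S => ∫ τ in a..b, D (τ, w)) (L ×ˢ univ) := by
    intro D hD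
    have h1 := contDiffOn_integral_Icc hab hLu (hD.mono (prod_mono hIA Subset.rfl))
    exact h1.comp (f := fun w : ℝ × S => (b, w)) (contDiffOn_const.prodMk contDiffOn_id)
      fun w hw => ⟨⟨hab.le, le_rfl⟩, hw⟩
  have hii : ∀ D : ℝ × (ℝ × S) → ℝ, ContDiffOn ℝ ∞ D T → ∀ l ∈ L, ∀ s : S,
      IntervalIntegrable (fun τ => D (τ, (l, s))) MeasureTheory.volume a b := by
    intro D hD l hl s
    refine ((contDiffOn_slice hD (l := (l, s)) ⟨hl, mem_univ _⟩).continuousOn.mono ?_).intervalIntegrable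
    rw [uIcc_of_le hab.le]
    exact hIA
  let f : ℝ × S → ℝ := fun w => ∫ τ in a..b, D₀ (τ, w)
  let M : ℝ × S → ℝ := fun w => ∫ τ in a..b, D₁ (τ, w)
  let q : ℝ × S → ℝ := fun w => ∫ τ in a..b, D₂ (τ, w)
  have hf := hInt D₀ hD₀
  have hM := hInt D₁ hD₁
  have hq := hInt D₂ hD₂
  have hAab : ∀ τ ∈ uIcc a b, τ ∈ A := fun τ hτ => hIA (by rwa [uIcc_of_le hab.le] at hτ)
  -- where the given change vanishes
  have hz : ∀ l ∈ L, ∀ s, (∀ τ ∈ A, c ((τ, l), s) = 0 ∧ d ((τ, l), s) = 0) →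
      f (l, s) = 0 ∧ 0 < M (l, s) := by
    intro l hl s h
    constructor
    · simp only [f]
      rw [intervalIntegral.integral_congr (g := fun _ => (0 : ℝ)) fun τ hτ => ?_]
      · simp
      · have h1 := h τ (hAab τ hτ)
        simp only [D₀, re]
        rw [h1.1, h1.2]
        simp
    · refine (hpos l hl).trans_eq (intervalIntegral.integral_congr fun τ hτ => ?_)
      have h1 := h τ (hAab τ hτ)
      have h2 := hc'0 τ (hAab τ hτ) l s fun τ hτ => (h τ hτ).1
      simp only [D₁, re, u₁, v₁]
      rw [h1.2, h2, add_zero, inner_zero_left, real_inner_smul_left, inner_neg_right,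
        real_inner_smul_right]
      ring
  obtain ⟨O, hO, h0O, hpo⟩ := exists_isOpen_forall_mem hΛ (s₀ := (0 : S))
    (g := fun w : ℝ × S => (M w, M w ^ 2 - 4 * q w * f w)) (N := Ioi 0 ×ˢ Ioi 0)
    ((hM.continuousOn.prodMk ((hM.continuousOn.pow 2).sub ((continuousOn_const.mul
      hq.continuousOn).mul hf.continuousOn))).mono (prod_mono hΛL Subset.rfl))
    (isOpen_Ioi.prod isOpen_Ioi) (fun l hl => by
      obtain ⟨h1, h2⟩ := hz l (hΛL hl) 0 fun τ _ => hcd0 _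
      refine ⟨h2, ?_⟩
      simp only [mem_Ioi]
      rw [h1]
      have := pow_pos h2 2
      linarith)
  -- For parameters outside `Λ` the given change vanishes. Then `f = 0` and `M` has its unperturbed
  -- value, so positivity holds for every `s`.
  have hpo' : ∀ s ∈ O, ∀ l ∈ L, 0 < M (l, s) ∧ 0 < M (l, s) ^ 2 - 4 * q (l, s) * f (l, s) := by
    intro s hs l hl
    by_cases hlΛ : l ∈ Λ
    · exact hpo s hs l hlΛ
    · obtain ⟨h1, h2⟩ := hz l hl s fun τ hτ => hoff s (τ, l) ⟨hτ, hl⟩ fun h => hlΛ h.2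
      refine ⟨h2, ?_⟩
      rw [h1]
      have := pow_pos h2 2
      linarith
  -- In this form of the root the denominator is positive. So `ν` is smooth and vanishes together
  -- with `f`, and no compensation is added where none is needed.
  let ν : ℝ × S → ℝ := fun w => -2 * f w / (M w + √(M w ^ 2 - 4 * q w * f w))
  have hν : ContDiffOn ℝ ∞ ν (L ×ˢ O) := by
    have hsub : L ×ˢ O ⊆ L ×ˢ univ := prod_mono Subset.rfl (subset_univ _)
    have hf' := hf.mono hsub
    have hM' := hM.mono hsub
    have hq' := hq.mono hsub
    refine ContDiffOn.div (contDiffOn_const.mul hf') (hM'.add (ContDiffOn.sqrt ((hM'.pow 2).sub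
      ((contDiffOn_const.mul hq').mul hf')) ?_)) ?_
    · intro w hw
      exact (hpo' w.2 hw.2 w.1 hw.1).2.ne'
    · intro w hw
      exact (add_pos_of_pos_of_nonneg (hpo' w.2 hw.2 w.1 hw.1).1 (Real.sqrt_nonneg _)).ne'
  have hν0 : ∀ w, f w = 0 → ν w = 0 := fun w hw => by simp [ν, hw]
  let u : (ℝ × ℝ) × S → fr.W := fun w => c w + ν (w.1.2, w.2) • u₁ w.1
  let v : (ℝ × ℝ) × S → fr.W := fun w => d w + ν (w.1.2, w.2) • v₁ w.1
  have hνc : ContDiffOn ℝ ∞ (fun w : (ℝ × ℝ) × S => ν (w.1.2, w.2)) ((A ×ˢ L) ×ˢ O) :=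
    hν.comp (by fun_prop : ContDiff ℝ ∞ fun w : (ℝ × ℝ) × S => (w.1.2, w.2)).contDiffOn
      fun w hw => ⟨hw.1.2, hw.2⟩
  have hu : ContDiffOn ℝ ∞ u ((A ×ˢ L) ×ˢ O) :=
    hc.contDiffOn.add (hνc.smul (hu₁.comp contDiffOn_fst fun w hw => hw.1))
  have hvv : ContDiffOn ℝ ∞ v ((A ×ˢ L) ×ˢ O) :=
    hd.contDiffOn.add (hνc.smul (hv₁.comp contDiffOn_fst fun w hw => hw.1))
  have hdefect : ∀ s ∈ O, ∀ y ∈ A ×ˢ L, Γ.defect q₀ fr A (fun y => u (y, s)) (fun y => v (y, s)) y =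
      D₀ (y.1, (y.2, s)) + ν (y.2, s) * D₁ (y.1, (y.2, s)) +
        ν (y.2, s) ^ 2 * D₂ (y.1, (y.2, s)) := by
    intro s hs y hy
    have h1 := hasDerivWithinAt_tderiv hA hcr (y := (y.1, (y.2, s))) ⟨hy.1, hy.2, mem_univ _⟩
    have h2 := (hasDerivWithinAt_tderiv hA hu₁ hy).const_smul (ν (y.2, s))
    have h3 : tderiv A (fun y => u (y, s)) y = c' (y.1, (y.2, s)) + ν (y.2, s) • tderiv A u₁ y :=
      (h1.add h2).derivWithin (hA _ hy.1)
    simp only [IntegralFamily.defect, D₀, D₁, D₂]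
    rw [h3]
    simp only [u, v, re, Prod.mk.eta, inner_add_left, inner_add_right, real_inner_smul_left,
      real_inner_smul_right]
    ring
  have hev := hv.eventually_change_of_defect (u := u) (v := v) hρ0 hρ' hρ'' hab ht₀ hIcc hB hΛ hΛL
    h𝒰 hO h0O hu hvv (fun y hy => by
      have h1 := hν0 (y.2, 0) (hz y.2 hy.2 0 fun τ _ => hcd0 _).1
      simp only [u, v]
      rw [h1, (hcd0 y).1, (hcd0 y).2]
      simp) (fun s hs y hy hyC => by
      have h1 := hoff s y hy hyC
      have h2 : ν (y.2, s) • u₁ y = 0 ∧ ν (y.2, s) • v₁ y = 0 := by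
        by_cases hlΛ : y.2 ∈ Λ
        · have h3 : ψ y.1 = 0 := hψ0 y.1 fun h => hyC ⟨⟨hy.1.1, h⟩, hlΛ⟩
          simp [u₁, v₁, h3]
        · rw [hν0 (y.2, s) (hz y.2 hy.2 s fun τ hτ =>
            hoff s (τ, y.2) ⟨hτ, hy.2⟩ fun h => hlΛ h.2).1]
          simp
      simp only [u, v]
      rw [h1.1, h1.2, h2.1, h2.2]
      simp) (fun s hs l hl => by
      have hlL := hΛL hl
      rw [intervalIntegral.integral_congr fun τ hτ => hdefect s hs (τ, l) ⟨hAab τ hτ, hlL⟩]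
      have i0 := hii D₀ hD₀ l hlL s
      have i1 := (hii D₁ hD₁ l hlL s).const_mul (ν (l, s))
      have i2 := (hii D₂ hD₂ l hlL s).const_mul (ν (l, s) ^ 2)
      rw [intervalIntegral.integral_add (i0.add i1) i2, intervalIntegral.integral_add i0 i1,
        intervalIntegral.integral_const_mul, intervalIntegral.integral_const_mul]
      exact small_root (hpo' s hs l hlL).1 (hpo' s hs l hlL).2)
  filter_upwards [hev] with s hs
  obtain ⟨Γ', hΓ', hoffΓ, hvΓ, hcoord⟩ := hs
  refine ⟨Γ', hΓ', hoffΓ, hvΓ, fun y hy hψy => ?_⟩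
  have h1 := hcoord y hy
  simp only [u, v, u₁, v₁, hψy] at h1
  simpa using h1

end Compensation

/-! ### Bad jets at nonimmersed points. -/

section NonimmersedStrata

variable {W : Type} [NormedAddCommGroup W] [InnerProductSpace ℝ W] [FiniteDimensional ℝ W]

/-- The condition on the jet of `(x, p)` under which the fourth derivative of `(x, z)` depends on
the second and the third one, at a point where `x` is not immersed. -/
def DependentFourth (w : (Fin (4 + 1) → W) × (Fin (4 + 1) → W)) : Prop :=
  ∃ α β : ℝ, w.1 4 = α • w.1 2 + β • w.1 3 ∧
    3 * inner ℝ (w.2 2) (w.1 2) = 2 * β * inner ℝ (w.2 1) (w.1 2) - 3 * inner ℝ (w.2 1) (w.1 3)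

/-- The linear relation is solved for the component of `p''` along `e i`, which is possible because
`x''` has a nonzero component there. Together with `x' = 0` this is codimension 3: the 17 free
parameters include `α` and `β`, and the jet space has dimension 20. -/
theorem isThin_dependentFourth (e : OrthonormalBasis (Fin 2) ℝ W) (i : Fin 2) :
    IsThin {w : (Fin (4 + 1) → W) × (Fin (4 + 1) → W) |
      w.1 1 = 0 ∧ inner ℝ (e i) (w.1 2) ≠ 0 ∧ DependentFourth w} := by
  have hW : finrank ℝ W = 2 := by rw [finrank_eq_card_basis e.toBasis, Fintype.card_fin]
  let P := (Fin 3 → W) × (Fin 4 → W) × (ℝ × ℝ × ℝ)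
  let Ω : Set P := {θ | inner ℝ (e i) (θ.1 1) ≠ 0}
  let b : P → ℝ := fun θ => ((2 * θ.2.2.2.1 * inner ℝ (θ.2.1 1) (θ.1 1) -
    3 * inner ℝ (θ.2.1 1) (θ.1 2)) / 3 - θ.2.2.2.2 * inner ℝ (e i.rev) (θ.1 1)) /
      inner ℝ (e i) (θ.1 1)
  let ψ₁ : P → Fin (4 + 1) → W := fun θ =>
    ![θ.1 0, 0, θ.1 1, θ.1 2, θ.2.2.1 • θ.1 1 + θ.2.2.2.1 • θ.1 2]
  let ψ₂ : P → Fin (4 + 1) → W := fun θ =>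
    ![θ.2.1 0, θ.2.1 1, θ.2.2.2.2 • e i.rev + b θ • e i, θ.2.1 2, θ.2.1 3]
  have hx : ∀ k : Fin 3, ContDiffOn ℝ 1 (fun θ : P => θ.1 k) Ω := fun k =>
    (contDiff_pi.1 contDiff_fst k).contDiffOn
  have hp : ∀ k : Fin 4, ContDiffOn ℝ 1 (fun θ : P => θ.2.1 k) Ω := fun k =>
    (contDiff_pi.1 contDiff_snd.fst k).contDiffOn
  have hb : ContDiffOn ℝ 1 b Ω := by
    have hin : ∀ v : W, ContDiffOn ℝ 1 (fun θ : P => inner ℝ v (θ.1 1)) Ω := fun v =>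
      contDiffOn_const.inner ℝ (hx 1)
    have h1 : ContDiffOn ℝ 1 (fun θ : P => 2 * θ.2.2.2.1) Ω :=
      (by fun_prop : ContDiff ℝ 1 fun θ : P => 2 * θ.2.2.2.1).contDiffOn
    have h2 : ContDiffOn ℝ 1 (fun θ : P => θ.2.2.2.2) Ω :=
      (by fun_prop : ContDiff ℝ 1 fun θ : P => θ.2.2.2.2).contDiffOn
    refine ContDiffOn.div (((((h1.mul ((hp 1).inner ℝ (hx 1))).sub (contDiffOn_const.mul
      ((hp 1).inner ℝ (hx 2)))).div_const 3)).sub (h2.mul (hin _))) (hin _) fun θ hθ => hθ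
  refine IsThin.of_param (P := P) (Ω := Ω) (ψ := fun θ => (ψ₁ θ, ψ₂ θ)) ?_ ?_ ?_ ?_
  · exact isOpen_ne_fun (continuous_const.inner ((continuous_apply 1).comp continuous_fst))
      continuous_const
  · refine ContDiffOn.prodMk (contDiffOn_pi.2 fun k => ?_) (contDiffOn_pi.2 fun k => ?_)
    · have h1 : ContDiffOn ℝ 1 (fun θ : P => θ.2.2.1) Ω :=
        (by fun_prop : ContDiff ℝ 1 fun θ : P => θ.2.2.1).contDiffOn
      have h2 : ContDiffOn ℝ 1 (fun θ : P => θ.2.2.2.1) Ω :=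
        (by fun_prop : ContDiff ℝ 1 fun θ : P => θ.2.2.2.1).contDiffOn
      fin_cases k
      · exact hx 0
      · exact contDiffOn_const
      · exact hx 1
      · exact hx 2
      · exact (h1.smul (hx 1)).add (h2.smul (hx 2))
    · have h2 : ContDiffOn ℝ 1 (fun θ : P => θ.2.2.2.2) Ω :=
        (by fun_prop : ContDiff ℝ 1 fun θ : P => θ.2.2.2.2).contDiffOn
      fin_cases k
      · exact hp 0
      · exact hp 1
      · exact (h2.smul contDiffOn_const).add (hb.smul contDiffOn_const)
      · exact hp 2
      · exact hp 3
  · simp only [P, Module.finrank_prod, Module.finrank_pi_fintype, Finset.sum_const,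
      Finset.card_univ, Fintype.card_fin, hW, finrank_self, smul_eq_mul]
    norm_num
  · rintro w ⟨h1, h2, α, β, h4, hrel⟩
    let θ : P := (![w.1 0, w.1 2, w.1 3], ![w.2 0, w.2 1, w.2 3, w.2 4],
      (α, β, inner ℝ (e i.rev) (w.2 2)))
    have hdec : ∀ v : W, v = inner ℝ (e i.rev) v • e i.rev + inner ℝ (e i) v • e i := by
      intro v
      have h5 := e.sum_repr v
      rw [Fin.sum_univ_two, e.repr_apply_apply, e.repr_apply_apply] at h5
      fin_cases i
      · exact h5.symm.trans (add_comm _ _)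
      · exact h5.symm
    have hbθ : b θ = inner ℝ (e i) (w.2 2) := by
      have h6 : inner ℝ (w.2 2) (w.1 2) = inner ℝ (e i.rev) (w.2 2) * inner ℝ (e i.rev) (w.1 2) +
          inner ℝ (e i) (w.2 2) * inner ℝ (e i) (w.1 2) := by
        conv_lhs => rw [hdec (w.2 2)]
        rw [inner_add_left, real_inner_smul_left, real_inner_smul_left]
      have h7 : b θ = ((2 * β * inner ℝ (w.2 1) (w.1 2) - 3 * inner ℝ (w.2 1) (w.1 3)) / 3 -
          inner ℝ (e i.rev) (w.2 2) * inner ℝ (e i.rev) (w.1 2)) / inner ℝ (e i) (w.1 2) := rfl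
      rw [h7, ← hrel, h6, div_eq_iff h2]
      ring
    refine ⟨θ, h2, Prod.ext (funext fun k => ?_) (funext fun k => ?_)⟩
    · fin_cases k
      · rfl
      · exact h1.symm
      · rfl
      · rfl
      · exact h4.symm
    · fin_cases k
      · rfl
      · rfl
      · change inner ℝ (e i.rev) (w.2 2) • e i.rev + b θ • e i = w.2 2
        rw [hbθ, ← hdec]
      · rfl
      · rfl

/-- Thin sets that contain all the jets of non-immersed curves, apart from those of the admissible
singular type of plane curves. -/
theorem exists_nonimmersedStrata {n : ℕ} (hn : 2 ≤ n) (hW : finrank ℝ W = n) :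
    ∃ S : Unit ⊕ Unit ⊕ Fin 2 → Set ((Fin (4 + 1) → W) × (Fin (4 + 1) → W)),
      (∀ i, IsThin (S i)) ∧ ∀ w, (∀ i, w ∉ S i) → w.1 1 ≠ 0 ∨
        (n = 2 ∧ w.1 2 ≠ 0 ∧ w.1 3 ∉ Submodule.span ℝ {w.1 2} ∧ ¬ DependentFourth w) := by
  rcases Nat.eq_or_lt_of_le hn with rfl | hn3
  -- For `n = 2` the codimensions are 4 for `x' = x'' = 0`, then 3 for `x' = 0` with `x'''` parallel
  -- to `x''`, and 3 for each of the two pieces of the dependent stratum, one per coordinate of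
  -- `x''`.
  · let e : OrthonormalBasis (Fin 2) ℝ W := (stdOrthonormalBasis ℝ W).reindex (finCongr hW)
    refine ⟨Sum.elim (fun _ => Prod.fst ⁻¹' depStratum W 4 {1, 2} fun _ => ∅)
      (Sum.elim (fun _ => Prod.fst ⁻¹' depStratum W 4 {1, 3} fun k => if k = 1 then ∅ else {2})
        fun i => {w | w.1 1 = 0 ∧ inner ℝ (e i) (w.1 2) ≠ 0 ∧ DependentFourth w}), ?_, ?_⟩
    · rintro (_ | _ | i)
      · refine (isThin_depStratum (by simp) (by simp) ?_).preimage_fst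
        simp [hW]
      · refine (isThin_depStratum (by simp) ?_ ?_).preimage_fst
        · intro k hk
          split_ifs <;> simp
        · rw [Finset.sum_pair (by norm_num), hW]
          simp
      · exact isThin_dependentFourth e i
    · intro w hw
      by_contra! hcon
      obtain ⟨h1, hcon⟩ := hcon
      have h2 : w.1 2 ≠ 0 := by
        intro h2
        refine hw (Sum.inl ()) ?_
        intro k hk
        simp only [Finset.mem_insert, Finset.mem_singleton] at hk
        rcases hk with hk | hk
        · rw [show k = 1 from Fin.ext hk, h1]
          exact Submodule.zero_mem _
        · rw [show k = 2 from Fin.ext hk, h2]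
          exact Submodule.zero_mem _
      have h3 : w.1 3 ∉ Submodule.span ℝ {w.1 2} := by
        intro h3
        refine hw (Sum.inr (Sum.inl ())) ?_
        intro k hk
        simp only [Finset.mem_insert, Finset.mem_singleton] at hk
        rcases hk with hk | hk
        · rw [show k = 1 from Fin.ext hk, h1]
          exact Submodule.zero_mem _
        · rw [show k = 3 from Fin.ext hk]
          refine Submodule.span_mono ?_ h3
          rintro _ rfl
          refine ⟨2, ?_, rfl⟩
          simp
      have h4 := hcon rfl h2 h3
      obtain ⟨i, hi⟩ : ∃ i, inner ℝ (e i) (w.1 2) ≠ 0 := by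
        by_contra! hall
        refine h2 ?_
        rw [← e.sum_repr (w.1 2)]
        exact Finset.sum_eq_zero fun i _ => by rw [e.repr_apply_apply, hall i, zero_smul]
      exact hw (Sum.inr (Sum.inr i)) ⟨h1, hi, h4⟩
  -- For `n ≥ 3` the condition `x' = 0` alone has codimension `n ≥ 3`, so generically there are no
  -- nonimmersed points.
  · refine ⟨fun _ => Prod.fst ⁻¹' depStratum W 4 {1} fun _ => ∅, fun _ =>
      (isThin_depStratum (by simp) (by simp) (by simp [hW]; omega)).preimage_fst,
      fun w hw => Or.inl fun h1 => hw (Sum.inl ()) ?_⟩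
    intro k hk
    rw [Finset.mem_singleton] at hk
    rw [show k = 1 from Fin.ext hk, h1]
    exact Submodule.zero_mem _

end NonimmersedStrata

/-! ### Calculus of time jets. -/

section TJetCalculus

variable {Q : Type*} [NormedAddCommGroup Q] [NormedSpace ℝ Q]
  {W : Type*} [NormedAddCommGroup W] [NormedSpace ℝ W] {A : Set ℝ} {U : Set Q} {F : ℝ × Q → W}

theorem hasDerivWithinAt_tjet (hA : UniqueDiffOn ℝ A) (hU : IsOpen U)
    (hF : ContDiffOn ℝ ∞ F (A ×ˢ U)) (k : ℕ) {y : ℝ × Q} (hy : y ∈ A ×ˢ U) :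
    HasDerivWithinAt (fun τ => tjet A F k (τ, y.2)) (tjet A F (k + 1) y) A y.1 := by
  rw [tjet_succ]
  exact hasDerivWithinAt_tderiv hA (hF.tjet hA hU k) hy

theorem tjet_succ_eq (hA : UniqueDiffOn ℝ A) {k : ℕ} {G : ℝ × Q → W} {G' : W} {y : ℝ × Q}
    (hy : y.1 ∈ A) (h : ∀ τ ∈ A, tjet A F k (τ, y.2) = G (τ, y.2))
    (hG : HasDerivWithinAt (fun τ => G (τ, y.2)) G' A y.1) : tjet A F (k + 1) y = G' := by
  rw [tjet_succ, ← hG.derivWithin (hA _ hy)]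
  exact derivWithin_congr (fun τ hτ => h τ hτ) (h y.1 hy)

theorem tjet_clm {W' : Type*} [NormedAddCommGroup W'] [NormedSpace ℝ W'] (hA : UniqueDiffOn ℝ A)
    (hU : IsOpen U) (κ : W →L[ℝ] W') (hF : ContDiffOn ℝ ∞ F (A ×ˢ U)) (k : ℕ) {y : ℝ × Q}
    (hy : y ∈ A ×ˢ U) : tjet A (fun y => κ (F y)) k y = κ (tjet A F k y) := by
  induction k generalizing y with
  | zero => rw [tjet_zero, tjet_zero]
  | succ k ih =>
    exact tjet_succ_eq hA (G := fun y => κ (tjet A F k y)) hy.1 (fun τ hτ => ih ⟨hτ, hy.2⟩)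
      (κ.hasFDerivAt.comp_hasDerivWithinAt y.1 (hasDerivWithinAt_tjet hA hU hF k hy))

end TJetCalculus

/-! ### Singular points of type `(2, 3, 4)`. -/

section SingularPoints

variable {n : ℕ} {H : Type*} [TopologicalSpace H] {IM : ModelWithCorners ℝ ℝ H}
  {I : Type*} [TopologicalSpace I] [ChartedSpace H I]
  {J : Type*} [TopologicalSpace J] [ChartedSpace ℝ J]
  [IsManifold IM ∞ I] [IsManifold 𝓘(ℝ, ℝ) ∞ J]
  {Γ : IntegralFamily n IM I J} {q₀ : I × J} {fr : ContactFrame n} {A L : Set ℝ}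

/-- These come from the Leibniz rule applied to `z' = ⟨p, x'⟩` along the whole curve; `x' = 0` is
inserted only after the last differentiation. -/
theorem IntegralFamily.ValidOn.tjet_Z (hv : Γ.ValidOn q₀ fr A L) (hB : IsBox IM q₀ A L)
    {y : ℝ × ℝ} (hy : y ∈ A ×ˢ L) (h1 : tjet A (Γ.X q₀ fr) 1 y = 0) :
    tjet A (Γ.Z q₀ fr) 1 y = 0 ∧
    tjet A (Γ.Z q₀ fr) 2 y = inner ℝ (Γ.P q₀ fr y) (tjet A (Γ.X q₀ fr) 2 y) ∧
    tjet A (Γ.Z q₀ fr) 3 y = 2 * inner ℝ (tjet A (Γ.P q₀ fr) 1 y) (tjet A (Γ.X q₀ fr) 2 y) +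
      inner ℝ (Γ.P q₀ fr y) (tjet A (Γ.X q₀ fr) 3 y) ∧
    tjet A (Γ.Z q₀ fr) 4 y = 3 * inner ℝ (tjet A (Γ.P q₀ fr) 2 y) (tjet A (Γ.X q₀ fr) 2 y) +
      3 * inner ℝ (tjet A (Γ.P q₀ fr) 1 y) (tjet A (Γ.X q₀ fr) 3 y) +
      inner ℝ (Γ.P q₀ fr y) (tjet A (Γ.X q₀ fr) 4 y) := by
  have hA := hB.uniqueDiffOn_left
  have hL := hB.isOpen_right
  have hX := fun k => fun z (hz : z ∈ A ×ˢ L) =>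
    hasDerivWithinAt_tjet hA hL (hv.contDiffOn_X hB) k hz
  have hP := fun k => fun z (hz : z ∈ A ×ˢ L) =>
    hasDerivWithinAt_tjet hA hL (hv.contDiffOn_P hB) k hz
  set x := tjet A (Γ.X q₀ fr) with hx
  set p := tjet A (Γ.P q₀ fr) with hp
  have hp0 : Γ.P q₀ fr y = p 0 y := (tjet_zero y).symm
  have hZ1 : ∀ z ∈ A ×ˢ L, tjet A (Γ.Z q₀ fr) 1 z = inner ℝ (p 0 z) (x 1 z) := fun z hz => by
    rw [tjet_one, hv.tderiv_Z hB hz, hx, hp, tjet_one, tjet_zero]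
  have hZ2 : ∀ z ∈ A ×ˢ L, tjet A (Γ.Z q₀ fr) 2 z =
      inner ℝ (p 0 z) (x 2 z) + inner ℝ (p 1 z) (x 1 z) := fun z hz =>
    tjet_succ_eq hA (G := fun z => inner ℝ (p 0 z) (x 1 z)) hz.1 (fun τ hτ => hZ1 _ ⟨hτ, hz.2⟩)
      ((hP 0 z hz).inner ℝ (hX 1 z hz))
  have hZ3 : ∀ z ∈ A ×ˢ L, tjet A (Γ.Z q₀ fr) 3 z =
      inner ℝ (p 0 z) (x 3 z) + inner ℝ (p 1 z) (x 2 z) +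
        (inner ℝ (p 1 z) (x 2 z) + inner ℝ (p 2 z) (x 1 z)) := fun z hz =>
    tjet_succ_eq hA (G := fun z => inner ℝ (p 0 z) (x 2 z) + inner ℝ (p 1 z) (x 1 z)) hz.1
      (fun τ hτ => hZ2 _ ⟨hτ, hz.2⟩)
      (((hP 0 z hz).inner ℝ (hX 2 z hz)).add ((hP 1 z hz).inner ℝ (hX 1 z hz)))
  have hZ4 : ∀ z ∈ A ×ˢ L, tjet A (Γ.Z q₀ fr) 4 z =
      inner ℝ (p 0 z) (x 4 z) + inner ℝ (p 1 z) (x 3 z) +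
        (inner ℝ (p 1 z) (x 3 z) + inner ℝ (p 2 z) (x 2 z)) +
        ((inner ℝ (p 1 z) (x 3 z) + inner ℝ (p 2 z) (x 2 z)) +
          (inner ℝ (p 2 z) (x 2 z) + inner ℝ (p 3 z) (x 1 z))) := fun z hz =>
    tjet_succ_eq hA (G := fun z => inner ℝ (p 0 z) (x 3 z) + inner ℝ (p 1 z) (x 2 z) +
        (inner ℝ (p 1 z) (x 2 z) + inner ℝ (p 2 z) (x 1 z))) hz.1
      (fun τ hτ => hZ3 _ ⟨hτ, hz.2⟩)
      ((((hP 0 z hz).inner ℝ (hX 3 z hz)).add ((hP 1 z hz).inner ℝ (hX 2 z hz))).add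
        (((hP 1 z hz).inner ℝ (hX 2 z hz)).add ((hP 2 z hz).inner ℝ (hX 1 z hz))))
  rw [hp0, hZ1 y hy, hZ2 y hy, hZ3 y hy, hZ4 y hy, h1]
  simp only [inner_zero_right]
  refine ⟨trivial, ?_, ?_, ?_⟩ <;> ring

/-- The second and third derivatives of `(x, z)` are independent because those of `x` are. If the
fourth one depended on them, subtracting `⟨p, ·⟩` of the relation for `x` from that for `z` would
give exactly `DependentFourth`. -/
theorem IntegralFamily.ValidOn.goodRanks_of_singular {Γ : IntegralFamily 2 IM I J}
    {fr : ContactFrame 2} (hv : Γ.ValidOn q₀ fr A L)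
    (hB : IsBox IM q₀ A L) {y : ℝ × ℝ} (hy : y ∈ A ×ˢ L) (h1 : tjet A (Γ.X q₀ fr) 1 y = 0)
    (h2 : tjet A (Γ.X q₀ fr) 2 y ≠ 0)
    (h3 : tjet A (Γ.X q₀ fr) 3 y ∉ Submodule.span ℝ {tjet A (Γ.X q₀ fr) 2 y})
    (h4 : ¬ DependentFourth ((fun k : Fin (4 + 1) => tjet A (Γ.X q₀ fr) k y),
      (fun k : Fin (4 + 1) => tjet A (Γ.P q₀ fr) k y))) :
    GoodRanks 2 (Γ.lineRank ((chart IM q₀).symm y)) := by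
  have hA := hB.uniqueDiffOn_left
  have hL := hB.isOpen_right
  have hY : ContDiffOn ℝ ∞ (Γ.Y q₀ fr) (A ×ˢ L) := (hv.contDiffOn_X hB).prodMk (hv.contDiffOn_Z hB)
  have hjet : ∀ k, tjet A (Γ.Y q₀ fr) k y =
      (tjet A (Γ.X q₀ fr) k y, tjet A (Γ.Z q₀ fr) k y) := fun k =>
    Prod.ext (tjet_clm hA hL (ContinuousLinearMap.fst ℝ fr.W ℝ) hY k hy).symm
      (tjet_clm hA hL (ContinuousLinearMap.snd ℝ fr.W ℝ) hY k hy).symm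
  obtain ⟨hz1, hz2, hz3, hz4⟩ := hv.tjet_Z hB hy h1
  set w : ℕ → fr.W × ℝ := fun k => tjet A (Γ.Y q₀ fr) k y with hw
  have hw1 : w 1 = 0 := by
    simp only [hw]
    rw [hjet, h1, hz1]
    rfl
  have hI1 : w '' Icc 1 1 = {0} := by rw [Icc_self, image_singleton, hw1]
  have hI2 : w '' Icc 1 2 = {0, w 2} := by
    rw [show (Icc 1 2 : Set ℕ) = {1, 2} by ext k; simp only [mem_Icc, mem_insert_iff, mem_singleton_iff]; omega,
      image_pair, hw1]
  have hI3 : w '' Icc 1 3 = {0, w 2, w 3} := by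
    rw [show (Icc 1 3 : Set ℕ) = {1, 2, 3} by
      ext k; simp only [mem_Icc, mem_insert_iff, mem_singleton_iff]; omega, image_insert_eq,
      image_pair, hw1]
  have hn2 : w 2 ∉ Submodule.span ℝ (w '' Icc 1 1) := by
    rw [hI1, Submodule.span_zero_singleton, Submodule.mem_bot]
    intro h
    simp only [hw] at h
    rw [hjet] at h
    exact h2 (Prod.ext_iff.1 h).1
  have hn3 : w 3 ∉ Submodule.span ℝ (w '' Icc 1 2) := by
    rw [hI2, Submodule.span_insert_zero, Submodule.mem_span_singleton]
    rintro ⟨α, h⟩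
    simp only [hw] at h
    rw [hjet, hjet] at h
    exact h3 (Submodule.mem_span_singleton.2 ⟨α, (Prod.ext_iff.1 h).1⟩)
  have hn4 : w 4 ∉ Submodule.span ℝ (w '' Icc 1 3) := by
    rw [hI3, Submodule.span_insert_zero, Submodule.mem_span_pair]
    rintro ⟨α, β, h⟩
    simp only [hw] at h
    rw [hjet, hjet, hjet] at h
    have e1 : α • tjet A (Γ.X q₀ fr) 2 y + β • tjet A (Γ.X q₀ fr) 3 y = tjet A (Γ.X q₀ fr) 4 y :=
      (Prod.ext_iff.1 h).1
    have e2 : α * tjet A (Γ.Z q₀ fr) 2 y + β * tjet A (Γ.Z q₀ fr) 3 y = tjet A (Γ.Z q₀ fr) 4 y :=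
      (Prod.ext_iff.1 h).2
    refine h4 ⟨α, β, e1.symm, ?_⟩
    change 3 * inner ℝ (tjet A (Γ.P q₀ fr) 2 y) (tjet A (Γ.X q₀ fr) 2 y) =
      2 * β * inner ℝ (tjet A (Γ.P q₀ fr) 1 y) (tjet A (Γ.X q₀ fr) 2 y) -
        3 * inner ℝ (tjet A (Γ.P q₀ fr) 1 y) (tjet A (Γ.X q₀ fr) 3 y)
    rw [hz2, hz3, hz4, ← e1, inner_add_right, real_inner_smul_right, real_inner_smul_right] at e2
    linarith
  refine Or.inr (Or.inr ⟨rfl, ?_⟩)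
  have hr : Γ.lineRank ((chart IM q₀).symm y) 4 = 1 + affRank w 4 := hv.lineRank_eq hB hy 4
  have hle := affRank_le w 4
  rw [fr.finrank_W_prod] at hle
  have h5 := affRank_succ hn2
  have h6 := affRank_succ hn3
  have h7 := affRank_succ hn4
  simp only [Nat.reduceAdd] at h5 h6 h7
  omega

end SingularPoints

/-! ### Perturbation to immersed or good points. -/

section SingularPerturbation

variable {n : ℕ} {H : Type*} [TopologicalSpace H] {IM : ModelWithCorners ℝ ℝ H}
  {I : Type*} [TopologicalSpace I] [ChartedSpace H I]
  {J : Type*} [TopologicalSpace J] [ChartedSpace ℝ J]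
  [IsManifold IM ∞ I] [IsManifold 𝓘(ℝ, ℝ) ∞ J] [T2Space I] [T2Space J]
  {Γ : IntegralFamily n IM I J} {q₀ : I × J} {fr : ContactFrame n}

/-- A family that is nowhere constant on the support of `ψ` becomes immersed or good on a box, away
from this support, after an arbitrarily small change. -/
theorem IntegralFamily.ValidOn.exists_immersed_or_goodRanks (hn : 2 ≤ n)
    {t₀ l₀ ρ ρ₁ ρ' ρ'' ρ₂ a b : ℝ} (hρ : 0 < ρ) (hρρ₁ : ρ < ρ₁) (hρ₁ : ρ₁ ≤ ρ') (hρ' : ρ' < ρ'')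
    (hρ'' : ρ'' < ρ₂) (hab : a < b) (ht₀ : t₀ ∈ Icc a b) (hIcc : Icc a b = tcball IM t₀ ρ'')
    {L : Set ℝ} (hB : IsBox IM q₀ (tball IM t₀ ρ₂) L) (hv : Γ.ValidOn q₀ fr (tball IM t₀ ρ₂) L)
    (hΛL : Metric.closedBall l₀ ρ₁ ⊆ L)
    {𝒰 : Set (IntegralFamily n IM I J)} (h𝒰 : 𝒰 ∈ 𝓝 Γ) {ψ : ℝ → ℝ} (hψ : ContDiff ℝ ∞ ψ)
    (hψ0 : ∀ t ∉ Metric.closedBall t₀ ρ', ψ t = 0) (hψρ : ∀ t ∈ Metric.ball t₀ ρ, ψ t = 0)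
    (hpos : ∀ l ∈ L, 0 < ∫ τ in a..b, ψ τ *
      (inner ℝ (tderiv (tball IM t₀ ρ₂) (Γ.X q₀ fr) (τ, l))
        (tderiv (tball IM t₀ ρ₂) (Γ.X q₀ fr) (τ, l)) +
      inner ℝ (tderiv (tball IM t₀ ρ₂) (Γ.P q₀ fr) (τ, l))
        (tderiv (tball IM t₀ ρ₂) (Γ.P q₀ fr) (τ, l)))) :
    ∃ Γ' ∈ 𝒰, (∀ q ∉ (chart IM q₀).symm '' (tball IM t₀ ρ₂ ×ˢ L), Γ'.toFun q = Γ.toFun q) ∧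
      ∀ y ∈ tball IM t₀ ρ ×ˢ Metric.ball l₀ ρ, 2 ≤ Γ'.lineRank ((chart IM q₀).symm y) 1 ∨
        GoodRanks n (Γ'.lineRank ((chart IM q₀).symm y)) := by
  obtain ⟨φ, hφ, hφ1, hφ0, -⟩ := exists_cutoff t₀ hρ hρρ₁
  obtain ⟨χ, hχ, hχ1, hχ0, -⟩ := exists_cutoff l₀ hρ hρρ₁
  let V := (Fin (4 + 1) → fr.W) × (Fin (4 + 1) → fr.W)
  let κ : (ℝ × ℝ) × V → ℝ := fun w => φ w.1.1 * χ w.1.2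
  have hκ : ContDiff ℝ ∞ κ := (hφ.comp contDiff_fst.fst).mul (hχ.comp contDiff_fst.snd)
  have hjf : ∀ σ : (ℝ × ℝ) × V → (Fin (4 + 1) → fr.W), ContDiff ℝ ∞ σ →
      ContDiff ℝ ∞ fun w => jetFlow fr.W 4 (w.1.1 - t₀) (σ w) 0 := by
    intro σ hσ
    have h1 : ContDiff ℝ ∞ fun w : (ℝ × ℝ) × V => jetFlow fr.W 4 (w.1.1 - t₀) (σ w) :=
      ((contDiff_jetFlow fr.W 4).comp (contDiff_fst.fst.sub contDiff_const)).clm_apply hσ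
    exact contDiff_pi.1 h1 0
  let c : (ℝ × ℝ) × V → fr.W := fun w => κ w • jetFlow fr.W 4 (w.1.1 - t₀) w.2.1 0
  let d : (ℝ × ℝ) × V → fr.W := fun w => κ w • jetFlow fr.W 4 (w.1.1 - t₀) w.2.2 0
  have hc : ContDiff ℝ ∞ c := hκ.smul (hjf _ contDiff_snd.fst)
  have hd : ContDiff ℝ ∞ d := hκ.smul (hjf _ contDiff_snd.snd)
  set A := tball IM t₀ ρ₂ with hAdef
  have hA := hB.uniqueDiffOn_left
  have hL := hB.isOpen_right
  have hev := hv.eventually_change_compensated (hρ.le.trans (hρρ₁.le.trans hρ₁)) hρ' hρ'' hab ht₀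
    hIcc hB (isCompact_closedBall l₀ ρ₁) hΛL h𝒰 hψ hψ0 hpos hc hd (fun y => by simp [c, d])
    (fun s y hy hyC => by
      have h0 : κ (y, s) = 0 := by
        simp only [κ]
        by_cases h1 : y.1 ∈ Metric.ball t₀ ρ₁
        · rw [hχ0 y.2, mul_zero]
          exact fun h2 => hyC ⟨⟨hy.1.1, Metric.closedBall_subset_closedBall hρ₁
            (Metric.ball_subset_closedBall h1)⟩, Metric.ball_subset_closedBall h2⟩
        · rw [hφ0 y.1 h1, zero_mul]
      simp [c, d, h0])
  let B : Set (ℝ × ℝ) := tball IM t₀ ρ ×ˢ Metric.ball l₀ ρ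
  have hBA : B ⊆ A ×ˢ L := prod_mono
    (inter_subset_inter_right _ (Metric.ball_subset_ball (by linarith)))
    ((Metric.ball_subset_ball hρρ₁.le).trans (Metric.ball_subset_closedBall.trans hΛL))
  have hX := hv.contDiffOn_X hB
  have hP := hv.contDiffOn_P hB
  obtain ⟨S, hthin, hS⟩ := exists_nonimmersedStrata hn fr.finrank_W
  let AA : ℝ → V →L[ℝ] V := fun τ => (jetFlow fr.W 4 τ).prodMap (jetFlow fr.W 4 τ)
  have hAA : ContDiff ℝ ∞ AA := contDiff_clm_apply_iff.2 fun s =>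
    ((contDiff_jetFlow fr.W 4).clm_apply contDiff_const).prodMk
      ((contDiff_jetFlow fr.W 4).clm_apply contDiff_const)
  -- On the inner box `ψ = 0`, so the compensation is not felt there, and `s` translates the jet of
  -- `(x, p)` of order four by the invertible flow.
  obtain ⟨s, ⟨Γ', hΓ', hoff, hvΓ, hcoord⟩, hs⟩ := exists_forall_notMem_of_isThin hthin (B := B)
    ((convex_tball t₀ ρ).prod (convex_ball l₀ ρ))
    (j := fun y => ((fun k => tjet A (Γ.X q₀ fr) k y), (fun k => tjet A (Γ.P q₀ fr) k y)))
    (ContDiffOn.prodMk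
      (contDiffOn_pi.2 fun k => ((hX.tjet hA hL k).mono hBA).of_le (by exact_mod_cast le_top))
      (contDiffOn_pi.2 fun k => ((hP.tjet hA hL k).mono hBA).of_le (by exact_mod_cast le_top)))
    (A := fun y => AA (y.1 - t₀)) (A' := fun y => AA (-(y.1 - t₀)))
    ((hAA.comp (contDiff_fst.sub contDiff_const).neg).contDiffOn.of_le (by exact_mod_cast le_top))
    (fun y _ s => Prod.ext (jetFlow_neg_jetFlow fr.W 4 (y.1 - t₀) s.1)
      (jetFlow_neg_jetFlow fr.W 4 (y.1 - t₀) s.2)) hev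
  refine ⟨Γ', hΓ', hoff, fun y hy => ?_⟩
  have hyA := hBA hy
  have hjet : ∀ (G G' : ℝ × ℝ → fr.W) (σ : Fin (4 + 1) → fr.W), ContDiffOn ℝ ∞ G (A ×ˢ L) →
      (∀ z ∈ A ×ˢ L, ψ z.1 = 0 → G' z = G z + κ (z, s) • jetFlow fr.W 4 (z.1 - t₀) σ 0) →
      ∀ k : Fin (4 + 1), tjet A G' k y = tjet A G k y + jetFlow fr.W 4 (y.1 - t₀) σ k := by
    intro G G' σ hG hGG' k
    have h1 : tjet A G' k y = tjet A (fun y => G y + jetFlow fr.W 4 (y.1 - t₀) σ 0) k y := by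
      refine tjet_congr_of_eventuallyEq hyA.1 ?_ k
      filter_upwards [self_mem_nhdsWithin,
        mem_nhdsWithin_of_mem_nhds (Metric.isOpen_ball.mem_nhds hy.1.2)] with τ hτ hτb
      rw [hGG' (τ, y.2) ⟨hτ, hyA.2⟩ (hψρ τ hτb)]
      simp only [κ]
      rw [hφ1 τ (Metric.ball_subset_closedBall hτb), hχ1 _ (Metric.ball_subset_closedBall hy.2),
        mul_one, one_smul]
    have h4 : ContDiff ℝ ∞ fun y : ℝ × ℝ => jetFlow fr.W 4 (y.1 - t₀) σ :=
      ((contDiff_jetFlow fr.W 4).comp (contDiff_fst.sub contDiff_const)).clm_apply contDiff_const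
    rw [h1, tjet_add hA hG (U := L) (G := fun y : ℝ × ℝ => jetFlow fr.W 4 (y.1 - t₀) σ 0)
      (contDiff_pi.1 h4 0).contDiffOn k hyA]
    congr 1
    exact iteratedDerivWithin_jetFlow hA t₀ σ k.2 hyA.1
  have hjX := hjet _ _ s.1 hX fun z hz hψz => (hcoord z hz hψz).1
  have hjP := hjet _ _ s.2 hP fun z hz hψz => (hcoord z hz hψz).2
  have hw := hS ((fun k : Fin (4 + 1) => tjet A (Γ'.X q₀ fr) k y),
    (fun k : Fin (4 + 1) => tjet A (Γ'.P q₀ fr) k y)) (fun i hi => hs y hy i (by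
      rw [funext hjX, funext hjP] at hi
      exact hi))
  by_cases h1 : tderiv A (Γ'.X q₀ fr) y = 0
  · refine Or.inr ?_
    rw [← tjet_one] at h1
    rcases hw with hw | ⟨rfl, h2, h3, h4⟩
    · exact absurd h1 hw
    · exact hvΓ.goodRanks_of_singular hB hyA h1 h2 h3 h4
  · exact Or.inl ((hvΓ.immersed_iff hB hyA).2 h1)

end SingularPerturbation

/-! ### Finite order and flatness along a line. -/

section Flatness

variable {W : Type} [NormedAddCommGroup W] [NormedSpace ℝ W]

/-- Either `F` has a finite order of vanishing along `λ = l`, or it is divisible by all powers of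
`λ - l`. -/
theorem exists_order_or_forall [CompleteSpace W] {T L : Set ℝ} (hT : IsOpen T) (hL : IsOpen L)
    (hLc : Convex ℝ L) {l : ℝ} (hl : l ∈ L) {F : ℝ × ℝ → W} (hF : ContDiffOn ℝ ∞ F (T ×ˢ L)) :
    (∃ (k : ℕ) (G : ℝ × ℝ → W), ContDiffOn ℝ ∞ G (T ×ˢ L) ∧
      (∀ y ∈ T ×ˢ L, F y = (y.2 - l) ^ k • G y) ∧ ∃ t ∈ T, G (t, l) ≠ 0) ∨
    ∀ k : ℕ, ∃ G : ℝ × ℝ → W, ContDiffOn ℝ ∞ G (T ×ˢ L) ∧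
      ∀ y ∈ T ×ˢ L, F y = (y.2 - l) ^ k • G y := by
  by_contra! h
  obtain ⟨h1, k, h2⟩ := h
  have : ∀ k : ℕ, ∃ G : ℝ × ℝ → W, ContDiffOn ℝ ∞ G (T ×ˢ L) ∧
      ∀ y ∈ T ×ˢ L, F y = (y.2 - l) ^ k • G y := by
    intro k
    induction k with
    | zero => exact ⟨F, hF, fun y _ => by rw [pow_zero, one_smul]⟩
    | succ k ih =>
      obtain ⟨G, hG, hFG⟩ := ih
      -- Excluding finite order means that each quotient vanishes on all of `λ = l`, so another
      -- factor `λ - l` can be split off.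
      obtain ⟨G₁, hG₁, h3⟩ := exists_eq_sub_smul hT hL hLc hl hG (h1 k G hG hFG)
      exact ⟨G₁, hG₁, fun y hy => by rw [hFG y hy, h3 y hy, smul_smul, pow_succ]⟩
  obtain ⟨G, hG, hFG⟩ := this k
  obtain ⟨y, hy, hne⟩ := h2 G hG
  exact hne (hFG y hy)

/-- Each differentiation lowers the power by one and keeps the shape of the function. After `k` of
them one factor, zero on `λ = l`, is left. -/
theorem iteratedFDeriv_pow_smul_eq_zero {D : Set (ℝ × ℝ)} (hD : IsOpen D) {l t : ℝ}
    (hy : (t, l) ∈ D) (k : ℕ) {G : ℝ × ℝ → W} (hG : ContDiffOn ℝ ∞ G D) {F : ℝ × ℝ → W}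
    (hF : ∀ y ∈ D, F y = (y.2 - l) ^ (k + 1) • G y) : iteratedFDeriv ℝ k F (t, l) = 0 := by
  induction k generalizing W with
  | zero =>
    rw [← norm_eq_zero, norm_iteratedFDeriv_zero, hF _ hy]
    simp
  | succ k ih =>
    rw [← norm_eq_zero, ← norm_iteratedFDeriv_fderiv, norm_eq_zero]
    let κ : ℝ × ℝ →L[ℝ] ℝ := ContinuousLinearMap.snd ℝ ℝ ℝ
    let G' : ℝ × ℝ → (ℝ × ℝ →L[ℝ] W) := fun y =>
      (y.2 - l) • fderiv ℝ G y + ((k + 2 : ℕ) : ℝ) • κ.smulRight (G y)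
    refine ih (G := G') ?_ fun y hy' => ?_
    · refine ContDiffOn.add (ContDiffOn.smul (contDiffOn_snd.sub contDiffOn_const)
        (hG.fderiv_of_isOpen hD (m := ∞) (by simp))) (ContDiffOn.const_smul _ ?_)
      exact (ContinuousLinearMap.smulRightL ℝ (ℝ × ℝ) W κ).contDiff.comp_contDiffOn hG
    · have h1 : F =ᶠ[𝓝 y] fun y => (y.2 - l) ^ (k + 2) • G y := by
        filter_upwards [hD.mem_nhds hy'] with z hz using hF z hz
      have hGd : HasFDerivAt G (fderiv ℝ G y) y :=
        ((hG.contDiffAt (hD.mem_nhds hy')).differentiableAt (by simp)).hasFDerivAt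
      have hs : HasFDerivAt (fun y : ℝ × ℝ => y.2 - l) κ y := κ.hasFDerivAt.sub_const l
      have h2 := (hs.pow (k + 2)).smul hGd
      rw [h1.fderiv_eq]
      refine h2.fderiv.trans ?_
      refine ContinuousLinearMap.ext fun v => ?_
      simp only [G', add_apply, smul_apply, ContinuousLinearMap.smulRight_apply,
        Nat.add_succ_sub_one, smul_eq_mul, nsmul_eq_mul]
      module

/-- A function that is flat along `λ = l` for all `l ∈ Y` is small of all orders near `Y`. -/
theorem exists_norm_iteratedFDeriv_le_pow {T L : Set ℝ} (hT : IsOpen T) (hL : IsOpen L)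
    {F : ℝ × ℝ → W} (hF : ContDiffOn ℝ ∞ F (T ×ˢ L)) {K Y : Set ℝ} {ρ₀ : ℝ} (hK : IsCompact K)
    (hKT : K ⊆ T) (hY : IsCompact (Metric.cthickening ρ₀ Y))
    (hYL : Metric.cthickening ρ₀ Y ⊆ L)
    (hflat : ∀ t ∈ T, ∀ l ∈ Y, ∀ j, iteratedFDeriv ℝ j F (t, l) = 0) (N i : ℕ) :
    ∃ C, 0 ≤ C ∧ ∀ t ∈ K, ∀ l ∈ Y, ∀ μ, |μ - l| ≤ ρ₀ →
      ‖iteratedFDeriv ℝ i F (t, μ)‖ ≤ C * |μ - l| ^ N := by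
  have ho : IsOpen (T ×ˢ L) := hT.prod hL
  have hmem : ∀ l ∈ Y, ∀ μ, |μ - l| ≤ ρ₀ → μ ∈ Metric.cthickening ρ₀ Y := fun l hl μ hμ =>
    Metric.mem_cthickening_of_dist_le μ l ρ₀ Y hl (by rwa [Real.dist_eq])
  induction N generalizing i with
  | zero =>
    have hc : ContinuousOn (iteratedFDeriv ℝ i F) (T ×ˢ L) := fun y hy =>
      ((hF.contDiffAt (ho.mem_nhds hy)).continuousAt_iteratedFDeriv
        (by exact_mod_cast le_top)).continuousWithinAt
    obtain ⟨C, hC⟩ := (hK.prod hY).exists_bound_of_continuousOn (hc.mono (prod_mono hKT hYL))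
    refine ⟨max C 0, le_max_right _ _, fun t ht l hl μ hμ => ?_⟩
    rw [pow_zero, mul_one]
    exact (hC (t, μ) ⟨ht, hmem l hl μ hμ⟩).trans (le_max_left _ _)
  | succ N ih =>
    -- The derivative of order `i` vanishes at `λ = l`. Integrating the bound for the order `i + 1`
    -- along `λ` gains one power of the distance.
    obtain ⟨C, hC0, hC⟩ := ih (i + 1)
    refine ⟨C, hC0, fun t ht l hl μ hμ => ?_⟩
    have hseg : ∀ ν ∈ uIcc l μ, |ν - l| ≤ |μ - l| := fun ν hν =>
      abs_sub_left_of_mem_uIcc hν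
    have hder : ∀ ν ∈ uIcc l μ, HasDerivWithinAt (fun ν => iteratedFDeriv ℝ i F (t, ν))
        (fderiv ℝ (iteratedFDeriv ℝ i F) (t, ν) (0, 1)) (uIcc l μ) ν := by
      intro ν hν
      have h1 : (t, ν) ∈ T ×ˢ L := ⟨hKT ht, hYL (hmem l hl ν ((hseg ν hν).trans hμ))⟩
      have h2 : DifferentiableAt ℝ (iteratedFDeriv ℝ i F) (t, ν) :=
        (hF.contDiffAt (ho.mem_nhds h1)).differentiableAt_iteratedFDeriv
          (by exact_mod_cast ENat.natCast_lt_top i)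
      have h3 : HasDerivAt (fun ν : ℝ => (t, ν)) ((0 : ℝ), (1 : ℝ)) ν :=
        (hasDerivAt_const ν t).prodMk (hasDerivAt_id ν)
      exact (h2.hasFDerivAt.comp_hasDerivAt ν h3).hasDerivWithinAt
    have hb : ∀ ν ∈ uIcc l μ, ‖fderiv ℝ (iteratedFDeriv ℝ i F) (t, ν) (0, 1)‖ ≤ C * |μ - l| ^ N := by
      intro ν hν
      refine (ContinuousLinearMap.le_opNorm _ _).trans ?_
      rw [norm_fderiv_iteratedFDeriv, Prod.norm_mk, norm_zero, norm_one, max_eq_right zero_le_one,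
        mul_one]
      refine (hC t ht l hl ν ((hseg ν hν).trans hμ)).trans ?_
      exact mul_le_mul_of_nonneg_left (pow_le_pow_left₀ (abs_nonneg _) (hseg ν hν) N) hC0
    have h4 := (convex_uIcc l μ).norm_image_sub_le_of_norm_hasDerivWithin_le hder hb
      left_mem_uIcc right_mem_uIcc
    rw [hflat t (hKT ht) l hl i, sub_zero, Real.norm_eq_abs] at h4
    rw [pow_succ, ← mul_assoc]
    exact h4

end Flatness

/-! ### Cutoff functions at a given scale. -/

section Grid

/-- A bump function whose integer translates form a partition of unity. -/
def gridBump (x : ℝ) : ℝ := Real.smoothTransition (x + 1) - Real.smoothTransition x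

theorem contDiff_gridBump : ContDiff ℝ ∞ gridBump :=
  (Real.smoothTransition.contDiff.comp (contDiff_id.add contDiff_const)).sub
    Real.smoothTransition.contDiff

theorem gridBump_nonneg (x : ℝ) : 0 ≤ gridBump x :=
  sub_nonneg.2 (Real.smoothTransition.monotone (by linarith))

theorem gridBump_eq_zero {x : ℝ} (hx : 1 ≤ |x|) : gridBump x = 0 := by
  rcases le_abs.1 hx with h | h
  · simp [gridBump, Real.smoothTransition.one_of_one_le h,
      Real.smoothTransition.one_of_one_le (show 1 ≤ x + 1 by linarith)]
  · simp [gridBump, Real.smoothTransition.zero_of_nonpos (show x ≤ 0 by linarith),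
      Real.smoothTransition.zero_of_nonpos (show x + 1 ≤ 0 by linarith)]

theorem tsupport_gridBump : tsupport gridBump ⊆ Icc (-1) 1 :=
  closure_minimal (fun x hx => by
    by_contra h
    refine hx (gridBump_eq_zero ?_)
    by_contra! h2
    exact h ⟨(abs_lt.1 h2).1.le, (abs_lt.1 h2).2.le⟩) isClosed_Icc

/-- The sum telescopes: the smooth transition is 1 beyond 1 and 0 before 0, and the two middle
values cancel. -/
theorem gridBump_add (x : ℝ) :
    gridBump (x - ⌊x⌋) + gridBump (x - (⌊x⌋ + 1 : ℤ)) = 1 := by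
  have h1 := Int.fract_nonneg x
  have h2 := Int.fract_lt_one x
  rw [Int.fract] at h1 h2
  simp only [gridBump]
  push_cast
  rw [show x - (⌊x⌋ + 1 : ℝ) + 1 = x - ⌊x⌋ by ring,
    Real.smoothTransition.one_of_one_le (show 1 ≤ x - ⌊x⌋ + 1 by linarith),
    Real.smoothTransition.zero_of_nonpos (show x - (⌊x⌋ + 1 : ℝ) ≤ 0 by linarith)]
  ring

/-- The partial sum of the partition of unity over the grid points in `K`. -/
def gridSum (K : Finset ℤ) (x : ℝ) : ℝ := ∑ k ∈ K, gridBump (x - k)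

theorem contDiff_gridSum (K : Finset ℤ) : ContDiff ℝ ∞ (gridSum K) :=
  ContDiff.sum fun _ _ => contDiff_gridBump.comp (contDiff_id.sub contDiff_const)

theorem gridSum_nonneg (K : Finset ℤ) (x : ℝ) : 0 ≤ gridSum K x :=
  Finset.sum_nonneg fun _ _ => gridBump_nonneg _

theorem gridSum_eq_zero {K : Finset ℤ} {x : ℝ} (h : ∀ k ∈ K, 1 ≤ |x - k|) : gridSum K x = 0 :=
  Finset.sum_eq_zero fun k hk => gridBump_eq_zero (h k hk)

theorem sum_pair_gridBump (x : ℝ) :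
    ∑ k ∈ ({⌊x⌋, ⌊x⌋ + 1} : Finset ℤ), gridBump (x - k) = 1 := by
  rw [Finset.sum_pair (by simp)]
  exact gridBump_add x

theorem gridBump_eq_zero_of_notMem {x : ℝ} {k : ℤ} (hk : k ∉ ({⌊x⌋, ⌊x⌋ + 1} : Finset ℤ)) :
    gridBump (x - k) = 0 := by
  refine gridBump_eq_zero ?_
  by_contra! h
  rw [abs_lt] at h
  apply hk
  have h1 : ⌊x⌋ ≤ k := by
    have : (⌊x⌋ : ℝ) < k + 1 := (Int.floor_le x).trans_lt (by linarith)
    exact Int.lt_add_one_iff.1 (by exact_mod_cast this)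
  have h2 : k ≤ ⌊x⌋ + 1 := by
    have h3 := Int.lt_floor_add_one x
    have : (k : ℝ) < ⌊x⌋ + 1 + 1 := by linarith
    exact Int.lt_add_one_iff.1 (by exact_mod_cast this)
  simp only [Finset.mem_insert, Finset.mem_singleton]
  omega

theorem gridSum_le_one (K : Finset ℤ) (x : ℝ) : gridSum K x ≤ 1 := by
  classical
  calc gridSum K x ≤ ∑ k ∈ K ∪ {⌊x⌋, ⌊x⌋ + 1}, gridBump (x - k) :=
        Finset.sum_le_sum_of_subset_of_nonneg Finset.subset_union_left
          fun _ _ _ => gridBump_nonneg _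
    _ = 1 := by
        rw [← sum_pair_gridBump x]
        exact (Finset.sum_subset Finset.subset_union_right fun k _ hk =>
          gridBump_eq_zero_of_notMem hk).symm

theorem gridSum_eq_one {K : Finset ℤ} {x : ℝ} (h : ∀ k : ℤ, |x - k| ≤ 1 → k ∈ K) :
    gridSum K x = 1 := by
  have h1 := Int.floor_le x
  have h2 := Int.lt_floor_add_one x
  rw [← sum_pair_gridBump x]
  refine (Finset.sum_subset (fun k hk => h k ?_) fun k _ hk => gridBump_eq_zero_of_notMem hk).symm
  simp only [Finset.mem_insert, Finset.mem_singleton] at hk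
  rw [abs_le]
  rcases hk with rfl | rfl
  · constructor <;> linarith
  · push_cast
    constructor <;> linarith

/-- The derivatives of the partial sums are bounded independently of the set of grid points. -/
theorem exists_norm_iteratedFDeriv_gridSum_le (r : ℕ) :
    ∃ B, 0 ≤ B ∧ ∀ K : Finset ℤ, ∀ i ≤ r, ∀ x, ‖iteratedFDeriv ℝ i (gridSum K) x‖ ≤ B := by
  have h1 : ∀ i : ℕ, ∃ B, 0 ≤ B ∧ ∀ x, ‖iteratedFDeriv ℝ i gridBump x‖ ≤ B := by
    intro i
    have hcs : HasCompactSupport gridBump :=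
      isCompact_Icc.of_isClosed_subset (isClosed_tsupport _) tsupport_gridBump
    obtain ⟨B, hB⟩ := (hcs.iteratedFDeriv i).exists_bound_of_continuous
      (contDiff_gridBump.continuous_iteratedFDeriv (m := i) (by exact_mod_cast le_top))
    exact ⟨B, (norm_nonneg _).trans (hB 0), hB⟩
  choose B hB0 hB using h1
  refine ⟨3 * ∑ i ∈ Finset.range (r + 1), B i,
    mul_nonneg (by norm_num) (Finset.sum_nonneg fun i _ => hB0 i), fun K i hi x => ?_⟩
  have hBi : B i ≤ ∑ i ∈ Finset.range (r + 1), B i :=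
    Finset.single_le_sum (fun i _ => hB0 i) (Finset.mem_range.2 (Nat.lt_succ_of_le hi))
  have hsum : iteratedFDeriv ℝ i (gridSum K) x =
      ∑ k ∈ K, iteratedFDeriv ℝ i gridBump (x - (k : ℝ)) := by
    refine (iteratedFDeriv_fun_sum_apply (f := fun (k : ℤ) (y : ℝ) => gridBump (y - k))
      fun k _ => ((contDiff_gridBump.comp (contDiff_id.sub contDiff_const)).of_le
        (by exact_mod_cast le_top)).contDiffAt).trans ?_
    exact Finset.sum_congr rfl fun k _ => iteratedFDeriv_comp_sub i (k : ℝ) x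
  have hzero : ∀ k ∈ K, k ∉ Finset.Icc (⌈x - 1⌉) ⌊x + 1⌋ →
      ‖iteratedFDeriv ℝ i gridBump (x - (k : ℝ))‖ = 0 := by
    intro k _ hk
    rw [norm_eq_zero]
    by_contra hne
    have h3 := tsupport_gridBump (support_iteratedFDeriv_subset (𝕜 := ℝ) i
      (Function.mem_support.2 hne))
    refine hk (Finset.mem_Icc.2 ⟨Int.ceil_le.2 ?_, Int.le_floor.2 ?_⟩)
    · linarith [h3.2]
    · linarith [h3.1]
  -- At most three integers lie within distance 1 of `x`, however large `K` is.
  have hcard : ((Finset.Icc (⌈x - 1⌉) ⌊x + 1⌋).card : ℝ) ≤ 3 := by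
    rw [Int.card_Icc]
    have h4 := Int.floor_le (x + 1)
    have h5 := Int.le_ceil (x - 1)
    have h6 : (⌊x + 1⌋ + 1 - ⌈x - 1⌉ : ℤ) ≤ 3 := by
      have : ((⌊x + 1⌋ + 1 - ⌈x - 1⌉ : ℤ) : ℝ) ≤ 3 := by push_cast; linarith
      exact_mod_cast this
    exact_mod_cast (show (⌊x + 1⌋ + 1 - ⌈x - 1⌉).toNat ≤ 3 by omega)
  rw [hsum]
  refine (norm_sum_le _ _).trans ?_
  classical
  rw [← Finset.sum_filter_add_sum_filter_not K (· ∈ Finset.Icc (⌈x - 1⌉) ⌊x + 1⌋),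
    Finset.sum_eq_zero (s := K.filter (· ∉ Finset.Icc (⌈x - 1⌉) ⌊x + 1⌋)) fun k hk =>
      hzero k (Finset.mem_filter.1 hk).1 (Finset.mem_filter.1 hk).2, add_zero]
  calc _ ≤ ∑ k ∈ Finset.Icc (⌈x - 1⌉) ⌊x + 1⌋, ‖iteratedFDeriv ℝ i gridBump (x - (k : ℝ))‖ :=
        Finset.sum_le_sum_of_subset_of_nonneg (fun k hk => (Finset.mem_filter.1 hk).2)
          fun _ _ _ => norm_nonneg _
    _ ≤ (Finset.Icc (⌈x - 1⌉) ⌊x + 1⌋).card • B i := Finset.sum_le_card_nsmul _ _ _ fun k _ => hB i _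
    _ ≤ 3 * ∑ i ∈ Finset.range (r + 1), B i := by
        rw [nsmul_eq_mul]
        exact mul_le_mul hcard hBi (hB0 i) (by norm_num)

/-- A compact set has a cutoff function adapted to the scale `ρ`. -/
theorem exists_grid_cutoff {Y : Set ℝ} (hY : IsCompact Y) {ρ : ℝ} (hρ : 0 < ρ) :
    ∃ K : Finset ℤ, (∀ x, (∃ y ∈ Y, |x - y| ≤ ρ) → gridSum K (ρ⁻¹ * x) = 1) ∧
      ∀ x, (∀ y ∈ Y, 3 * ρ < |x - y|) → gridSum K (ρ⁻¹ * x) = 0 := by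
  have habs : ∀ x (k : ℝ), |ρ⁻¹ * x - k| = ρ⁻¹ * |x - ρ * k| := fun x k => by
    rw [← abs_of_pos (inv_pos.2 hρ), ← abs_mul, abs_of_pos (inv_pos.2 hρ), mul_sub,
      inv_mul_cancel_left₀ hρ.ne']
  -- The chosen grid points `ρ k` lie within `2 ρ` of `Y`. A point within `ρ` of `Y` sees only
  -- chosen neighbours, and a point farther than `3 ρ` sees none of them.
  have hfin : {k : ℤ | ∃ y ∈ Y, |y - ρ * k| ≤ 2 * ρ}.Finite := by
    obtain ⟨R, hR⟩ := hY.isBounded.exists_norm_le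
    refine (finite_Icc ⌈-(ρ⁻¹ * R + 2)⌉ ⌊ρ⁻¹ * R + 2⌋).subset ?_
    rintro k ⟨y, hy, hk⟩
    have h1 := hR y hy
    rw [Real.norm_eq_abs, abs_le] at h1
    rw [abs_le] at hk
    have h2 : ρ * (ρ⁻¹ * R + 2) = R + 2 * ρ := by field_simp
    constructor
    · refine Int.ceil_le.2 (le_of_mul_le_mul_left ?_ hρ)
      rw [mul_neg, h2]
      linarith
    · refine Int.le_floor.2 (le_of_mul_le_mul_left ?_ hρ)
      rw [h2]
      linarith
  refine ⟨hfin.toFinset, fun x ⟨y, hy, hxy⟩ => gridSum_eq_one fun k hk => ?_,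
    fun x hx => gridSum_eq_zero fun k hk => ?_⟩
  · rw [Finite.mem_toFinset]
    refine ⟨y, hy, ?_⟩
    rw [habs, inv_mul_le_iff₀ hρ, mul_one] at hk
    have := abs_sub_le y x (ρ * k)
    rw [abs_sub_comm y x] at this
    linarith
  · rw [Finite.mem_toFinset] at hk
    obtain ⟨y, hy, hk⟩ := hk
    rw [habs, le_inv_mul_iff₀ hρ, mul_one]
    have h1 := hx y hy
    have h2 := abs_sub_le x (ρ * k) y
    rw [abs_sub_comm (ρ * (k : ℝ)) y] at h2
    linarith

end Grid

/-! ### Slowing down time near flat parameters. -/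

section SlowDown

/-- The change of the time variable with speed field `γ` and amplitude `χ`. -/
def slowDown (χ γ : ℝ → ℝ) (y : ℝ × ℝ) : ℝ × ℝ := (y.1 + χ y.2 * γ y.1, y.2)

theorem contDiff_slowDown {χ γ : ℝ → ℝ} (hχ : ContDiff ℝ ∞ χ) (hγ : ContDiff ℝ ∞ γ) :
    ContDiff ℝ ∞ (slowDown χ γ) :=
  (contDiff_fst.add ((hχ.comp contDiff_snd).mul (hγ.comp contDiff_fst))).prodMk contDiff_snd

theorem norm_iteratedFDeriv_id_le {E : Type*} [NormedAddCommGroup E] [NormedSpace ℝ E] (x : E)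
    {i : ℕ} (hi : 1 ≤ i) : ‖iteratedFDeriv ℝ i (fun x : E => x) x‖ ≤ 1 := by
  obtain ⟨j, rfl⟩ := Nat.exists_eq_add_of_le' hi
  rw [← norm_iteratedFDeriv_fderiv]
  have h1 : fderiv ℝ (fun x : E => x) = fun _ => ContinuousLinearMap.id ℝ E := by
    funext y
    exact fderiv_fun_id
  rw [h1]
  rcases Nat.eq_zero_or_pos j with rfl | hj
  · rw [norm_iteratedFDeriv_zero]
    exact ContinuousLinearMap.norm_id_le
  · rw [iteratedFDeriv_const_of_ne hj.ne', Pi.zero_apply, norm_zero]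
    exact zero_le_one

theorem norm_iteratedFDeriv_comp_clm_le {E E' W : Type*} [NormedAddCommGroup E] [NormedSpace ℝ E]
    [NormedAddCommGroup E'] [NormedSpace ℝ E'] [NormedAddCommGroup W] [NormedSpace ℝ W]
    {f : E' → W} (hf : ContDiff ℝ ∞ f) (g : E →L[ℝ] E') (x : E) (i : ℕ) :
    ‖iteratedFDeriv ℝ i (fun y => f (g y)) x‖ ≤ ‖iteratedFDeriv ℝ i f (g x)‖ * ‖g‖ ^ i := by
  have h1 := g.iteratedFDeriv_comp_right hf x (i := i) (by exact_mod_cast le_top)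
  have h2 : (fun y => f (g y)) = f ∘ g := rfl
  rw [h2, h1]
  refine (ContinuousMultilinearMap.norm_compContinuousLinearMap_le _ _).trans ?_
  simp

/-- Each derivative of the cutoff in `λ` costs a factor `ρ⁻¹`, with constants independent of the
grid set. The form of an `i`-th power is the one required by the estimate for compositions. -/
theorem norm_iteratedFDeriv_slowDown_le {K : Finset ℤ} {γ : ℝ → ℝ} (hγ : ContDiff ℝ ∞ γ)
    {ρ : ℝ} (hρ : 0 < ρ) (hρ1 : ρ ≤ 1) {B B' : ℝ} (hB0 : 0 ≤ B) (hB'0 : 0 ≤ B') {r : ℕ}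
    (hB : ∀ i ≤ r, ∀ x, ‖iteratedFDeriv ℝ i (gridSum K) x‖ ≤ B) {y : ℝ × ℝ}
    (hB' : ∀ i ≤ r, ‖iteratedFDeriv ℝ i γ y.1‖ ≤ B') {i : ℕ} (hi : 1 ≤ i) (hir : i ≤ r) :
    ‖iteratedFDeriv ℝ i (slowDown (fun l => gridSum K (ρ⁻¹ * l)) γ) y‖ ≤
      (2 * (1 + B * B') * ρ⁻¹) ^ i := by
  let g : ℝ × ℝ →L[ℝ] ℝ := ρ⁻¹ • ContinuousLinearMap.snd ℝ ℝ ℝ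
  have hg : ‖g‖ ≤ ρ⁻¹ := by
    rw [norm_smul, Real.norm_eq_abs, abs_of_pos (inv_pos.2 hρ)]
    exact mul_le_of_le_one_right (inv_pos.2 hρ).le (ContinuousLinearMap.norm_snd_le ℝ ℝ ℝ)
  have hρ' : 1 ≤ ρ⁻¹ := (one_le_inv₀ hρ).2 hρ1
  let f₁ : ℝ × ℝ → ℝ := fun y => gridSum K (g y)
  let f₂ : ℝ × ℝ → ℝ := fun y => γ (ContinuousLinearMap.fst ℝ ℝ ℝ y)
  have hf₁ : ContDiff ℝ ∞ f₁ := (contDiff_gridSum K).comp g.contDiff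
  have hf₂ : ContDiff ℝ ∞ f₂ := hγ.comp contDiff_fst
  have hb₁ : ∀ j ≤ r, ‖iteratedFDeriv ℝ j f₁ y‖ ≤ B * ρ⁻¹ ^ j := fun j hj =>
    (norm_iteratedFDeriv_comp_clm_le (contDiff_gridSum K) g y j).trans
      (mul_le_mul (hB j hj _) (pow_le_pow_left₀ (norm_nonneg _) hg j) (by positivity) hB0)
  have hb₂ : ∀ j ≤ r, ‖iteratedFDeriv ℝ j f₂ y‖ ≤ B' := fun j hj =>
    (norm_iteratedFDeriv_comp_clm_le hγ (ContinuousLinearMap.fst ℝ ℝ ℝ) y j).trans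
      ((mul_le_mul (hB' j hj) (pow_le_one₀ (norm_nonneg _) (ContinuousLinearMap.norm_fst_le ℝ ℝ ℝ))
        (by positivity) hB'0).trans (mul_one _).le)
  have hprod : ‖iteratedFDeriv ℝ i (fun y => f₁ y * f₂ y) y‖ ≤ B * B' * (ρ⁻¹ + 1) ^ i := by
    refine (norm_iteratedFDeriv_mul_le hf₁ hf₂ y (n := i) (by exact_mod_cast le_top)).trans ?_
    rw [add_pow, Finset.mul_sum]
    refine Finset.sum_le_sum fun j hj => ?_
    have hj' : j ≤ i := Nat.lt_succ_iff.1 (Finset.mem_range.1 hj)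
    calc _ ≤ (i.choose j : ℝ) * (B * ρ⁻¹ ^ j) * B' :=
          mul_le_mul (mul_le_mul_of_nonneg_left (hb₁ j (hj'.trans hir)) (by positivity))
            (hb₂ _ ((Nat.sub_le _ _).trans hir)) (norm_nonneg _) (by positivity)
      _ = _ := by rw [one_pow]; ring
  have hdec : slowDown (fun l => gridSum K (ρ⁻¹ * l)) γ =
      fun y => y + ContinuousLinearMap.inl ℝ ℝ ℝ (f₁ y * f₂ y) := by
    funext z
    ext <;> simp [slowDown, f₁, f₂, g]
  have hsm : ContDiff ℝ ∞ fun y => f₁ y * f₂ y := hf₁.mul hf₂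
  have hadd : iteratedFDeriv ℝ i (fun y => y + ContinuousLinearMap.inl ℝ ℝ ℝ (f₁ y * f₂ y)) y =
      iteratedFDeriv ℝ i (fun y => y) y +
        iteratedFDeriv ℝ i (fun y => ContinuousLinearMap.inl ℝ ℝ ℝ (f₁ y * f₂ y)) y :=
    iteratedFDeriv_add_apply contDiff_id.contDiffAt
      (((ContinuousLinearMap.inl ℝ ℝ ℝ).contDiff.comp hsm).of_le
        (by exact_mod_cast le_top)).contDiffAt
  rw [hdec, hadd]
  have hinl : ‖iteratedFDeriv ℝ i (fun y => ContinuousLinearMap.inl ℝ ℝ ℝ (f₁ y * f₂ y)) y‖ ≤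
      B * B' * (ρ⁻¹ + 1) ^ i := by
    refine ((ContinuousLinearMap.inl ℝ ℝ ℝ).norm_iteratedFDeriv_comp_left hsm.contDiffAt
      (n := i) (by exact_mod_cast le_top)).trans ?_
    exact (mul_le_of_le_one_left (norm_nonneg _)
      (ContinuousLinearMap.norm_inl_le_one ℝ ℝ ℝ)).trans hprod
  refine (norm_add_le _ _).trans ((add_le_add (norm_iteratedFDeriv_id_le y hi) hinl).trans ?_)
  have h1 : 1 ≤ (ρ⁻¹ + 1) ^ i := one_le_pow₀ (by linarith)
  have hBB : 0 ≤ B * B' := mul_nonneg hB0 hB'0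
  calc 1 + B * B' * (ρ⁻¹ + 1) ^ i ≤ (1 + B * B') * (ρ⁻¹ + 1) ^ i := by linarith
    _ ≤ (1 + B * B') ^ i * (ρ⁻¹ + 1) ^ i :=
        mul_le_mul_of_nonneg_right (le_self_pow₀ (by linarith) (by omega)) (by positivity)
    _ = ((1 + B * B') * (ρ⁻¹ + 1)) ^ i := (mul_pow _ _ _).symm
    _ ≤ _ := by
        refine pow_le_pow_left₀ (by positivity) ?_ i
        nlinarith

variable {W : Type} [NormedAddCommGroup W] [NormedSpace ℝ W]

/-- Near a set along which `F` is flat, the time variable can be changed at will at the cost of a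
small change of `F`. -/
theorem exists_slowDown {t₁ η : ℝ} (hη : 0 < η) {L : Set ℝ} (hL : IsOpen L) {F : ℝ × ℝ → W}
    (hF : ContDiffOn ℝ ∞ F (Metric.ball t₁ η ×ˢ L)) {Y : Set ℝ} (hY : IsCompact Y) {ρ₀ : ℝ}
    (hρ₀ : 0 < ρ₀) (hYL : Metric.cthickening ρ₀ Y ⊆ L)
    (hflat : ∀ t ∈ Metric.ball t₁ η, ∀ l ∈ Y, ∀ j, iteratedFDeriv ℝ j F (t, l) = 0)
    {γ : ℝ → ℝ} (hγ : ContDiff ℝ ∞ γ)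
    (hγ1 : ∀ c, 0 ≤ c → c ≤ 1 → ∀ t ∈ Metric.closedBall t₁ (η / 2),
      t + c * γ t ∈ Metric.closedBall t₁ (η / 2))
    (hγ2 : ∀ c, 0 ≤ c → c ≤ 1 → ∀ t ∈ Metric.ball t₁ η, t + c * γ t ∈ Metric.ball t₁ η)
    (r : ℕ) {δ : ℝ} (hδ : 0 < δ) :
    ∃ χ : ℝ → ℝ, ContDiff ℝ ∞ χ ∧ (∀ l, 0 ≤ χ l ∧ χ l ≤ 1) ∧
      (∀ l ∉ Metric.cthickening ρ₀ Y, χ l = 0) ∧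
      (∃ ρ > 0, ∀ x, (∃ y ∈ Y, |x - y| ≤ ρ) → χ x = 1) ∧
      ∀ k ≤ r, ∀ y ∈ Metric.closedBall t₁ (η / 2) ×ˢ L,
        ‖iteratedFDeriv ℝ k (fun y => F (slowDown χ γ y) - F y) y‖ < δ := by
  have hKT : Metric.closedBall t₁ (η / 2) ⊆ Metric.ball t₁ η :=
    Metric.closedBall_subset_ball (by linarith)
  have hYc : IsCompact (Metric.cthickening ρ₀ Y) :=
    Metric.isCompact_of_isClosed_isBounded Metric.isClosed_cthickening hY.isBounded.cthickening
  have hD : IsOpen (Metric.ball t₁ η ×ˢ L) := Metric.isOpen_ball.prod hL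
  -- Composing with the slow-down costs up to `ρ⁻¹` to the power `r`. Vanishing to order `r + 1` in
  -- the distance to `Y` beats this and leaves one factor `ρ`.
  choose C hC0 hC using fun i : ℕ => exists_norm_iteratedFDeriv_le_pow Metric.isOpen_ball hL hF
    (isCompact_closedBall t₁ (η / 2)) hKT hYc hYL hflat (r + 1) i
  set C' := ∑ i ∈ Finset.range (r + 1), C i with hC'
  have hC'0 : 0 ≤ C' := Finset.sum_nonneg fun i _ => hC0 i
  have hCC' : ∀ i ≤ r, C i ≤ C' := fun i hi =>
    Finset.single_le_sum (fun i _ => hC0 i) (Finset.mem_range.2 (Nat.lt_succ_of_le hi))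
  obtain ⟨B, hB0, hB⟩ := exists_norm_iteratedFDeriv_gridSum_le r
  have hγb : ∀ i : ℕ, ∃ B, 0 ≤ B ∧ ∀ t ∈ Metric.closedBall t₁ (η / 2),
      ‖iteratedFDeriv ℝ i γ t‖ ≤ B := by
    intro i
    obtain ⟨b, hb⟩ := (isCompact_closedBall t₁ (η / 2)).exists_bound_of_continuousOn
      (hγ.continuous_iteratedFDeriv (m := i) (by exact_mod_cast le_top)).continuousOn
    exact ⟨b, (norm_nonneg _).trans (hb t₁ (Metric.mem_closedBall_self (by linarith))), hb⟩
  choose b hb0 hb using hγb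
  set B' := ∑ i ∈ Finset.range (r + 1), b i with hB'
  have hB'0 : 0 ≤ B' := Finset.sum_nonneg fun i _ => hb0 i
  have hbB' : ∀ i ≤ r, ∀ t ∈ Metric.closedBall t₁ (η / 2), ‖iteratedFDeriv ℝ i γ t‖ ≤ B' :=
    fun i hi t ht => (hb i t ht).trans
      (Finset.single_le_sum (fun i _ => hb0 i) (Finset.mem_range.2 (Nat.lt_succ_of_le hi)))
  set M := 2 * (1 + B * B') with hM
  have hM1 : 1 ≤ M := by have := mul_nonneg hB0 hB'0; linarith
  let Q : ℝ := (r.factorial + 1) * (C' * 4 ^ (r + 1)) * M ^ r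
  have hQ0 : 0 ≤ Q := by positivity
  obtain ⟨ρ, hρ, hρ1, hρ4, hρQ⟩ : ∃ ρ : ℝ, 0 < ρ ∧ ρ ≤ 1 ∧ 4 * ρ ≤ ρ₀ ∧ Q * ρ < δ := by
    refine ⟨min 1 (min (ρ₀ / 4) (δ / (2 * (Q + 1)))), by positivity, min_le_left _ _, ?_, ?_⟩
    · have : min 1 (min (ρ₀ / 4) (δ / (2 * (Q + 1)))) ≤ ρ₀ / 4 :=
        (min_le_right _ _).trans (min_le_left _ _)
      linarith
    · have h1 : min 1 (min (ρ₀ / 4) (δ / (2 * (Q + 1)))) ≤ δ / (2 * (Q + 1)) :=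
        (min_le_right _ _).trans (min_le_right _ _)
      calc Q * _ ≤ Q * (δ / (2 * (Q + 1))) := mul_le_mul_of_nonneg_left h1 hQ0
        _ < δ := by
          rw [← mul_div_assoc, div_lt_iff₀ (by positivity)]
          nlinarith
  obtain ⟨K, hK1, hK0⟩ := exists_grid_cutoff hY hρ
  let χ : ℝ → ℝ := fun l => gridSum K (ρ⁻¹ * l)
  have hχ : ContDiff ℝ ∞ χ := (contDiff_gridSum K).comp (contDiff_const.mul contDiff_id)
  have hχ01 : ∀ l, 0 ≤ χ l ∧ χ l ≤ 1 := fun l => ⟨gridSum_nonneg K _, gridSum_le_one K _⟩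
  have hmaps : MapsTo (slowDown χ γ) (Metric.ball t₁ η ×ˢ L) (Metric.ball t₁ η ×ˢ L) :=
    fun y hy => ⟨hγ2 _ (hχ01 y.2).1 (hχ01 y.2).2 y.1 hy.1, hy.2⟩
  refine ⟨χ, hχ, hχ01, fun l hl => hK0 l fun y hy => ?_, ⟨ρ, hρ, hK1⟩, fun k hk y hy => ?_⟩
  · by_contra! h
    exact hl (Metric.mem_cthickening_of_dist_le l y ρ₀ Y hy (by rw [Real.dist_eq]; linarith))
  have hyD : y ∈ Metric.ball t₁ η ×ˢ L := ⟨hKT hy.1, hy.2⟩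
  -- The cutoff vanishes beyond distance `3 ρ`. Beyond `4 ρ` it therefore vanishes on a whole
  -- neighbourhood, and so do all derivatives of the difference.
  by_cases hnear : ∃ l ∈ Y, |y.2 - l| ≤ 4 * ρ
  · obtain ⟨l, hl, hyl⟩ := hnear
    have hbound : ∀ t ∈ Metric.closedBall t₁ (η / 2), ∀ i ≤ r,
        ‖iteratedFDeriv ℝ i F (t, y.2)‖ ≤ C' * (4 * ρ) ^ (r + 1) := fun t ht i hi =>
      (hC i t ht l hl y.2 (hyl.trans hρ4)).trans (mul_le_mul (hCC' i hi)
        (pow_le_pow_left₀ (abs_nonneg _) hyl _) (by positivity) hC'0)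
    have hcomp : ‖iteratedFDeriv ℝ k (F ∘ slowDown χ γ) y‖ ≤
        k.factorial * (C' * (4 * ρ) ^ (r + 1)) * (M * ρ⁻¹) ^ k := by
      rw [← iteratedFDerivWithin_of_isOpen k hD hyD]
      refine norm_iteratedFDerivWithin_comp_le hF (contDiff_slowDown hχ hγ).contDiffOn
        (by exact_mod_cast le_top) hD.uniqueDiffOn hD.uniqueDiffOn hmaps hyD ?_ ?_
      · intro i hi
        rw [iteratedFDerivWithin_of_isOpen i hD (hmaps hyD)]
        exact hbound _ (hγ1 _ (hχ01 y.2).1 (hχ01 y.2).2 y.1 hy.1) i (hi.trans hk)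
      · intro i hi hik
        rw [iteratedFDerivWithin_of_isOpen i hD hyD]
        exact norm_iteratedFDeriv_slowDown_le hγ hρ hρ1 hB0 hB'0 (hB K)
          (fun i hi => hbB' i hi y.1 hy.1) hi (hik.trans hk)
    have hFc : ContDiffAt ℝ k F y := (hF.contDiffAt (hD.mem_nhds hyD)).of_le
      (by exact_mod_cast le_top)
    have hFs : ContDiffAt ℝ k (F ∘ slowDown χ γ) y :=
      ((hF.comp (contDiff_slowDown hχ hγ).contDiffOn hmaps).contDiffAt (hD.mem_nhds hyD)).of_le
        (by exact_mod_cast le_top)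
    have hsub : iteratedFDeriv ℝ k (fun y => F (slowDown χ γ y) - F y) y =
        iteratedFDeriv ℝ k (F ∘ slowDown χ γ) y - iteratedFDeriv ℝ k F y :=
      iteratedFDeriv_sub_apply hFs hFc
    rw [hsub]
    refine (norm_sub_le _ _).trans_lt ((add_le_add hcomp (hbound y.1 hy.1 k hk)).trans_lt ?_)
    refine lt_of_le_of_lt ?_ hρQ
    have hk1 : (k.factorial : ℝ) ≤ r.factorial := by exact_mod_cast Nat.factorial_le hk
    have hMk : M ^ k ≤ M ^ r := pow_le_pow_right₀ hM1 hk
    have hρk : ρ ^ (r + 1) * ρ⁻¹ ^ k ≤ ρ := by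
      have h1 : ρ ^ (r + 1) * ρ⁻¹ ^ k = ρ ^ (r + 1 - k) := by
        rw [pow_sub₀ _ hρ.ne' (by omega), inv_pow]
      rw [h1]
      exact pow_le_of_le_one hρ.le hρ1 (by omega)
    have hρr : ρ ^ (r + 1) ≤ ρ := pow_le_of_le_one hρ.le hρ1 (by omega)
    have hMr : 1 ≤ M ^ r := one_le_pow₀ hM1
    have hP0 : 0 ≤ C' * 4 ^ (r + 1) := by positivity
    have e1 : k.factorial * (C' * (4 * ρ) ^ (r + 1)) * (M * ρ⁻¹) ^ k ≤
        r.factorial * (C' * 4 ^ (r + 1)) * M ^ r * ρ := by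
      calc k.factorial * (C' * (4 * ρ) ^ (r + 1)) * (M * ρ⁻¹) ^ k =
            k.factorial * (C' * 4 ^ (r + 1)) * M ^ k * (ρ ^ (r + 1) * ρ⁻¹ ^ k) := by
            rw [mul_pow, mul_pow]; ring
        _ ≤ _ := by gcongr
    have e2 : C' * (4 * ρ) ^ (r + 1) ≤ (C' * 4 ^ (r + 1)) * M ^ r * ρ := by
      calc C' * (4 * ρ) ^ (r + 1) = (C' * 4 ^ (r + 1)) * 1 * ρ ^ (r + 1) := by
            rw [mul_pow]; ring
        _ ≤ _ := by gcongr
    calc _ ≤ _ := add_le_add e1 e2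
      _ = Q * ρ := by simp only [Q]; ring
  · push Not at hnear
    have hev : (fun y => F (slowDown χ γ y) - F y) =ᶠ[𝓝 y] fun _ => 0 := by
      have hb : ∀ᶠ z : ℝ × ℝ in 𝓝 y, |z.2 - y.2| < ρ := by
        have hc : ContinuousAt (fun z : ℝ × ℝ => |z.2 - y.2|) y := by fun_prop
        exact hc.eventually (Iio_mem_nhds (by simpa using hρ))
      filter_upwards [hb] with z hz
      have hz0 : χ z.2 = 0 := hK0 _ fun l hl => by
        have h1 := hnear l hl
        have h2 := abs_sub_le y.2 z.2 l
        rw [abs_sub_comm y.2 z.2] at h2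
        linarith
      simp [slowDown, hz0]
    rw [hev.iteratedFDeriv ℝ k |>.self_of_nhds]
    simpa using hδ

end SlowDown

/-! ### Time windows and parameters of constant curves. -/

section Windows

variable {n : ℕ} {H : Type*} [TopologicalSpace H] {IM : ModelWithCorners ℝ ℝ H}
  {I : Type*} [TopologicalSpace I] [ChartedSpace H I]
  {J : Type*} [TopologicalSpace J] [ChartedSpace ℝ J]

variable (IM) in
/-- A box with an interior time interval `ball t₁ η`. -/
structure IsWindow (q₀ : I × J) (t₀ ρ' ρ'' ρ₂ a b t₁ η : ℝ) (L : Set ℝ) : Prop where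
  nonneg : 0 ≤ ρ'
  lt_mid : ρ' < ρ''
  lt_right : ρ'' < ρ₂
  lt_ends : a < b
  mem_Icc : t₀ ∈ Icc a b
  Icc_eq : Icc a b = tcball IM t₀ ρ''
  isBox : IsBox IM q₀ (tball IM t₀ ρ₂) L
  pos : 0 < η
  subset : Metric.closedBall t₁ η ⊆ tcball IM t₀ ρ'

variable [IsManifold IM ∞ I] [IsManifold 𝓘(ℝ, ℝ) ∞ J]
  {Γ Γ' Γ'' : IntegralFamily n IM I J} {q₀ : I × J} {fr : ContactFrame n}
  {t₀ ρ' ρ'' ρ₂ a b t₁ η : ℝ} {L : Set ℝ}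

theorem IsWindow.ball_subset (hw : IsWindow IM q₀ t₀ ρ' ρ'' ρ₂ a b t₁ η L) :
    Metric.ball t₁ η ⊆ tball IM t₀ ρ₂ :=
  Metric.ball_subset_closedBall.trans (hw.subset.trans (inter_subset_inter_right _
    (Metric.closedBall_subset_ball (hw.lt_mid.trans hw.lt_right))))

theorem IsWindow.mem_center (hw : IsWindow IM q₀ t₀ ρ' ρ'' ρ₂ a b t₁ η L) :
    t₁ ∈ tball IM t₀ ρ₂ := hw.ball_subset (Metric.mem_ball_self hw.pos)

/-- The parameters for which the curve is constant on `ball t₁ η`. -/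
def IntegralFamily.constSet (Γ : IntegralFamily n IM I J) (q₀ : I × J) (fr : ContactFrame n)
    (t₁ η : ℝ) : Set ℝ :=
  {l | ∀ t ∈ Metric.ball t₁ η, Γ.X q₀ fr (t, l) = Γ.X q₀ fr (t₁, l) ∧
    Γ.P q₀ fr (t, l) = Γ.P q₀ fr (t₁, l)}

/-- The family `Γ'` agrees with `Γ` off the box, and stays in the coordinate domain. -/
def IntegralFamily.AgreesOff (Γ Γ' : IntegralFamily n IM I J) (q₀ : I × J) (fr : ContactFrame n)
    (A L : Set ℝ) : Prop :=
  (∀ q ∉ (chart IM q₀).symm '' (A ×ˢ L), Γ'.toFun q = Γ.toFun q) ∧ Γ'.ValidOn q₀ fr A L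

theorem IntegralFamily.AgreesOff.trans {A : Set ℝ} (h : Γ.AgreesOff Γ' q₀ fr A L)
    (h' : Γ'.AgreesOff Γ'' q₀ fr A L) : Γ.AgreesOff Γ'' q₀ fr A L :=
  ⟨fun q hq => (h'.1 q hq).trans (h.1 q hq), h'.2⟩

/-- A function on a ball of the line with vanishing derivative is constant. -/
theorem eq_of_tderiv_eq_zero {W : Type*} [NormedAddCommGroup W] [NormedSpace ℝ W] {A : Set ℝ}
    (hA : UniqueDiffOn ℝ A) {F : ℝ × ℝ → W} (hF : ContDiffOn ℝ ∞ F (A ×ˢ L)) {l : ℝ} (hl : l ∈ L)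
    (hball : Metric.ball t₁ η ⊆ A) (h0 : ∀ t ∈ Metric.ball t₁ η, tderiv A F (t, l) = 0) {t : ℝ}
    (ht : t ∈ Metric.ball t₁ η) : F (t, l) = F (t₁, l) := by
  have hd : ∀ τ ∈ Metric.ball t₁ η,
      HasDerivWithinAt (fun τ => F (τ, l)) 0 (Metric.ball t₁ η) τ := fun τ hτ => by
    have := hasDerivWithinAt_tderiv hA hF (y := (τ, l)) ⟨hball hτ, hl⟩
    rw [h0 τ hτ] at this
    exact this.mono hball
  have h1 := (convex_ball t₁ η).norm_image_sub_le_of_norm_hasDerivWithin_le (C := 0) hd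
    (fun τ _ => by simp) (Metric.mem_ball_self (Metric.pos_of_mem_ball ht)) ht
  rw [zero_mul, norm_le_zero_iff, sub_eq_zero] at h1
  exact h1

theorem IntegralFamily.ValidOn.mem_constSet (hv : Γ.ValidOn q₀ fr (tball IM t₀ ρ₂) L)
    (hw : IsWindow IM q₀ t₀ ρ' ρ'' ρ₂ a b t₁ η L) {l : ℝ} (hl : l ∈ L)
    (h : ∀ t ∈ Metric.ball t₁ η, tderiv (tball IM t₀ ρ₂) (Γ.X q₀ fr) (t, l) = 0 ∧
      tderiv (tball IM t₀ ρ₂) (Γ.P q₀ fr) (t, l) = 0) : l ∈ Γ.constSet q₀ fr t₁ η :=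
  fun _ ht => ⟨eq_of_tderiv_eq_zero hw.isBox.uniqueDiffOn_left (hv.contDiffOn_X hw.isBox) hl
    hw.ball_subset (fun t ht => (h t ht).1) ht,
    eq_of_tderiv_eq_zero hw.isBox.uniqueDiffOn_left (hv.contDiffOn_P hw.isBox) hl
    hw.ball_subset (fun t ht => (h t ht).2) ht⟩

theorem tderiv_eq_zero_of_eq_const {W : Type*} [NormedAddCommGroup W] [NormedSpace ℝ W] {A : Set ℝ}
    {F : ℝ × ℝ → W} {U : Set ℝ} (hU : IsOpen U) {l : ℝ} {c : W} (h : ∀ t ∈ U, F (t, l) = c) {t : ℝ}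
    (ht : t ∈ U) : tderiv A F (t, l) = 0 := by
  have h1 : (fun τ => F (τ, l)) =ᶠ[𝓝 t] fun _ => c := by
    filter_upwards [hU.mem_nhds ht] with τ hτ using h τ hτ
  unfold tderiv
  rw [(h1.filter_mono nhdsWithin_le_nhds).derivWithin_eq h1.self_of_nhds]
  simp

variable (Γ q₀ fr) in
/-- The coordinates of the family. -/
def IntegralFamily.coords (y : ℝ × ℝ) : fr.Par := (Γ.X q₀ fr y, Γ.P q₀ fr y, Γ.Z q₀ fr y)

variable (Γ q₀ fr) in
/-- The displacement of the coordinates from their values at time `t₁`. -/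
def IntegralFamily.displ (t₁ : ℝ) (y : ℝ × ℝ) : fr.Par :=
  Γ.coords q₀ fr y - Γ.coords q₀ fr (t₁, y.2)

theorem IntegralFamily.ValidOn.contDiffOn_coords {A : Set ℝ} (hv : Γ.ValidOn q₀ fr A L)
    (hB : IsBox IM q₀ A L) : ContDiffOn ℝ ∞ (Γ.coords q₀ fr) (A ×ˢ L) :=
  (hv.contDiffOn_X hB).prodMk ((hv.contDiffOn_P hB).prodMk (hv.contDiffOn_Z hB))

theorem IntegralFamily.ValidOn.contDiffOn_displ {A : Set ℝ} (hv : Γ.ValidOn q₀ fr A L)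
    (hB : IsBox IM q₀ A L) (ht₁ : t₁ ∈ A) : ContDiffOn ℝ ∞ (Γ.displ q₀ fr t₁) (A ×ˢ L) :=
  (hv.contDiffOn_coords hB).sub ((hv.contDiffOn_coords hB).comp
    (contDiffOn_const.prodMk contDiffOn_snd) fun _ hy => ⟨ht₁, hy.2⟩)

theorem IntegralFamily.ValidOn.displ_eq_zero (hv : Γ.ValidOn q₀ fr (tball IM t₀ ρ₂) L)
    (hw : IsWindow IM q₀ t₀ ρ' ρ'' ρ₂ a b t₁ η L) {l : ℝ} (hl : l ∈ L)
    (h : l ∈ Γ.constSet q₀ fr t₁ η) {t : ℝ} (ht : t ∈ Metric.ball t₁ η) :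
    Γ.displ q₀ fr t₁ (t, l) = 0 := by
  have hX : ∀ τ ∈ Metric.ball t₁ η, tderiv (tball IM t₀ ρ₂) (Γ.X q₀ fr) (τ, l) = 0 := fun τ hτ =>
    tderiv_eq_zero_of_eq_const Metric.isOpen_ball (fun t ht => (h t ht).1) hτ
  have hZ : Γ.Z q₀ fr (t, l) = Γ.Z q₀ fr (t₁, l) :=
    eq_of_tderiv_eq_zero hw.isBox.uniqueDiffOn_left (hv.contDiffOn_Z hw.isBox) hl
      hw.ball_subset (fun τ hτ => by
        rw [hv.tderiv_Z hw.isBox (y := (τ, l)) ⟨hw.ball_subset hτ, hl⟩, hX τ hτ, inner_zero_right])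
      ht
  simp only [IntegralFamily.displ, IntegralFamily.coords]
  rw [(h t ht).1, (h t ht).2, hZ, sub_self]

variable [T2Space I] [T2Space J]

/-- Small multiples of a change of `(x, p)` without defect extend to changes of the family. -/
theorem IntegralFamily.ValidOn.eventually_change_smul (hv : Γ.ValidOn q₀ fr (tball IM t₀ ρ₂) L)
    (hw : IsWindow IM q₀ t₀ ρ' ρ'' ρ₂ a b t₁ η L) {Λ : Set ℝ} (hΛ : IsCompact Λ) (hΛL : Λ ⊆ L)
    {𝒰 : Set (IntegralFamily n IM I J)} (h𝒰 : 𝒰 ∈ 𝓝 Γ) {u v : ℝ × ℝ → fr.W}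
    (hu : ContDiffOn ℝ ∞ u (tball IM t₀ ρ₂ ×ˢ L)) (hvs : ContDiffOn ℝ ∞ v (tball IM t₀ ρ₂ ×ˢ L))
    (hoff : ∀ y ∈ tball IM t₀ ρ₂ ×ˢ L, y ∉ Metric.closedBall t₁ η ×ˢ Λ → u y = 0 ∧ v y = 0)
    (h1 : ∀ y ∈ tball IM t₀ ρ₂ ×ˢ L, inner ℝ (v y) (tderiv (tball IM t₀ ρ₂) (Γ.X q₀ fr) y) = 0)
    (h2 : ∀ y ∈ tball IM t₀ ρ₂ ×ˢ L, inner ℝ (tderiv (tball IM t₀ ρ₂) (Γ.P q₀ fr) y) (u y) = 0)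
    (h3 : ∀ y ∈ tball IM t₀ ρ₂ ×ˢ L, inner ℝ (v y) (tderiv (tball IM t₀ ρ₂) u y) = 0) :
    ∃ ε : ℝ, 0 < ε ∧ ∃ Γ' ∈ 𝒰, Γ.AgreesOff Γ' q₀ fr (tball IM t₀ ρ₂) L ∧ ∀ y ∈ tball IM t₀ ρ₂ ×ˢ L,
      Γ'.X q₀ fr y = Γ.X q₀ fr y + ε • u y ∧ Γ'.P q₀ fr y = Γ.P q₀ fr y + ε • v y := by
  have hIA : Icc a b ⊆ tball IM t₀ ρ₂ := by
    rw [hw.Icc_eq]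
    exact inter_subset_inter_right _ (Metric.closedBall_subset_ball hw.lt_right)
  have hev := hv.eventually_change_of_defect hw.nonneg hw.lt_mid hw.lt_right hw.lt_ends hw.mem_Icc
    hw.Icc_eq hw.isBox hΛ hΛL h𝒰 (S := ℝ) isOpen_univ (mem_univ (0 : ℝ))
    (u := fun w => w.2 • u w.1) (v := fun w => w.2 • v w.1)
    (contDiffOn_snd.smul (hu.comp contDiffOn_fst fun w hw => hw.1))
    (contDiffOn_snd.smul (hvs.comp contDiffOn_fst fun w hw => hw.1))
    (fun y _ => by simp) (fun s _ y hy hyC => by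
      have := hoff y hy fun h => hyC ⟨hw.subset h.1, h.2⟩
      simp [this.1, this.2])
    -- The defect of `(s u, s v)` is `s ⟨v, x'⟩ + s² ⟨v, u'⟩ - s ⟨p', u⟩`, and the three hypotheses
    -- make every term vanish.
    (fun s _ l hl => by
      rw [intervalIntegral.integral_congr (g := fun _ => (0 : ℝ)) fun τ hτ => ?_]
      · simp
      · rw [uIcc_of_le hw.lt_ends.le] at hτ
        have hy : (τ, l) ∈ tball IM t₀ ρ₂ ×ˢ L := ⟨hIA hτ, hΛL hl⟩
        have hd : tderiv (tball IM t₀ ρ₂) (fun y => s • u y) (τ, l) =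
            s • tderiv (tball IM t₀ ρ₂) u (τ, l) :=
          tderiv_clm hw.isBox.uniqueDiffOn_left (s • ContinuousLinearMap.id ℝ fr.W) hu hy
        simp only [IntegralFamily.defect]
        rw [hd, inner_add_right, inner_smul_left, inner_smul_right, inner_smul_left,
          inner_smul_right, h1 _ hy, h2 _ hy, h3 _ hy]
        simp)
  obtain ⟨ε, hε, hb⟩ := Metric.eventually_nhds_iff_ball.1 hev
  obtain ⟨Γ', hΓ', h4, h5, h6⟩ := hb (ε / 2) (by
    rw [mem_ball_zero_iff, Real.norm_eq_abs, abs_of_pos (by linarith)]; linarith)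
  exact ⟨ε / 2, half_pos hε, Γ', hΓ', ⟨h4, h5⟩, h6⟩

end Windows

/-- In dimension at least two there is a skew endomorphism that does not kill a given vector. -/
theorem exists_skew_apply_ne_zero {W : Type*} [NormedAddCommGroup W] [InnerProductSpace ℝ W]
    [FiniteDimensional ℝ W] (hW : 2 ≤ finrank ℝ W) {w : W} (hw : w ≠ 0) :
    ∃ R : W →L[ℝ] W, (∀ y, inner ℝ y (R y) = 0) ∧ R w ≠ 0 := by
  obtain ⟨b, hb, hb0⟩ : ∃ b ∈ (Submodule.span ℝ {w})ᗮ, b ≠ 0 := by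
    refine Submodule.exists_mem_ne_zero_of_ne_bot fun h => ?_
    have h1 := Submodule.finrank_add_finrank_orthogonal (Submodule.span ℝ {w})
    rw [h, finrank_bot, finrank_span_singleton hw] at h1
    omega
  have hwb : inner ℝ w b = 0 := Submodule.mem_orthogonal_singleton_iff_inner_right.1 hb
  -- This is the infinitesimal rotation in the plane spanned by `w` and the orthogonal vector `b`.
  refine ⟨(innerSL ℝ w).smulRight b - (innerSL ℝ b).smulRight w, fun y => ?_, ?_⟩
  · simp only [sub_apply, ContinuousLinearMap.smulRight_apply, innerSL_apply_apply,
      inner_sub_right, inner_smul_right]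
    rw [real_inner_comm y w, real_inner_comm y b]
    ring
  · simp only [sub_apply, ContinuousLinearMap.smulRight_apply, innerSL_apply_apply]
    rw [real_inner_comm w b, hwb, zero_smul, sub_zero]
    exact smul_ne_zero (inner_self_ne_zero.2 hw) hb0

/-! ### Removing a parameter of finite order. -/

section KillFiniteOrder

variable {n : ℕ} {H : Type*} [TopologicalSpace H] {IM : ModelWithCorners ℝ ℝ H}
  {I : Type*} [TopologicalSpace I] [ChartedSpace H I]
  {J : Type*} [TopologicalSpace J] [ChartedSpace ℝ J]
  [IsManifold IM ∞ I] [IsManifold 𝓘(ℝ, ℝ) ∞ J]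
  {Γ : IntegralFamily n IM I J} {q₀ : I × J} {fr : ContactFrame n}
  {t₀ ρ' ρ'' ρ₂ a b t₁ η : ℝ} {L : Set ℝ}

theorem tderiv_smul_right {W : Type*} [NormedAddCommGroup W] [NormedSpace ℝ W] {A T : Set ℝ}
    (hT : IsOpen T) {F G : ℝ × ℝ → W} {c : ℝ → ℝ} {c₀ : ℝ → W}
    (hFG : ∀ y ∈ T ×ˢ L, F y = c₀ y.2 + c y.2 • G y)
    (hG : ContDiffOn ℝ ∞ G (T ×ˢ L)) (hTA : T ⊆ A) {y : ℝ × ℝ}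
    (hy : y ∈ T ×ˢ L) : tderiv A F y = c y.2 • tderiv T G y := by
  have h1 : A =ᶠ[𝓝 y.1] T := by
    filter_upwards [hT.mem_nhds hy.1] with t ht
    exact propext ⟨fun _ => ht, fun h => hTA h⟩
  rw [tderiv_congr_set h1]
  have h2 := ((hasDerivWithinAt_tderiv hT.uniqueDiffOn hG hy).const_smul (c y.2)).const_add (c₀ y.2)
  exact (h2.congr (fun τ hτ => hFG (τ, y.2) ⟨hτ, hy.2⟩) (hFG y hy)).derivWithin
    (hT.uniqueDiffOn _ hy.1)

/-- At an isolated parameter of finite order, the velocity of one of the leading coefficients does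
not vanish. -/
theorem IntegralFamily.ValidOn.exists_leading_ne_zero (hv : Γ.ValidOn q₀ fr (tball IM t₀ ρ₂) L)
    (hw : IsWindow IM q₀ t₀ ρ' ρ'' ρ₂ a b t₁ η L) {l : ℝ} (hl : l ∈ L) {k : ℕ}
    {G : ℝ × ℝ → fr.Par} (hG : ContDiffOn ℝ ∞ G (Metric.ball t₁ η ×ˢ L))
    (hFG : ∀ y ∈ Metric.ball t₁ η ×ˢ L, Γ.displ q₀ fr t₁ y = (y.2 - l) ^ k • G y)
    (hne : ∃ t ∈ Metric.ball t₁ η, G (t, l) ≠ 0) :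
    ∃ t ∈ Metric.ball t₁ η, tderiv (Metric.ball t₁ η) (fun y => (G y).1) (t, l) ≠ 0 ∨
      tderiv (Metric.ball t₁ η) (fun y => (G y).2.1) (t, l) ≠ 0 := by
  by_contra! h
  set T := Metric.ball t₁ η with hTdef
  have hT : IsOpen T := Metric.isOpen_ball
  have ht₁ : t₁ ∈ T := Metric.mem_ball_self hw.pos
  have hL := hw.isBox.isOpen_right
  have hA := hw.isBox.uniqueDiffOn_left
  have hX : ContDiffOn ℝ ∞ (fun y => (G y).1) (T ×ˢ L) := contDiff_fst.comp_contDiffOn hG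
  have hP : ContDiffOn ℝ ∞ (fun y => (G y).2.1) (T ×ˢ L) := contDiff_snd.fst.comp_contDiffOn hG
  have hZ : ContDiffOn ℝ ∞ (fun y => (G y).2.2) (T ×ˢ L) := contDiff_snd.snd.comp_contDiffOn hG
  -- For parameters other than `l` the factor `(λ - l)^k` can be cancelled; the resulting identities
  -- extend to `l` by continuity.
  have hlim : ∀ {V : Type} [NormedAddCommGroup V] (f g : ℝ → V), ContinuousOn f L →
      ContinuousOn g L → (∀ μ ∈ L, μ ≠ l → f μ = g μ) → f l = g l := by
    intro V _ f g hf hg hfg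
    have h1 : Tendsto f (𝓝[≠] l) (𝓝 (f l)) :=
      ((hf.continuousAt (hL.mem_nhds hl)).tendsto).mono_left nhdsWithin_le_nhds
    have h2 : Tendsto g (𝓝[≠] l) (𝓝 (g l)) :=
      ((hg.continuousAt (hL.mem_nhds hl)).tendsto).mono_left nhdsWithin_le_nhds
    refine tendsto_nhds_unique (h1.congr' ?_) h2
    filter_upwards [mem_nhdsWithin_of_mem_nhds (hL.mem_nhds hl), self_mem_nhdsWithin] with μ hμ hμl
    exact hfg μ hμ hμl
  have hline : ∀ t ∈ T, ∀ {V : Type} [NormedAddCommGroup V] [NormedSpace ℝ V] {f : ℝ × ℝ → V},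
      ContDiffOn ℝ ∞ f (T ×ˢ L) → ContinuousOn (fun μ => f (t, μ)) L := fun t ht V _ _ f hf =>
    hf.continuousOn.comp (by fun_prop) fun μ hμ => ⟨ht, hμ⟩
  have hG1 : G (t₁, l) = 0 := by
    refine hlim (fun μ => G (t₁, μ)) (fun _ => 0) (hline t₁ ht₁ hG) continuousOn_const
      fun μ hμ hμl => ?_
    have h1 := hFG (t₁, μ) ⟨ht₁, hμ⟩
    rw [IntegralFamily.displ, sub_self] at h1
    exact (smul_eq_zero.1 h1.symm).resolve_left (pow_ne_zero k (sub_ne_zero.2 hμl))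
  have hdisp : ∀ y ∈ T ×ˢ L, Γ.coords q₀ fr y = Γ.coords q₀ fr (t₁, y.2) + (y.2 - l) ^ k • G y :=
    fun y hy => by rw [← hFG y hy, IntegralFamily.displ, add_sub_cancel]
  have hZ' : ∀ t ∈ T, tderiv T (fun y => (G y).2.2) (t, l) = 0 := by
    intro t ht
    have h1 : tderiv T (fun y => (G y).2.2) (t, l) =
        inner ℝ (Γ.P q₀ fr (t, l)) (tderiv T (fun y => (G y).1) (t, l)) := by
      refine hlim (fun μ => tderiv T (fun y => (G y).2.2) (t, μ)) (fun μ =>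
        inner ℝ (Γ.P q₀ fr (t, μ)) (tderiv T (fun y => (G y).1) (t, μ)))
        (hline t ht (hZ.tderiv hT.uniqueDiffOn hL))
        (ContinuousOn.inner (hline t ht ((hv.contDiffOn_P hw.isBox).mono
          (prod_mono hw.ball_subset Subset.rfl))) (hline t ht (hX.tderiv hT.uniqueDiffOn hL)))
        fun μ hμ hμl => ?_
      have hy : (t, μ) ∈ T ×ˢ L := ⟨ht, hμ⟩
      have e1 := tderiv_smul_right (A := tball IM t₀ ρ₂) hT (F := Γ.X q₀ fr)
        (c := fun μ => (μ - l) ^ k) (c₀ := fun μ => Γ.X q₀ fr (t₁, μ))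
        (fun y hy => congrArg Prod.fst (hdisp y hy)) hX hw.ball_subset hy
      have e2 := tderiv_smul_right (A := tball IM t₀ ρ₂) hT (F := Γ.Z q₀ fr)
        (c := fun μ => (μ - l) ^ k) (c₀ := fun μ => Γ.Z q₀ fr (t₁, μ))
        (fun y hy => congrArg (fun p => p.2.2) (hdisp y hy)) hZ hw.ball_subset hy
      have e3 := hv.tderiv_Z hw.isBox (y := (t, μ)) ⟨hw.ball_subset ht, hμ⟩
      rw [e1, e2, inner_smul_right, smul_eq_mul] at e3
      exact mul_left_cancel₀ (pow_ne_zero k (sub_ne_zero.2 hμl)) e3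
    rw [h1, (h t ht).1, inner_zero_right]
  obtain ⟨t, ht, hGt⟩ := hne
  refine hGt ?_
  rw [← hG1]
  have c1 := eq_of_tderiv_eq_zero hT.uniqueDiffOn hX hl Subset.rfl (fun t ht => (h t ht).1) ht
  have c2 := eq_of_tderiv_eq_zero hT.uniqueDiffOn hP hl Subset.rfl (fun t ht => (h t ht).2) ht
  have c3 := eq_of_tderiv_eq_zero hT.uniqueDiffOn hZ hl Subset.rfl hZ' ht
  exact Prod.ext c1 (Prod.ext c2 c3)

variable [T2Space I] [T2Space J]

/-- An isolated parameter of finite order can be removed from the set of parameters of constant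
curves. -/
theorem IntegralFamily.ValidOn.exists_change_of_order (hn : 2 ≤ n)
    (hv : Γ.ValidOn q₀ fr (tball IM t₀ ρ₂) L)
    (hw : IsWindow IM q₀ t₀ ρ' ρ'' ρ₂ a b t₁ η L) {l : ℝ} (hl : l ∈ L) {k : ℕ}
    {G : ℝ × ℝ → fr.Par} (hG : ContDiffOn ℝ ∞ G (Metric.ball t₁ η ×ˢ L))
    (hFG : ∀ y ∈ Metric.ball t₁ η ×ˢ L, Γ.displ q₀ fr t₁ y = (y.2 - l) ^ k • G y)
    (hne : ∃ t ∈ Metric.ball t₁ η, G (t, l) ≠ 0) (hlc : l ∈ Γ.constSet q₀ fr t₁ η)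
    {𝒰 : Set (IntegralFamily n IM I J)} (h𝒰 : 𝒰 ∈ 𝓝 Γ) :
    ∃ Γ' ∈ 𝒰, Γ.AgreesOff Γ' q₀ fr (tball IM t₀ ρ₂) L ∧
      Γ'.constSet q₀ fr t₁ η ∩ L ⊆ Γ.constSet q₀ fr t₁ η \ {l} := by
  obtain ⟨t₂, ht₂, hne⟩ := hv.exists_leading_ne_zero hw hl hG hFG hne
  set T := Metric.ball t₁ η with hTdef
  set A := tball IM t₀ ρ₂ with hAdef
  have hT : IsOpen T := Metric.isOpen_ball
  have ht₁ : t₁ ∈ T := Metric.mem_ball_self hw.pos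
  have hL := hw.isBox.isOpen_right
  have hA := hw.isBox.uniqueDiffOn_left
  have hd : dist t₂ t₁ < η := ht₂
  let σ := (dist t₂ t₁ + η) / 2
  have hσ1 : dist t₂ t₁ < σ := by simp only [σ]; linarith
  have hση : σ < η := by simp only [σ]; linarith
  let σ' := (σ + η) / 2
  have hσσ' : σ < σ' := by simp only [σ']; linarith
  have hσ'η : σ' < η := by simp only [σ']; linarith
  have hσ0 : 0 < σ := dist_nonneg.trans_lt hσ1
  obtain ⟨φ, hφ, hφ1, hφ0, -⟩ := exists_cutoff t₁ hσ0 hσσ'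
  obtain ⟨ε, hε, hεL⟩ := Metric.isOpen_iff.1 hL l hl
  obtain ⟨χ, hχ, hχ1, hχ0, -⟩ := exists_cutoff l (show 0 < ε / 3 by linarith)
    (show ε / 3 < ε / 2 by linarith)
  have hΛL : Metric.closedBall l (ε / 2) ⊆ L :=
    (Metric.closedBall_subset_ball (by linarith)).trans hεL
  have hdisp : ∀ y ∈ T ×ˢ L, Γ.coords q₀ fr y = Γ.coords q₀ fr (t₁, y.2) + (y.2 - l) ^ k • G y :=
    fun y hy => by rw [← hFG y hy, IntegralFamily.displ, add_sub_cancel]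
  -- a time in the window where the cutoff vanishes
  obtain ⟨t₃, ht₃, hφ3⟩ : ∃ t ∈ T, φ t = 0 := by
    refine ⟨t₁ + σ', ?_, hφ0 _ ?_⟩
    · rw [hTdef, Metric.mem_ball, Real.dist_eq, add_sub_cancel_left, abs_of_pos (hσ0.trans hσσ')]
      exact hσ'η
    · rw [Metric.mem_ball, Real.dist_eq, add_sub_cancel_left, abs_of_pos (hσ0.trans hσσ')]
      exact lt_irrefl _
  have hφ2 : φ t₂ = 1 := hφ1 _ hσ1.le
  have hχl : χ l = 1 := hχ1 _ (Metric.mem_closedBall_self (by linarith))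
  -- the localized rotated velocity of a coefficient
  have key : ∀ (g F : ℝ × ℝ → fr.W) (c₀ : ℝ → fr.W), ContDiffOn ℝ ∞ g (T ×ˢ L) →
      (∀ y ∈ T ×ˢ L, F y = c₀ y.2 + (y.2 - l) ^ k • g y) → tderiv T g (t₂, l) ≠ 0 →
      ∃ u : ℝ × ℝ → fr.W, ContDiffOn ℝ ∞ u (A ×ˢ L) ∧
        (∀ y ∈ A ×ˢ L, y ∉ Metric.closedBall t₁ η ×ˢ Metric.closedBall l (ε / 2) → u y = 0) ∧
        (∀ y ∈ A ×ˢ L, inner ℝ (tderiv A F y) (u y) = 0) ∧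
        (∀ y ∈ T ×ˢ L, y.2 ≠ l → tderiv A F y = 0 → u y = 0) ∧
        u (t₂, l) ≠ 0 ∧ u (t₃, l) = 0 := by
    intro g F c₀ hg hF hg2
    -- The rotated leading velocity is orthogonal to the actual velocity, so it produces no defect.
    -- Away from `l` it vanishes whenever the actual velocity does, so no new constant curve arises.
    -- At `l` itself it is nonzero.
    obtain ⟨R, hR, hR2⟩ := exists_skew_apply_ne_zero (fr.finrank_W.symm ▸ hn) hg2
    have hFd : ∀ y ∈ T ×ˢ L, tderiv A F y = (y.2 - l) ^ k • tderiv T g y := fun y hy =>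
      tderiv_smul_right hT (c := fun μ => (μ - l) ^ k) hF hg hw.ball_subset hy
    have hoffT : ∀ y : ℝ × ℝ, y.1 ∉ Metric.closedBall t₁ σ' → φ y.1 = 0 := fun y hy =>
      hφ0 _ fun h => hy (Metric.ball_subset_closedBall h)
    have hcT : Metric.closedBall t₁ σ' ⊆ T := Metric.closedBall_subset_ball hσ'η
    refine ⟨fun y => (χ y.2 * φ y.1) • R (tderiv T g y), ?_, ?_, ?_, ?_, ?_, ?_⟩
    · refine contDiffOn_of_eq_zero_off (C := Metric.closedBall t₁ σ' ×ˢ univ) (D := T ×ˢ L)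
        (Metric.isClosed_closedBall.prod isClosed_univ) (fun y hy hyC => ?_) ?_ fun y hy hyC => ?_
      · exact mem_nhdsWithin_of_mem_nhds ((hT.prod hL).mem_nhds ⟨hcT hyC.1, hy.2⟩)
      · refine ContDiffOn.mono ?_ inter_subset_right
        exact ((hχ.comp contDiff_snd).mul (hφ.comp contDiff_fst)).contDiffOn.smul
          (R.contDiff.comp_contDiffOn (hg.tderiv hT.uniqueDiffOn hL))
      · simp only [hoffT y fun h => hyC ⟨h, mem_univ _⟩, mul_zero, zero_smul]
    · intro y hy hyC
      by_cases h1 : y.1 ∈ Metric.closedBall t₁ σ'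
      · have h2 : χ y.2 = 0 := hχ0 _ fun h => hyC
          ⟨Metric.ball_subset_closedBall (hcT h1), Metric.ball_subset_closedBall h⟩
        simp only [h2, zero_mul, zero_smul]
      · simp only [hoffT y h1, mul_zero, zero_smul]
    · intro y hy
      by_cases h1 : y.1 ∈ Metric.closedBall t₁ σ'
      · rw [hFd y ⟨hcT h1, hy.2⟩, inner_smul_left, inner_smul_right, hR]
        simp
      · simp only [hoffT y h1, mul_zero, zero_smul, inner_zero_right]
    · intro y hy hyl h0
      rw [hFd y hy] at h0
      have h1 := (smul_eq_zero.1 h0).resolve_left (pow_ne_zero k (sub_ne_zero.2 hyl))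
      simp only [h1, map_zero, smul_zero]
    · simp only [hχl, hφ2, mul_one, one_smul]
      exact hR2
    · simp only [hφ3, mul_zero, zero_smul]
  have hz : ContDiffOn ℝ ∞ (fun _ : ℝ × ℝ => (0 : fr.W)) (A ×ˢ L) := contDiffOn_const
  have hz' : ∀ y, tderiv A (fun _ : ℝ × ℝ => (0 : fr.W)) y = 0 := fun y => by simp [tderiv]
  rcases hne with hne | hne
  · obtain ⟨v, hvs, hvoff, hvi, hvz, hv2, hv3⟩ := key (fun y => (G y).1) (Γ.X q₀ fr)
      (fun μ => Γ.X q₀ fr (t₁, μ)) (contDiff_fst.comp_contDiffOn hG)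
      (fun y hy => congrArg Prod.fst (hdisp y hy)) hne
    obtain ⟨e, he, Γ', hΓ', hag, hc⟩ := hv.eventually_change_smul hw
      (isCompact_closedBall l (ε / 2)) hΛL h𝒰 hz hvs (fun y hy hyC => ⟨rfl, hvoff y hy hyC⟩)
      (fun y hy => by rw [real_inner_comm]; exact hvi y hy) (fun y _ => inner_zero_right _)
      (fun y _ => by rw [hz', inner_zero_right])
    refine ⟨Γ', hΓ', hag, fun μ ⟨hμ, hμL⟩ => ?_⟩
    have hXμ : ∀ t ∈ T, Γ.X q₀ fr (t, μ) = Γ.X q₀ fr (t₁, μ) := fun t ht => by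
      have := (hμ t ht).1
      rw [(hc (t, μ) ⟨hw.ball_subset ht, hμL⟩).1, (hc (t₁, μ) ⟨hw.mem_center, hμL⟩).1] at this
      simpa using this
    have hPμ : ∀ t ∈ T, Γ.P q₀ fr (t, μ) + e • v (t, μ) = Γ.P q₀ fr (t₁, μ) + e • v (t₁, μ) :=
      fun t ht => by
        have := (hμ t ht).2
        rwa [(hc (t, μ) ⟨hw.ball_subset ht, hμL⟩).2, (hc (t₁, μ) ⟨hw.mem_center, hμL⟩).2] at this
    -- At `l` the old curve is constant, while the added term is nonzero at `t₂` and zero at `t₃`.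
    have hμl : μ ≠ l := by
      rintro rfl
      have h2 := hPμ t₂ ht₂
      have h3 := hPμ t₃ ht₃
      rw [(hlc t₂ ht₂).2] at h2
      rw [(hlc t₃ ht₃).2, ← h2, hv3] at h3
      exact hv2 (by simpa [he.ne'] using h3)
    have hv0 : ∀ t ∈ T, v (t, μ) = 0 := fun t ht => hvz (t, μ) ⟨ht, hμL⟩ hμl
      (tderiv_eq_zero_of_eq_const hT hXμ ht)
    refine ⟨fun t ht => ⟨hXμ t ht, ?_⟩, hμl⟩
    simpa [hv0 t ht, hv0 t₁ ht₁] using hPμ t ht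
  · obtain ⟨u, hus, huoff, hui, huz, hu2, hu3⟩ := key (fun y => (G y).2.1) (Γ.P q₀ fr)
      (fun μ => Γ.P q₀ fr (t₁, μ)) (contDiff_snd.fst.comp_contDiffOn hG)
      (fun y hy => congrArg (fun p => p.2.1) (hdisp y hy)) hne
    obtain ⟨e, he, Γ', hΓ', hag, hc⟩ := hv.eventually_change_smul hw
      (isCompact_closedBall l (ε / 2)) hΛL h𝒰 hus hz (fun y hy hyC => ⟨huoff y hy hyC, rfl⟩)
      (fun y hy => inner_zero_left _) hui (fun y _ => inner_zero_left _)
    refine ⟨Γ', hΓ', hag, fun μ ⟨hμ, hμL⟩ => ?_⟩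
    have hPμ : ∀ t ∈ T, Γ.P q₀ fr (t, μ) = Γ.P q₀ fr (t₁, μ) := fun t ht => by
      have := (hμ t ht).2
      rw [(hc (t, μ) ⟨hw.ball_subset ht, hμL⟩).2, (hc (t₁, μ) ⟨hw.mem_center, hμL⟩).2] at this
      simpa using this
    have hXμ : ∀ t ∈ T, Γ.X q₀ fr (t, μ) + e • u (t, μ) = Γ.X q₀ fr (t₁, μ) + e • u (t₁, μ) :=
      fun t ht => by
        have := (hμ t ht).1
        rwa [(hc (t, μ) ⟨hw.ball_subset ht, hμL⟩).1, (hc (t₁, μ) ⟨hw.mem_center, hμL⟩).1] at this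
    have hμl : μ ≠ l := by
      rintro rfl
      have h2 := hXμ t₂ ht₂
      have h3 := hXμ t₃ ht₃
      rw [(hlc t₂ ht₂).1] at h2
      rw [(hlc t₃ ht₃).1, ← h2, hu3] at h3
      exact hu2 (by simpa [he.ne'] using h3)
    have hu0 : ∀ t ∈ T, u (t, μ) = 0 := fun t ht => huz (t, μ) ⟨ht, hμL⟩ hμl
      (tderiv_eq_zero_of_eq_const hT hPμ ht)
    refine ⟨fun t ht => ⟨?_, hPμ t ht⟩, hμl⟩
    simpa [hu0 t ht, hu0 t₁ ht₁] using hXμ t ht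

end KillFiniteOrder

/-! ### Removing flat parameters. -/

section KillFlat

variable {n : ℕ} {H : Type*} [TopologicalSpace H] {IM : ModelWithCorners ℝ ℝ H}
  {I : Type*} [TopologicalSpace I] [ChartedSpace H I]
  {J : Type*} [TopologicalSpace J] [ChartedSpace ℝ J]
  [IsManifold IM ∞ I] [IsManifold 𝓘(ℝ, ℝ) ∞ J]
  {Γ : IntegralFamily n IM I J} {q₀ : I × J} {fr : ContactFrame n}
  {t₀ ρ' ρ'' ρ₂ a b t₁ η : ℝ} {L : Set ℝ}

theorem tderiv_comp_slowDown {V : Type*} [NormedAddCommGroup V] [NormedSpace ℝ V] {A : Set ℝ}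
    (hA : UniqueDiffOn ℝ A) {χ γ : ℝ → ℝ} (hγ : ContDiff ℝ ∞ γ)
    (hmaps : MapsTo (slowDown χ γ) (A ×ˢ L) (A ×ˢ L)) {F : ℝ × ℝ → V}
    (hF : ContDiffOn ℝ ∞ F (A ×ˢ L)) {y : ℝ × ℝ} (hy : y ∈ A ×ˢ L) :
    tderiv A (fun y => F (slowDown χ γ y)) y =
      (1 + χ y.2 * deriv γ y.1) • tderiv A F (slowDown χ γ y) := by
  have h1 : HasDerivWithinAt (fun t => t + χ y.2 * γ t) (1 + χ y.2 * deriv γ y.1) A y.1 :=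
    ((hasDerivAt_id y.1).add (((hγ.differentiable (by simp)) y.1).hasDerivAt.const_mul
      (χ y.2))).hasDerivWithinAt
  have h2 := hasDerivWithinAt_tderiv hA hF (hmaps hy)
  have h3 : MapsTo (fun t => t + χ y.2 * γ t) A A := fun t ht => (hmaps (x := (t, y.2)) ⟨ht, hy.2⟩).1
  exact (HasDerivWithinAt.scomp y.1 h2 h1 h3).derivWithin (hA _ hy.1)

variable [T2Space I] [T2Space J]

/-- Near a compact set of parameters along which the family is flat, the curves can be made
constant near `t₁`, without creating constant curves. -/
theorem IntegralFamily.ValidOn.exists_slowDown (hv : Γ.ValidOn q₀ fr (tball IM t₀ ρ₂) L)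
    (hw : IsWindow IM q₀ t₀ ρ' ρ'' ρ₂ a b t₁ η L) {Y : Set ℝ} (hY : IsCompact Y) (hYL : Y ⊆ L)
    (hflat : ∀ t ∈ Metric.ball t₁ η, ∀ l ∈ Y, ∀ j,
      iteratedFDeriv ℝ j (Γ.displ q₀ fr t₁) (t, l) = 0)
    {𝒰 : Set (IntegralFamily n IM I J)} (h𝒰 : 𝒰 ∈ 𝓝 Γ) :
    ∃ Γ' ∈ 𝒰, Γ.AgreesOff Γ' q₀ fr (tball IM t₀ ρ₂) L ∧
      Γ'.constSet q₀ fr t₁ η ∩ L ⊆ Γ.constSet q₀ fr t₁ η ∧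
      ∃ ρ > 0, ∀ x ∈ L, (∃ y ∈ Y, |x - y| ≤ ρ) → ∀ t ∈ Metric.ball t₁ (η / 4),
        Γ'.X q₀ fr (t, x) = Γ.X q₀ fr (t₁, x) ∧ Γ'.P q₀ fr (t, x) = Γ.P q₀ fr (t₁, x) := by
  have hη := hw.pos
  have hB := hw.isBox
  have hL := hB.isOpen_right
  have hA := hB.uniqueDiffOn_left
  set A := tball IM t₀ ρ₂ with hAdef
  obtain ⟨ρ₀, hρ₀, hρ₀L⟩ := hY.exists_cthickening_subset_open hL hYL
  have hYc : IsCompact (Metric.cthickening ρ₀ Y) :=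
    Metric.isCompact_of_isClosed_isBounded Metric.isClosed_cthickening hY.isBounded.cthickening
  obtain ⟨β, hβ, hβ1, hβ0, hβ01⟩ := exists_cutoff t₁ (show 0 < η / 4 by linarith)
    (show η / 4 < η / 2 by linarith)
  -- With full amplitude this field moves every time within `η / 4` to `t₁`; in general it only
  -- brings times closer to `t₁`.
  let γ : ℝ → ℝ := fun t => β t * (t₁ - t)
  have hγ : ContDiff ℝ ∞ γ := hβ.mul (contDiff_const.sub contDiff_id)
  have hdist : ∀ c, 0 ≤ c → c ≤ 1 → ∀ t, dist (t + c * γ t) t₁ ≤ dist t t₁ := by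
    intro c hc0 hc1 t
    have h1 : t + c * γ t - t₁ = (1 - c * β t) * (t - t₁) := by simp only [γ]; ring
    have h2 : 0 ≤ c * β t := mul_nonneg hc0 (hβ01 t).1
    have h3 : c * β t ≤ 1 := mul_le_one₀ hc1 (hβ01 t).1 (hβ01 t).2
    rw [Real.dist_eq, Real.dist_eq, h1, abs_mul, abs_of_nonneg (by linarith)]
    exact mul_le_of_le_one_left (abs_nonneg _) (by linarith)
  have hTA : Metric.ball t₁ η ⊆ A := hw.ball_subset
  have hCT : Metric.closedBall t₁ (η / 2) ⊆ Metric.ball t₁ η :=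
    Metric.closedBall_subset_ball (by linarith)
  have hγ0 : ∀ t ∉ Metric.closedBall t₁ (η / 2), γ t = 0 := fun t ht => by
    simp only [γ]
    rw [hβ0 t fun h => ht (Metric.ball_subset_closedBall h), zero_mul]
  have hcoo := hv.contDiffOn_coords hB
  have hdis := hv.contDiffOn_displ hB hw.mem_center
  set C : Set (ℝ × ℝ) := Metric.closedBall t₁ (η / 2) ×ˢ Metric.cthickening ρ₀ Y with hCdef
  have hC : IsCompact C := (isCompact_closedBall _ _).prod hYc
  have hCB : C ⊆ A ×ˢ L := prod_mono (hCT.trans hTA) hρ₀L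
  obtain ⟨r, δ, hδ, hch⟩ := hv.exists_isChange hB hC hCB h𝒰
  obtain ⟨χ, hχ, hχ01, hχ0, ⟨ρ, hρ, hχ1⟩, hsmall⟩ := _root_.exists_slowDown hη hL
    (hdis.mono (prod_mono hTA Subset.rfl)) hY hρ₀ hρ₀L hflat hγ
    (fun c hc0 hc1 t ht => (hdist c hc0 hc1 t).trans ht)
    (fun c hc0 hc1 t ht => (hdist c hc0 hc1 t).trans_lt ht) r hδ
  have hmaps : MapsTo (slowDown χ γ) (A ×ˢ L) (A ×ˢ L) := by
    intro y hy
    refine ⟨?_, hy.2⟩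
    by_cases h : y.1 ∈ Metric.closedBall t₁ (η / 2)
    · exact hTA ((hdist _ (hχ01 y.2).1 (hχ01 y.2).2 y.1).trans_lt (hCT h))
    · simp only [slowDown, hγ0 _ h, mul_zero, add_zero]
      exact hy.1
  -- A change of the time variable preserves `z' = ⟨p, x'⟩`. Since `λ` is kept, the same difference
  -- arises from the displacement, which is flat along `Y`.
  let h : ℝ × ℝ → fr.Par := fun y => Γ.coords q₀ fr (slowDown χ γ y) - Γ.coords q₀ fr y
  have hh : ContDiffOn ℝ ∞ h (A ×ˢ L) :=
    (hcoo.comp (contDiff_slowDown hχ hγ).contDiffOn hmaps).sub hcoo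
  obtain ⟨Γ', hΓ', hoff, hv', hc⟩ := hch h hh (fun y hy hyC => by
      have h0 : χ y.2 * γ y.1 = 0 := by
        by_cases h1 : y.1 ∈ Metric.closedBall t₁ (η / 2)
        · rw [hχ0 y.2 fun h2 => hyC ⟨h1, h2⟩, zero_mul]
        · rw [hγ0 _ h1, mul_zero]
      simp only [h, slowDown, h0, add_zero, Prod.mk.eta, sub_self])
    (fun y hy => by
      have e1 : (fun y => Γ.Z q₀ fr y + (h y).2.2) = fun y => Γ.Z q₀ fr (slowDown χ γ y) := by
        funext z
        simp [h, IntegralFamily.coords]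
      have e2 : (fun y => Γ.X q₀ fr y + (h y).1) = fun y => Γ.X q₀ fr (slowDown χ γ y) := by
        funext z
        simp [h, IntegralFamily.coords]
      have e3 : Γ.P q₀ fr y + (h y).2.1 = Γ.P q₀ fr (slowDown χ γ y) := by
        simp [h, IntegralFamily.coords]
      rw [e1, e2, e3, tderiv_comp_slowDown hA hγ hmaps (hv.contDiffOn_Z hB) hy,
        tderiv_comp_slowDown hA hγ hmaps (hv.contDiffOn_X hB) hy, inner_smul_right,
        hv.tderiv_Z hB (hmaps hy), smul_eq_mul])
    (fun k hk y hy => by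
      have hyT : y ∈ Metric.ball t₁ η ×ˢ L := ⟨hCT hy.1, hρ₀L hy.2⟩
      have hopen : IsOpen (Metric.ball t₁ η ×ˢ L) := Metric.isOpen_ball.prod hL
      have e1 : iteratedFDerivWithin ℝ k h (A ×ˢ L) y = iteratedFDeriv ℝ k h y := by
        rw [← iteratedFDerivWithin_univ]
        refine iteratedFDerivWithin_congr_set ?_ k
        filter_upwards [hopen.mem_nhds hyT] with z hz
        exact propext ⟨fun _ => mem_univ z, fun _ => ⟨hTA hz.1, hz.2⟩⟩
      have e2 : h = fun y => Γ.displ q₀ fr t₁ (slowDown χ γ y) - Γ.displ q₀ fr t₁ y := by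
        funext z
        simp only [h, IntegralFamily.displ, slowDown]
        abel
      rw [e1, e2]
      exact hsmall k hk y ⟨hy.1, hyT.2⟩)
  have hX' : ∀ y ∈ A ×ˢ L, Γ'.X q₀ fr y = Γ.X q₀ fr (slowDown χ γ y) := fun y hy => by
    rw [(hc y hy).1]
    simp [h, IntegralFamily.coords]
  have hP' : ∀ y ∈ A ×ˢ L, Γ'.P q₀ fr y = Γ.P q₀ fr (slowDown χ γ y) := fun y hy => by
    rw [(hc y hy).2.1]
    simp [h, IntegralFamily.coords]
  have hsd : ∀ x, slowDown χ γ (t₁, x) = (t₁, x) := fun x => by simp [slowDown, γ]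
  refine ⟨Γ', hΓ', ⟨fun q hq => hoff q fun h => hq (image_mono hCB h), hv'⟩, ?_, ρ, hρ, ?_⟩
  · rintro μ ⟨hμ, hμL⟩ s hs
    -- The time change is onto the window by the intermediate value theorem. So a curve that is
    -- constant after the change was constant before.
    obtain ⟨t, ht, hts⟩ : ∃ t ∈ Metric.ball t₁ η, slowDown χ γ (t, μ) = (s, μ) := by
      let σ := max (η / 2) (dist s t₁)
      have hσ0 : 0 < σ := lt_max_of_lt_left (by linarith)
      have hση : σ < η := max_lt (by linarith) hs
      have hf : ContinuousOn (fun t => t + χ μ * γ t) (Icc (t₁ - σ) (t₁ + σ)) :=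
        (continuous_id.add (continuous_const.mul hγ.continuous)).continuousOn
      have hend : ∀ t, dist t t₁ = σ → t + χ μ * γ t = t := fun t ht => by
        have : γ t = 0 := by
          simp only [γ]
          rw [hβ0 t fun h => ?_, zero_mul]
          have h1 : dist t t₁ < η / 2 := h
          have h2 : η / 2 ≤ σ := le_max_left _ _
          linarith
        rw [this, mul_zero, add_zero]
      have h1 := intermediate_value_Icc (by linarith) hf
      rw [hend (t₁ - σ) (by rw [Real.dist_eq, sub_sub_cancel_left, abs_neg, abs_of_pos hσ0]),
        hend (t₁ + σ) (by rw [Real.dist_eq, add_sub_cancel_left, abs_of_pos hσ0]),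
        ← Real.closedBall_eq_Icc] at h1
      obtain ⟨t, ht, hts⟩ := h1 (show s ∈ Metric.closedBall t₁ σ from Metric.mem_closedBall.2 (le_max_right _ _))
      exact ⟨t, Metric.closedBall_subset_ball hση ht, Prod.ext hts rfl⟩
    have h2 := hμ t ht
    rw [hX' (t, μ) ⟨hTA ht, hμL⟩, hX' (t₁, μ) ⟨hw.mem_center, hμL⟩,
      hP' (t, μ) ⟨hTA ht, hμL⟩, hP' (t₁, μ) ⟨hw.mem_center, hμL⟩, hts, hsd] at h2
    exact h2
  · intro x hx hxY t ht
    have htA : t ∈ A := hTA (Metric.ball_subset_ball (by linarith) ht)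
    have hs : slowDown χ γ (t, x) = (t₁, x) := by
      simp only [slowDown, γ]
      rw [hχ1 x hxY, hβ1 t (Metric.ball_subset_closedBall ht)]
      simp
    rw [hX' (t, x) ⟨htA, hx⟩, hP' (t, x) ⟨htA, hx⟩, hs]
    exact ⟨rfl, rfl⟩

/-- A compact set of parameters along which the family is flat can be removed from the set of
parameters of constant curves. -/
theorem IntegralFamily.ValidOn.exists_change_of_flat (hn : 2 ≤ n)
    (hv : Γ.ValidOn q₀ fr (tball IM t₀ ρ₂) L)
    (hw : IsWindow IM q₀ t₀ ρ' ρ'' ρ₂ a b t₁ η L) {Y : Set ℝ} (hY : IsCompact Y) (hYL : Y ⊆ L)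
    (hflat : ∀ t ∈ Metric.ball t₁ η, ∀ l ∈ Y, ∀ j,
      iteratedFDeriv ℝ j (Γ.displ q₀ fr t₁) (t, l) = 0)
    {𝒰 : Set (IntegralFamily n IM I J)} (h𝒰 : 𝒰 ∈ 𝓝 Γ) :
    ∃ Γ' ∈ 𝒰, Γ.AgreesOff Γ' q₀ fr (tball IM t₀ ρ₂) L ∧ ∃ G, IsOpen G ∧ Y ⊆ G ∧
      Γ'.constSet q₀ fr t₁ η ∩ L ⊆ Γ.constSet q₀ fr t₁ η \ G := by
  have hη := hw.pos
  obtain ⟨Γ₁, hΓ₁, hag₁, hsub₁, ρ, hρ, hconst⟩ := hv.exists_slowDown hw hY hYL hflat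
    (interior_mem_nhds.2 h𝒰)
  obtain ⟨ρ₀, hρ₀, hρ₀L⟩ := hY.exists_cthickening_subset_open hw.isBox.isOpen_right hYL
  have hYc : IsCompact (Metric.cthickening ρ₀ Y) :=
    Metric.isCompact_of_isClosed_isBounded Metric.isClosed_cthickening hY.isBounded.cthickening
  -- The grid cutoff reaches out to three times its scale, which must remain within both radii.
  have hm : 0 < min ρ ρ₀ / 3 := by positivity
  obtain ⟨K, hK1, hK0⟩ := exists_grid_cutoff hY hm
  let θ : ℝ → ℝ := fun x => gridSum K ((min ρ ρ₀ / 3)⁻¹ * x)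
  have hθ : ContDiff ℝ ∞ θ := (contDiff_gridSum K).comp (contDiff_const.mul contDiff_id)
  have hθne : ∀ x, θ x ≠ 0 → ∃ y ∈ Y, |x - y| ≤ min ρ ρ₀ := fun x hx => by
    by_contra! h
    exact hx (hK0 x fun y hy => by linarith [h y hy])
  obtain ⟨φ, hφ, hφ1, hφ0, -⟩ := exists_cutoff t₁ (show 0 < η / 16 by linarith)
    (show η / 16 < η / 8 by linarith)
  have : Nontrivial fr.W := Module.nontrivial_of_finrank_pos (R := ℝ) (by rw [fr.finrank_W]; omega)
  obtain ⟨w, hw0⟩ := exists_ne (0 : fr.W)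
  -- Where `x` no longer moves, any change of `p` is free of defect, so a bump in a fixed direction
  -- `w` is allowed.
  let v : ℝ × ℝ → fr.W := fun y => (θ y.2 * φ y.1) • w
  have hvs : ContDiff ℝ ∞ v :=
    ((hθ.comp contDiff_snd).mul (hφ.comp contDiff_fst)).smul contDiff_const
  have hz' : ∀ y, tderiv (tball IM t₀ ρ₂) (fun _ : ℝ × ℝ => (0 : fr.W)) y = 0 := fun y => by
    simp [tderiv]
  obtain ⟨e, he, Γ', hΓ', hag, hc⟩ := hag₁.2.eventually_change_smul hw hYc hρ₀L
    (mem_interior_iff_mem_nhds.1 hΓ₁) (u := fun _ => 0) contDiffOn_const hvs.contDiffOn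
    (fun y hy hyC => ⟨rfl, by
      have h0 : θ y.2 * φ y.1 = 0 := by
        by_contra h
        obtain ⟨x, hx, hxy⟩ := hθne y.2 (left_ne_zero_of_mul h)
        refine hyC ⟨?_, Metric.mem_cthickening_of_dist_le y.2 x ρ₀ Y hx
          (hxy.trans (min_le_right _ _))⟩
        by_contra h1
        refine right_ne_zero_of_mul h (hφ0 _ fun h2 => h1 ?_)
        exact Metric.closedBall_subset_closedBall (by linarith) (Metric.ball_subset_closedBall h2)
      simp only [v, h0, zero_smul]⟩)
    (fun y hy => by
      by_cases h : θ y.2 * φ y.1 = 0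
      · simp only [v, h, zero_smul, inner_zero_left]
      · obtain ⟨x, hx, hxy⟩ := hθne y.2 (left_ne_zero_of_mul h)
        have h1 : y.1 ∈ Metric.ball t₁ (η / 4) := by
          by_contra h1
          exact right_ne_zero_of_mul h (hφ0 _ fun h2 =>
            h1 (Metric.ball_subset_ball (by linarith) h2))
        have h2 : tderiv (tball IM t₀ ρ₂) (Γ₁.X q₀ fr) (y.1, y.2) = 0 :=
          tderiv_eq_zero_of_eq_const Metric.isOpen_ball
            (fun t ht => (hconst y.2 hy.2 ⟨x, hx, hxy.trans (min_le_left _ _)⟩ t ht).1) h1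
        rw [show y = (y.1, y.2) from rfl, h2, inner_zero_right])
    (fun y _ => inner_zero_right _) (fun y _ => by rw [hz', inner_zero_right])
  refine ⟨Γ', hΓ', hag₁.trans hag, {x | θ x ≠ 0}, isOpen_ne_fun hθ.continuous continuous_const,
    fun y hy => ?_, ?_⟩
  · have : θ y = 1 := hK1 y ⟨y, hy, by rw [sub_self, abs_zero]; exact hm.le⟩
    rw [mem_ofPred_eq, this]
    exact one_ne_zero
  rintro μ ⟨hμ, hμL⟩
  have hXμ : ∀ t ∈ Metric.ball t₁ η, Γ₁.X q₀ fr (t, μ) = Γ₁.X q₀ fr (t₁, μ) := fun t ht => by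
    have := (hμ t ht).1
    rw [(hc (t, μ) ⟨hw.ball_subset ht, hμL⟩).1, (hc (t₁, μ) ⟨hw.mem_center, hμL⟩).1] at this
    simpa using this
  have hPμ : ∀ t ∈ Metric.ball t₁ η, Γ₁.P q₀ fr (t, μ) + e • v (t, μ) =
      Γ₁.P q₀ fr (t₁, μ) + e • v (t₁, μ) := fun t ht => by
    have := (hμ t ht).2
    rwa [(hc (t, μ) ⟨hw.ball_subset ht, hμL⟩).2, (hc (t₁, μ) ⟨hw.mem_center, hμL⟩).2] at this
  -- Where `θ` is nonzero, `p` was constant near `t₁` and has received a bump which is 1 at `t₁` and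
  -- 0 at `t₁ + η / 8`.
  have hθμ : θ μ = 0 := by
    by_contra hne
    obtain ⟨x, hx, hxy⟩ := hθne μ hne
    have hcst := hconst μ hμL ⟨x, hx, hxy.trans (min_le_left _ _)⟩
    have hd : dist (t₁ + η / 8) t₁ = η / 8 := by
      rw [Real.dist_eq, add_sub_cancel_left, abs_of_pos (by linarith)]
    have h1 := hPμ (t₁ + η / 8) (by rw [Metric.mem_ball, hd]; linarith)
    rw [(hcst (t₁ + η / 8) (by rw [Metric.mem_ball, hd]; linarith)).2,
      (hcst t₁ (Metric.mem_ball_self (by linarith))).2] at h1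
    simp only [v] at h1
    rw [hφ0 _ (by rw [Metric.mem_ball, hd]; exact lt_irrefl _),
      hφ1 _ (Metric.mem_closedBall_self (by linarith))] at h1
    simp [he.ne', hne, hw0] at h1
  refine ⟨hsub₁ ⟨fun t ht => ⟨hXμ t ht, ?_⟩, hμL⟩, fun h => h hθμ⟩
  simpa [v, hθμ] using hPμ t ht

end KillFlat

/-! ### Families without constant curves on a window. -/

section Nonconstant

variable {n : ℕ} {H : Type*} [TopologicalSpace H] {IM : ModelWithCorners ℝ ℝ H}
  {I : Type*} [TopologicalSpace I] [ChartedSpace H I]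
  {J : Type*} [TopologicalSpace J] [ChartedSpace ℝ J]
  [IsManifold IM ∞ I] [IsManifold 𝓘(ℝ, ℝ) ∞ J]
  {Γ : IntegralFamily n IM I J} {q₀ : I × J} {fr : ContactFrame n}
  {t₀ ρ' ρ'' ρ₂ a b t₁ η : ℝ} {L : Set ℝ}

theorem IntegralFamily.ValidOn.order_or_flat (hv : Γ.ValidOn q₀ fr (tball IM t₀ ρ₂) L)
    (hw : IsWindow IM q₀ t₀ ρ' ρ'' ρ₂ a b t₁ η L) {l : ℝ} (hl : l ∈ L) :
    (∃ (k : ℕ) (G : ℝ × ℝ → fr.Par), ContDiffOn ℝ ∞ G (Metric.ball t₁ η ×ˢ L) ∧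
      (∀ y ∈ Metric.ball t₁ η ×ˢ L, Γ.displ q₀ fr t₁ y = (y.2 - l) ^ k • G y) ∧
      ∃ t ∈ Metric.ball t₁ η, G (t, l) ≠ 0) ∨
    ∀ t ∈ Metric.ball t₁ η, ∀ j, iteratedFDeriv ℝ j (Γ.displ q₀ fr t₁) (t, l) = 0 := by
  have hL := hw.isBox.isOpen_right
  refine (exists_order_or_forall Metric.isOpen_ball hL hw.isBox.convex_right hl
    ((hv.contDiffOn_displ hw.isBox hw.mem_center).mono
      (prod_mono hw.ball_subset Subset.rfl))).imp_right fun h t ht j => ?_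
  obtain ⟨G, hG, hFG⟩ := h (j + 1)
  exact iteratedFDeriv_pow_smul_eq_zero (Metric.isOpen_ball.prod hL) ⟨ht, hl⟩ j hG hFG

variable [T2Space I] [T2Space J]

/-- Induction on the finite set: each parameter is removed by the change for finite order or for
flatness, and neither creates new parameters of constant curves. -/
theorem IntegralFamily.ValidOn.exists_notMem_constSet_of_finite (hn : 2 ≤ n)
    (hw : IsWindow IM q₀ t₀ ρ' ρ'' ρ₂ a b t₁ η L) {Λ : Set ℝ} (hΛL : Λ ⊆ L) (s : Finset ℝ) :
    ∀ {Γ : IntegralFamily n IM I J}, Γ.ValidOn q₀ fr (tball IM t₀ ρ₂) L →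
      Γ.constSet q₀ fr t₁ η ∩ Λ ⊆ s → ∀ {𝒰 : Set (IntegralFamily n IM I J)}, 𝒰 ∈ 𝓝 Γ →
      ∃ Γ' ∈ 𝒰, Γ.AgreesOff Γ' q₀ fr (tball IM t₀ ρ₂) L ∧ ∀ l ∈ Λ, l ∉ Γ'.constSet q₀ fr t₁ η := by
  classical
  induction s using Finset.induction_on with
  | empty =>
    intro Γ hv hs 𝒰 h𝒰
    exact ⟨Γ, mem_of_mem_nhds h𝒰, ⟨fun _ _ => rfl, hv⟩, fun l hl hc => by simpa using hs ⟨hc, hl⟩⟩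
  | insert l s _ ih =>
    intro Γ hv hs 𝒰 h𝒰
    by_cases hl : l ∈ Γ.constSet q₀ fr t₁ η ∩ Λ
    · obtain ⟨Γ₁, hΓ₁, hag₁, hsub⟩ : ∃ Γ' ∈ interior 𝒰,
          Γ.AgreesOff Γ' q₀ fr (tball IM t₀ ρ₂) L ∧
          Γ'.constSet q₀ fr t₁ η ∩ L ⊆ Γ.constSet q₀ fr t₁ η \ {l} := by
        rcases hv.order_or_flat hw (hΛL hl.2) with ⟨k, G, hG, hFG, hne⟩ | hflat
        · exact hv.exists_change_of_order hn hw (hΛL hl.2) hG hFG hne hl.1 (interior_mem_nhds.2 h𝒰)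
        · obtain ⟨Γ', hΓ', hag, G, -, hlG, hsub⟩ := hv.exists_change_of_flat hn hw
            (isCompact_singleton (x := l)) (singleton_subset_iff.2 (hΛL hl.2))
            (fun t ht μ hμ j => by rw [mem_singleton_iff.1 hμ]; exact hflat t ht j)
            (interior_mem_nhds.2 h𝒰)
          exact ⟨Γ', hΓ', hag, hsub.trans (sdiff_subset_sdiff_right hlG)⟩
      obtain ⟨Γ', hΓ', hag, hno⟩ := ih hag₁.2 (fun μ hμ => by
        have h1 := hsub ⟨hμ.1, hΛL hμ.2⟩
        have h2 := hs ⟨h1.1, hμ.2⟩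
        rw [Finset.coe_insert] at h2
        exact h2.resolve_left h1.2) (mem_interior_iff_mem_nhds.1 hΓ₁)
      exact ⟨Γ', hΓ', hag₁.trans hag, hno⟩
    · refine ih hv (fun μ hμ => ?_) h𝒰
      have h2 := hs hμ
      rw [Finset.coe_insert] at h2
      exact h2.resolve_left fun h => hl (h ▸ hμ)

/-- After an arbitrarily small change, no curve with parameter in a compact set is constant on the
window. -/
theorem IntegralFamily.ValidOn.exists_notMem_constSet (hn : 2 ≤ n)
    (hv : Γ.ValidOn q₀ fr (tball IM t₀ ρ₂) L)
    (hw : IsWindow IM q₀ t₀ ρ' ρ'' ρ₂ a b t₁ η L) {Λ : Set ℝ} (hΛ : IsCompact Λ) (hΛL : Λ ⊆ L)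
    {𝒰 : Set (IntegralFamily n IM I J)} (h𝒰 : 𝒰 ∈ 𝓝 Γ) :
    ∃ Γ' ∈ 𝒰, Γ.AgreesOff Γ' q₀ fr (tball IM t₀ ρ₂) L ∧ ∀ l ∈ Λ, l ∉ Γ'.constSet q₀ fr t₁ η := by
  classical
  have hL := hw.isBox.isOpen_right
  have ht₁ : t₁ ∈ Metric.ball t₁ η := Metric.mem_ball_self hw.pos
  have hdis := (hv.contDiffOn_displ hw.isBox hw.mem_center).mono
    (prod_mono hw.ball_subset Subset.rfl)
  have hline : ∀ t ∈ Metric.ball t₁ η, ∀ {V : Type} [NormedAddCommGroup V] (f : ℝ × ℝ → V),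
      ContinuousOn f (Metric.ball t₁ η ×ˢ L) → ContinuousOn (fun μ => f (t, μ)) Λ :=
    fun t ht V _ f hf => hf.comp (by fun_prop) fun μ hμ => ⟨ht, hΛL hμ⟩
  -- This is the compact set of flat parameters in `Λ`. It is removed in one step, together with a
  -- neighbourhood `G`.
  let Y : Set ℝ := Λ ∩ ⋂ (t : ℝ) (_ : t ∈ Metric.ball t₁ η) (j : ℕ),
    (Λ ∩ (fun μ => iteratedFDeriv ℝ j (Γ.displ q₀ fr t₁) (t, μ)) ⁻¹' {0})
  have hYc : IsClosed Y := by
    refine hΛ.isClosed.inter (isClosed_iInter fun t => isClosed_iInter fun ht =>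
      isClosed_iInter fun j => ContinuousOn.preimage_isClosed_of_isClosed ?_ hΛ.isClosed
        isClosed_singleton)
    have hc : ContinuousOn (iteratedFDeriv ℝ j (Γ.displ q₀ fr t₁)) (Metric.ball t₁ η ×ˢ L) :=
      fun y hy => ((hdis.contDiffAt ((Metric.isOpen_ball.prod hL).mem_nhds
        hy)).continuousAt_iteratedFDeriv (by exact_mod_cast le_top)).continuousWithinAt
    exact hc.comp (by fun_prop) fun μ hμ => ⟨ht, hΛL hμ⟩
  have hY : IsCompact Y := hΛ.of_isClosed_subset hYc inter_subset_left
  obtain ⟨Γ₁, hΓ₁, hag₁, G, hG, hYG, hsub⟩ := hv.exists_change_of_flat hn hw hY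
    (inter_subset_left.trans hΛL) (fun t ht l hl j => by
      have h1 := mem_iInter.1 (mem_iInter₂.1 hl.2 t ht) j
      exact h1.2) (interior_mem_nhds.2 h𝒰)
  -- What may remain is compact and consists of parameters of finite order. They are isolated, so
  -- there are finitely many.
  let E : Set ℝ := (Λ \ G) ∩ Γ.constSet q₀ fr t₁ η
  have hE : IsCompact E := by
    refine (hΛ.diff hG).of_isClosed_subset ?_ inter_subset_left
    have h1 : E = (Λ \ G) ∩ ⋂ (t : ℝ) (_ : t ∈ Metric.ball t₁ η),
        (Λ ∩ (fun μ => (Γ.X q₀ fr (t, μ) - Γ.X q₀ fr (t₁, μ),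
          Γ.P q₀ fr (t, μ) - Γ.P q₀ fr (t₁, μ))) ⁻¹' {0}) := by
      ext μ
      refine and_congr_right fun hμ => ?_
      simp only [mem_iInter]
      refine forall₂_congr fun t _ => ?_
      rw [mem_inter_iff, mem_preimage, mem_singleton_iff, Prod.mk_eq_zero, sub_eq_zero, sub_eq_zero]
      exact (and_iff_right hμ.1).symm
    rw [h1]
    refine (hΛ.diff hG).isClosed.inter (isClosed_iInter fun t => isClosed_iInter fun ht =>
      ContinuousOn.preimage_isClosed_of_isClosed ?_ hΛ.isClosed isClosed_singleton)
    have hX := ((hv.contDiffOn_X hw.isBox).mono (prod_mono hw.ball_subset Subset.rfl)).continuousOn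
    have hP := ((hv.contDiffOn_P hw.isBox).mono (prod_mono hw.ball_subset Subset.rfl)).continuousOn
    exact ((hline t ht _ hX).sub (hline t₁ ht₁ _ hX)).prodMk
      ((hline t ht _ hP).sub (hline t₁ ht₁ _ hP))
  -- Near `l` the displacement is `(λ - l)^k` times a factor that is nonzero at some time, so it
  -- cannot vanish identically in time for `λ ≠ l`.
  have hiso : ∀ l ∈ E, ∃ U ∈ 𝓝 l, U ∩ E ⊆ {l} := by
    intro l hl
    have hlL := hΛL hl.1.1
    rcases hv.order_or_flat hw hlL with ⟨k, g, hg, hFg, t, ht, hne⟩ | hflat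
    · have hc : ContinuousAt (fun μ => g (t, μ)) l :=
        ContinuousAt.comp (f := fun μ : ℝ => (t, μ)) (hg.continuousOn.continuousAt
          ((Metric.isOpen_ball.prod hL).mem_nhds ⟨ht, hlL⟩)) (by fun_prop)
      refine ⟨_, hc.eventually_ne hne, fun μ ⟨hμ, hμE⟩ => ?_⟩
      by_contra hμl
      have h1 := hFg (t, μ) ⟨ht, hΛL hμE.1.1⟩
      rw [hv.displ_eq_zero hw (hΛL hμE.1.1) hμE.2 ht] at h1
      exact hμ ((smul_eq_zero.1 h1.symm).resolve_left (pow_ne_zero k (sub_ne_zero.2 hμl)))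
    · refine absurd (hYG ⟨hl.1.1, ?_⟩) hl.1.2
      simp only [mem_iInter]
      exact fun t ht j => ⟨hl.1.1, hflat t ht j⟩
  choose! U hU hUE using hiso
  obtain ⟨s, hs⟩ := hE.elim_nhds_subcover' (fun l _ => U l) fun l hl => hU l hl
  obtain ⟨Γ', hΓ', hag, hno⟩ := IntegralFamily.ValidOn.exists_notMem_constSet_of_finite hn hw hΛL
    (s.image Subtype.val) hag₁.2 (fun μ hμ => by
      have h1 := hsub ⟨hμ.1, hΛL hμ.2⟩
      have hμE : μ ∈ E := ⟨⟨hμ.2, h1.2⟩, h1.1⟩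
      obtain ⟨x, hx, hμx⟩ := mem_iUnion₂.1 (hs hμE)
      have : μ = x := hUE x x.2 ⟨hμx, hμE⟩
      rw [Finset.coe_image]
      exact ⟨x, hx, this.symm⟩) (mem_interior_iff_mem_nhds.1 hΓ₁)
  exact ⟨Γ', hΓ', hag₁.trans hag, hno⟩

end Nonconstant

/-! ### Density. -/

section Density

variable {n : ℕ} {H : Type*} [TopologicalSpace H] {IM : ModelWithCorners ℝ ℝ H}
  {I : Type*} [TopologicalSpace I] [ChartedSpace H I]
  {J : Type*} [TopologicalSpace J] [ChartedSpace ℝ J]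
  [IsManifold IM ∞ I] [IsManifold 𝓘(ℝ, ℝ) ∞ J] [T2Space I] [T2Space J]
  [SecondCountableTopology I] [SecondCountableTopology J]

/-- The range of the model is the closure of its interior, so open time intervals exist near every
point, also near a boundary point. -/
theorem exists_ball_subset_range (IM : ModelWithCorners ℝ ℝ H) {t₀ ρ : ℝ} (ht₀ : t₀ ∈ range IM)
    (hρ : 0 < ρ) : ∃ t₁, t₁ ≠ t₀ ∧ ∃ η > 0, Metric.ball t₁ η ⊆ range IM ∩ Metric.ball t₀ ρ := by
  have hU : IsOpen (interior (range IM) ∩ Metric.ball t₀ ρ) :=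
    isOpen_interior.inter Metric.isOpen_ball
  have hne : (interior (range IM) ∩ Metric.ball t₀ ρ).Nonempty := by
    rw [inter_comm]
    exact mem_closure_iff.1 (IM.range_subset_closure_interior ht₀) _ Metric.isOpen_ball
      (Metric.mem_ball_self hρ)
  obtain ⟨t₁, ht₁, hne₁⟩ := (dense_compl_singleton t₀).inter_open_nonempty _ hU hne
  obtain ⟨η, hη, hb⟩ := Metric.isOpen_iff.1 hU t₁ ht₁
  exact ⟨t₁, hne₁, η, hη, hb.trans (inter_subset_inter_left _ interior_subset)⟩

/-- All curves are first made nonconstant on a window beside `t₀`. That window then absorbs the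
defect of a generic change of `(x, p)` around `t₀`. -/
theorem locallyDense_immersed_or_goodRanks (hn : 2 ≤ n) :
    LocallyDense (fun (Γ : IntegralFamily n IM I J) q =>
      2 ≤ Γ.lineRank q 1 ∨ GoodRanks n (Γ.lineRank q)) univ univ := by
  intro Γ₀ _ q _ S hS
  obtain ⟨fr, hfr⟩ := ContactFrame.exists_valid (Γ₀.toFun q)
  obtain ⟨𝒱, h𝒱, N, hN, hval⟩ := (jetOpen_valid fr).exists_nhds hfr
  obtain ⟨ρ₀, hρ₀, hbox⟩ := exists_isBox (IM := IM) q (inter_mem hS hN)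
  obtain ⟨hB, hsub⟩ := hbox ρ₀ hρ₀ le_rfl
  set t₀ := (chart IM q q).1 with ht₀def
  set l₀ := (chart IM q q).2 with hl₀def
  have ht₀ : t₀ ∈ range IM := (box_mem_nhds (IM := IM) q hρ₀ |> mem_of_mem_nhds).2.1.1
  obtain ⟨t₁, hne, η₀, hη₀, hηsub⟩ := exists_ball_subset_range IM ht₀ (half_pos hρ₀)
  have hd : 0 < dist t₁ t₀ := dist_pos.2 hne
  have hdρ : dist t₁ t₀ < ρ₀ / 2 := (hηsub (Metric.mem_ball_self hη₀)).2
  set d := dist t₁ t₀ with hddef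
  -- The compensating bump lives in the ball of radius `2 η ≤ d / 2` around `t₁`, so it does not
  -- meet the ball of radius `d / 4` around `t₀` on which the jets are made generic.
  let η := min (η₀ / 4) (d / 4)
  have hη : 0 < η := by positivity
  have hηη₀ : 2 * η < η₀ := by have : η ≤ η₀ / 4 := min_le_left _ _; linarith
  have hηd : 2 * η ≤ d / 2 := by have : η ≤ d / 4 := min_le_right _ _; linarith
  have hmem₀ : t₀ ∈ tcball IM t₀ (3 * ρ₀ / 4) := ⟨ht₀, Metric.mem_closedBall_self (by linarith)⟩
  have hmem₁ : t₁ ∈ tcball IM t₀ (3 * ρ₀ / 4) :=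
    ⟨(hηsub (Metric.mem_ball_self hη₀)).1, Metric.mem_closedBall.2 (by linarith)⟩
  -- A compact convex subset of the line is an interval; near a boundary point of the time manifold
  -- it is one-sided.
  obtain ⟨a, b, hIcc⟩ : ∃ a b, tcball IM t₀ (3 * ρ₀ / 4) = Icc a b :=
    ⟨_, _, eq_Icc_of_connected_compact ⟨⟨t₀, hmem₀⟩, (convex_tcball _ _).isPreconnected⟩
      (isCompact_tcball _ _)⟩
  have hab : a < b := by
    rw [hIcc] at hmem₀ hmem₁
    rcases lt_or_gt_of_ne hne with h | h
    · linarith [hmem₀.2, hmem₁.1]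
    · linarith [hmem₁.2, hmem₀.1]
  have hw : IsWindow IM q t₀ (ρ₀ / 2) (3 * ρ₀ / 4) ρ₀ a b t₁ η (Metric.ball l₀ ρ₀) :=
    { nonneg := by linarith
      lt_mid := by linarith
      lt_right := by linarith
      lt_ends := hab
      mem_Icc := hIcc ▸ hmem₀
      Icc_eq := hIcc.symm
      isBox := hB
      pos := hη
      subset := (Metric.closedBall_subset_ball (by linarith)).trans
        (hηsub.trans (inter_subset_inter_right _ Metric.ball_subset_closedBall)) }
  obtain ⟨ψ, hψ, hψ1, hψ0, hψ01⟩ := exists_cutoff t₁ hη (show η < 2 * η by linarith)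
  have hL' : Metric.ball l₀ (ρ₀ / 2) ⊆ Metric.ball l₀ ρ₀ := Metric.ball_subset_ball (by linarith)
  have hB' : IsBox IM q (tball IM t₀ ρ₀) (Metric.ball l₀ (ρ₀ / 2)) :=
    ⟨hB.exists_open, Metric.isOpen_ball, hL'.trans hB.right_subset, hB.convex_left,
      convex_ball _ _⟩
  refine ⟨𝒱, h𝒱, _, box_mem_nhds (IM := IM) q (ρ := d / 4) (by linarith), fun Γ hΓ 𝒰 h𝒰 => ?_⟩
  have hv : Γ.ValidOn q fr (tball IM t₀ ρ₀) (Metric.ball l₀ ρ₀) :=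
    fun y hy => hval Γ hΓ _ (hsub y hy).2
  obtain ⟨Γ₁, hΓ₁, ⟨hoff₁, hv₁⟩, hnc⟩ := hv.exists_notMem_constSet hn hw
    (isCompact_closedBall l₀ (ρ₀ / 2)) (Metric.closedBall_subset_ball (by linarith))
    (interior_mem_nhds.2 h𝒰)
  have hv₁' : Γ₁.ValidOn q fr (tball IM t₀ ρ₀) (Metric.ball l₀ (ρ₀ / 2)) :=
    fun y hy => hv₁ y ⟨hy.1, hL' hy.2⟩
  have hIA : Icc a b ⊆ tball IM t₀ ρ₀ := by
    rw [← hIcc]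
    exact inter_subset_inter_right _ (Metric.closedBall_subset_ball (by linarith))
  have hX := (hv₁.contDiffOn_X hB).tderiv hB.uniqueDiffOn_left hB.isOpen_right
  have hP := (hv₁.contDiffOn_P hB).tderiv hB.uniqueDiffOn_left hB.isOpen_right
  obtain ⟨Γ', hΓ', hoff, hgood⟩ := hv₁'.exists_immersed_or_goodRanks hn (ρ := d / 4) (ρ₁ := d / 2)
    (ρ' := ρ₀ / 2) (ρ'' := 3 * ρ₀ / 4) (l₀ := l₀) (by linarith) (by linarith) (by linarith)
    (by linarith) (by linarith) hab hw.mem_Icc hIcc.symm hB'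
    (Metric.closedBall_subset_ball (by linarith)) (mem_interior_iff_mem_nhds.1 hΓ₁) hψ
    (fun t ht => hψ0 t fun h => ht (Metric.ball_subset_closedBall
      (hηsub (Metric.ball_subset_ball hηη₀.le h)).2))
    (fun t ht => hψ0 t fun h => by
      have h1 : dist t t₁ < 2 * η := h
      have h2 : dist t t₀ < d / 4 := ht
      have h3 := dist_triangle_left t₁ t₀ t
      linarith)
    (fun l hl => by
      have hlc := hnc l (Metric.ball_subset_closedBall hl)
      obtain ⟨τ, hτ, hτne⟩ : ∃ τ ∈ Metric.ball t₁ η,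
          tderiv (tball IM t₀ ρ₀) (Γ₁.X q fr) (τ, l) ≠ 0 ∨
          tderiv (tball IM t₀ ρ₀) (Γ₁.P q fr) (τ, l) ≠ 0 := by
        by_contra! h
        exact hlc (hv₁.mem_constSet hw (hL' hl) h)
      have hc : ∀ {f : ℝ × ℝ → fr.W},
          ContDiffOn ℝ ∞ f (tball IM t₀ ρ₀ ×ˢ Metric.ball l₀ ρ₀) →
          ContinuousOn (fun τ => f (τ, l)) (Icc a b) := fun hf =>
        ((contDiffOn_slice hf (hL' hl)).continuousOn).mono hIA
      have hnn : ∀ w : fr.W, 0 ≤ inner ℝ w w := fun w => real_inner_self_nonneg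
      refine intervalIntegral.integral_pos hab ?_ (fun x _ => mul_nonneg (hψ01 x).1
        (add_nonneg (hnn _) (hnn _))) ⟨τ, ?_, ?_⟩
      · exact hψ.continuous.continuousOn.mul
          (((hc hX).inner (hc hX)).add ((hc hP).inner (hc hP)))
      · rw [← hIcc]
        exact inter_subset_inter_right _ (Metric.closedBall_subset_closedBall (by linarith))
          (hw.subset (Metric.ball_subset_closedBall hτ))
      · rw [hψ1 τ (Metric.ball_subset_closedBall hτ), one_mul]
        rcases hτne with h | h
        · exact add_pos_of_pos_of_nonneg (real_inner_self_pos.2 h) (hnn _)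
        · exact add_pos_of_nonneg_of_pos (hnn _) (real_inner_self_pos.2 h))
  refine ⟨Γ', hΓ', fun q' hq' => ?_, fun q' hq' => ?_⟩
  · rw [hoff q', hoff₁ q']
    · rintro ⟨y, hy, rfl⟩
      exact hq' (hsub y hy).1
    · rintro ⟨y, hy, rfl⟩
      exact hq' (hsub y ⟨hy.1, hL' hy.2⟩).1
  · have := hgood _ hq'.2
    rwa [(chart IM q).left_inv hq'.1] at this

/-- The two perturbations are composed. Once every point of the compact set `N'` is immersed or
good, the immersed case gives good ranks on all of it. -/
theorem locallyDense_goodRanks (hn : 2 ≤ n) :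
    LocallyDense (fun (Γ : IntegralFamily n IM I J) q => GoodRanks n (Γ.lineRank q))
      univ univ := by
  have : LocallyCompactSpace (I × J) := Manifold.locallyCompact_of_finiteDimensional
    (IM.prod 𝓘(ℝ, ℝ))
  intro Γ₀ h₀ q hq S hS
  obtain ⟨𝒱, h𝒱, N, hN, hd⟩ := locallyDense_immersed_or_goodRanks hn Γ₀ h₀ q hq S hS
  obtain ⟨N', hN', hN's, hN'c⟩ := local_compact_nhds (inter_mem hN (interior_mem_nhds.2 hS))
  refine ⟨𝒱, h𝒱, N', hN', fun Γ hΓ 𝒰 h𝒰 => ?_⟩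
  obtain ⟨Γ₁, hΓ₁, hoff₁, him⟩ := hd Γ hΓ _ (interior_mem_nhds.2 h𝒰)
  obtain ⟨Γ', hΓ', hoff, hgood⟩ := (jetOpen_goodRanks hn).exists_forall_mem_of_isCompact
    (locallyDense_of_immersed hn N') hN'c (S := S)
    (mem_nhdsSet_iff_forall.2 fun x hx => mem_interior_iff_mem_nhds.1 (hN's hx).2)
    (show Γ₁ ∈ _ from fun q' hq' => him q' (hN's hq').1) (mem_interior_iff_mem_nhds.1 hΓ₁)
  exact ⟨Γ', hΓ', fun q' hq' => (hoff q' hq').trans (hoff₁ q' hq'), hgood⟩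

theorem isOpen_and_dense_goodRanks (hn : 2 ≤ n) :
    IsOpen {Γ : IntegralFamily n IM I J | ∀ q, GoodRanks n (Γ.lineRank q)} ∧
      Dense {Γ : IntegralFamily n IM I J | ∀ q, GoodRanks n (Γ.lineRank q)} := by
  refine ⟨?_, (jetOpen_goodRanks hn).dense_forall (fun Γ Γ' q h hg => by
    rwa [← IntegralFamily.lineRank_congr h]) (locallyDense_goodRanks hn)⟩
  simpa using (jetOpen_goodRanks (IM := IM) (I := I) (J := J) hn).isOpen_forall isClosed_univ

end Density

end

/-- For a generic one-parameter family of integral curves, all germs of the curves and of their duals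
have one of the listed types. -/
theorem mainTheorem4 (n : ℕ) (hn : 2 ≤ n)
    {H : Type*} [TopologicalSpace H] (IM : ModelWithCorners ℝ ℝ H)
    (I : Type*) [TopologicalSpace I] [ChartedSpace H I] [IsManifold IM ∞ I]
    [T2Space I] [SecondCountableTopology I] [ConnectedSpace I]
    (J : Type*) [TopologicalSpace J] [ChartedSpace ℝ J] [IsManifold 𝓘(ℝ, ℝ) ∞ J]
    [T2Space J] [SecondCountableTopology J] :
    IsOpen (goodFamilies n IM I J) ∧ Dense (goodFamilies n IM I J) := by
  obtain ⟨ho, hd⟩ := isOpen_and_dense_goodRanks (IM := IM) (I := I) (J := J) hn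
  rw [goodFamilies_eq hn]
  -- Duality is a homeomorphism, so the dual condition is open and dense as well, and two open dense
  -- sets have a dense intersection.
  have ho' := ho.preimage (IntegralFamily.dualHomeo n IM I J).continuous
  exact ⟨ho.inter ho', hd.inter_of_isOpen_left
    (hd.preimage (IntegralFamily.dualHomeo n IM I J).isOpenMap) ho⟩
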